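/- **Filtered $SQ_p$ algebras.** Let $p\in[1,\infty)$. An $SQ_p$ algebra is a norm-closed subalgebra $A\subset B(E)$, where $E$ is a Banach space isometric to a subspace of a quotient of some $L_p$-space; $M_n(A)$ carries the norm of $B(\ell_p^n(E))$. It is filtered if it comes with closed subspaces $(A_r)_{r>0}$ such that $A_r\subset A_{r'}$ for $r\le r'$, $A_rA_{r'}\subset A_{r+r'}$, $\bigcup_r A_r$ is dense in $A$, and $1_A\in A_r$ for all $r$ if $A$ has a unit. For a closed two-sided ideal $J$ of $A$ put $J_r=J\cap A_r$. The extension $0\to J\xrightarrow{j} A\xrightarrow{q} A/J\to 0$ is $C$-completely filtered if $$\inf_{y\in M_n(J_r)}\|x+y\|\le C\inf_{y\in M_n(J)}\|x+y\|\qquad\text{for all }n\in\mathbb N,\ r>0,\ x\in M_n(A_r).$$ **Unitizations.** $A^\sharp=\{(T,z)\in B(E)\times\mathbb C: T-z1\in A\}$, with the filtration $\{(T,z):T-z1\in A_r\}$, the augmentation $\pi(T,z)=z$, and on $M_n(A^\sharp)$ the maximum of the norms in $B(\ell_p^n(E))$ and in $M_n(\mathbb C)=B(\ell_p^n)$. $J^\sharp\subset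 A^\sharp$ is defined in the same way from $J$ and $(J_r)$, and $(A/J)^\sharp=A^\sharp/J$, with $M_n(A^\sharp/J)=M_n(A^\sharp)/M_n(J)$ normed by the quotient norm, and with the image filtration. **Quantitative $K$-groups.** Let $0<\varepsilon<\frac1{20}$, $r>0$, $N\ge1$, and let $B$ be a unital filtered algebra of this kind. An $(\varepsilon,r,N)$-idempotent in $M_n(B)$ is a matrix $e$ with entries in $B_r$, $\|e^2-e\|<\varepsilon$ and $\max(\|e\|,\|1-e\|)\le N$. An $(\varepsilon,r,N)$-inverse pair is a pair $(u,v)$ of matrices with entries in $B_r$, norms $\le N$, and $\|uv-1\|,\|vu-1\|<\varepsilon$; then $u$ is called $(\varepsilon,r,N)$-invertible. Two quasi-idempotents are $(\varepsilon,r,N)$-homotopic if they are joined by a norm-continuous path of $(\varepsilon,r,N)$-idempotents; two quasi-invertibles are $(\varepsilon,r,N)$-homotopic if they are the endpoints of the first component of a norm-continuous path of $(\varepsilon,r,N)$-inverse pairs. $K_0^{\varepsilon,r,N}(B)$ is the Grothendieck group of the semigroup (under block sum) of $(\varepsilon,r,N)$-idempotents of all sizes, where $e$ is identified with $\mathrm{diag}(e,0)$,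 modulo $(4\varepsilon,r,4N)$-homotopy. $K_1^{\varepsilon,r,N}(B)$ is the group of $(\varepsilon,r,N)$-invertibles of all sizes, where $u$ is identified with $\mathrm{diag}(u,1)$, modulo $(4\varepsilon,2r,4N)$-homotopy. For $D=A,J,A/J$ put $K_i^{\varepsilon,r,N}(D)=\ker(\pi_*:K_i^{\varepsilon,r,N}(D^\sharp)\to K_i^{\varepsilon,r,N}(\mathbb C))$ and $\mathcal K_i(D)=(K_i^{\varepsilon,r,N}(D))_{\varepsilon,r,N}$. For $\varepsilon\le\varepsilon'$, $r\le r'$, $N\le N'$ there are relaxation maps $\iota$, induced by $[x]_{\varepsilon,r,N}\mapsto[x]_{\varepsilon',r',N'}$. **Controlled morphisms and exactness.** A control pair $(\lambda,h)$ consists of a non-decreasing $\lambda:[1,\infty)\to[1,\infty)$ and a function $h:(0,\frac1{20})\times[1,\infty)\to[1,\infty)$ that is non-increasing in the first variable; $(\lambda,h)\le(\lambda',h')$ is meant pointwise. A $(\lambda,h)$-controlled morphism $\mathcal F:\mathcal K_i(B)\to\mathcal K_j(D)$ is a family of homomorphisms $F^{\varepsilon,r,N}:K_i^{\varepsilon,r,N}(B)\to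 K_j^{\lambda_N\varepsilon,h_{\varepsilon,N}r,\lambda_N}(D)$, for $\lambda_N\varepsilon<\frac1{20}$, commuting with all relaxation maps that exist. The inclusion $j$ and the quotient map $q$ induce controlled morphisms $j_*,q_*$ by $[x]\mapsto[j(x)]$, $[x]\mapsto[q(x)]$, with control pair $\lambda_N=N$, $h=1$. For controlled morphisms $\mathcal F$, $\mathcal G$ with control pairs $(\lambda^{\mathcal F},h^{\mathcal F})$, $(\lambda^{\mathcal G},h^{\mathcal G})$, the composition $\mathcal K_i(B)\xrightarrow{\mathcal F}\mathcal K_j(B')\xrightarrow{\mathcal G}\mathcal K_l(B'')$ is $(\lambda,h)$-exact if $\mathcal G\circ\mathcal F=0$ and if for all $r>0$, $N\ge1$, $\varepsilon>0$ with $\lambda^{\mathcal F}_{\lambda_N}\lambda_N\varepsilon<\frac1{20}$, $\lambda^{\mathcal G}_N\varepsilon<\frac1{20}$, and all $y\in K_j^{\varepsilon,r,N}(B')$ with $G^{\varepsilon,r,N}(y)=0$ there is $x\in K_i^{\lambda_N\varepsilon,h_{\varepsilon,N}r,\lambda_N}(B)$ such that $F^{\lambda_N\varepsilon,h_{\varepsilon,N}r,\lambda_N}(x)$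 and $y$ have the same image in $K_j^{\varepsilon_1,r_1,N_1}(B')$, where $\varepsilon_1=\lambda^{\mathcal F}_{\lambda_N}\lambda_N\varepsilon$, $r_1=h^{\mathcal F}_{\lambda_N\varepsilon,\lambda_N}h_{\varepsilon,N}r$, $N_1=\lambda^{\mathcal F}_{\lambda_N}\lambda_N$ (in particular $N\le N_1$). **Boundary map.** Let $C\ge1$, let $0\to J\to A\to A/J\to0$ be a $C$-completely filtered extension and let $(\lambda^0,h^0)\le(\lambda^{\mathcal D},h^{\mathcal D})$ be control pairs. For an $(\varepsilon,r,N)$-invertible $u\in M_n((A/J)^\sharp)$, *boundary data* are: an $(\varepsilon,r,N)$-invertible $v\in M_m((A/J)^\sharp)$ such that $\mathrm{diag}(u,v)$ is $(2\varepsilon,2r,2(N+\varepsilon))$-homotopic to $I_{n+m}$; a $(\lambda^0_N\varepsilon,h^0_{\varepsilon,N}r,\lambda^0_N)$-inverse pair $(w,w')$ in $M_{n+m}(A^\sharp)$ with $\|q(w)-\mathrm{diag}(u,v)\|<\lambda^0_N\varepsilon$; and $y\in M_{n+m}(J_{h^0_{\varepsilon,N}r})$ with $\|w\,\mathrm{diag}(I_n,0)\,w'-\mathrm{diag}(I_n,0)-y\|<3C\lambda^0_N\varepsilon$.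 A $(\lambda^{\mathcal D},h^{\mathcal D})$-controlled morphism $\mathcal D_1=(\partial_1^{\varepsilon,r,N}):\mathcal K_1(A/J)\to\mathcal K_0(J)$ is the *controlled boundary map* (relative to $(\lambda^0,h^0)$) if, for all $\varepsilon,r,N$ with $\lambda^{\mathcal D}_N\varepsilon<\frac1{20}$ and every $(\varepsilon,r,N)$-invertible $u\in M_n((A/J)^\sharp)$ with $[u]\in K_1^{\varepsilon,r,N}(A/J)$, boundary data exist for $\mathrm{diag}(u,I_k)$ for some $k\ge0$, and for all boundary data of $u$ the matrices $y+\mathrm{diag}(I_n,0)$ and $\mathrm{diag}(I_n,0)$ are $(\lambda^{\mathcal D}_N\varepsilon,h^{\mathcal D}_{\varepsilon,N}r,\lambda^{\mathcal D}_N)$-idempotents over $J^\sharp$ and $$\partial_1^{\varepsilon,r,N}([u])=[y+\mathrm{diag}(I_n,0)]-[\mathrm{diag}(I_n,0)].$$ These conditions determine $\mathcal D_1$. **Theorem.** For every $C\ge1$ there are control pairs $(\lambda^0,h^0)\le(\lambda^{\mathcal D},h^{\mathcal D})$ and $(\lambda,h)$, depending only on $C$, such that for every $p\in[1,\infty)$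 and every $C$-completely filtered extension $0\to J\to A\to A/J\to0$ of filtered $SQ_p$ algebras the $(\lambda^{\mathcal D},h^{\mathcal D})$-controlled boundary map $\mathcal D_1$ relative to $(\lambda^0,h^0)$ exists, and the sequence $$\mathcal K_1(J)\xrightarrow{j_*}\mathcal K_1(A)\xrightarrow{q_*}\mathcal K_1(A/J)\xrightarrow{\mathcal D_1}\mathcal K_0(J)\xrightarrow{j_*}\mathcal K_0(A)\xrightarrow{q_*}\mathcal K_0(A/J)$$ is $(\lambda,h)$-exact, that is, $(\lambda,h)$-exact at each of its four middle terms. -/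

import Mathlib

set_option linter.unusedSectionVars false
set_option linter.unusedSimpArgs false
set_option linter.unusedVariables false

open scoped ENNReal

universe u v

noncomputable section

namespace QuantK

/-! ### Norms on matrices of operators -/

section OperatorMatrices

variable {E : Type u} [NormedAddCommGroup E] [NormedSpace ℂ E]

/-- The operator on the `ℓ_p`-direct sum of copies of `E` given by a square matrix of bounded
operators on `E`. -/
def matrixOp (p : ℝ≥0∞) [Fact (1 ≤ p)] {ι : Type} [Fintype ι] (T : Matrix ι ι (E →L[ℂ] E)) :
    PiLp p (fun _ : ι => E) →L[ℂ] PiLp p (fun _ : ι => E) :=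
  ((PiLp.continuousLinearEquiv p ℂ (fun _ : ι => E)).symm : (ι → E) →L[ℂ] PiLp p (fun _ : ι => E)) ∘L
    (ContinuousLinearMap.pi fun i => ∑ j, T i j ∘L ContinuousLinearMap.proj j) ∘L
      ((PiLp.continuousLinearEquiv p ℂ (fun _ : ι => E)) : PiLp p (fun _ : ι => E) →L[ℂ] (ι → E))

/-- The norm of a matrix of operators: `M_n(B(E))` is identified with `B(ℓ_p^n(E))`. -/
def opNorm (p : ℝ≥0∞) [Fact (1 ≤ p)] (ι : Type) [Fintype ι] (T : Matrix ι ι (E →L[ℂ] E)) : ℝ :=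
  ‖matrixOp p T‖

variable {p : ℝ≥0∞} [Fact (1 ≤ p)] {ι κ : Type} [Fintype ι] [Fintype κ]

lemma matrixOp_apply (T : Matrix ι ι (E →L[ℂ] E)) (x : PiLp p (fun _ : ι => E)) (i : ι) :
    matrixOp p T x i = ∑ j, T i j (x j) := by
  simp [matrixOp]

lemma matrixOp_zero : matrixOp p (0 : Matrix ι ι (E →L[ℂ] E)) = 0 := by
  ext x i; simp [matrixOp_apply]

lemma matrixOp_add (S T : Matrix ι ι (E →L[ℂ] E)) :
    matrixOp p (S + T) = matrixOp p S + matrixOp p T := by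
  ext x i; simp [matrixOp_apply, Finset.sum_add_distrib]

lemma matrixOp_smul (c : ℂ) (T : Matrix ι ι (E →L[ℂ] E)) :
    matrixOp p (c • T) = c • matrixOp p T := by
  ext x i; simp [matrixOp_apply, Finset.smul_sum]

lemma matrixOp_mul (S T : Matrix ι ι (E →L[ℂ] E)) :
    matrixOp p (S * T) = matrixOp p S * matrixOp p T := by
  ext x i
  have e : (matrixOp p S * matrixOp p T) x = matrixOp p S (matrixOp p T x) := rfl
  simp only [e, matrixOp_apply, Matrix.mul_apply, map_sum, sum_apply]
  rw [Finset.sum_comm]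
  rfl

lemma matrixOp_one [DecidableEq ι] : matrixOp p (1 : Matrix ι ι (E →L[ℂ] E)) = 1 := by
  ext x i
  rw [matrixOp_apply, Finset.sum_eq_single i]
  · simp
  · intro j _ hj; simp [Matrix.one_apply_ne (Ne.symm hj)]
  · simp

lemma opNorm_blocks_le [hp : Fact (p ≠ ∞)] (S : Matrix ι ι (E →L[ℂ] E)) (T : Matrix κ κ (E →L[ℂ] E)) :
    opNorm p (ι ⊕ κ) (Matrix.fromBlocks S 0 0 T) ≤ max (opNorm p ι S) (opNorm p κ T) := by
  have hp0 : 0 < p.toReal := ENNReal.toReal_pos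
    (lt_of_lt_of_le one_pos (Fact.out : 1 ≤ p)).ne' hp.out
  refine ContinuousLinearMap.opNorm_le_bound _ (le_max_of_le_left (norm_nonneg _)) fun x => ?_
  set M := max (opNorm p ι S) (opNorm p κ T) with hM
  have hM0 : 0 ≤ M := le_max_of_le_left (norm_nonneg _)
  let x₁ : PiLp p (fun _ : ι => E) := WithLp.toLp p (fun i => x (Sum.inl i))
  let x₂ : PiLp p (fun _ : κ => E) := WithLp.toLp p (fun i => x (Sum.inr i))
  have key : ∀ (y : PiLp p (fun _ : ι ⊕ κ => E)) (y₁ : PiLp p (fun _ : ι => E))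
      (y₂ : PiLp p (fun _ : κ => E)), (∀ i, y (Sum.inl i) = y₁ i) → (∀ i, y (Sum.inr i) = y₂ i) →
      ‖y‖ ^ p.toReal = ‖y₁‖ ^ p.toReal + ‖y₂‖ ^ p.toReal := by
    intro y y₁ y₂ h₁ h₂
    have aux : ∀ {ν : Type} [Fintype ν] (z : PiLp p (fun _ : ν => E)),
        ‖z‖ ^ p.toReal = ∑ i, ‖z i‖ ^ p.toReal := by
      intro ν _ z
      rw [PiLp.norm_eq_sum hp0, ← Real.rpow_mul (Finset.sum_nonneg fun i _ => by positivity)]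
      rw [one_div_mul_cancel hp0.ne', Real.rpow_one]
    rw [aux, aux, aux, Fintype.sum_sum_type]
    simp [h₁, h₂]
  have hx := key x x₁ x₂ (fun _ => rfl) (fun _ => rfl)
  have hy := key (matrixOp p (Matrix.fromBlocks S 0 0 T) x) (matrixOp p S x₁) (matrixOp p T x₂)
    (fun i => by simp [matrixOp_apply, x₁]) (fun i => by simp [matrixOp_apply, x₂])
  have b₁ : ‖matrixOp p S x₁‖ ≤ M * ‖x₁‖ :=
    (ContinuousLinearMap.le_opNorm _ _).trans
      (mul_le_mul_of_nonneg_right (le_max_left _ _) (norm_nonneg _))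
  have b₂ : ‖matrixOp p T x₂‖ ≤ M * ‖x₂‖ :=
    (ContinuousLinearMap.le_opNorm _ _).trans
      (mul_le_mul_of_nonneg_right (le_max_right _ _) (norm_nonneg _))
  rw [← Real.rpow_le_rpow_iff (norm_nonneg _) (by positivity) hp0, hy,
    Real.mul_rpow hM0 (norm_nonneg _), hx, mul_add, ← Real.mul_rpow hM0 (norm_nonneg _),
    ← Real.mul_rpow hM0 (norm_nonneg _)]
  gcongr

lemma opNorm_submatrix_le (T : Matrix ι ι (E →L[ℂ] E)) (σ τ : κ ≃ ι) :
    opNorm p κ (T.submatrix σ τ) ≤ opNorm p ι T := by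
  refine ContinuousLinearMap.opNorm_le_bound _ (norm_nonneg _) fun x => ?_
  have h : matrixOp p (T.submatrix σ τ) x =
      LinearIsometryEquiv.piLpCongrLeft p ℂ E σ.symm
        (matrixOp p T (LinearIsometryEquiv.piLpCongrLeft p ℂ E τ x)) := by
    ext i
    simp only [matrixOp_apply, LinearIsometryEquiv.piLpCongrLeft_apply, Matrix.submatrix_apply,
      Equiv.piCongrLeft'_apply, Equiv.symm_symm]
    exact Fintype.sum_equiv τ _ _ fun j => by simp
  rw [h, LinearIsometryEquiv.norm_map]
  refine (ContinuousLinearMap.le_opNorm _ _).trans ?_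
  rw [LinearIsometryEquiv.norm_map]
  rfl

end OperatorMatrices

/-! ### Matrix norms on algebras -/

/-- A compatible family of (semi)norms on the matrix algebras over `B`, indexed by finite index
types: submultiplicative, with `‖1‖ ≤ 1`, block diagonal matrices normed by the maximum, and
invariant under permutations of rows and of columns. -/
structure IsMatrixNorm (B : Type u) [Ring B] [Algebra ℂ B]
    (nrm : ∀ (ι : Type) [Fintype ι], Matrix ι ι B → ℝ) : Prop where
  zero_eq : ∀ (ι : Type) [Fintype ι], nrm ι 0 = 0
  add_le : ∀ (ι : Type) [Fintype ι] (x y : Matrix ι ι B), nrm ι (x + y) ≤ nrm ι x + nrm ι y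
  smul_le : ∀ (ι : Type) [Fintype ι] (c : ℂ) (x : Matrix ι ι B), nrm ι (c • x) ≤ ‖c‖ * nrm ι x
  mul_le : ∀ (ι : Type) [Fintype ι] (x y : Matrix ι ι B), nrm ι (x * y) ≤ nrm ι x * nrm ι y
  one_le : ∀ (ι : Type) [Fintype ι] [DecidableEq ι], nrm ι 1 ≤ 1
  blocks_le : ∀ (ι κ : Type) [Fintype ι] [Fintype κ] (x : Matrix ι ι B) (y : Matrix κ κ B),
    nrm (ι ⊕ κ) (Matrix.fromBlocks x 0 0 y) ≤ max (nrm ι x) (nrm κ y)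
  submatrix_le : ∀ (ι κ : Type) [Fintype ι] [Fintype κ] (x : Matrix ι ι B) (σ τ : κ ≃ ι),
    nrm κ (x.submatrix σ τ) ≤ nrm ι x

namespace IsMatrixNorm

variable {B : Type u} [Ring B] [Algebra ℂ B] {nrm nrm' : ∀ (ι : Type) [Fintype ι], Matrix ι ι B → ℝ}

lemma neg_le (h : IsMatrixNorm B nrm) {ι : Type} [Fintype ι] (x : Matrix ι ι B) :
    nrm ι (-x) ≤ nrm ι x := by
  simpa using h.smul_le ι (-1) x

lemma nonneg (h : IsMatrixNorm B nrm) {ι : Type} [Fintype ι] (x : Matrix ι ι B) : 0 ≤ nrm ι x := by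
  have h1 := h.add_le ι x (-x)
  rw [add_neg_cancel, h.zero_eq] at h1
  linarith [h.neg_le x]

lemma opNorm_pullback {E : Type v} [NormedAddCommGroup E] [NormedSpace ℂ E] (p : ℝ≥0∞)
    [Fact (1 ≤ p)] [Fact (p ≠ ∞)] (ρ : B →ₐ[ℂ] (E →L[ℂ] E)) :
    IsMatrixNorm B fun ι _ x => opNorm p ι (x.map ρ) where
  zero_eq ι _ := by simp [opNorm, Matrix.map_zero _ (map_zero ρ), matrixOp_zero]
  add_le ι _ x y := by
    rw [Matrix.map_add _ (map_add ρ)]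
    simp only [opNorm, matrixOp_add]
    exact norm_add_le _ _
  smul_le ι _ c x := by
    rw [Matrix.map_smul _ _ (map_smul ρ c)]
    simp only [opNorm, matrixOp_smul]
    exact (norm_smul _ _).le
  mul_le ι _ x y := by
    rw [Matrix.map_mul]
    simp only [opNorm, matrixOp_mul]
    exact norm_mul_le _ _
  one_le ι _ _ := by
    rw [Matrix.map_one _ (map_zero ρ) (map_one ρ)]
    simp only [opNorm, matrixOp_one]
    exact ContinuousLinearMap.norm_id_le
  blocks_le ι κ _ _ x y := by
    rw [Matrix.fromBlocks_map, Matrix.map_zero _ (map_zero ρ), Matrix.map_zero _ (map_zero ρ)]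
    exact opNorm_blocks_le _ _
  submatrix_le ι κ _ _ x σ τ := by
    rw [← Matrix.submatrix_map]
    exact opNorm_submatrix_le _ _ _

lemma sup (h : IsMatrixNorm B nrm) (h' : IsMatrixNorm B nrm') :
    IsMatrixNorm B fun ι _ x => max (nrm ι x) (nrm' ι x) where
  zero_eq ι _ := by simp [h.zero_eq, h'.zero_eq]
  add_le ι _ x y := max_le
    ((h.add_le ι x y).trans (add_le_add (le_max_left _ _) (le_max_left _ _)))
    ((h'.add_le ι x y).trans (add_le_add (le_max_right _ _) (le_max_right _ _)))
  smul_le ι _ c x := max_le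
    ((h.smul_le ι c x).trans (mul_le_mul_of_nonneg_left (le_max_left _ _) (norm_nonneg _)))
    ((h'.smul_le ι c x).trans (mul_le_mul_of_nonneg_left (le_max_right _ _) (norm_nonneg _)))
  mul_le ι _ x y := max_le
    ((h.mul_le ι x y).trans (mul_le_mul (le_max_left _ _) (le_max_left _ _) (h.nonneg y)
      (le_max_of_le_left (h.nonneg x))))
    ((h'.mul_le ι x y).trans (mul_le_mul (le_max_right _ _) (le_max_right _ _) (h'.nonneg y)
      (le_max_of_le_left (h.nonneg x))))
  one_le ι _ _ := max_le (h.one_le ι) (h'.one_le ι)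
  blocks_le ι κ _ _ x y := max_le
    ((h.blocks_le ι κ x y).trans (max_le_max (le_max_left _ _) (le_max_left _ _)))
    ((h'.blocks_le ι κ x y).trans (max_le_max (le_max_right _ _) (le_max_right _ _)))
  submatrix_le ι κ _ _ x σ τ := max_le
    ((h.submatrix_le ι κ x σ τ).trans (le_max_left _ _))
    ((h'.submatrix_le ι κ x σ τ).trans (le_max_right _ _))

end IsMatrixNorm

/-- The quotient norms along `q`: the infimum of the norms of the lifts. -/
def quotientNorm {B : Type u} {B' : Type v} (nrm : ∀ (ι : Type) [Fintype ι], Matrix ι ι B → ℝ)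
    (q : B → B') (ι : Type) [Fintype ι] (x : Matrix ι ι B') : ℝ :=
  ⨅ X : {X : Matrix ι ι B // X.map q = x}, nrm ι X.1

section Quotient

variable {B : Type u} {B' : Type v} {nrm : ∀ (ι : Type) [Fintype ι], Matrix ι ι B → ℝ}

lemma quotientNorm_le [Ring B] [Algebra ℂ B] (h : IsMatrixNorm B nrm) (q : B → B') {ι : Type} [Fintype ι]
    (X : Matrix ι ι B) : quotientNorm nrm q ι (X.map q) ≤ nrm ι X :=
  ciInf_le (f := fun Y : {Y : Matrix ι ι B // Y.map q = X.map q} => nrm ι Y.1)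
    ⟨0, by rintro _ ⟨Y, rfl⟩; exact h.nonneg _⟩ ⟨X, rfl⟩

lemma exists_lift_lt {q : B → B'} (hq : Function.Surjective q) {ι : Type} [Fintype ι]
    (x : Matrix ι ι B') {δ : ℝ} (hδ : 0 < δ) :
    ∃ X : Matrix ι ι B, X.map q = x ∧ nrm ι X < quotientNorm nrm q ι x + δ := by
  have : Nonempty {X : Matrix ι ι B // X.map q = x} :=
    ⟨⟨x.map (Function.surjInv hq), by ext i j; simp [Function.surjInv_eq hq]⟩⟩
  obtain ⟨X, hX⟩ := exists_lt_of_ciInf_lt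
    (show (⨅ X : {X : Matrix ι ι B // X.map q = x}, nrm ι X.1) < quotientNorm nrm q ι x + δ from
      lt_add_of_pos_right _ hδ)
  exact ⟨X.1, X.2, hX⟩

lemma quotientNorm_nonneg [Ring B] [Algebra ℂ B] (h : IsMatrixNorm B nrm) (q : B → B') {ι : Type} [Fintype ι]
    (x : Matrix ι ι B') : 0 ≤ quotientNorm nrm q ι x :=
  Real.iInf_nonneg fun X => h.nonneg X.1

lemma IsMatrixNorm.quotient [Ring B] [Algebra ℂ B] [Ring B'] [Algebra ℂ B'] (h : IsMatrixNorm B nrm) (q : B →ₐ[ℂ] B')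
    (hq : Function.Surjective q) : IsMatrixNorm B' (quotientNorm nrm q) where
  zero_eq ι _ := by
    refine le_antisymm ?_ (quotientNorm_nonneg h q _)
    have := quotientNorm_le h q (0 : Matrix ι ι B)
    rwa [Matrix.map_zero _ (map_zero q), h.zero_eq] at this
  add_le ι _ x y := by
    refine le_of_forall_pos_le_add fun δ hδ => ?_
    obtain ⟨X, rfl, hX⟩ := exists_lift_lt (nrm := nrm) hq x (half_pos hδ)
    obtain ⟨Y, rfl, hY⟩ := exists_lift_lt (nrm := nrm) hq y (half_pos hδ)
    rw [← Matrix.map_add _ (map_add q)]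
    linarith [quotientNorm_le h q (X + Y), h.add_le ι X Y]
  smul_le ι _ c x := by
    refine le_of_forall_pos_le_add fun δ hδ => ?_
    obtain ⟨X, rfl, hX⟩ := exists_lift_lt (nrm := nrm) hq x
      (show 0 < δ / (‖c‖ + 1) by positivity)
    rw [← Matrix.map_smul _ _ (map_smul q c)]
    refine (quotientNorm_le h q _).trans ((h.smul_le ι c X).trans ?_)
    have h1 : ‖c‖ * nrm ι X ≤ ‖c‖ * (quotientNorm nrm q ι (X.map q) + δ / (‖c‖ + 1)) :=
      mul_le_mul_of_nonneg_left hX.le (norm_nonneg _)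
    have h2 : ‖c‖ * (δ / (‖c‖ + 1)) ≤ δ := by
      rw [mul_div_assoc', div_le_iff₀ (by positivity)]
      nlinarith [norm_nonneg c]
    linarith [mul_add ‖c‖ (quotientNorm nrm q ι (X.map q)) (δ / (‖c‖ + 1))]
  mul_le ι _ x y := by
    have hx := quotientNorm_nonneg h q x
    have hy := quotientNorm_nonneg h q y
    have lim : Filter.Tendsto
        (fun δ : ℝ => (quotientNorm nrm q ι x + δ) * (quotientNorm nrm q ι y + δ))
        (nhdsWithin 0 (Set.Ioi 0)) (nhds (quotientNorm nrm q ι x * quotientNorm nrm q ι y)) := by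
      have : Continuous fun δ : ℝ =>
        (quotientNorm nrm q ι x + δ) * (quotientNorm nrm q ι y + δ) := by fun_prop
      simpa using (this.tendsto 0).mono_left nhdsWithin_le_nhds
    refine ge_of_tendsto lim ?_
    filter_upwards [self_mem_nhdsWithin] with δ hδ
    obtain ⟨X, hXx, hX⟩ := exists_lift_lt (nrm := nrm) hq x hδ
    obtain ⟨Y, hYy, hY⟩ := exists_lift_lt (nrm := nrm) hq y hδ
    have e : x * y = (X * Y).map q := by rw [Matrix.map_mul, hXx, hYy]
    rw [e]
    refine (quotientNorm_le h q _).trans ((h.mul_le ι X Y).trans ?_)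
    exact mul_le_mul hX.le hY.le (h.nonneg Y) (by linarith [Set.mem_Ioi.mp hδ])
  one_le ι _ _ := by
    have := quotientNorm_le h q (1 : Matrix ι ι B)
    rw [Matrix.map_one _ (map_zero q) (map_one q)] at this
    exact this.trans (h.one_le ι)
  blocks_le ι κ _ _ x y := by
    refine le_of_forall_pos_le_add fun δ hδ => ?_
    obtain ⟨X, rfl, hX⟩ := exists_lift_lt (nrm := nrm) hq x hδ
    obtain ⟨Y, rfl, hY⟩ := exists_lift_lt (nrm := nrm) hq y hδ
    have e : Matrix.fromBlocks (X.map q) 0 0 (Y.map q) = (Matrix.fromBlocks X 0 0 Y).map q := by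
      rw [Matrix.fromBlocks_map, Matrix.map_zero _ (map_zero q), Matrix.map_zero _ (map_zero q)]
    rw [e]
    refine (quotientNorm_le h q _).trans ((h.blocks_le ι κ X Y).trans ?_)
    rw [← max_add_add_right]
    exact max_le_max hX.le hY.le
  submatrix_le ι κ _ _ x σ τ := by
    refine le_of_forall_pos_le_add fun δ hδ => ?_
    obtain ⟨X, rfl, hX⟩ := exists_lift_lt (nrm := nrm) hq x hδ
    rw [Matrix.submatrix_map]
    exact (quotientNorm_le h q _).trans ((h.submatrix_le ι κ X σ τ).trans hX.le)

end Quotient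

/-! ### Stable classes of matrices

The semigroups of classes of quasi-idempotents and of quasi-invertibles are both obtained from
square matrices of all sizes, stabilised by a constant `c` on the diagonal (`c = 0` for
idempotents, `c = 1` for invertibles), modulo homotopy after stabilisation, with block sum as
addition. -/

/-- A class of square matrices (`Good`) with a notion of homotopy (`Hom`), compatible with block
sums, with stabilisation by `c` on the diagonal and with simultaneous permutation of rows and
columns. -/
structure StableSystem (B : Type u) [Ring B] where
  c : B
  Good : ∀ {ι : Type} [Fintype ι] [DecidableEq ι], Matrix ι ι B → Prop
  Hom : ∀ {ι : Type} [Fintype ι] [DecidableEq ι], Matrix ι ι B → Matrix ι ι B → Prop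
  good_pad : ∀ (ι : Type) [Fintype ι] [DecidableEq ι], Good (Matrix.diagonal fun _ : ι => c)
  good_reindex : ∀ {ι κ : Type} [Fintype ι] [DecidableEq ι] [Fintype κ] [DecidableEq κ]
    (σ : κ ≃ ι) {x : Matrix ι ι B}, Good x → Good (x.submatrix σ σ)
  good_blocks : ∀ {ι κ : Type} [Fintype ι] [DecidableEq ι] [Fintype κ] [DecidableEq κ]
    {x : Matrix ι ι B} {y : Matrix κ κ B}, Good x → Good y → Good (Matrix.fromBlocks x 0 0 y)
  hom_refl : ∀ {ι : Type} [Fintype ι] [DecidableEq ι] {x : Matrix ι ι B}, Good x → Hom x x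
  hom_symm : ∀ {ι : Type} [Fintype ι] [DecidableEq ι] {x y : Matrix ι ι B}, Hom x y → Hom y x
  hom_trans : ∀ {ι : Type} [Fintype ι] [DecidableEq ι] {x y z : Matrix ι ι B},
    Hom x y → Hom y z → Hom x z
  hom_reindex : ∀ {ι κ : Type} [Fintype ι] [DecidableEq ι] [Fintype κ] [DecidableEq κ]
    (σ : κ ≃ ι) {x y : Matrix ι ι B}, Hom x y → Hom (x.submatrix σ σ) (y.submatrix σ σ)
  hom_blocks : ∀ {ι κ : Type} [Fintype ι] [DecidableEq ι] [Fintype κ] [DecidableEq κ]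
    {x x' : Matrix ι ι B} {y y' : Matrix κ κ B}, Hom x x' → Hom y y' →
    Hom (Matrix.fromBlocks x 0 0 y) (Matrix.fromBlocks x' 0 0 y')
  hom_rot : ∀ {ι : Type} [Fintype ι] [DecidableEq ι] {x : Matrix ι ι B}, Good x →
    Hom (Matrix.fromBlocks x 0 0 (Matrix.diagonal fun _ : ι => c))
      (Matrix.fromBlocks (Matrix.diagonal fun _ : ι => c) 0 0 x)

/-- `diag(x, y)`, as a matrix of size `n + m`. -/
def blockSum {B : Type u} [Zero B] {n m : ℕ} (x : Matrix (Fin n) (Fin n) B)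
    (y : Matrix (Fin m) (Fin m) B) : Matrix (Fin (n + m)) (Fin (n + m)) B :=
  (Matrix.fromBlocks x 0 0 y).submatrix finSumFinEquiv.symm finSumFinEquiv.symm

/-- `diag(x, c, …, c)` of size `K`, for a matrix `x` of size `n ≤ K`. -/
def padTo {B : Type u} [Zero B] (c : B) {n : ℕ} (K : ℕ) (x : Matrix (Fin n) (Fin n) B) :
    Matrix (Fin K) (Fin K) B := fun i j =>
  if h : i.1 < n ∧ j.1 < n then x ⟨i.1, h.1⟩ ⟨j.1, h.2⟩ else if i = j then c else 0

namespace StableSystem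

variable {B : Type u} [Ring B] (S : StableSystem B)

lemma padTo_padTo {B : Type u} [Zero B] {c : B} {n L K : ℕ} (h1 : n ≤ L) (_h2 : L ≤ K)
    (x : Matrix (Fin n) (Fin n) B) : padTo c K (padTo c L x) = padTo c K x := by
  ext i j
  by_cases hL : i.1 < L ∧ j.1 < L
  · simp [padTo, hL, Fin.ext_iff]
  · have hn : ¬(i.1 < n ∧ j.1 < n) := fun h => hL ⟨h.1.trans_le h1, h.2.trans_le h1⟩
    simp [padTo, hL, hn]

lemma padTo_self {B : Type u} [Zero B] {c : B} {n : ℕ} (x : Matrix (Fin n) (Fin n) B) :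
    padTo c n x = x := by
  ext i j; simp [padTo]

/-- The index set of size `K` split as the first `n` indices and the others. -/
def splitEquiv {n K : ℕ} (h : n ≤ K) : Fin n ⊕ Fin (K - n) ≃ Fin K :=
  finSumFinEquiv.trans (finCongr (Nat.add_sub_cancel' h))

lemma padTo_submatrix {B : Type u} [Zero B] {c : B} {n K : ℕ} (h : n ≤ K)
    (x : Matrix (Fin n) (Fin n) B) : (padTo c K x).submatrix (splitEquiv h) (splitEquiv h) =
      Matrix.fromBlocks x 0 0 (Matrix.diagonal fun _ => c) := by
  ext (i | i) (j | j)
  · simp [padTo, splitEquiv]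
  · have := i.2
    simp [padTo, splitEquiv, Fin.ext_iff]; omega
  · have := j.2
    simp [padTo, splitEquiv, Fin.ext_iff]; omega
  · simp [padTo, splitEquiv, Fin.ext_iff, Matrix.diagonal_apply]

variable {S}

lemma good_padTo {n K : ℕ} (h : n ≤ K) {x : Matrix (Fin n) (Fin n) B} (hx : S.Good x) :
    S.Good (padTo S.c K x) := by
  have := S.good_reindex (splitEquiv h).symm
    (S.good_blocks hx (S.good_pad (Fin (K - n))))
  rw [← padTo_submatrix h] at this
  simpa [Matrix.submatrix_submatrix] using this

lemma hom_padTo {n K : ℕ} (h : n ≤ K) {x y : Matrix (Fin n) (Fin n) B} (hx : S.Hom x y) :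
    S.Hom (padTo S.c K x) (padTo S.c K y) := by
  have := S.hom_reindex (splitEquiv h).symm
    (S.hom_blocks hx (S.hom_refl (S.good_pad (Fin (K - n)))))
  rw [← padTo_submatrix h, ← padTo_submatrix h] at this
  simpa [Matrix.submatrix_submatrix] using this

variable (S)

/-- Good matrices of all sizes. -/
def Elem : Type u := Σ n : ℕ, {x : Matrix (Fin n) (Fin n) B // S.Good x}

/-- Two good matrices are equivalent if they become homotopic after stabilisation. -/
def Rel (x y : S.Elem) : Prop :=
  ∃ K : ℕ, x.1 ≤ K ∧ y.1 ≤ K ∧ S.Hom (padTo S.c K x.2.1) (padTo S.c K y.2.1)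

instance setoid : Setoid S.Elem where
  r := S.Rel
  iseqv := by
    refine ⟨fun x => ⟨x.1, le_rfl, le_rfl, ?_⟩, ?_, ?_⟩
    · exact S.hom_refl (good_padTo le_rfl x.2.2)
    · rintro x y ⟨K, h1, h2, h⟩
      exact ⟨K, h2, h1, S.hom_symm h⟩
    · rintro x y z ⟨K, h1, h2, h⟩ ⟨L, h3, h4, h'⟩
      refine ⟨max K L, h1.trans (le_max_left _ _), h4.trans (le_max_right _ _), ?_⟩
      have a := hom_padTo (le_max_left K L) h
      have b := hom_padTo (le_max_right K L) h'
      rw [padTo_padTo h1 (le_max_left K L), padTo_padTo h2 (le_max_left K L)] at a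
      rw [padTo_padTo h3 (le_max_right K L), padTo_padTo h4 (le_max_right K L)] at b
      exact S.hom_trans a b

/-- The set of stable homotopy classes. -/
def Classes : Type u := Quotient S.setoid

variable {S}

/-- The class of a good matrix. -/
def cls {n : ℕ} (x : Matrix (Fin n) (Fin n) B) (hx : S.Good x) : S.Classes :=
  Quotient.mk S.setoid ⟨n, x, hx⟩

lemma hom_perm {ι : Type} [Fintype ι] [DecidableEq ι] {x : Matrix ι ι B} (hx : S.Good x)
    (σ : ι ≃ ι) :
    S.Hom (Matrix.fromBlocks x 0 0 (Matrix.diagonal fun _ : ι => S.c))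
      (Matrix.fromBlocks (x.submatrix σ σ) 0 0 (Matrix.diagonal fun _ : ι => S.c)) := by
  have h1 := S.hom_reindex (Equiv.sumCongr (Equiv.refl ι) σ) (S.hom_rot hx)
  have h2 := S.hom_symm (S.hom_rot (S.good_reindex σ hx))
  have e1 : (Matrix.fromBlocks x 0 0 (Matrix.diagonal fun _ : ι => S.c)).submatrix
      (Equiv.sumCongr (Equiv.refl ι) σ) (Equiv.sumCongr (Equiv.refl ι) σ) =
      Matrix.fromBlocks x 0 0 (Matrix.diagonal fun _ : ι => S.c) := by
    ext (i | i) (j | j) <;> simp [Matrix.diagonal_apply]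
  have e2 : (Matrix.fromBlocks (Matrix.diagonal fun _ : ι => S.c) 0 0 x).submatrix
      (Equiv.sumCongr (Equiv.refl ι) σ) (Equiv.sumCongr (Equiv.refl ι) σ) =
      Matrix.fromBlocks (Matrix.diagonal fun _ : ι => S.c) 0 0 (x.submatrix σ σ) := by
    ext (i | i) (j | j) <;> simp
  rw [e1, e2] at h1
  exact S.hom_trans h1 h2

lemma exists_perm {ι κ κ' μ : Type} [Fintype ι] [DecidableEq ι] [Fintype κ] [DecidableEq κ]
    [Fintype κ'] [DecidableEq κ'] [Fintype μ] [DecidableEq μ] {c : B} (s : ι ⊕ κ ≃ μ)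
    (s' : ι ⊕ κ' ≃ μ) {x : Matrix ι ι B} {P P' : Matrix μ μ B}
    (hP : P.submatrix s s = Matrix.fromBlocks x 0 0 (Matrix.diagonal fun _ => c))
    (hP' : P'.submatrix s' s' = Matrix.fromBlocks x 0 0 (Matrix.diagonal fun _ => c)) :
    ∃ σ : μ ≃ μ, P = P'.submatrix σ σ := by
  have hc : Fintype.card κ = Fintype.card κ' := by
    have h1 := Fintype.card_congr s
    have h2 := Fintype.card_congr s'
    simp only [Fintype.card_sum] at h1 h2
    omega
  let e : κ ≃ κ' := Fintype.equivOfCardEq hc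
  refine ⟨s.symm.trans ((Equiv.sumCongr (Equiv.refl ι) e).trans s'), ?_⟩
  have h1 : P = (P.submatrix s s).submatrix s.symm s.symm := by
    ext i j; simp
  have h2 : P'.submatrix (s.symm.trans ((Equiv.sumCongr (Equiv.refl ι) e).trans s'))
      (s.symm.trans ((Equiv.sumCongr (Equiv.refl ι) e).trans s')) =
      ((P'.submatrix s' s').submatrix (Equiv.sumCongr (Equiv.refl ι) e)
        (Equiv.sumCongr (Equiv.refl ι) e)).submatrix s.symm s.symm := by
    ext i j; simp
  rw [h2, hP', h1, hP]
  congr 1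
  ext (i | i) (j | j) <;> simp [Matrix.diagonal_apply]

/-- Equivalence may be tested after putting the two matrices anywhere on the diagonal of matrices
of the same size. -/
lemma rel_of_hom {n m : ℕ} {x : Matrix (Fin n) (Fin n) B} {y : Matrix (Fin m) (Fin m) B}
    (hx : S.Good x) (hy : S.Good y) {κ κ' μ : Type} [Fintype κ] [DecidableEq κ] [Fintype κ']
    [DecidableEq κ'] [Fintype μ] [DecidableEq μ] (s : Fin n ⊕ κ ≃ μ) (t : Fin m ⊕ κ' ≃ μ)
    {P Q : Matrix μ μ B}
    (hP : P.submatrix s s = Matrix.fromBlocks x 0 0 (Matrix.diagonal fun _ => S.c))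
    (hQ : Q.submatrix t t = Matrix.fromBlocks y 0 0 (Matrix.diagonal fun _ => S.c))
    (h : S.Hom P Q) : S.Rel ⟨n, x, hx⟩ ⟨m, y, hy⟩ := by
  set K := Fintype.card μ with hK
  let u : Fin K ≃ μ := (Fintype.equivFin μ).symm
  have hn : n ≤ K := by
    have := Fintype.card_congr s
    simp only [Fintype.card_sum, Fintype.card_fin] at this
    omega
  have hm : m ≤ K := by
    have := Fintype.card_congr t
    simp only [Fintype.card_sum, Fintype.card_fin] at this
    omega
  have h' := S.hom_reindex u h
  obtain ⟨σ, hσ⟩ := exists_perm (c := S.c) (s.trans u.symm) (splitEquiv hn)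
    (P := P.submatrix u u) (P' := padTo S.c K x) (x := x)
    (by rw [← hP]; ext i j; simp) (padTo_submatrix hn x)
  obtain ⟨τ, hτ⟩ := exists_perm (c := S.c) (t.trans u.symm) (splitEquiv hm)
    (P := Q.submatrix u u) (P' := padTo S.c K y) (x := y)
    (by rw [← hQ]; ext i j; simp) (padTo_submatrix hm y)
  have a1 := hom_perm (good_padTo hn hx) σ
  have a3 := S.hom_symm (hom_perm (good_padTo hm hy) τ)
  rw [hσ, hτ] at h'
  have a2 := S.hom_blocks h' (S.hom_refl (S.good_pad (Fin K)))
  have a := S.hom_reindex finSumFinEquiv.symm (S.hom_trans a1 (S.hom_trans a2 a3))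
  have e : ∀ z : Matrix (Fin K) (Fin K) B,
      (Matrix.fromBlocks z 0 0 (Matrix.diagonal fun _ => S.c)).submatrix
        finSumFinEquiv.symm finSumFinEquiv.symm = padTo S.c (K + K) z := by
    intro z
    have := congrArg (fun w => w.submatrix finSumFinEquiv.symm finSumFinEquiv.symm)
      (show (padTo S.c (K + K) z).submatrix finSumFinEquiv finSumFinEquiv =
        Matrix.fromBlocks z 0 0 (Matrix.diagonal fun _ => S.c) by
          ext (i | i) (j | j)
          · simp [padTo]
          · simp [padTo, Fin.ext_iff]; omega
          · simp [padTo, Fin.ext_iff]; omega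
          · simp [padTo, Fin.ext_iff, Matrix.diagonal_apply])
    rw [← this]
    ext i j; simp
  rw [e, e, padTo_padTo hn (Nat.le_add_left K K), padTo_padTo hm (Nat.le_add_left K K)] at a
  exact ⟨K + K, hn.trans (Nat.le_add_left K K), hm.trans (Nat.le_add_left K K), a⟩

lemma rel_of_equiv {n m : ℕ} {x : Matrix (Fin n) (Fin n) B} {y : Matrix (Fin m) (Fin m) B}
    (hx : S.Good x) (hy : S.Good y) (e : Fin n ≃ Fin m) (h : x = y.submatrix e e) :
    S.Rel ⟨n, x, hx⟩ ⟨m, y, hy⟩ := by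
  refine rel_of_hom hx hy (κ := Fin 0) (κ' := Fin 0) (μ := Fin m)
    ((Equiv.sumEmpty _ _).trans e) (Equiv.sumEmpty _ _) (P := y) (Q := y) ?_ ?_ (S.hom_refl hy)
  · ext (i | i) (j | j)
    · simp [h]
    · exact j.elim0
    · exact i.elim0
    · exact i.elim0
  · ext (i | i) (j | j)
    · simp
    · exact j.elim0
    · exact i.elim0
    · exact i.elim0

lemma good_blockSum {n m : ℕ} {x : Matrix (Fin n) (Fin n) B} {y : Matrix (Fin m) (Fin m) B}
    (hx : S.Good x) (hy : S.Good y) : S.Good (blockSum x y) :=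
  S.good_reindex _ (S.good_blocks hx hy)

variable (S) in
/-- Block sum on good matrices. -/
def Elem.sum (x y : S.Elem) : S.Elem := ⟨x.1 + y.1, blockSum x.2.1 y.2.1, good_blockSum x.2.2 y.2.2⟩

lemma rel_sum {x x' y y' : S.Elem} (h : S.Rel x x') (h' : S.Rel y y') :
    S.Rel (Elem.sum S x y) (Elem.sum S x' y') := by
  obtain ⟨K, h1, h2, hK⟩ := h
  obtain ⟨L, h3, h4, hL⟩ := h'
  have main : ∀ (z w : S.Elem) (hz : z.1 ≤ K) (hw : w.1 ≤ L),
      (Matrix.fromBlocks (padTo S.c K z.2.1) 0 0 (padTo S.c L w.2.1)).submatrix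
        (((Equiv.sumCongr finSumFinEquiv.symm (Equiv.refl (Fin (K - z.1) ⊕ Fin (L - w.1)))).trans
          (Equiv.sumSumSumComm _ _ _ _)).trans (Equiv.sumCongr (splitEquiv hz) (splitEquiv hw)))
        (((Equiv.sumCongr finSumFinEquiv.symm (Equiv.refl (Fin (K - z.1) ⊕ Fin (L - w.1)))).trans
          (Equiv.sumSumSumComm _ _ _ _)).trans (Equiv.sumCongr (splitEquiv hz) (splitEquiv hw))) =
      Matrix.fromBlocks (blockSum z.2.1 w.2.1) 0 0 (Matrix.diagonal fun _ => S.c) := by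
    intro z w hz hw
    have ez := padTo_submatrix (c := S.c) hz z.2.1
    have ew := padTo_submatrix (c := S.c) hw w.2.1
    have ez' : ∀ a b, padTo S.c K z.2.1 (splitEquiv hz a) (splitEquiv hz b) =
      Matrix.fromBlocks z.2.1 0 0 (Matrix.diagonal fun _ => S.c) a b := fun a b => by
        rw [← ez]; rfl
    have ew' : ∀ a b, padTo S.c L w.2.1 (splitEquiv hw a) (splitEquiv hw b) =
      Matrix.fromBlocks w.2.1 0 0 (Matrix.diagonal fun _ => S.c) a b := fun a b => by
        rw [← ew]; rfl
    ext (i | i) (j | j)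
    · obtain ⟨i, rfl⟩ := finSumFinEquiv.surjective i
      obtain ⟨j, rfl⟩ := finSumFinEquiv.surjective j
      rcases i with i | i <;> rcases j with j | j <;> simp [blockSum, ez', ew']
    · obtain ⟨i, rfl⟩ := finSumFinEquiv.surjective i
      rcases i with i | i <;> rcases j with j | j <;> simp [ez', ew']
    · obtain ⟨j, rfl⟩ := finSumFinEquiv.surjective j
      rcases i with i | i <;> rcases j with j | j <;> simp [ez', ew']
    · rcases i with i | i <;> rcases j with j | j <;> simp [ez', ew', Matrix.diagonal_apply]
  exact rel_of_hom _ _ _ _ (main x y h1 h3) (main x' y' h2 h4) (S.hom_blocks hK hL)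

instance : Add S.Classes where
  add := Quotient.map₂ (Elem.sum S) fun _ _ h _ _ h' => rel_sum h h'

instance : Zero S.Classes where
  zero := cls (Matrix.diagonal fun _ : Fin 0 => S.c) (S.good_pad (Fin 0))

lemma cls_add {n m : ℕ} {x : Matrix (Fin n) (Fin n) B} {y : Matrix (Fin m) (Fin m) B}
    (hx : S.Good x) (hy : S.Good y) : cls x hx + cls y hy = cls (blockSum x y) (good_blockSum hx hy) :=
  rfl

lemma zero_def :
    (0 : S.Classes) = cls (Matrix.diagonal fun _ : Fin 0 => S.c) (S.good_pad (Fin 0)) := rfl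

lemma cls_surj (a : S.Classes) : ∃ (n : ℕ) (x : Matrix (Fin n) (Fin n) B) (hx : S.Good x),
    a = cls x hx := by
  induction a using Quotient.inductionOn with
  | h a => exact ⟨a.1, a.2.1, a.2.2, rfl⟩

lemma cls_congr {n : ℕ} {x y : Matrix (Fin n) (Fin n) B} (hx : S.Good x) (hy : S.Good y)
    (h : x = y) : cls x hx = cls y hy := by
  subst h; rfl

lemma cls_eq_zero_of_hom {n : ℕ} {x : Matrix (Fin n) (Fin n) B} (hx : S.Good x)
    (h : S.Hom x (Matrix.diagonal fun _ => S.c)) : cls x hx = 0 := by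
  refine Quotient.sound (s := S.setoid) ⟨n, le_rfl, Nat.zero_le n, ?_⟩
  have e : padTo S.c n (Matrix.diagonal fun _ : Fin 0 => S.c) =
      Matrix.diagonal fun _ : Fin n => S.c := by
    ext i j; simp [padTo, Matrix.diagonal_apply]
  show S.Hom (padTo S.c n x) (padTo S.c n (Matrix.diagonal fun _ : Fin 0 => S.c))
  rw [e, padTo_self]
  exact h

lemma add_comm_aux (a b : S.Classes) : a + b = b + a := by
  obtain ⟨n, x, hx, rfl⟩ := cls_surj a
  obtain ⟨m, y, hy, rfl⟩ := cls_surj b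
  rw [cls_add, cls_add]
  refine Quotient.sound (s := S.setoid) (rel_of_equiv _ _
    (finSumFinEquiv.symm.trans ((Equiv.sumComm _ _).trans finSumFinEquiv)) ?_)
  ext i j
  obtain ⟨i, rfl⟩ := finSumFinEquiv.surjective i
  obtain ⟨j, rfl⟩ := finSumFinEquiv.surjective j
  rcases i with i | i <;> rcases j with j | j <;> simp [blockSum]

instance : AddCommMonoid S.Classes where
  add_assoc a b d := by
    obtain ⟨n, x, hx, rfl⟩ := cls_surj a
    obtain ⟨m, y, hy, rfl⟩ := cls_surj b
    obtain ⟨k, z, hz, rfl⟩ := cls_surj d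
    simp only [cls_add]
    refine Quotient.sound (s := S.setoid) (rel_of_equiv _ _
      (finSumFinEquiv.symm.trans ((Equiv.sumCongr finSumFinEquiv.symm (Equiv.refl _)).trans
        ((Equiv.sumAssoc _ _ _).trans ((Equiv.sumCongr (Equiv.refl _) finSumFinEquiv).trans
          finSumFinEquiv)))) ?_)
    ext i j
    obtain ⟨i, rfl⟩ := finSumFinEquiv.surjective i
    obtain ⟨j, rfl⟩ := finSumFinEquiv.surjective j
    rcases i with i | i <;> rcases j with j | j
    · obtain ⟨i, rfl⟩ := finSumFinEquiv.surjective i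
      obtain ⟨j, rfl⟩ := finSumFinEquiv.surjective j
      rcases i with i | i <;> rcases j with j | j <;> simp [blockSum]
    · obtain ⟨i, rfl⟩ := finSumFinEquiv.surjective i
      rcases i with i | i <;> simp [blockSum]
    · obtain ⟨j, rfl⟩ := finSumFinEquiv.surjective j
      rcases j with j | j <;> simp [blockSum]
    · simp [blockSum]
  zero_add a := by
    obtain ⟨n, x, hx, rfl⟩ := cls_surj a
    rw [zero_def, cls_add]
    refine Quotient.sound (s := S.setoid) (rel_of_equiv _ _
      (finSumFinEquiv.symm.trans (Equiv.emptySum _ _)) ?_)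
    ext i j
    obtain ⟨i, rfl⟩ := finSumFinEquiv.surjective i
    obtain ⟨j, rfl⟩ := finSumFinEquiv.surjective j
    rcases i with i | i
    · exact i.elim0
    rcases j with j | j
    · exact j.elim0
    simp only [blockSum, Matrix.submatrix_apply, Equiv.symm_apply_apply, Equiv.trans_apply]
    rfl
  add_zero a := by
    obtain ⟨n, x, hx, rfl⟩ := cls_surj a
    rw [zero_def, cls_add]
    refine Quotient.sound (s := S.setoid) (rel_of_equiv _ _
      (finSumFinEquiv.symm.trans (Equiv.sumEmpty _ _)) ?_)
    ext i j
    obtain ⟨i, rfl⟩ := finSumFinEquiv.surjective i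
    obtain ⟨j, rfl⟩ := finSumFinEquiv.surjective j
    rcases i with i | i
    · rcases j with j | j
      · simp [blockSum]
      · exact j.elim0
    · exact i.elim0
  add_comm := add_comm_aux
  nsmul := nsmulRec

lemma map_padTo {B' : Type v} [Ring B'] (f : B →+* B') {c : B} {n K : ℕ}
    (x : Matrix (Fin n) (Fin n) B) : (padTo c K x).map f = padTo (f c) K (x.map f) := by
  ext i j
  simp only [padTo, Matrix.map_apply]
  split_ifs <;> simp

lemma map_blockSum {B' : Type v} [Ring B'] (f : B →+* B') {n m : ℕ}
    (x : Matrix (Fin n) (Fin n) B) (y : Matrix (Fin m) (Fin m) B) :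
    (blockSum x y).map f = blockSum (x.map f) (y.map f) := by
  rw [blockSum, blockSum, ← Matrix.submatrix_map, Matrix.fromBlocks_map,
    Matrix.map_zero _ (map_zero f), Matrix.map_zero _ (map_zero f)]

/-- The map `[x] ↦ [f(x)]` induced by a ring homomorphism on stable classes. -/
def mapClasses {B' : Type v} [Ring B'] {S' : StableSystem B'} (f : B →+* B') (hc : f S.c = S'.c)
    (hgood : ∀ {n : ℕ} {x : Matrix (Fin n) (Fin n) B}, S.Good x → S'.Good (x.map f))
    (hhom : ∀ {n : ℕ} {x y : Matrix (Fin n) (Fin n) B},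
      S.Hom x y → S'.Hom (x.map f) (y.map f)) : S.Classes →+ S'.Classes where
  toFun := Quotient.map (fun x : S.Elem => (⟨x.1, x.2.1.map f, hgood x.2.2⟩ : S'.Elem)) (by
    rintro x y ⟨K, h1, h2, h⟩
    refine ⟨K, h1, h2, ?_⟩
    have := hhom h
    rwa [map_padTo, map_padTo, hc] at this)
  map_zero' := by
    refine Quotient.sound (s := S'.setoid) (rel_of_equiv _ _ (Equiv.refl _) ?_)
    ext i j
    exact i.elim0
  map_add' a b := by
    obtain ⟨n, x, hx, rfl⟩ := cls_surj a
    obtain ⟨m, y, hy, rfl⟩ := cls_surj b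
    refine Quotient.sound (s := S'.setoid) (rel_of_equiv _ _ (Equiv.refl _) ?_)
    show (blockSum x y).map f = _
    rw [map_blockSum]
    rfl

lemma mapClasses_cls {B' : Type v} [Ring B'] {S' : StableSystem B'} (f : B →+* B')
    (hc : f S.c = S'.c)
    (hgood : ∀ {n : ℕ} {x : Matrix (Fin n) (Fin n) B}, S.Good x → S'.Good (x.map f))
    (hhom : ∀ {n : ℕ} {x y : Matrix (Fin n) (Fin n) B},
      S.Hom x y → S'.Hom (x.map f) (y.map f)) {n : ℕ} {x : Matrix (Fin n) (Fin n) B}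
    (hx : S.Good x) : mapClasses (S' := S') f hc hgood hhom (cls x hx) = cls (x.map f) (hgood hx) :=
  rfl

end StableSystem

/-! ### Filtered algebras with matrix norms -/

/-- A unital complex algebra with norms on its matrix algebras, a filtration `(B_r)_{r > 0}` by
subspaces containing the unit, and a character `π` (the augmentation) that is contractive on
matrices of all sizes, where `M_n(ℂ)` is normed as `B(ℓ_p^n)`. -/
structure FilteredMatrixAlgebra (p : ℝ≥0∞) [Fact (1 ≤ p)] where
  carrier : Type u
  [ring : Ring carrier]
  [algebra : Algebra ℂ carrier]
  nrm : ∀ (ι : Type) [Fintype ι], Matrix ι ι carrier → ℝ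
  isMatrixNorm : IsMatrixNorm carrier nrm
  fil : ℝ → Submodule ℂ carrier
  fil_mono : ∀ {r s : ℝ}, 0 < r → r ≤ s → fil r ≤ fil s
  one_mem : ∀ {r : ℝ}, 0 < r → 1 ∈ fil r
  mul_mem : ∀ {r s : ℝ} {a b : carrier}, 0 < r → 0 < s → a ∈ fil r → b ∈ fil s →
    a * b ∈ fil (r + s)
  aug : carrier →ₐ[ℂ] ℂ
  aug_le : ∀ (ι : Type) [Fintype ι] (x : Matrix ι ι carrier),
    opNorm p ι (x.map fun a => aug a • (1 : ℂ →L[ℂ] ℂ)) ≤ nrm ι x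

attribute [instance] FilteredMatrixAlgebra.ring FilteredMatrixAlgebra.algebra

namespace FilteredMatrixAlgebra

variable {p : ℝ≥0∞} [Fact (1 ≤ p)]

instance (X : FilteredMatrixAlgebra.{u} p) {ι : Type} [Fintype ι] [DecidableEq ι] :
    SeminormedRing (Matrix ι ι X.carrier) :=
  { (inferInstance : Ring (Matrix ι ι X.carrier)),
    AddGroupSeminorm.toSeminormedAddCommGroup
      { toFun := X.nrm ι
        map_zero' := X.isMatrixNorm.zero_eq ι
        add_le' := X.isMatrixNorm.add_le ι
        neg' := fun x => le_antisymm (X.isMatrixNorm.neg_le x)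
          (by simpa using X.isMatrixNorm.neg_le (-x)) } with
    norm_mul_le := X.isMatrixNorm.mul_le ι }

instance (X : FilteredMatrixAlgebra.{u} p) {ι : Type} [Fintype ι] [DecidableEq ι] :
    NormedSpace ℂ (Matrix ι ι X.carrier) where
  norm_smul_le := X.isMatrixNorm.smul_le ι

variable (X : FilteredMatrixAlgebra.{u} p)

lemma norm_def {ι : Type} [Fintype ι] [DecidableEq ι] (x : Matrix ι ι X.carrier) :
    ‖x‖ = X.nrm ι x := rfl

/-- `(ε, r, N)`-idempotents. -/
def IsIdem (ε r N : ℝ) {ι : Type} [Fintype ι] [DecidableEq ι] (e : Matrix ι ι X.carrier) : Prop :=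
  ‖e * e - e‖ < ε ∧ (∀ i j, e i j ∈ X.fil r) ∧ ‖e‖ ≤ N ∧ ‖1 - e‖ ≤ N

/-- `(ε, r, N)`-inverse pairs. -/
def IsInvPair (ε r N : ℝ) {ι : Type} [Fintype ι] [DecidableEq ι] (u v : Matrix ι ι X.carrier) :
    Prop :=
  (∀ i j, u i j ∈ X.fil r) ∧ (∀ i j, v i j ∈ X.fil r) ∧ ‖u‖ ≤ N ∧ ‖v‖ ≤ N ∧
    ‖u * v - 1‖ < ε ∧ ‖v * u - 1‖ < ε

/-- `(ε, r, N)`-invertibles. -/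
def IsInv (ε r N : ℝ) {ι : Type} [Fintype ι] [DecidableEq ι] (u : Matrix ι ι X.carrier) : Prop :=
  ∃ v, X.IsInvPair ε r N u v

/-- A norm-continuous path of `(ε, r, N)`-idempotents. -/
def IdemHomotopic (ε r N : ℝ) {ι : Type} [Fintype ι] [DecidableEq ι]
    (e f : Matrix ι ι X.carrier) : Prop :=
  ∃ γ : Path e f, ∀ t, X.IsIdem ε r N (γ t)

/-- An `(ε, r, N)`-invertible of the algebra of continuous functions on `[0,1]` with prescribed
values at `0` and `1`: a norm-continuous path together with a norm-continuous path of
`(ε, r, N)`-inverses. -/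
def InvHomotopic (ε r N : ℝ) {ι : Type} [Fintype ι] [DecidableEq ι]
    (u u' : Matrix ι ι X.carrier) : Prop :=
  ∃ (v v' : Matrix ι ι X.carrier) (γ : Path u u') (δ : Path v v'),
    ∀ t, X.IsInvPair ε r N (γ t) (δ t)

section Basic

variable {X} {ι κ : Type} [Fintype ι] [DecidableEq ι] [Fintype κ] [DecidableEq κ]

lemma norm_blocks_le (x : Matrix ι ι X.carrier) (y : Matrix κ κ X.carrier) :
    ‖Matrix.fromBlocks x 0 0 y‖ ≤ max ‖x‖ ‖y‖ := X.isMatrixNorm.blocks_le ι κ x y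

lemma norm_submatrix_le (x : Matrix ι ι X.carrier) (σ τ : κ ≃ ι) : ‖x.submatrix σ τ‖ ≤ ‖x‖ :=
  X.isMatrixNorm.submatrix_le ι κ x σ τ

lemma norm_one_le : ‖(1 : Matrix ι ι X.carrier)‖ ≤ 1 := X.isMatrixNorm.one_le ι

lemma norm_antiblocks_le (x y : Matrix ι ι X.carrier) :
    ‖Matrix.fromBlocks 0 x y 0‖ ≤ max ‖x‖ ‖y‖ := by
  have h := norm_submatrix_le (Matrix.fromBlocks x 0 0 y) (Equiv.refl (ι ⊕ ι)) (Equiv.sumComm ι ι)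
  refine le_trans (le_of_eq ?_) (h.trans (norm_blocks_le x y))
  congr 1
  ext (i | i) (j | j) <;> rfl

lemma continuous_submatrix (σ : κ ≃ ι) :
    Continuous fun x : Matrix ι ι X.carrier => x.submatrix σ σ :=
  AddMonoidHomClass.continuous_of_bound
    (⟨⟨fun x : Matrix ι ι X.carrier => x.submatrix σ σ, rfl⟩, fun _ _ => rfl⟩ :
      Matrix ι ι X.carrier →+ Matrix κ κ X.carrier) 1
    fun x => by rw [one_mul]; exact norm_submatrix_le x σ σ

lemma continuous_blocks : Continuous fun z : Matrix ι ι X.carrier × Matrix κ κ X.carrier =>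
    Matrix.fromBlocks z.1 0 0 z.2 :=
  AddMonoidHomClass.continuous_of_bound
    (⟨⟨fun z : Matrix ι ι X.carrier × Matrix κ κ X.carrier => Matrix.fromBlocks z.1 0 0 z.2,
      Matrix.fromBlocks_zero⟩, fun a b => by
        simp [Matrix.fromBlocks_add]⟩ :
      Matrix ι ι X.carrier × Matrix κ κ X.carrier →+ Matrix (ι ⊕ κ) (ι ⊕ κ) X.carrier) 1
    fun x => by simpa [Prod.norm_def] using norm_blocks_le x.1 x.2

lemma IsIdem.reindex {ε r N : ℝ} {e : Matrix ι ι X.carrier} (h : X.IsIdem ε r N e) (σ : κ ≃ ι) :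
    X.IsIdem ε r N (e.submatrix σ σ) := by
  obtain ⟨h1, h2, h3, h4⟩ := h
  refine ⟨?_, fun i j => h2 _ _, (norm_submatrix_le e σ σ).trans h3, ?_⟩
  · rw [Matrix.submatrix_mul_equiv]
    exact (norm_submatrix_le (e * e - e) σ σ).trans_lt h1
  · rw [← Matrix.submatrix_one_equiv σ]
    exact (norm_submatrix_le (1 - e) σ σ).trans h4

lemma IsInvPair.reindex {ε r N : ℝ} {u v : Matrix ι ι X.carrier} (h : X.IsInvPair ε r N u v)
    (σ : κ ≃ ι) : X.IsInvPair ε r N (u.submatrix σ σ) (v.submatrix σ σ) := by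
  obtain ⟨h1, h2, h3, h4, h5, h6⟩ := h
  refine ⟨fun i j => h1 _ _, fun i j => h2 _ _, (norm_submatrix_le u σ σ).trans h3,
    (norm_submatrix_le v σ σ).trans h4, ?_, ?_⟩
  · rw [Matrix.submatrix_mul_equiv, ← Matrix.submatrix_one_equiv σ]
    exact (norm_submatrix_le (u * v - 1) σ σ).trans_lt h5
  · rw [Matrix.submatrix_mul_equiv, ← Matrix.submatrix_one_equiv σ]
    exact (norm_submatrix_le (v * u - 1) σ σ).trans_lt h6

lemma blocks_mul (a b : Matrix ι ι X.carrier) (c d : Matrix κ κ X.carrier) :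
    Matrix.fromBlocks a 0 0 c * Matrix.fromBlocks b 0 0 d =
      Matrix.fromBlocks (a * b) 0 0 (c * d) := by
  simp [Matrix.fromBlocks_multiply]

lemma blocks_sub (a b : Matrix ι ι X.carrier) (c d : Matrix κ κ X.carrier) :
    Matrix.fromBlocks a 0 0 c - Matrix.fromBlocks b 0 0 d =
      Matrix.fromBlocks (a - b) 0 0 (c - d) := by
  ext (i | i) (j | j) <;> simp

lemma blocks_mem {r : ℝ} {x : Matrix ι ι X.carrier} {y : Matrix κ κ X.carrier}
    (hx : ∀ i j, x i j ∈ X.fil r) (hy : ∀ i j, y i j ∈ X.fil r) :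
    ∀ i j, Matrix.fromBlocks x 0 0 y i j ∈ X.fil r := by
  rintro (i | i) (j | j)
  · exact hx i j
  · exact Submodule.zero_mem _
  · exact Submodule.zero_mem _
  · exact hy i j

lemma IsIdem.blocks {ε r N : ℝ} {e : Matrix ι ι X.carrier} {f : Matrix κ κ X.carrier}
    (h : X.IsIdem ε r N e) (h' : X.IsIdem ε r N f) :
    X.IsIdem ε r N (Matrix.fromBlocks e 0 0 f) := by
  refine ⟨?_, blocks_mem h.2.1 h'.2.1, ?_, ?_⟩
  · rw [blocks_mul, blocks_sub]
    exact (norm_blocks_le _ _).trans_lt (max_lt h.1 h'.1)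
  · exact (norm_blocks_le _ _).trans (max_le h.2.2.1 h'.2.2.1)
  · rw [← Matrix.fromBlocks_one, blocks_sub]
    exact (norm_blocks_le _ _).trans (max_le h.2.2.2 h'.2.2.2)

lemma IsInvPair.blocks {ε r N : ℝ} {u v : Matrix ι ι X.carrier} {u' v' : Matrix κ κ X.carrier}
    (h : X.IsInvPair ε r N u v) (h' : X.IsInvPair ε r N u' v') :
    X.IsInvPair ε r N (Matrix.fromBlocks u 0 0 u') (Matrix.fromBlocks v 0 0 v') := by
  obtain ⟨h1, h2, h3, h4, h5, h6⟩ := h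
  obtain ⟨k1, k2, k3, k4, k5, k6⟩ := h'
  refine ⟨blocks_mem h1 k1, blocks_mem h2 k2, (norm_blocks_le _ _).trans (max_le h3 k3),
    (norm_blocks_le _ _).trans (max_le h4 k4), ?_, ?_⟩
  · rw [blocks_mul, ← Matrix.fromBlocks_one, blocks_sub]
    exact (norm_blocks_le _ _).trans_lt (max_lt h5 k5)
  · rw [blocks_mul, ← Matrix.fromBlocks_one, blocks_sub]
    exact (norm_blocks_le _ _).trans_lt (max_lt h6 k6)

lemma zero_isIdem {ε r N : ℝ} (hε : 0 < ε) (hN : 1 ≤ N) :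
    X.IsIdem ε r N (0 : Matrix ι ι X.carrier) := by
  refine ⟨by simpa using hε, fun _ _ => Submodule.zero_mem _, ?_, ?_⟩
  · rw [norm_zero]; linarith
  · rw [sub_zero]; exact norm_one_le.trans hN

lemma one_entry_mem {r : ℝ} (hr : 0 < r) (i j : ι) : (1 : Matrix ι ι X.carrier) i j ∈ X.fil r := by
  rw [Matrix.one_apply]
  split_ifs
  · exact X.one_mem hr
  · exact Submodule.zero_mem _

lemma one_isInvPair {ε r N : ℝ} (hε : 0 < ε) (hr : 0 < r) (hN : 1 ≤ N) :
    X.IsInvPair ε r N (1 : Matrix ι ι X.carrier) 1 :=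
  ⟨one_entry_mem hr, one_entry_mem hr, norm_one_le.trans hN, norm_one_le.trans hN,
    by simpa using hε, by simpa using hε⟩

lemma forall_trans {α β : Type u} [TopologicalSpace α] [TopologicalSpace β] {a b c : α}
    {a' b' c' : β} {Q : α → β → Prop} {γ : Path a b} {γ' : Path b c} {δ : Path a' b'}
    {δ' : Path b' c'} (h : ∀ t, Q (γ t) (δ t)) (h' : ∀ t, Q (γ' t) (δ' t)) :
    ∀ t, Q (γ.trans γ' t) (δ.trans δ' t) := by
  intro t
  rw [Path.trans_apply, Path.trans_apply]
  split_ifs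
  · exact h _
  · exact h' _

lemma IdemHomotopic.trans {ε r N : ℝ} {e f g : Matrix ι ι X.carrier}
    (h : X.IdemHomotopic ε r N e f) (h' : X.IdemHomotopic ε r N f g) :
    X.IdemHomotopic ε r N e g := by
  obtain ⟨γ, hγ⟩ := h
  obtain ⟨γ', hγ'⟩ := h'
  exact ⟨γ.trans γ', forall_trans (Q := fun a _ => X.IsIdem ε r N a) (δ := γ) (δ' := γ') hγ hγ'⟩

lemma entries_combo {r : ℝ} {v w : Matrix ι ι X.carrier} (hv : ∀ i j, v i j ∈ X.fil r)
    (hw : ∀ i j, w i j ∈ X.fil r) (a b : ℂ) : ∀ i j, (a • v + b • w) i j ∈ X.fil r := fun i j =>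
  Submodule.add_mem _ (Submodule.smul_mem _ _ (hv i j)) (Submodule.smul_mem _ _ (hw i j))

lemma norm_combo_le {N : ℝ} {v w : Matrix ι ι X.carrier} (hv : ‖v‖ ≤ N) (hw : ‖w‖ ≤ N) {t : ℝ}
    (h0 : 0 ≤ t) (h1 : t ≤ 1) : ‖((1 - t : ℝ) : ℂ) • v + (t : ℂ) • w‖ ≤ N := by
  refine (norm_add_le _ _).trans ?_
  rw [norm_smul, norm_smul, Complex.norm_real, Complex.norm_real, Real.norm_of_nonneg h0,
    Real.norm_of_nonneg (by linarith)]
  nlinarith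

lemma norm_combo_lt {N : ℝ} {v w : Matrix ι ι X.carrier} (hv : ‖v‖ < N) (hw : ‖w‖ < N) {t : ℝ}
    (h0 : 0 ≤ t) (h1 : t ≤ 1) : ‖((1 - t : ℝ) : ℂ) • v + (t : ℂ) • w‖ < N :=
  (norm_combo_le (le_max_left _ _) (le_max_right _ _) h0 h1).trans_lt (max_lt hv hw)

/-- The segment between two matrices. -/
def segPath (v w : Matrix ι ι X.carrier) : Path v w where
  toFun t := ((1 - (t : ℝ) : ℝ) : ℂ) • v + ((t : ℝ) : ℂ) • w
  continuous_toFun := by fun_prop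
  source' := by simp
  target' := by simp

lemma IsInvPair.combo {ε r N : ℝ} {u v w : Matrix ι ι X.carrier} (h : X.IsInvPair ε r N u v)
    (h' : X.IsInvPair ε r N u w) (t : unitInterval) : X.IsInvPair ε r N u (segPath v w t) := by
  obtain ⟨h1, h2, h3, h4, h5, h6⟩ := h
  obtain ⟨k1, k2, k3, k4, k5, k6⟩ := h'
  have e : segPath v w t = ((1 - (t : ℝ) : ℝ) : ℂ) • v + ((t : ℝ) : ℂ) • w := rfl
  have one : (1 : Matrix ι ι X.carrier) =
      ((1 - (t : ℝ) : ℝ) : ℂ) • (1 : Matrix ι ι X.carrier) + ((t : ℝ) : ℂ) • (1 : Matrix ι ι X.carrier) := by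
    rw [← add_smul]; simp
  refine ⟨h1, ?_, h3, ?_, ?_, ?_⟩
  · rw [e]; exact entries_combo h2 k2 _ _
  · rw [e]; exact norm_combo_le h4 k4 t.2.1 t.2.2
  · have : u * segPath v w t - 1 = ((1 - (t : ℝ) : ℝ) : ℂ) • (u * v - 1) +
        ((t : ℝ) : ℂ) • (u * w - 1) := by
      conv_lhs => rw [e, one]
      rw [mul_add, mul_smul_comm, mul_smul_comm, smul_sub, smul_sub]
      abel
    rw [this]; exact norm_combo_lt h5 k5 t.2.1 t.2.2
  · have : segPath v w t * u - 1 = ((1 - (t : ℝ) : ℝ) : ℂ) • (v * u - 1) +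
        ((t : ℝ) : ℂ) • (w * u - 1) := by
      conv_lhs => rw [e, one]
      rw [add_mul, smul_mul_assoc, smul_mul_assoc, smul_sub, smul_sub]
      abel
    rw [this]; exact norm_combo_lt h6 k6 t.2.1 t.2.2

lemma InvHomotopic.trans {ε r N : ℝ} {u₀ u₁ u₂ : Matrix ι ι X.carrier}
    (h : X.InvHomotopic ε r N u₀ u₁) (h' : X.InvHomotopic ε r N u₁ u₂) :
    X.InvHomotopic ε r N u₀ u₂ := by
  obtain ⟨v, w, γ, δ, hγ⟩ := h
  obtain ⟨v', w', γ', δ', hγ'⟩ := h'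
  have a : X.IsInvPair ε r N u₁ w := by simpa using hγ 1
  have b : X.IsInvPair ε r N u₁ v' := by simpa using hγ' 0
  exact ⟨v, w', γ.trans ((Path.refl u₁).trans γ'), δ.trans ((segPath w v').trans δ'),
    forall_trans hγ (forall_trans (fun t => a.combo b t) hγ')⟩

/-! #### Rotations -/

variable (X ι) in
/-- `(0, -1; 1, 0)`. -/
def quarter : Matrix (ι ⊕ ι) (ι ⊕ ι) X.carrier := Matrix.fromBlocks 0 (-1) 1 0

lemma norm_quarter_le : ‖quarter X ι‖ ≤ 1 := by
  refine (norm_antiblocks_le _ _).trans (max_le ?_ norm_one_le)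
  rw [norm_neg]; exact norm_one_le

variable (X ι) in
/-- Rotation by the angle `πt/2`. -/
def rot (t : ℝ) : Matrix (ι ⊕ ι) (ι ⊕ ι) X.carrier :=
  (Real.cos (Real.pi / 2 * t) : ℂ) • 1 + (Real.sin (Real.pi / 2 * t) : ℂ) • quarter X ι

variable (X ι) in
/-- Rotation by the angle `-πt/2`. -/
def rotInv (t : ℝ) : Matrix (ι ⊕ ι) (ι ⊕ ι) X.carrier :=
  (Real.cos (Real.pi / 2 * t) : ℂ) • 1 - (Real.sin (Real.pi / 2 * t) : ℂ) • quarter X ι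

lemma quarter_mul_quarter : quarter X ι * quarter X ι = -1 := by
  rw [quarter, Matrix.fromBlocks_multiply, ← Matrix.fromBlocks_one, Matrix.fromBlocks_neg]
  simp

lemma cs_sq (t : ℝ) : (Real.cos t : ℂ) * (Real.cos t : ℂ) + (Real.sin t : ℂ) * (Real.sin t : ℂ) = 1 := by
  have := Real.cos_sq_add_sin_sq t
  rw [← Complex.ofReal_mul, ← Complex.ofReal_mul, ← Complex.ofReal_add]
  rw [← sq, ← sq, this, Complex.ofReal_one]

lemma rot_mul_rotInv (t : ℝ) : rot X ι t * rotInv X ι t = 1 := by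
  simp only [rot, rotInv, add_mul, mul_sub, smul_mul_smul_comm, quarter_mul_quarter, one_mul,
    mul_one]
  rw [mul_comm (Real.sin (Real.pi / 2 * t) : ℂ) (Real.cos (Real.pi / 2 * t) : ℂ), smul_neg]
  have e := congrArg (fun z : ℂ => z • (1 : Matrix (ι ⊕ ι) (ι ⊕ ι) X.carrier))
    (cs_sq (Real.pi / 2 * t))
  simp only [add_smul, one_smul] at e
  refine Eq.trans ?_ e
  abel

lemma rotInv_mul_rot (t : ℝ) : rotInv X ι t * rot X ι t = 1 := by
  simp only [rot, rotInv, sub_mul, mul_add, smul_mul_smul_comm, quarter_mul_quarter, one_mul,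
    mul_one]
  rw [mul_comm (Real.sin (Real.pi / 2 * t) : ℂ) (Real.cos (Real.pi / 2 * t) : ℂ), smul_neg]
  have e := congrArg (fun z : ℂ => z • (1 : Matrix (ι ⊕ ι) (ι ⊕ ι) X.carrier))
    (cs_sq (Real.pi / 2 * t))
  simp only [add_smul, one_smul] at e
  refine Eq.trans ?_ e
  abel

lemma norm_conj_le (t : ℝ) (x : Matrix (ι ⊕ ι) (ι ⊕ ι) X.carrier) :
    ‖rot X ι t * x * rotInv X ι t‖ ≤ 2 * ‖x‖ := by
  set c := Real.cos (Real.pi / 2 * t)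
  set s := Real.sin (Real.pi / 2 * t)
  have hc : ‖(c : ℂ) • (1 : Matrix (ι ⊕ ι) (ι ⊕ ι) X.carrier)‖ ≤ |c| := by
    rw [norm_smul, Complex.norm_real, Real.norm_eq_abs]
    exact mul_le_of_le_one_right (abs_nonneg _) norm_one_le
  have hs : ‖(s : ℂ) • quarter X ι‖ ≤ |s| := by
    rw [norm_smul, Complex.norm_real, Real.norm_eq_abs]
    exact mul_le_of_le_one_right (abs_nonneg _) norm_quarter_le
  have h1 : ‖rot X ι t‖ ≤ |c| + |s| := (norm_add_le _ _).trans (add_le_add hc hs)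
  have h2 : ‖rotInv X ι t‖ ≤ |c| + |s| := (norm_sub_le _ _).trans (add_le_add hc hs)
  have h3 : (|c| + |s|) * (|c| + |s|) ≤ 2 := by
    have e : |c| ^ 2 + |s| ^ 2 = 1 := by
      rw [sq_abs, sq_abs]; exact Real.cos_sq_add_sin_sq _
    nlinarith [sq_nonneg (|c| - |s|)]
  calc ‖rot X ι t * x * rotInv X ι t‖ ≤ ‖rot X ι t‖ * ‖x‖ * ‖rotInv X ι t‖ :=
        (norm_mul_le _ _).trans (mul_le_mul_of_nonneg_right (norm_mul_le _ _) (norm_nonneg _))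
    _ ≤ (|c| + |s|) * ‖x‖ * (|c| + |s|) := by gcongr
    _ = (|c| + |s|) * (|c| + |s|) * ‖x‖ := by ring
    _ ≤ 2 * ‖x‖ := mul_le_mul_of_nonneg_right h3 (norm_nonneg _)

lemma conj_eq (t : ℝ) (x y : Matrix ι ι X.carrier) :
    rot X ι t * Matrix.fromBlocks x 0 0 y * rotInv X ι t =
      Matrix.fromBlocks
        (((Real.cos (Real.pi / 2 * t) * Real.cos (Real.pi / 2 * t) : ℝ) : ℂ) • x +
          ((Real.sin (Real.pi / 2 * t) * Real.sin (Real.pi / 2 * t) : ℝ) : ℂ) • y)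
        (((Real.cos (Real.pi / 2 * t) * Real.sin (Real.pi / 2 * t) : ℝ) : ℂ) • (x - y))
        (((Real.cos (Real.pi / 2 * t) * Real.sin (Real.pi / 2 * t) : ℝ) : ℂ) • (x - y))
        (((Real.sin (Real.pi / 2 * t) * Real.sin (Real.pi / 2 * t) : ℝ) : ℂ) • x +
          ((Real.cos (Real.pi / 2 * t) * Real.cos (Real.pi / 2 * t) : ℝ) : ℂ) • y) := by
  set c := Real.cos (Real.pi / 2 * t)
  set s := Real.sin (Real.pi / 2 * t)
  have hR : rot X ι t = Matrix.fromBlocks ((c : ℂ) • 1) (-((s : ℂ) • 1)) ((s : ℂ) • 1) ((c : ℂ) • 1) := by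
    rw [rot, quarter, ← Matrix.fromBlocks_one, Matrix.fromBlocks_smul, Matrix.fromBlocks_smul,
      Matrix.fromBlocks_add]
    simp [c, s]
  have hR' : rotInv X ι t =
      Matrix.fromBlocks ((c : ℂ) • 1) ((s : ℂ) • 1) (-((s : ℂ) • 1)) ((c : ℂ) • 1) := by
    rw [rotInv, sub_eq_add_neg, quarter, ← Matrix.fromBlocks_one, Matrix.fromBlocks_smul,
      Matrix.fromBlocks_smul, Matrix.fromBlocks_neg, Matrix.fromBlocks_add]
    simp [c, s]
  rw [hR, hR', Matrix.fromBlocks_multiply, Matrix.fromBlocks_multiply]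
  simp only [smul_mul_assoc, mul_smul_comm, one_mul, mul_one, mul_zero, zero_mul, add_zero,
    zero_add, neg_mul, mul_neg, smul_smul, smul_zero, neg_neg, smul_neg, Complex.ofReal_mul,
    smul_sub]
  congr 1
  · rw [sub_eq_add_neg, mul_comm (s : ℂ) (c : ℂ)]
  · rw [sub_eq_add_neg, mul_comm (s : ℂ) (c : ℂ)]

lemma continuous_rot : Continuous (rot X ι) := by unfold rot; fun_prop

lemma continuous_rotInv : Continuous (rotInv X ι) := by unfold rotInv; fun_prop

/-- The rotation path from `diag(x, y)` to `diag(y, x)`. -/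
def rotPath (x y : Matrix ι ι X.carrier) :
    Path (Matrix.fromBlocks x 0 0 y) (Matrix.fromBlocks y 0 0 x) where
  toFun t := rot X ι t * Matrix.fromBlocks x 0 0 y * rotInv X ι t
  continuous_toFun := by
    have h1 := continuous_rot (X := X) (ι := ι)
    have h2 := continuous_rotInv (X := X) (ι := ι)
    fun_prop
  source' := by rw [conj_eq]; simp
  target' := by rw [conj_eq]; simp

lemma conj_mem {r : ℝ} {x y : Matrix ι ι X.carrier} (hx : ∀ i j, x i j ∈ X.fil r)
    (hy : ∀ i j, y i j ∈ X.fil r) (t : ℝ) :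
    ∀ i j, (rot X ι t * Matrix.fromBlocks x 0 0 y * rotInv X ι t) i j ∈ X.fil r := by
  have hd : ∀ (a : ℂ) i j, (a • (x - y)) i j ∈ X.fil r := fun a i j =>
    Submodule.smul_mem _ _ (Submodule.sub_mem _ (hx i j) (hy i j))
  rw [conj_eq]
  rintro (i | i) (j | j)
  · exact entries_combo hx hy _ _ i j
  · exact hd _ i j
  · exact hd _ i j
  · exact entries_combo hx hy _ _ i j

lemma conj_mul_conj (t : ℝ) (x y : Matrix (ι ⊕ ι) (ι ⊕ ι) X.carrier) :
    rot X ι t * x * rotInv X ι t * (rot X ι t * y * rotInv X ι t) =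
      rot X ι t * (x * y) * rotInv X ι t := by
  calc _ = rot X ι t * x * (rotInv X ι t * rot X ι t) * y * rotInv X ι t := by
        simp only [mul_assoc]
    _ = _ := by rw [rotInv_mul_rot, mul_one]; simp only [mul_assoc]

lemma conj_one (t : ℝ) : rot X ι t * 1 * rotInv X ι t = 1 := by rw [mul_one, rot_mul_rotInv]

lemma conj_sub (t : ℝ) (x y : Matrix (ι ⊕ ι) (ι ⊕ ι) X.carrier) :
    rot X ι t * x * rotInv X ι t - rot X ι t * y * rotInv X ι t =
      rot X ι t * (x - y) * rotInv X ι t := by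
  rw [mul_sub, sub_mul]

lemma idemHomotopic_rot {ε r N : ℝ} (hε : 0 < ε) (hN : 1 ≤ N) {x : Matrix ι ι X.carrier}
    (hx : X.IsIdem ε r N x) : X.IdemHomotopic (4 * ε) r (4 * N)
      (Matrix.fromBlocks x 0 0 (0 : Matrix ι ι X.carrier)) (Matrix.fromBlocks 0 0 0 x) := by
  have hb := hx.blocks (zero_isIdem (X := X) (ι := ι) (r := r) hε hN)
  obtain ⟨b1, b2, b3, b4⟩ := hb
  refine ⟨rotPath x 0, fun t => ?_⟩
  have e : rotPath x 0 t = rot X ι t * Matrix.fromBlocks x 0 0 0 * rotInv X ι t := rfl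
  rw [e]
  refine ⟨?_, conj_mem hx.2.1 (fun _ _ => Submodule.zero_mem _) _, ?_, ?_⟩
  · rw [conj_mul_conj, conj_sub]
    refine (norm_conj_le _ _).trans_lt ?_
    linarith
  · refine (norm_conj_le _ _).trans ?_
    linarith
  · have := conj_sub (t : ℝ) (1 : Matrix (ι ⊕ ι) (ι ⊕ ι) X.carrier) (Matrix.fromBlocks x 0 0 0)
    rw [conj_one] at this
    rw [this]
    refine (norm_conj_le _ _).trans ?_
    linarith

lemma fil_mono_mem {r s : ℝ} (hr : 0 < r) (hs : r ≤ s) {x : Matrix ι ι X.carrier}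
    (hx : ∀ i j, x i j ∈ X.fil r) : ∀ i j, x i j ∈ X.fil s := fun i j => X.fil_mono hr hs (hx i j)

lemma IsInvPair.mono {ε r N ε' r' N' : ℝ} {u v : Matrix ι ι X.carrier}
    (h : X.IsInvPair ε r N u v) (hr : 0 < r) (hε : ε ≤ ε') (hr' : r ≤ r') (hN : N ≤ N') :
    X.IsInvPair ε' r' N' u v :=
  ⟨fil_mono_mem hr hr' h.1, fil_mono_mem hr hr' h.2.1, h.2.2.1.trans hN, h.2.2.2.1.trans hN,
    h.2.2.2.2.1.trans_le hε, h.2.2.2.2.2.trans_le hε⟩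

lemma IsIdem.mono {ε r N ε' r' N' : ℝ} {e : Matrix ι ι X.carrier}
    (h : X.IsIdem ε r N e) (hr : 0 < r) (hε : ε ≤ ε') (hr' : r ≤ r') (hN : N ≤ N') :
    X.IsIdem ε' r' N' e :=
  ⟨h.1.trans_le hε, fil_mono_mem hr hr' h.2.1, h.2.2.1.trans hN, h.2.2.2.trans hN⟩

lemma IdemHomotopic.mono {ε r N ε' r' N' : ℝ} {e f : Matrix ι ι X.carrier}
    (h : X.IdemHomotopic ε r N e f) (hr : 0 < r) (hε : ε ≤ ε') (hr' : r ≤ r') (hN : N ≤ N') :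
    X.IdemHomotopic ε' r' N' e f := by
  obtain ⟨γ, hγ⟩ := h
  exact ⟨γ, fun t => (hγ t).mono hr hε hr' hN⟩

lemma InvHomotopic.mono {ε r N ε' r' N' : ℝ} {e f : Matrix ι ι X.carrier}
    (h : X.InvHomotopic ε r N e f) (hr : 0 < r) (hε : ε ≤ ε') (hr' : r ≤ r') (hN : N ≤ N') :
    X.InvHomotopic ε' r' N' e f := by
  obtain ⟨v, v', γ, δ, hγ⟩ := h
  exact ⟨v, v', γ, δ, fun t => (hγ t).mono hr hε hr' hN⟩

lemma invHomotopic_rot {ε r N : ℝ} (hε : 0 < ε) (hr : 0 < r) (hN : 1 ≤ N)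
    {x : Matrix ι ι X.carrier} (hx : X.IsInv ε r N x) : X.InvHomotopic (4 * ε) (2 * r) (4 * N)
      (Matrix.fromBlocks x 0 0 (1 : Matrix ι ι X.carrier)) (Matrix.fromBlocks 1 0 0 x) := by
  obtain ⟨y, hy⟩ := hx
  have hb := hy.blocks (one_isInvPair (X := X) (ι := ι) hε hr hN)
  obtain ⟨b1, b2, b3, b4, b5, b6⟩ := hb
  refine ⟨_, _, rotPath x 1, rotPath y 1, fun t => ?_⟩
  have e : ∀ z : Matrix ι ι X.carrier,
    rotPath z 1 t = rot X ι t * Matrix.fromBlocks z 0 0 1 * rotInv X ι t := fun _ => rfl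
  rw [e, e]
  have hr2 : r ≤ 2 * r := by linarith
  refine ⟨fil_mono_mem hr hr2 (conj_mem hy.1 (one_entry_mem hr) _),
    fil_mono_mem hr hr2 (conj_mem hy.2.1 (one_entry_mem hr) _), ?_, ?_, ?_, ?_⟩
  · refine (norm_conj_le _ _).trans ?_
    linarith
  · refine (norm_conj_le _ _).trans ?_
    linarith
  · rw [conj_mul_conj]
    have := conj_sub (t : ℝ) (Matrix.fromBlocks x 0 0 1 * Matrix.fromBlocks y 0 0 1)
      (1 : Matrix (ι ⊕ ι) (ι ⊕ ι) X.carrier)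
    rw [conj_one] at this
    rw [this]
    refine (norm_conj_le _ _).trans_lt ?_
    linarith
  · rw [conj_mul_conj]
    have := conj_sub (t : ℝ) (Matrix.fromBlocks y 0 0 1 * Matrix.fromBlocks x 0 0 1)
      (1 : Matrix (ι ⊕ ι) (ι ⊕ ι) X.carrier)
    rw [conj_one] at this
    rw [this]
    refine (norm_conj_le _ _).trans_lt ?_
    linarith

lemma mul_entries_mem {r : ℝ} (hr : 0 < r) {x y : Matrix ι ι X.carrier}
    (hx : ∀ i j, x i j ∈ X.fil r) (hy : ∀ i j, y i j ∈ X.fil r) :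
    ∀ i j, (x * y) i j ∈ X.fil (2 * r) := fun i j => by
  rw [Matrix.mul_apply, two_mul]
  exact Submodule.sum_mem _ fun k _ => X.mul_mem hr hr (hx i k) (hy k j)

/-- For an `(ε, r, N)`-inverse pair `(u, v)`, `diag(u, v)` is homotopic to the identity. -/
lemma invHomotopic_pair {ε r N : ℝ} (hε : 0 < ε) (hε' : ε ≤ 1) (hr : 0 < r) (hN : 1 ≤ N)
    {u v : Matrix ι ι X.carrier} (h : X.IsInvPair ε r N u v) :
    X.InvHomotopic (4 * ε) (2 * r) (4 * N) (Matrix.fromBlocks u 0 0 v) 1 := by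
  obtain ⟨h1, h2, h3, h4, h5, h6⟩ := h
  have hr2 : r ≤ 2 * r := by linarith
  have r2 : 0 < 2 * r := by linarith
  have n1 : ‖(1 : Matrix ι ι X.carrier)‖ ≤ 1 := norm_one_le
  have huv : ‖u * v‖ ≤ 1 + ε := by
    have : u * v = (u * v - 1) + 1 := by abel
    rw [this]; exact (norm_add_le _ _).trans (by linarith)
  have hvu : ‖v * u‖ ≤ 1 + ε := by
    have : v * u = (v * u - 1) + 1 := by abel
    rw [this]; exact (norm_add_le _ _).trans (by linarith)
  -- the first homotopy, from `diag(u, v)` to `diag(uv, 1)`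
  have first : X.InvHomotopic (4 * ε) (2 * r) (4 * N) (Matrix.fromBlocks u 0 0 v)
      (Matrix.fromBlocks (u * v) 0 0 1) := by
    let U : ℝ → Matrix (ι ⊕ ι) (ι ⊕ ι) X.carrier := fun t =>
      Matrix.fromBlocks u 0 0 1 * (rot X ι t * Matrix.fromBlocks 1 0 0 v * rotInv X ι t)
    let V : ℝ → Matrix (ι ⊕ ι) (ι ⊕ ι) X.carrier := fun t =>
      (rot X ι t * Matrix.fromBlocks v 0 0 1 * rotInv X ι t) * Matrix.fromBlocks 1 0 0 u
    have cU : Continuous U := by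
      have h1 := continuous_rot (X := X) (ι := ι)
      have h2 := continuous_rotInv (X := X) (ι := ι)
      fun_prop
    have cV : Continuous V := by
      have h1 := continuous_rot (X := X) (ι := ι)
      have h2 := continuous_rotInv (X := X) (ι := ι)
      fun_prop
    have eU : ∀ t, U t =
        ((Real.cos (Real.pi / 2 * t) * Real.cos (Real.pi / 2 * t) : ℝ) : ℂ) •
            Matrix.fromBlocks u 0 0 v +
          ((Real.sin (Real.pi / 2 * t) * Real.sin (Real.pi / 2 * t) : ℝ) : ℂ) •
            Matrix.fromBlocks (u * v) 0 0 1 +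
          ((Real.cos (Real.pi / 2 * t) * Real.sin (Real.pi / 2 * t) : ℝ) : ℂ) •
            Matrix.fromBlocks 0 (u - u * v) (1 - v) 0 := by
      intro t
      simp only [U]
      rw [conj_eq, Matrix.fromBlocks_multiply, Matrix.fromBlocks_smul, Matrix.fromBlocks_smul,
        Matrix.fromBlocks_smul, Matrix.fromBlocks_add, Matrix.fromBlocks_add]
      simp only [mul_add, mul_smul_comm, mul_one, one_mul, zero_mul, add_zero, zero_add, smul_zero,
        mul_sub]
      congr 1 <;> (try simp only [sub_self, smul_zero]) <;> abel
    have eV : ∀ t, V t =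
        ((Real.cos (Real.pi / 2 * t) * Real.cos (Real.pi / 2 * t) : ℝ) : ℂ) •
            Matrix.fromBlocks v 0 0 u +
          ((Real.sin (Real.pi / 2 * t) * Real.sin (Real.pi / 2 * t) : ℝ) : ℂ) •
            Matrix.fromBlocks 1 0 0 (v * u) +
          ((Real.cos (Real.pi / 2 * t) * Real.sin (Real.pi / 2 * t) : ℝ) : ℂ) •
            Matrix.fromBlocks 0 (v * u - u) (v - 1) 0 := by
      intro t
      simp only [V]
      rw [conj_eq, Matrix.fromBlocks_multiply, Matrix.fromBlocks_smul, Matrix.fromBlocks_smul,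
        Matrix.fromBlocks_smul, Matrix.fromBlocks_add, Matrix.fromBlocks_add]
      simp only [add_mul, smul_mul_assoc, mul_one, one_mul, mul_zero, add_zero, zero_add, smul_zero,
        sub_mul]
      congr 1 <;> (try simp only [sub_self, smul_zero]) <;> abel
    -- norm bound for the three-term expressions
    have bound : ∀ (t : ℝ) (a b d : Matrix (ι ⊕ ι) (ι ⊕ ι) X.carrier), ‖a‖ ≤ N → ‖b‖ ≤ 1 + ε →
        ‖d‖ ≤ N + 1 + ε →
        ‖((Real.cos (Real.pi / 2 * t) * Real.cos (Real.pi / 2 * t) : ℝ) : ℂ) • a +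
          ((Real.sin (Real.pi / 2 * t) * Real.sin (Real.pi / 2 * t) : ℝ) : ℂ) • b +
          ((Real.cos (Real.pi / 2 * t) * Real.sin (Real.pi / 2 * t) : ℝ) : ℂ) • d‖ ≤ 4 * N := by
      intro t a b d ha hb hd
      set c := Real.cos (Real.pi / 2 * t)
      set s := Real.sin (Real.pi / 2 * t)
      have hcs : c ^ 2 + s ^ 2 = 1 := Real.cos_sq_add_sin_sq _
      refine (norm_add₃_le).trans ?_
      rw [norm_smul, norm_smul, norm_smul, Complex.norm_real, Complex.norm_real, Complex.norm_real,
        Real.norm_of_nonneg (mul_self_nonneg c), Real.norm_of_nonneg (mul_self_nonneg s),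
        Real.norm_eq_abs]
      have k1 : |c * s| ≤ 1 / 2 := by
        rw [abs_le]
        constructor <;> nlinarith [sq_nonneg (c + s), sq_nonneg (c - s)]
      have k2 : |c * s| * ‖d‖ ≤ 1 / 2 * (N + 1 + ε) := by
        gcongr
      have k3 : c * c * ‖a‖ ≤ c * c * N := by gcongr; exact mul_self_nonneg c
      have k4 : s * s * ‖b‖ ≤ s * s * (2 * N) := by
        have : ‖b‖ ≤ 2 * N := by linarith
        gcongr; exact mul_self_nonneg s
      nlinarith [mul_self_nonneg c, mul_self_nonneg s]
    have memcomb : ∀ (t : ℝ) (a b d : Matrix (ι ⊕ ι) (ι ⊕ ι) X.carrier),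
        (∀ i j, a i j ∈ X.fil (2 * r)) → (∀ i j, b i j ∈ X.fil (2 * r)) →
        (∀ i j, d i j ∈ X.fil (2 * r)) → ∀ i j,
        (((Real.cos (Real.pi / 2 * t) * Real.cos (Real.pi / 2 * t) : ℝ) : ℂ) • a +
          ((Real.sin (Real.pi / 2 * t) * Real.sin (Real.pi / 2 * t) : ℝ) : ℂ) • b +
          ((Real.cos (Real.pi / 2 * t) * Real.sin (Real.pi / 2 * t) : ℝ) : ℂ) • d) i j ∈
            X.fil (2 * r) := fun t a b d ha hb hd i j =>
      Submodule.add_mem _ (entries_combo ha hb _ _ i j) (Submodule.smul_mem _ _ (hd i j))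
    have anti_mem : ∀ {x y : Matrix ι ι X.carrier}, (∀ i j, x i j ∈ X.fil (2 * r)) →
        (∀ i j, y i j ∈ X.fil (2 * r)) →
        ∀ i j, Matrix.fromBlocks 0 x y 0 i j ∈ X.fil (2 * r) := by
      intro x y hx hy
      rintro (i | i) (j | j)
      · exact Submodule.zero_mem _
      · exact hx i j
      · exact hy i j
      · exact Submodule.zero_mem _
    have sub_mem : ∀ {x y : Matrix ι ι X.carrier}, (∀ i j, x i j ∈ X.fil (2 * r)) →
        (∀ i j, y i j ∈ X.fil (2 * r)) → ∀ i j, (x - y) i j ∈ X.fil (2 * r) :=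
      fun hx hy i j => Submodule.sub_mem _ (hx i j) (hy i j)
    have mu := fil_mono_mem hr hr2 h1
    have mv := fil_mono_mem hr hr2 h2
    have m1 := one_entry_mem (X := X) (ι := ι) r2
    have muv := mul_entries_mem hr h1 h2
    have mvu := mul_entries_mem hr h2 h1
    have eUV : ∀ t, U t * V t = Matrix.fromBlocks (u * v) 0 0 (v * u) := by
      intro t
      have hcomm : rot X ι t * Matrix.fromBlocks v 0 0 v * rotInv X ι t =
          Matrix.fromBlocks v 0 0 v := by
        rw [conj_eq]
        simp only [sub_self, smul_zero]
        rw [← add_smul, ← add_smul, ← Complex.ofReal_add, ← Complex.ofReal_add, ← sq, ← sq,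
          Real.cos_sq_add_sin_sq, Real.sin_sq_add_cos_sq]
        simp
      calc U t * V t = Matrix.fromBlocks u 0 0 1 *
            ((rot X ι t * Matrix.fromBlocks 1 0 0 v * rotInv X ι t) *
              (rot X ι t * Matrix.fromBlocks v 0 0 1 * rotInv X ι t)) *
              Matrix.fromBlocks 1 0 0 u := by simp only [U, V, mul_assoc]
        _ = _ := by
          rw [conj_mul_conj, blocks_mul, one_mul, mul_one, hcomm, blocks_mul, blocks_mul, mul_one,
            one_mul]
    have eVU : ∀ t, V t * U t =
        rot X ι t * Matrix.fromBlocks (v * u) 0 0 (u * v) * rotInv X ι t := by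
      intro t
      have hcomm : rot X ι t * Matrix.fromBlocks u 0 0 u * rotInv X ι t =
          Matrix.fromBlocks u 0 0 u := by
        rw [conj_eq]
        simp only [sub_self, smul_zero]
        rw [← add_smul, ← add_smul, ← Complex.ofReal_add, ← Complex.ofReal_add, ← sq, ← sq,
          Real.cos_sq_add_sin_sq, Real.sin_sq_add_cos_sq]
        simp
      calc V t * U t = (rot X ι t * Matrix.fromBlocks v 0 0 1 * rotInv X ι t) *
            (Matrix.fromBlocks 1 0 0 u * Matrix.fromBlocks u 0 0 1) *
              (rot X ι t * Matrix.fromBlocks 1 0 0 v * rotInv X ι t) := by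
            simp only [U, V, mul_assoc]
        _ = _ := by
          rw [blocks_mul, one_mul, mul_one, ← hcomm, conj_mul_conj, conj_mul_conj, blocks_mul,
            blocks_mul, one_mul, mul_one]
    refine ⟨Matrix.fromBlocks v 0 0 u, Matrix.fromBlocks 1 0 0 (v * u),
      ⟨⟨fun t => U t, by fun_prop⟩, ?_, ?_⟩, ⟨⟨fun t => V t, by fun_prop⟩, ?_, ?_⟩, fun t => ?_⟩
    · show U ((0 : unitInterval) : ℝ) = _
      rw [eU]; simp
    · show U ((1 : unitInterval) : ℝ) = _
      rw [eU]; simp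
    · show V ((0 : unitInterval) : ℝ) = _
      rw [eV]; simp
    · show V ((1 : unitInterval) : ℝ) = _
      rw [eV]; simp
    show X.IsInvPair _ _ _ (U t) (V t)
    refine ⟨?_, ?_, ?_, ?_, ?_, ?_⟩
    · rw [eU]
      exact memcomb _ _ _ _ (blocks_mem mu mv) (blocks_mem muv m1)
        (anti_mem (sub_mem mu muv) (sub_mem m1 mv))
    · rw [eV]
      exact memcomb _ _ _ _ (blocks_mem mv mu) (blocks_mem m1 mvu)
        (anti_mem (sub_mem mvu mu) (sub_mem mv m1))
    · rw [eU]
      refine bound _ _ _ _ ((norm_blocks_le _ _).trans (max_le h3 h4))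
        ((norm_blocks_le _ _).trans (max_le huv (by linarith)))
        ((norm_antiblocks_le _ _).trans (max_le ?_ ?_))
      · exact (norm_sub_le _ _).trans (by linarith)
      · exact (norm_sub_le _ _).trans (by linarith)
    · rw [eV]
      refine bound _ _ _ _ ((norm_blocks_le _ _).trans (max_le h4 h3))
        ((norm_blocks_le _ _).trans (max_le (by linarith) hvu))
        ((norm_antiblocks_le _ _).trans (max_le ?_ ?_))
      · exact (norm_sub_le _ _).trans (by linarith)
      · exact (norm_sub_le _ _).trans (by linarith)
    · rw [eUV, ← Matrix.fromBlocks_one, blocks_sub]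
      exact (norm_blocks_le _ _).trans_lt (max_lt (by linarith) (by linarith))
    · have := conj_sub (t : ℝ) (Matrix.fromBlocks (v * u) 0 0 (u * v))
        (1 : Matrix (ι ⊕ ι) (ι ⊕ ι) X.carrier)
      rw [conj_one] at this
      rw [eVU, this]
      refine (norm_conj_le _ _).trans_lt ?_
      rw [← Matrix.fromBlocks_one, blocks_sub]
      have := norm_blocks_le (X := X) (v * u - 1) (u * v - 1)
      have := max_lt h6 h5
      linarith
  -- the second homotopy, from `diag(uv, 1)` to the identity
  have second : X.InvHomotopic (4 * ε) (2 * r) (4 * N)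
      (Matrix.fromBlocks (u * v) 0 0 (1 : Matrix ι ι X.carrier)) 1 := by
    rw [← Matrix.fromBlocks_one]
    have small : ‖Matrix.fromBlocks (u * v) 0 0 (1 : Matrix ι ι X.carrier) - 1‖ ≤ ε := by
      rw [← Matrix.fromBlocks_one, blocks_sub]
      refine (norm_blocks_le _ _).trans (max_le h5.le ?_)
      rw [sub_self, norm_zero]; exact hε.le
    have one' : (1 : Matrix (ι ⊕ ι) (ι ⊕ ι) X.carrier) = Matrix.fromBlocks 1 0 0 1 :=
      Matrix.fromBlocks_one.symm
    have pb : X.IsInvPair (4 * ε) (2 * r) (4 * N)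
        (1 : Matrix (ι ⊕ ι) (ι ⊕ ι) X.carrier) (Matrix.fromBlocks (u * v) 0 0 1) := by
      refine ⟨one_entry_mem r2, blocks_mem (mul_entries_mem hr h1 h2) (one_entry_mem r2),
        norm_one_le.trans (by linarith), (norm_blocks_le _ _).trans
          (max_le (by linarith) (by linarith)), ?_, ?_⟩
      · rw [one_mul]; linarith
      · rw [mul_one]; linarith
    have pc := (one_isInvPair (X := X) (ι := ι ⊕ ι) (show 0 < 4 * ε by linarith) r2
      (show 1 ≤ 4 * N by linarith))
    rw [← one'] 
    refine ⟨1, 1, segPath _ _, Path.refl 1, fun t => ?_⟩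
    have := pb.combo pc t
    exact ⟨this.2.1, this.1, this.2.2.2.1, this.2.2.1, this.2.2.2.2.2, this.2.2.2.2.1⟩
  exact first.trans second

end Basic

end FilteredMatrixAlgebra

/-! ### Parameters, control pairs and quantitative families -/

/-- The parameters `(ε, r, N)` of quantitative `K`-theory. -/
@[ext] structure Param where
  ε : ℝ
  r : ℝ
  N : ℝ
  ε_pos : 0 < ε
  ε_lt : ε < 1 / 20
  r_pos : 0 < r
  one_le_N : 1 ≤ N

instance : Preorder Param where
  le P Q := P.ε ≤ Q.ε ∧ P.r ≤ Q.r ∧ P.N ≤ Q.N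
  le_refl _ := ⟨le_rfl, le_rfl, le_rfl⟩
  le_trans _ _ _ h h' := ⟨h.1.trans h'.1, h.2.1.trans h'.2.1, h.2.2.trans h'.2.2⟩

/-- Control pairs `(λ, h)`, with `λ : [1, ∞) → [1, ∞)` and `h : (0, 1/20) × [1, ∞) → [1, ∞)`
(the values outside these domains play no role). -/
structure ControlPair where
  lam : ℝ → ℝ
  h : ℝ → ℝ → ℝ
  one_le_lam : ∀ {N : ℝ}, 1 ≤ N → 1 ≤ lam N
  lam_mono : ∀ {N N' : ℝ}, 1 ≤ N → N ≤ N' → lam N ≤ lam N'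
  one_le_h : ∀ {ε N : ℝ}, 0 < ε → ε < 1 / 20 → 1 ≤ N → 1 ≤ h ε N
  h_anti : ∀ {ε ε' N : ℝ}, 0 < ε → ε ≤ ε' → ε' < 1 / 20 → 1 ≤ N → h ε' N ≤ h ε N

instance : LE ControlPair where
  le c c' := (∀ N, 1 ≤ N → c.lam N ≤ c'.lam N) ∧
    ∀ ε N, 0 < ε → ε < 1 / 20 → 1 ≤ N → c.h ε N ≤ c'.h ε N

/-- The parameters `(λ_N ε, h_{ε,N} r, λ_N)`, defined when `λ_N ε < 1/20`. -/
def Param.ctrl (P : Param) (c : ControlPair) (hP : c.lam P.N * P.ε < 1 / 20) : Param where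
  ε := c.lam P.N * P.ε
  r := c.h P.ε P.N * P.r
  N := c.lam P.N
  ε_pos := mul_pos (one_pos.trans_le (c.one_le_lam P.one_le_N)) P.ε_pos
  ε_lt := hP
  r_pos := mul_pos (one_pos.trans_le (c.one_le_h P.ε_pos P.ε_lt P.one_le_N)) P.r_pos
  one_le_N := c.one_le_lam P.one_le_N

/-- A family of abelian groups indexed by `(ε, r, N)` with relaxation of control maps. -/
structure QFamily where
  grp : Param → Type u
  [inst : ∀ P, AddCommGroup (grp P)]
  relax : ∀ {P Q : Param}, P ≤ Q → grp P →+ grp Q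

attribute [instance] QFamily.inst

/-- `(λ, h)`-controlled morphisms. -/
structure ControlledMorphism (c : ControlPair) (F : QFamily.{u}) (G : QFamily.{u}) where
  app : ∀ (P : Param) (hP : c.lam P.N * P.ε < 1 / 20), F.grp P →+ G.grp (P.ctrl c hP)
  naturality : ∀ (P P' : Param) (hP : c.lam P.N * P.ε < 1 / 20)
    (hP' : c.lam P'.N * P'.ε < 1 / 20) (hle : P ≤ P') (hle' : P.ctrl c hP ≤ P'.ctrl c hP')
    (x : F.grp P), app P' hP' (F.relax hle x) = G.relax hle' (app P hP x)

lemma lt_of_comp_lt {c c' : ControlPair} {P : Param}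
    (hP : c'.lam (c.lam P.N) * c.lam P.N * P.ε < 1 / 20) : c.lam P.N * P.ε < 1 / 20 := by
  have h1 := c'.one_le_lam (c.one_le_lam P.one_le_N)
  have h2 : 0 < c.lam P.N * P.ε := mul_pos (one_pos.trans_le (c.one_le_lam P.one_le_N)) P.ε_pos
  nlinarith

/-- The parameters `((λ'·λ)_N ε, (h'·h)_{ε,N} r, (λ'·λ)_N)`, where `(λ'·λ)_N = λ'_{λ_N} λ_N` and
`(h'·h)_{ε,N} = h'_{λ_N ε,λ_N} h_{ε,N}`. -/
def Param.comp (P : Param) (c' c : ControlPair)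
    (hP : c'.lam (c.lam P.N) * c.lam P.N * P.ε < 1 / 20) : Param where
  ε := c'.lam (c.lam P.N) * c.lam P.N * P.ε
  r := c'.h (c.lam P.N * P.ε) (c.lam P.N) * c.h P.ε P.N * P.r
  N := c'.lam (c.lam P.N) * c.lam P.N
  ε_pos := mul_pos (mul_pos (one_pos.trans_le (c'.one_le_lam (c.one_le_lam P.one_le_N)))
    (one_pos.trans_le (c.one_le_lam P.one_le_N))) P.ε_pos
  ε_lt := hP
  r_pos := mul_pos (mul_pos
    (one_pos.trans_le (c'.one_le_h (P.ctrl c (lt_of_comp_lt hP)).ε_pos (lt_of_comp_lt hP)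
      (c.one_le_lam P.one_le_N)))
    (one_pos.trans_le (c.one_le_h P.ε_pos P.ε_lt P.one_le_N))) P.r_pos
  one_le_N := one_le_mul_of_one_le_of_one_le (c'.one_le_lam (c.one_le_lam P.one_le_N))
    (c.one_le_lam P.one_le_N)

lemma Param.comp_lt {c c' : ControlPair} {P : Param}
    (hP : c'.lam (c.lam P.N) * c.lam P.N * P.ε < 1 / 20) :
    c'.lam (P.ctrl c (lt_of_comp_lt hP)).N * (P.ctrl c (lt_of_comp_lt hP)).ε < 1 / 20 := by
  have : c'.lam (c.lam P.N) * (c.lam P.N * P.ε) < 1 / 20 := by rwa [← mul_assoc]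
  exact this

lemma Param.ctrl_ctrl_le {c c' : ControlPair} {P : Param}
    (hP : c'.lam (c.lam P.N) * c.lam P.N * P.ε < 1 / 20) :
    (P.ctrl c (lt_of_comp_lt hP)).ctrl c' (Param.comp_lt hP) ≤ P.comp c' c hP := by
  refine ⟨le_of_eq (mul_assoc _ _ _).symm, le_of_eq (mul_assoc _ _ _).symm, ?_⟩
  exact le_mul_of_one_le_right (one_pos.trans_le (c'.one_le_lam (c.one_le_lam P.one_le_N))).le
    (c.one_le_lam P.one_le_N)

/-- `(λ, h)`-exactness of `A --F--> B --G--> C` at `B`. -/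
def IsExact (c : ControlPair) {cF cG : ControlPair} {A B C : QFamily.{u}}
    (F : ControlledMorphism cF A B) (G : ControlledMorphism cG B C) : Prop :=
  (∀ (P : Param) (hP : cG.lam (cF.lam P.N) * cF.lam P.N * P.ε < 1 / 20) (x : A.grp P),
    G.app (P.ctrl cF (lt_of_comp_lt hP)) (Param.comp_lt hP) (F.app P (lt_of_comp_lt hP) x) = 0) ∧
  ∀ (P : Param) (hF : cF.lam (c.lam P.N) * c.lam P.N * P.ε < 1 / 20)
    (hG : cG.lam P.N * P.ε < 1 / 20) (y : B.grp P), G.app P hG y = 0 →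
    ∃ (hle : P ≤ P.comp cF c hF) (x : A.grp (P.ctrl c (lt_of_comp_lt hF))),
      B.relax (Param.ctrl_ctrl_le hF)
        (F.app (P.ctrl c (lt_of_comp_lt hF)) (Param.comp_lt hF) x) = B.relax hle y

/-- The control pair of the morphisms induced by completely contractive filtered homomorphisms:
the third parameter of the target of a controlled morphism being `λ_N`, this is `λ_N = N`,
`h = 1`. -/
def ControlPair.induced : ControlPair where
  lam N := N
  h _ _ := 1
  one_le_lam h := h
  lam_mono _ h := h
  one_le_h _ _ _ := le_rfl
  h_anti _ _ _ _ := le_rfl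

lemma Param.le_induced (P : Param) (hP : ControlPair.induced.lam P.N * P.ε < 1 / 20) :
    P ≤ P.ctrl ControlPair.induced hP :=
  ⟨le_mul_of_one_le_left P.ε_pos.le P.one_le_N, (one_mul P.r).ge, le_rfl⟩

/-! ### Quantitative `K`-groups -/

namespace FilteredMatrixAlgebra

variable {p : ℝ≥0∞} [Fact (1 ≤ p)]

/-- `(ε, r, N)`-idempotents, up to `(4ε, r, 4N)`-homotopy. -/
def idemSystem (X : FilteredMatrixAlgebra.{u} p) (P : Param) : StableSystem X.carrier where
  c := 0
  Good e := X.IsIdem P.ε P.r P.N e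
  Hom e f := X.IdemHomotopic (4 * P.ε) P.r (4 * P.N) e f
  good_pad ι _ _ := by
    rw [Matrix.diagonal_zero]
    exact zero_isIdem P.ε_pos P.one_le_N
  good_reindex σ _ h := h.reindex σ
  good_blocks h h' := h.blocks h'
  hom_refl {ι _ _ x} h := ⟨Path.refl x, fun _ => h.mono P.r_pos (by linarith [P.ε_pos]) le_rfl
    (by linarith [P.one_le_N])⟩
  hom_symm := by
    rintro ι _ _ x y ⟨γ, h⟩
    exact ⟨γ.symm, fun t => h _⟩
  hom_trans h h' := h.trans h'
  hom_reindex := by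
    rintro ι κ _ _ _ _ σ x y ⟨γ, h⟩
    exact ⟨γ.map (continuous_submatrix σ), fun t => (h t).reindex σ⟩
  hom_blocks := by
    rintro ι κ _ _ _ _ x x' y y' ⟨γ, h⟩ ⟨γ', h'⟩
    exact ⟨(γ.prod γ').map continuous_blocks, fun t => (h t).blocks (h' t)⟩
  hom_rot h := by
    rw [Matrix.diagonal_zero]
    exact idemHomotopic_rot P.ε_pos P.one_le_N h

/-- `(ε, r, N)`-invertibles, up to `(4ε, 2r, 4N)`-homotopy. -/
def glSystem (X : FilteredMatrixAlgebra.{u} p) (P : Param) : StableSystem X.carrier where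
  c := 1
  Good u := X.IsInv P.ε P.r P.N u
  Hom u v := X.InvHomotopic (4 * P.ε) (2 * P.r) (4 * P.N) u v
  good_pad ι _ _ := by
    rw [Matrix.diagonal_one]
    exact ⟨1, one_isInvPair P.ε_pos P.r_pos P.one_le_N⟩
  good_reindex σ _ h := by
    obtain ⟨v, h⟩ := h
    exact ⟨_, h.reindex σ⟩
  good_blocks h h' := by
    obtain ⟨v, h⟩ := h
    obtain ⟨v', h'⟩ := h'
    exact ⟨_, h.blocks h'⟩
  hom_refl {ι _ _ x} h := by
    obtain ⟨v, h⟩ := h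
    exact ⟨v, v, Path.refl x, Path.refl v, fun _ => h.mono P.r_pos (by linarith [P.ε_pos])
      (by linarith [P.r_pos]) (by linarith [P.one_le_N])⟩
  hom_symm := by
    rintro ι _ _ x y ⟨v, v', γ, δ, h⟩
    exact ⟨v', v, γ.symm, δ.symm, fun t => h _⟩
  hom_trans h h' := h.trans h'
  hom_reindex := by
    rintro ι κ _ _ _ _ σ x y ⟨v, v', γ, δ, h⟩
    exact ⟨_, _, γ.map (continuous_submatrix σ), δ.map (continuous_submatrix σ),
      fun t => (h t).reindex σ⟩
  hom_blocks := by
    rintro ι κ _ _ _ _ x x' y y' ⟨v, v', γ, δ, h⟩ ⟨w, w', γ', δ', h'⟩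
    exact ⟨_, _, (γ.prod γ').map continuous_blocks, (δ.prod δ').map continuous_blocks,
      fun t => (h t).blocks (h' t)⟩
  hom_rot h := by
    rw [Matrix.diagonal_one]
    exact invHomotopic_rot P.ε_pos P.r_pos P.one_le_N h

lemma exists_neg (X : FilteredMatrixAlgebra.{u} p) (P : Param) (a : (X.glSystem P).Classes) :
    ∃ b, b + a = 0 := by
  obtain ⟨n, x, hx, rfl⟩ := StableSystem.cls_surj a
  obtain ⟨y, hy⟩ := id hx
  have hy' : (X.glSystem P).Good y :=
    ⟨x, hy.2.1, hy.1, hy.2.2.2.1, hy.2.2.1, hy.2.2.2.2.2, hy.2.2.2.2.1⟩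
  refine ⟨StableSystem.cls y hy', ?_⟩
  rw [add_comm, StableSystem.cls_add]
  refine StableSystem.cls_eq_zero_of_hom _ ?_
  have h := (X.glSystem P).hom_reindex finSumFinEquiv.symm
    (invHomotopic_pair P.ε_pos (by linarith [P.ε_lt]) P.r_pos P.one_le_N hy)
  rw [Matrix.submatrix_one_equiv] at h
  have e : (Matrix.diagonal fun _ => (X.glSystem P).c : Matrix (Fin (n + n)) (Fin (n + n)) X.carrier)
    = 1 := Matrix.diagonal_one
  rw [e]
  exact h

instance (X : FilteredMatrixAlgebra.{u} p) (P : Param) : Neg (X.glSystem P).Classes where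
  neg a := Classical.choose (exists_neg X P a)

instance (X : FilteredMatrixAlgebra.{u} p) (P : Param) : AddCommGroup (X.glSystem P).Classes :=
  { (inferInstance : AddCommMonoid (X.glSystem P).Classes) with
    zsmul := zsmulRec
    neg_add_cancel := fun a => Classical.choose_spec (exists_neg X P a) }

/-- `K_0` of a unital algebra: the Grothendieck group of the classes of `(ε, r, N)`-idempotents. -/
abbrev K0u (X : FilteredMatrixAlgebra.{u} p) (P : Param) : Type u :=
  Algebra.GrothendieckAddGroup (X.idemSystem P).Classes

/-- `K_1` of a unital algebra: the classes of `(ε, r, N)`-invertibles. -/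
abbrev K1u (X : FilteredMatrixAlgebra.{u} p) (P : Param) : Type u := (X.glSystem P).Classes

/-- Unital homomorphisms that are contractive on matrices of all sizes, respect the filtrations
and commute with the augmentations. -/
structure Hom (X : FilteredMatrixAlgebra.{u} p) (Y : FilteredMatrixAlgebra.{v} p) where
  toAlgHom : X.carrier →ₐ[ℂ] Y.carrier
  nrm_le : ∀ (ι : Type) [Fintype ι] (x : Matrix ι ι X.carrier),
    Y.nrm ι (x.map toAlgHom) ≤ X.nrm ι x
  fil_le : ∀ {r : ℝ} {a : X.carrier}, 0 < r → a ∈ X.fil r → toAlgHom a ∈ Y.fil r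
  aug_comp : ∀ a, Y.aug (toAlgHom a) = X.aug a

namespace Hom

variable {X : FilteredMatrixAlgebra.{u} p} {Y : FilteredMatrixAlgebra.{v} p}

/-- The identity. -/
def id (X : FilteredMatrixAlgebra.{u} p) : Hom X X where
  toAlgHom := AlgHom.id ℂ _
  nrm_le ι _ x := le_of_eq (by congr 1)
  fil_le _ h := h
  aug_comp _ := rfl

variable (φ : Hom X Y) {ι : Type} [Fintype ι] [DecidableEq ι]

/-- The induced additive homomorphism on matrices. -/
def mat : Matrix ι ι X.carrier →+ Matrix ι ι Y.carrier where
  toFun x := x.map φ.toAlgHom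
  map_zero' := Matrix.map_zero _ (map_zero φ.toAlgHom)
  map_add' := Matrix.map_add _ (map_add φ.toAlgHom)

lemma norm_mat_le (x : Matrix ι ι X.carrier) : ‖φ.mat x‖ ≤ ‖x‖ := φ.nrm_le ι x

lemma continuous_mat : Continuous (φ.mat : Matrix ι ι X.carrier → Matrix ι ι Y.carrier) :=
  AddMonoidHomClass.continuous_of_bound φ.mat 1 fun x => by
    rw [one_mul]; exact φ.norm_mat_le x

lemma mat_mul (x y : Matrix ι ι X.carrier) : φ.mat (x * y) = φ.mat x * φ.mat y :=
  Matrix.map_mul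

lemma mat_one : φ.mat (1 : Matrix ι ι X.carrier) = 1 :=
  Matrix.map_one _ (map_zero φ.toAlgHom) (map_one φ.toAlgHom)

lemma isIdem {ε r N : ℝ} (hr : 0 < r) {e : Matrix ι ι X.carrier} (h : X.IsIdem ε r N e) :
    Y.IsIdem ε r N (φ.mat e) := by
  obtain ⟨h1, h2, h3, h4⟩ := h
  refine ⟨?_, fun i j => φ.fil_le hr (h2 i j), (φ.norm_mat_le e).trans h3, ?_⟩
  · rw [← mat_mul, ← map_sub]
    exact (φ.norm_mat_le _).trans_lt h1
  · rw [← mat_one φ, ← map_sub]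
    exact (φ.norm_mat_le _).trans h4

lemma isInvPair {ε r N : ℝ} (hr : 0 < r) {u v : Matrix ι ι X.carrier} (h : X.IsInvPair ε r N u v) :
    Y.IsInvPair ε r N (φ.mat u) (φ.mat v) := by
  obtain ⟨h1, h2, h3, h4, h5, h6⟩ := h
  refine ⟨fun i j => φ.fil_le hr (h1 i j), fun i j => φ.fil_le hr (h2 i j),
    (φ.norm_mat_le u).trans h3, (φ.norm_mat_le v).trans h4, ?_, ?_⟩
  · rw [← mat_mul, ← mat_one φ, ← map_sub]
    exact (φ.norm_mat_le _).trans_lt h5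
  · rw [← mat_mul, ← mat_one φ, ← map_sub]
    exact (φ.norm_mat_le _).trans_lt h6

/-- `[e]_{ε,r,N} ↦ [φ(e)]_{ε',r',N'}` on classes of quasi-idempotents, for `ε ≤ ε'`, `r ≤ r'`,
`N ≤ N'`. -/
def mapIdem {P Q : Param} (h : P ≤ Q) : (X.idemSystem P).Classes →+ (Y.idemSystem Q).Classes :=
  StableSystem.mapClasses (S := X.idemSystem P) (S' := Y.idemSystem Q)
    (φ.toAlgHom : X.carrier →+* Y.carrier) (map_zero φ.toAlgHom)
    (fun hx => (φ.isIdem P.r_pos hx).mono P.r_pos h.1 h.2.1 h.2.2)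
    (fun hx => by
      obtain ⟨γ, hγ⟩ := hx
      exact ⟨γ.map φ.continuous_mat, fun t => (φ.isIdem P.r_pos (hγ t)).mono P.r_pos
        (by linarith [h.1]) h.2.1 (by linarith [h.2.2])⟩)

/-- `[u]_{ε,r,N} ↦ [φ(u)]_{ε',r',N'}` on classes of quasi-invertibles, for `ε ≤ ε'`, `r ≤ r'`,
`N ≤ N'`. -/
def mapGL {P Q : Param} (h : P ≤ Q) : X.K1u P →+ Y.K1u Q :=
  StableSystem.mapClasses (S := X.glSystem P) (S' := Y.glSystem Q)
    (φ.toAlgHom : X.carrier →+* Y.carrier) (map_one φ.toAlgHom)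
    (fun hx => by
      obtain ⟨v, hx⟩ := hx
      exact ⟨_, (φ.isInvPair P.r_pos hx).mono P.r_pos h.1 h.2.1 h.2.2⟩)
    (fun hx => by
      have r2 : 0 < 2 * P.r := by linarith [P.r_pos]
      obtain ⟨v, v', γ, δ, hγ⟩ := hx
      exact ⟨_, _, γ.map φ.continuous_mat, δ.map φ.continuous_mat, fun t =>
        (φ.isInvPair r2 (hγ t)).mono r2 (by linarith [h.1]) (by linarith [h.2.1])
          (by linarith [h.2.2])⟩)

/-- The map induced on the `K_0`-groups of unital algebras. -/
def mapK0u {P Q : Param} (h : P ≤ Q) : X.K0u P →+ Y.K0u Q :=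
  Algebra.GrothendieckAddGroup.lift (Algebra.GrothendieckAddGroup.of.comp (φ.mapIdem h))

lemma mapK0u_of {P Q : Param} (h : P ≤ Q) (a : (X.idemSystem P).Classes) :
    φ.mapK0u h (Algebra.GrothendieckAddGroup.of a) =
      Algebra.GrothendieckAddGroup.of (φ.mapIdem h a) :=
  DFunLike.congr_fun (Algebra.GrothendieckAddGroup.lift.symm_apply_apply
    (Algebra.GrothendieckAddGroup.of.comp (φ.mapIdem h))) a

section Comp

universe w w'

variable {Z : FilteredMatrixAlgebra.{w} p} {Y' : FilteredMatrixAlgebra.{w'} p}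

lemma mapIdem_square (ψ : Hom Y Z) (φ' : Hom X Y') (ψ' : Hom Y' Z)
    (hc : ∀ a, ψ.toAlgHom (φ.toAlgHom a) = ψ'.toAlgHom (φ'.toAlgHom a)) {P Q Q' R : Param}
    (h : P ≤ Q) (k : Q ≤ R) (h' : P ≤ Q') (k' : Q' ≤ R) (a : (X.idemSystem P).Classes) :
    ψ.mapIdem k (φ.mapIdem h a) = ψ'.mapIdem k' (φ'.mapIdem h' a) := by
  obtain ⟨n, x, hx, rfl⟩ := StableSystem.cls_surj a
  refine StableSystem.cls_congr _ _ ?_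
  ext i j
  exact hc _

lemma mapGL_square (ψ : Hom Y Z) (φ' : Hom X Y') (ψ' : Hom Y' Z)
    (hc : ∀ a, ψ.toAlgHom (φ.toAlgHom a) = ψ'.toAlgHom (φ'.toAlgHom a)) {P Q Q' R : Param}
    (h : P ≤ Q) (k : Q ≤ R) (h' : P ≤ Q') (k' : Q' ≤ R) (a : X.K1u P) :
    ψ.mapGL k (φ.mapGL h a) = ψ'.mapGL k' (φ'.mapGL h' a) := by
  obtain ⟨n, x, hx, rfl⟩ := StableSystem.cls_surj a
  refine StableSystem.cls_congr _ _ ?_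
  ext i j
  exact hc _

lemma mapK0u_square (ψ : Hom Y Z) (φ' : Hom X Y') (ψ' : Hom Y' Z)
    (hc : ∀ a, ψ.toAlgHom (φ.toAlgHom a) = ψ'.toAlgHom (φ'.toAlgHom a)) {P Q Q' R : Param}
    (h : P ≤ Q) (k : Q ≤ R) (h' : P ≤ Q') (k' : Q' ≤ R) (a : X.K0u P) :
    ψ.mapK0u k (φ.mapK0u h a) = ψ'.mapK0u k' (φ'.mapK0u h' a) := by
  suffices H : (ψ.mapK0u k).comp (φ.mapK0u h) = (ψ'.mapK0u k').comp (φ'.mapK0u h') from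
    DFunLike.congr_fun H a
  apply Algebra.GrothendieckAddGroup.lift.symm.injective
  ext b
  show ψ.mapK0u k (φ.mapK0u h (Algebra.GrothendieckAddGroup.of b)) =
    ψ'.mapK0u k' (φ'.mapK0u h' (Algebra.GrothendieckAddGroup.of b))
  rw [mapK0u_of, mapK0u_of, mapK0u_of, mapK0u_of, mapIdem_square φ ψ φ' ψ' hc h k h' k']

end Comp

end Hom

/-- The complex numbers, with `M_n(ℂ) = B(ℓ_p^n)` and `ℂ_r = ℂ` for all `r`. -/
def scalars (p : ℝ≥0∞) [Fact (1 ≤ p)] [Fact (p ≠ ∞)] : FilteredMatrixAlgebra.{0} p where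
  carrier := ℂ
  nrm ι _ x := opNorm p ι (x.map fun z => z • (1 : ℂ →L[ℂ] ℂ))
  isMatrixNorm := by
    have h := IsMatrixNorm.opNorm_pullback p (Algebra.ofId ℂ (ℂ →L[ℂ] ℂ))
    have e : (⇑(Algebra.ofId ℂ (ℂ →L[ℂ] ℂ)) : ℂ → ℂ →L[ℂ] ℂ) = fun z => z • 1 :=
      funext fun z => Algebra.algebraMap_eq_smul_one z
    rwa [e] at h
  fil _ := ⊤
  fil_mono _ _ := le_rfl
  one_mem _ := trivial
  mul_mem _ _ _ _ := trivial
  aug := AlgHom.id ℂ ℂ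
  aug_le _ _ _ := le_rfl

variable [Fact (p ≠ ∞)]

/-- The augmentation as a homomorphism to the complex numbers. -/
def augHom (X : FilteredMatrixAlgebra.{u} p) : Hom X (scalars p) where
  toAlgHom := X.aug
  nrm_le ι _ x := by
    refine le_trans (le_of_eq ?_) (X.aug_le ι x)
    exact congrArg (opNorm p ι) (by ext i j; rfl)
  fil_le _ _ := trivial
  aug_comp _ := rfl

/-- `ker (π_* : K_0(X) → K_0(ℂ))`. -/
def K0red (X : FilteredMatrixAlgebra.{u} p) (P : Param) : AddSubgroup (X.K0u P) :=
  (X.augHom.mapK0u (le_refl P)).ker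

/-- `ker (π_* : K_1(X) → K_1(ℂ))`. -/
def K1red (X : FilteredMatrixAlgebra.{u} p) (P : Param) : AddSubgroup (X.K1u P) :=
  (X.augHom.mapGL (le_refl P)).ker

variable {X Y : FilteredMatrixAlgebra.{u} p}

lemma mapK0u_mem (φ : Hom X Y) {P Q : Param} (h : P ≤ Q) {x : X.K0u P} (hx : x ∈ X.K0red P) :
    φ.mapK0u h x ∈ Y.K0red Q := by
  have hx' : X.augHom.mapK0u (le_refl P) x = 0 := hx
  show Y.augHom.mapK0u (le_refl Q) (φ.mapK0u h x) = 0
  rw [Hom.mapK0u_square φ Y.augHom X.augHom (Hom.id _) φ.aug_comp h (le_refl Q) (le_refl P) h, hx',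
    map_zero]

lemma mapGL_mem (φ : Hom X Y) {P Q : Param} (h : P ≤ Q) {x : X.K1u P} (hx : x ∈ X.K1red P) :
    φ.mapGL h x ∈ Y.K1red Q := by
  have hx' : X.augHom.mapGL (le_refl P) x = 0 := hx
  show Y.augHom.mapGL (le_refl Q) (φ.mapGL h x) = 0
  rw [Hom.mapGL_square φ Y.augHom X.augHom (Hom.id _) φ.aug_comp h (le_refl Q) (le_refl P) h, hx',
    map_zero]

/-- The map induced on reduced `K_0`-groups, followed by relaxation of control. -/
def Hom.mapK0 (φ : Hom X Y) {P Q : Param} (h : P ≤ Q) : X.K0red P →+ Y.K0red Q :=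
  ((φ.mapK0u h).comp (X.K0red P).subtype).codRestrict _ fun x => mapK0u_mem φ h x.2

/-- The map induced on reduced `K_1`-groups, followed by relaxation of control. -/
def Hom.mapK1 (φ : Hom X Y) {P Q : Param} (h : P ≤ Q) : X.K1red P →+ Y.K1red Q :=
  ((φ.mapGL h).comp (X.K1red P).subtype).codRestrict _ fun x => mapGL_mem φ h x.2

/-- The family of the groups `ker (π_* : K_0^{ε,r,N}(X) → K_0^{ε,r,N}(ℂ))`. -/
def K0 (X : FilteredMatrixAlgebra.{u} p) : QFamily.{u} where
  grp P := X.K0red P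
  relax h := (Hom.id X).mapK0 h

/-- The family of the groups `ker (π_* : K_1^{ε,r,N}(X) → K_1^{ε,r,N}(ℂ))`. -/
def K1 (X : FilteredMatrixAlgebra.{u} p) : QFamily.{u} where
  grp P := X.K1red P
  relax h := (Hom.id X).mapK1 h

/-- The controlled morphism induced by `φ` on `K_0`. -/
def Hom.onK0 (φ : Hom X Y) : ControlledMorphism ControlPair.induced X.K0 Y.K0 where
  app P hP := φ.mapK0 (P.le_induced hP)
  naturality P P' hP hP' hle hle' x := Subtype.ext
    (Hom.mapK0u_square (Hom.id X) φ φ (Hom.id Y) (fun _ => rfl) hle (P'.le_induced hP')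
      (P.le_induced hP) hle' x.1)

/-- The controlled morphism induced by `φ` on `K_1`. -/
def Hom.onK1 (φ : Hom X Y) : ControlledMorphism ControlPair.induced X.K1 Y.K1 where
  app P hP := φ.mapK1 (P.le_induced hP)
  naturality P P' hP hP' hle hle' x := Subtype.ext
    (Hom.mapGL_square (Hom.id X) φ φ (Hom.id Y) (fun _ => rfl) hle (P'.le_induced hP')
      (P.le_induced hP) hle' x.1)

/-- The class of an `(ε, r, N)`-idempotent in the `K_0`-group of a unital algebra. -/
def idemClass (X : FilteredMatrixAlgebra.{u} p) (P : Param) {n : ℕ}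
    (e : Matrix (Fin n) (Fin n) X.carrier) (he : X.IsIdem P.ε P.r P.N e) : X.K0u P :=
  Algebra.GrothendieckAddGroup.of (StableSystem.cls (S := X.idemSystem P) e he)

/-- The class of an `(ε, r, N)`-invertible in the `K_1`-group of a unital algebra. -/
def invClass (X : FilteredMatrixAlgebra.{u} p) (P : Param) {n : ℕ}
    (u : Matrix (Fin n) (Fin n) X.carrier) (hu : X.IsInv P.ε P.r P.N u) : X.K1u P :=
  StableSystem.cls (S := X.glSystem P) u hu

/-- `diag(1_n, 0_m)`. -/
def corner (X : FilteredMatrixAlgebra.{u} p) (n m : ℕ) :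
    Matrix (Fin (n + m)) (Fin (n + m)) X.carrier :=
  blockSum (1 : Matrix (Fin n) (Fin n) X.carrier) (0 : Matrix (Fin m) (Fin m) X.carrier)

end FilteredMatrixAlgebra

/-! ### Filtered algebras of operators -/

/-- `E` is isometric to a subspace of a quotient of an `L_p`-space. -/
def IsSQp (p : ℝ≥0∞) [Fact (1 ≤ p)] (E : Type u) [NormedAddCommGroup E] [NormedSpace ℂ E] : Prop :=
  ∃ (Ω : Type v) (_ : MeasurableSpace Ω) (μ : MeasureTheory.Measure Ω)
    (M : Submodule ℂ (MeasureTheory.Lp ℂ p μ)) (_ : IsClosed (M : Set (MeasureTheory.Lp ℂ p μ))),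
    Nonempty (E →ₗᵢ[ℂ] (MeasureTheory.Lp ℂ p μ ⧸ M))

section Operators

variable {E : Type u} [NormedAddCommGroup E] [NormedSpace ℂ E]

variable (E) in
/-- An algebra `A` of operators on `E` with subspaces `(A_r)_{r > 0}`, increasing in `r` and with
`A_r A_s ⊆ A_{r+s}`. -/
structure FilteredSubalgebra where
  alg : NonUnitalSubalgebra ℂ (E →L[ℂ] E)
  fil : ℝ → Submodule ℂ (E →L[ℂ] E)
  fil_le : ∀ {r : ℝ} {a : E →L[ℂ] E}, 0 < r → a ∈ fil r → a ∈ alg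
  fil_mono : ∀ {r s : ℝ}, 0 < r → r ≤ s → fil r ≤ fil s
  mul_mem : ∀ {r s : ℝ} {a b : E →L[ℂ] E}, 0 < r → 0 < s → a ∈ fil r → b ∈ fil s →
    a * b ∈ fil (r + s)

namespace FilteredSubalgebra

/-- `A` is a filtered Banach algebra: it is norm closed, the `A_r` are closed subspaces with dense
union, and if `A` has a unit then the unit lies in every `A_r`. -/
structure IsFiltered (A : FilteredSubalgebra E) : Prop where
  isClosed : IsClosed (A.alg : Set (E →L[ℂ] E))
  isClosed_fil : ∀ r, 0 < r → IsClosed (A.fil r : Set (E →L[ℂ] E))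
  dense : (A.alg : Set (E →L[ℂ] E)) ⊆ closure (⋃ (r : ℝ) (_ : 0 < r), (A.fil r : Set (E →L[ℂ] E)))
  unit_mem : ∀ e ∈ A.alg, (∀ a ∈ A.alg, e * a = a ∧ a * e = a) → ∀ r, 0 < r → e ∈ A.fil r

/-- Closed two-sided ideals. -/
structure ClosedIdeal (A : FilteredSubalgebra E) where
  carrier : Submodule ℂ (E →L[ℂ] E)
  le : ∀ {x : E →L[ℂ] E}, x ∈ carrier → x ∈ A.alg
  isClosed : IsClosed (carrier : Set (E →L[ℂ] E))
  mul_mem_left : ∀ {a x : E →L[ℂ] E}, a ∈ A.alg → x ∈ carrier → a * x ∈ carrier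
  mul_mem_right : ∀ {a x : E →L[ℂ] E}, a ∈ A.alg → x ∈ carrier → x * a ∈ carrier

/-- The ideal `J` as an algebra with the filtration `J_r = J ∩ A_r`. -/
def ClosedIdeal.toFiltered {A : FilteredSubalgebra E} (J : A.ClosedIdeal) : FilteredSubalgebra E where
  alg :=
    { carrier := J.carrier
      add_mem' := fun ha hb => J.carrier.add_mem ha hb
      zero_mem' := J.carrier.zero_mem
      mul_mem' := fun ha hb => J.mul_mem_left (J.le ha) hb
      smul_mem' := fun c _ hx => J.carrier.smul_mem c hx }
  fil r := J.carrier ⊓ A.fil r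
  fil_le _ ha := ha.1
  fil_mono h h' := inf_le_inf_left _ (A.fil_mono h h')
  mul_mem h h' ha hb := ⟨J.mul_mem_left (J.le ha.1) hb.1, A.mul_mem h h' ha.2 hb.2⟩

/-- The extension `0 → J → A → A/J → 0` is `C`-completely filtered. -/
def ClosedIdeal.IsCompletelyFiltered {A : FilteredSubalgebra E} (J : A.ClosedIdeal) (p : ℝ≥0∞)
    [Fact (1 ≤ p)] (C : ℝ) : Prop :=
  ∀ (n : ℕ) (r : ℝ), 0 < r → ∀ x : Matrix (Fin n) (Fin n) (E →L[ℂ] E), (∀ i j, x i j ∈ A.fil r) →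
    (⨅ y : {y : Matrix (Fin n) (Fin n) (E →L[ℂ] E) // ∀ i j, y i j ∈ J.carrier ⊓ A.fil r},
      opNorm p (Fin n) (x + y.1)) ≤
    C * ⨅ y : {y : Matrix (Fin n) (Fin n) (E →L[ℂ] E) // ∀ i j, y i j ∈ J.carrier},
      opNorm p (Fin n) (x + y.1)

variable (A : FilteredSubalgebra E)

/-- The unitization `A^♯`: the pairs `(T, z)` with `T - z 1 ∈ A`. -/
def unitizationAlg : Subalgebra ℂ ((E →L[ℂ] E) × ℂ) where
  carrier := {x | x.1 - x.2 • (1 : E →L[ℂ] E) ∈ A.alg}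
  mul_mem' {x y} hx hy := by
    have e : (x * y).1 - (x * y).2 • (1 : E →L[ℂ] E) =
        (x.1 - x.2 • (1 : E →L[ℂ] E)) * (y.1 - y.2 • (1 : E →L[ℂ] E)) +
          (x.2 • (y.1 - y.2 • (1 : E →L[ℂ] E)) + y.2 • (x.1 - x.2 • (1 : E →L[ℂ] E))) := by
      rw [Prod.fst_mul, Prod.snd_mul]
      simp only [mul_sub, sub_mul, mul_smul_comm, smul_mul_assoc, mul_one, one_mul, smul_sub,
        smul_smul, mul_comm y.2 x.2]
      abel
    show _ ∈ A.alg
    rw [e]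
    exact add_mem (A.alg.mul_mem hx hy) (add_mem (SMulMemClass.smul_mem _ hy) (SMulMemClass.smul_mem _ hx))
  add_mem' {x y} hx hy := by
    have e : (x + y).1 - (x + y).2 • (1 : E →L[ℂ] E) =
        (x.1 - x.2 • (1 : E →L[ℂ] E)) + (y.1 - y.2 • (1 : E →L[ℂ] E)) := by
      rw [Prod.fst_add, Prod.snd_add, add_smul]; abel
    show _ ∈ A.alg
    rw [e]
    exact add_mem hx hy
  algebraMap_mem' z := by
    show algebraMap ℂ (E →L[ℂ] E) z - z • (1 : E →L[ℂ] E) ∈ A.alg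
    rw [Algebra.algebraMap_eq_smul_one, sub_self]
    exact zero_mem _

/-- `(T, z) ↦ T - z 1`. -/
def nonunitalPart : A.unitizationAlg →ₗ[ℂ] (E →L[ℂ] E) where
  toFun x := x.1.1 - x.1.2 • (1 : E →L[ℂ] E)
  map_add' x y := by
    show (x.1.1 + y.1.1) - (x.1.2 + y.1.2) • (1 : E →L[ℂ] E) = _
    rw [add_smul]; abel
  map_smul' c x := by
    show c • x.1.1 - (c • x.1.2) • (1 : E →L[ℂ] E) = c • (x.1.1 - x.1.2 • (1 : E →L[ℂ] E))
    rw [smul_sub, smul_assoc]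

/-- `(T, z) ↦ T`. -/
def opPart : A.unitizationAlg →ₐ[ℂ] (E →L[ℂ] E) :=
  (AlgHom.fst ℂ (E →L[ℂ] E) ℂ).comp A.unitizationAlg.val

/-- `(T, z) ↦ z`. -/
def scalarPart : A.unitizationAlg →ₐ[ℂ] ℂ :=
  (AlgHom.snd ℂ (E →L[ℂ] E) ℂ).comp A.unitizationAlg.val

variable (p : ℝ≥0∞) [Fact (1 ≤ p)] [Fact (p ≠ ∞)]

/-- The norm of a matrix over `A^♯`: the maximum of the norms of its image in `M_n(B(E))` and of
its scalar part in `M_n(ℂ) = B(ℓ_p^n)`. -/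
def unitizationNrm (ι : Type) [Fintype ι] (x : Matrix ι ι A.unitizationAlg) : ℝ :=
  max (opNorm p ι (x.map A.opPart))
    (opNorm p ι (x.map fun a => A.scalarPart a • (1 : ℂ →L[ℂ] ℂ)))

lemma unitizationNrm_isMatrixNorm : IsMatrixNorm A.unitizationAlg (A.unitizationNrm p) := by
  have h := IsMatrixNorm.opNorm_pullback p ((Algebra.ofId ℂ (ℂ →L[ℂ] ℂ)).comp A.scalarPart)
  have e : (⇑((Algebra.ofId ℂ (ℂ →L[ℂ] ℂ)).comp A.scalarPart) : A.unitizationAlg → ℂ →L[ℂ] ℂ) =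
      fun a => A.scalarPart a • 1 :=
    funext fun a => Algebra.algebraMap_eq_smul_one (A := ℂ →L[ℂ] ℂ) (A.scalarPart a)
  rw [e] at h
  exact (IsMatrixNorm.opNorm_pullback p A.opPart).sup h

/-- The unitization `A^♯`, with matrix norms, the filtration `(A_r + ℂ 1)_{r > 0}` and its
augmentation. -/
def unitization : FilteredMatrixAlgebra.{u} p where
  carrier := A.unitizationAlg
  nrm := A.unitizationNrm p
  isMatrixNorm := A.unitizationNrm_isMatrixNorm p
  fil r := (A.fil r).comap A.nonunitalPart
  fil_mono h h' := Submodule.comap_mono (A.fil_mono h h')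
  one_mem {r} _ := by
    show (1 : E →L[ℂ] E) - (1 : ℂ) • (1 : E →L[ℂ] E) ∈ A.fil r
    rw [one_smul, sub_self]
    exact zero_mem _
  mul_mem {r s a b} hr hs ha hb := by
    have e : A.nonunitalPart (a * b) = A.nonunitalPart a * A.nonunitalPart b +
        (a.1.2 • A.nonunitalPart b + b.1.2 • A.nonunitalPart a) := by
      show a.1.1 * b.1.1 - (a.1.2 * b.1.2) • (1 : E →L[ℂ] E) =
        (a.1.1 - a.1.2 • (1 : E →L[ℂ] E)) * (b.1.1 - b.1.2 • (1 : E →L[ℂ] E)) +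
          (a.1.2 • (b.1.1 - b.1.2 • (1 : E →L[ℂ] E)) + b.1.2 • (a.1.1 - a.1.2 • (1 : E →L[ℂ] E)))
      simp only [mul_sub, sub_mul, mul_smul_comm, smul_mul_assoc, mul_one, one_mul, smul_sub,
        smul_smul, mul_comm b.1.2 a.1.2]
      abel
    show A.nonunitalPart (a * b) ∈ A.fil (r + s)
    rw [e]
    exact add_mem (A.mul_mem hr hs ha hb) (add_mem
      (Submodule.smul_mem _ _ (A.fil_mono hs (by linarith) hb))
      (Submodule.smul_mem _ _ (A.fil_mono hr (by linarith) ha)))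
  aug := A.scalarPart
  aug_le _ _ _ := le_max_right _ _

namespace ClosedIdeal

variable {A} (J : A.ClosedIdeal)

/-- `J` as an ideal of `A^♯`. -/
def ideal : Ideal A.unitizationAlg where
  carrier := {x | x.1.2 = 0 ∧ x.1.1 ∈ J.carrier}
  add_mem' {x y} hx hy := by
    refine ⟨?_, J.carrier.add_mem hx.2 hy.2⟩
    show x.1.2 + y.1.2 = 0
    rw [hx.1, hy.1, add_zero]
  zero_mem' := ⟨rfl, J.carrier.zero_mem⟩
  smul_mem' a x hx := by
    refine ⟨?_, ?_⟩
    · show a.1.2 * x.1.2 = 0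
      rw [hx.1, mul_zero]
    · show a.1.1 * x.1.1 ∈ J.carrier
      have e : a.1.1 * x.1.1 =
          (a.1.1 - a.1.2 • (1 : E →L[ℂ] E)) * x.1.1 + a.1.2 • x.1.1 := by
        rw [sub_mul, smul_mul_assoc, one_mul]; abel
      rw [e]
      exact add_mem (J.mul_mem_left a.2 hx.2) (J.carrier.smul_mem _ hx.2)

instance : J.ideal.IsTwoSided where
  mul_mem_of_left {x} a hx := by
    refine ⟨?_, ?_⟩
    · show x.1.2 * a.1.2 = 0
      rw [hx.1, zero_mul]
    · show x.1.1 * a.1.1 ∈ J.carrier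
      have e : x.1.1 * a.1.1 =
          x.1.1 * (a.1.1 - a.1.2 • (1 : E →L[ℂ] E)) + a.1.2 • x.1.1 := by
        rw [mul_sub, mul_smul_comm, mul_one]; abel
      rw [e]
      exact add_mem (J.mul_mem_right a.2 hx.2) (J.carrier.smul_mem _ hx.2)

/-- The quotient map `A^♯ → A^♯/J`. -/
def quot : A.unitizationAlg →ₐ[ℂ] (A.unitizationAlg ⧸ J.ideal) := Ideal.Quotient.mkₐ ℂ J.ideal

lemma quot_surjective : Function.Surjective J.quot := Ideal.Quotient.mkₐ_surjective ℂ J.ideal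

/-- The augmentation of `A^♯/J`. -/
def quotientAug : (A.unitizationAlg ⧸ J.ideal) →ₐ[ℂ] ℂ :=
  Ideal.Quotient.liftₐ J.ideal A.scalarPart fun _ ha => ha.1

lemma quotientAug_quot (a : A.unitizationAlg) : J.quotientAug (J.quot a) = A.scalarPart a := rfl

/-- The unitization `(A/J)^♯ = A^♯/J` of the quotient, where `M_n(A^♯/J) = M_n(A^♯)/M_n(J)` has the
quotient norm and `(A^♯/J)_r` is the image of `A_r + ℂ 1`. -/
def quotient : FilteredMatrixAlgebra.{u} p where
  carrier := A.unitizationAlg ⧸ J.ideal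
  nrm := quotientNorm (A.unitizationNrm p) J.quot
  isMatrixNorm := (A.unitizationNrm_isMatrixNorm p).quotient J.quot J.quot_surjective
  fil r := ((A.unitization p).fil r).map J.quot.toLinearMap
  fil_mono h h' := Submodule.map_mono ((A.unitization p).fil_mono h h')
  one_mem h := ⟨1, (A.unitization p).one_mem h, map_one J.quot⟩
  mul_mem := by
    rintro r s _ _ hr hs ⟨a, ha, rfl⟩ ⟨b, hb, rfl⟩
    exact ⟨a * b, (A.unitization p).mul_mem hr hs ha hb, map_mul J.quot a b⟩
  aug := J.quotientAug
  aug_le ι _ x := by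
    have : Nonempty {X : Matrix ι ι A.unitizationAlg // X.map J.quot = x} :=
      ⟨⟨x.map (Function.surjInv J.quot_surjective), by
        ext i j; exact Function.surjInv_eq J.quot_surjective _⟩⟩
    refine le_ciInf ?_
    rintro ⟨X, rfl⟩
    exact le_max_right _ _

/-- The inclusion `J^♯ → A^♯`. -/
def inclusion : (J.toFiltered.unitization p).Hom (A.unitization p) where
  toAlgHom := Subalgebra.inclusion (S := J.toFiltered.unitizationAlg) (T := A.unitizationAlg)
    fun _ hx => J.le hx
  nrm_le _ _ _ := le_rfl
  fil_le _ h := h.2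
  aug_comp _ := rfl

/-- The quotient homomorphism `A^♯ → (A/J)^♯`. -/
def quotientHom : (A.unitization p).Hom (J.quotient p) where
  toAlgHom := J.quot
  nrm_le _ _ x := quotientNorm_le (A.unitizationNrm_isMatrixNorm p) J.quot x
  fil_le _ h := ⟨_, h, rfl⟩
  aug_comp _ := rfl

/-! ### The controlled boundary map -/

/-- The choices in the construction of the controlled boundary of an `(ε, r, N)`-invertible `u`
over `(A/J)^♯`: an `(ε, r, N)`-invertible `v` such that `diag(u, v)` is
`(2ε, 2r, 2(N+ε))`-homotopic to `1`, a `(λ_N ε, h_{ε,N} r, λ_N)`-inverse pair `(w, w')` over `A^♯`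
with `w` lifting `diag(u, v)` up to `λ_N ε`, and a matrix `y` over `J` with propagation
`h_{ε,N} r` such that `‖w diag(1_n, 0) w' - diag(1_n, 0) - y‖ < 3 C λ_N ε`. -/
structure BoundaryDatum (C : ℝ) (c : ControlPair) (P : Param) {n m : ℕ}
    (u : Matrix (Fin n) (Fin n) (J.quotient p).carrier)
    (v : Matrix (Fin m) (Fin m) (J.quotient p).carrier)
    (w w' : Matrix (Fin (n + m)) (Fin (n + m)) (A.unitization p).carrier)
    (y : Matrix (Fin (n + m)) (Fin (n + m)) (J.toFiltered.unitization p).carrier) : Prop where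
  inv : (J.quotient p).IsInv P.ε P.r P.N v
  homotopic : (J.quotient p).InvHomotopic (2 * P.ε) (2 * P.r) (2 * (P.N + P.ε)) (blockSum u v) 1
  pair : (A.unitization p).IsInvPair (c.lam P.N * P.ε) (c.h P.ε P.N * P.r) (c.lam P.N) w w'
  lift : ‖(J.quotientHom p).mat w - blockSum u v‖ < c.lam P.N * P.ε
  aug_eq : ∀ i j, (J.toFiltered.unitization p).aug (y i j) = 0
  mem : ∀ i j, y i j ∈ (J.toFiltered.unitization p).fil (c.h P.ε P.N * P.r)
  approx : ‖w * (A.unitization p).corner n m * w' - (A.unitization p).corner n m -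
    (J.inclusion p).mat y‖ < 3 * C * (c.lam P.N * P.ε)

/-- `D` is the controlled boundary map `K_1(A/J) → K_0(J)`: for every `(ε, r, N)`-invertible `u`
with class in `K_1^{ε,r,N}(A/J)`, the choices as above exist for some stabilisation `diag(u, 1_k)`
of `u`, and `D [u] = [y + diag(1_n, 0)] - [diag(1_n, 0)]` for all such choices. -/
def IsBoundaryMap (C : ℝ) (c : ControlPair) {cD : ControlPair}
    (D : ControlledMorphism cD (J.quotient p).K1 (J.toFiltered.unitization p).K0) : Prop :=
  ∀ (P : Param) (hP : cD.lam P.N * P.ε < 1 / 20) (n : ℕ)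
    (u : Matrix (Fin n) (Fin n) (J.quotient p).carrier)
    (hu : (J.quotient p).IsInv P.ε P.r P.N u)
    (hker : (J.quotient p).invClass P u hu ∈ (J.quotient p).K1red P),
    (∃ (k m : ℕ) (v : Matrix (Fin m) (Fin m) (J.quotient p).carrier)
      (w w' : Matrix (Fin (n + k + m)) (Fin (n + k + m)) (A.unitization p).carrier)
      (y : Matrix (Fin (n + k + m)) (Fin (n + k + m)) (J.toFiltered.unitization p).carrier),
      J.BoundaryDatum p C c P (blockSum u (1 : Matrix (Fin k) (Fin k) (J.quotient p).carrier))
        v w w' y) ∧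
    ∀ (m : ℕ) (v : Matrix (Fin m) (Fin m) (J.quotient p).carrier)
      (w w' : Matrix (Fin (n + m)) (Fin (n + m)) (A.unitization p).carrier)
      (y : Matrix (Fin (n + m)) (Fin (n + m)) (J.toFiltered.unitization p).carrier),
      J.BoundaryDatum p C c P u v w w' y →
      ∃ (hy : (J.toFiltered.unitization p).IsIdem (P.ctrl cD hP).ε (P.ctrl cD hP).r (P.ctrl cD hP).N
          (y + (J.toFiltered.unitization p).corner n m))
        (h1 : (J.toFiltered.unitization p).IsIdem (P.ctrl cD hP).ε (P.ctrl cD hP).r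
          (P.ctrl cD hP).N ((J.toFiltered.unitization p).corner n m)),
        ((J.toFiltered.unitization p).K0red (P.ctrl cD hP)).subtype
            (D.app P hP ⟨(J.quotient p).invClass P u hu, hker⟩) =
          (J.toFiltered.unitization p).idemClass (P.ctrl cD hP) _ hy -
            (J.toFiltered.unitization p).idemClass (P.ctrl cD hP) _ h1

end ClosedIdeal

end FilteredSubalgebra

end Operators

end QuantK

end

/-! The theorem is the classical six-term argument carried out with quasi-idempotents and
quasi-invertibles. The difficulty is uniformity: every choice must have norm, propagation and error
bounded independently of matrix sizes, of the extension and of the number of steps in a homotopy.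

The bookkeeping is done by a `Scale` (M, ε, r), eventually with M = 40CN. Level n means norm at most
M^n, propagation at most M^n r, error at most M^n ε (`Bd`, `Cl`). As M ≥ 2, sums and products cost a
fixed number of levels, and M ≥ 40C absorbs the constant of the extension. Every construction is
then described by an exponent, and the control pairs are powers (40CN)^n.

A homotopy is cut into f_0, …, f_k with consecutive terms ε-close, where k is uncontrolled. Block
diagonal matrices are normed by the maximum, so A = diag(f_0, …, f_{k-1}) and B = diag(f_1, …, f_k)
are close with bounds independent of k, while diag(f_0, B) is a permutation of diag(A, f_k). This
shift shows that a quasi-invertible homotopic to 1 lifts stably to an exact invertible connected to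
1 (`GH.exists_lift`), and that quasi-idempotents with the same class become conjugate by a liftable
exact invertible after adding a scalar projection (`IH.conjLift`, `exists_conjLift_of_icls_eq`).
Exact invertibility costs nothing: products of elementary matrices (`elem`, `braid`) are invertible
whatever their entries are.

Complete filtration is used as one approximation property: a matrix over A^♯ with small image in
(A/J)^♯ is close to a matrix over J of the same propagation (`Extension.exists_approx`, and
`ih_of_path` for paths). The geometry of E enters only through the bound for scalar matrices acting
on ℓ_p^n(E), which makes the unit ℂ → A^♯ contractive.

If w lifts diag(u, v), then w diag(1, 0) w⁻¹ has image close to diag(1, 0), hence is close to y +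
diag(1, 0) with y over J. Two such lifts differ by a transition matrix g whose image almost fixes
the corner; g need not be homotopic to 1, but diag(g, g⁻¹) is, and the Whitehead path conjugates the
projection while its image stays close to a scalar projection (`ih_of_lifts`). So the class depends
on [u] only (`IsDatum.dcls_eq`) and is additive by block sums.

Exactness is proved as follows. If q(u) is stably homotopic to 1, dividing u by a lift connected to
1 gives a matrix close to J^♯. If q(e) is stably conjugate to a scalar projection, the conjugation
lifts and moves e close to J^♯. If the boundary of u vanishes, some S over J^♯ moves y + diag(1, 0)
back to a scalar projection; then Sw almost commutes with this projection and its compression lifts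
u stably. If e over J^♯ becomes conjugate over A^♯ to a scalar projection by some S, the compression
of q(S) is a quasi-invertible whose boundary is the class of e. -/

noncomputable section
namespace QuantK

/-! ### Stable classes of matrices with arbitrary finite index types -/

namespace StableSystem

section Classes

variable {B : Type u} [Ring B] {S : StableSystem B}

/-- The class of a good matrix with an arbitrary finite index type. -/
def tcls {ι : Type} [Fintype ι] [DecidableEq ι] (x : Matrix ι ι B) (hx : S.Good x) : S.Classes :=
  cls (x.submatrix (Fintype.equivFin ι).symm (Fintype.equivFin ι).symm) (S.good_reindex _ hx)

variable {ι κ : Type} [Fintype ι] [DecidableEq ι] [Fintype κ] [DecidableEq κ]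

lemma cls_eq_of_equiv {n m : ℕ} {x : Matrix (Fin n) (Fin n) B} {y : Matrix (Fin m) (Fin m) B}
    (hx : S.Good x) (hy : S.Good y) (e : Fin n ≃ Fin m) (h : x = y.submatrix e e) :
    cls x hx = cls y hy :=
  Quotient.sound (s := S.setoid) (rel_of_equiv hx hy e h)

lemma tcls_fin {n : ℕ} {x : Matrix (Fin n) (Fin n) B} (hx : S.Good x) : tcls x hx = cls x hx :=
  cls_eq_of_equiv _ _ (Fintype.equivFin (Fin n)).symm rfl

lemma tcls_congr {x y : Matrix ι ι B} (hx : S.Good x) (hy : S.Good y) (h : x = y) :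
    tcls x hx = tcls y hy := by
  subst h; rfl

lemma tcls_reindex (σ : κ ≃ ι) {x : Matrix ι ι B} (hx : S.Good x) {x' : Matrix κ κ B}
    (hx' : S.Good x') (h : x' = x.submatrix σ σ) : tcls x' hx' = tcls x hx := by
  subst h
  refine cls_eq_of_equiv _ _
    ((Fintype.equivFin κ).symm.trans (σ.trans (Fintype.equivFin ι))) ?_
  ext i j; simp

lemma tcls_blocks {x : Matrix ι ι B} {y : Matrix κ κ B} (hx : S.Good x) (hy : S.Good y) :
    tcls (Matrix.fromBlocks x 0 0 y) (S.good_blocks hx hy) = tcls x hx + tcls y hy := by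
  rw [tcls, tcls, tcls, cls_add]
  refine cls_eq_of_equiv _ _ ((Fintype.equivFin (ι ⊕ κ)).symm.trans
    ((Equiv.sumCongr (Fintype.equivFin ι) (Fintype.equivFin κ)).trans finSumFinEquiv)) ?_
  ext i j
  obtain ⟨i, rfl⟩ := (Fintype.equivFin (ι ⊕ κ)).surjective i
  obtain ⟨j, rfl⟩ := (Fintype.equivFin (ι ⊕ κ)).surjective j
  rcases i with i | i <;> rcases j with j | j <;> simp [blockSum]

lemma tcls_hom {x y : Matrix ι ι B} (hx : S.Good x) (hy : S.Good y) (h : S.Hom x y) :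
    tcls x hx = tcls y hy := by
  refine Quotient.sound (s := S.setoid) ⟨_, le_rfl, le_rfl, ?_⟩
  show S.Hom (padTo S.c _ _) (padTo S.c _ _)
  rw [padTo_self, padTo_self]
  exact S.hom_reindex _ h

lemma tcls_pad : tcls (Matrix.diagonal fun _ : ι => S.c) (S.good_pad ι) = 0 := by
  refine cls_eq_zero_of_hom _ ?_
  have e : (Matrix.diagonal fun _ : ι => S.c).submatrix (Fintype.equivFin ι).symm
      (Fintype.equivFin ι).symm = Matrix.diagonal fun _ => S.c := by
    ext i j; simp [Matrix.diagonal_apply]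
  rw [e]
  exact S.hom_refl (S.good_pad _)

/-- Equality of classes means homotopy after stabilisation. -/
lemma exists_hom_of_tcls_eq {x : Matrix ι ι B} {y : Matrix κ κ B} (hx : S.Good x) (hy : S.Good y)
    (h : tcls x hx = tcls y hy) : ∃ (m m' : ℕ) (σ : ι ⊕ Fin m ≃ κ ⊕ Fin m'),
      S.Hom (Matrix.fromBlocks x 0 0 (Matrix.diagonal fun _ => S.c))
        ((Matrix.fromBlocks y 0 0 (Matrix.diagonal fun _ => S.c)).submatrix σ σ) := by
  obtain ⟨K, h1, h2, hK⟩ := Quotient.exact (s := S.setoid) h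
  dsimp only at h1 h2
  have key : ∀ {ν : Type} [Fintype ν] [DecidableEq ν] (z : Matrix ν ν B)
      (hK : Fintype.card ν ≤ K),
      ∃ s : ν ⊕ Fin (K - Fintype.card ν) ≃ Fin K,
        (padTo S.c K (z.submatrix (Fintype.equivFin ν).symm (Fintype.equivFin ν).symm)).submatrix s s
          = Matrix.fromBlocks z 0 0 (Matrix.diagonal fun _ => S.c) := by
    intro ν _ _ z hK
    refine ⟨(Equiv.sumCongr (Fintype.equivFin ν) (Equiv.refl _)).trans (splitEquiv hK), ?_⟩
    have e := padTo_submatrix (c := S.c) hK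
      (z.submatrix (Fintype.equivFin ν).symm (Fintype.equivFin ν).symm)
    have e' := congrArg (fun w => w.submatrix
      (Equiv.sumCongr (Fintype.equivFin ν) (Equiv.refl (Fin (K - Fintype.card ν))))
      (Equiv.sumCongr (Fintype.equivFin ν) (Equiv.refl (Fin (K - Fintype.card ν))))) e
    rw [Matrix.submatrix_submatrix] at e'
    refine Eq.trans e' ?_
    ext (i | i) (j | j) <;> simp
  obtain ⟨s, hs⟩ := key x h1
  obtain ⟨t, ht⟩ := key y h2
  -- Both padded index types are identified with `Fin K`, where the homotopy takes place; the
  -- permutation compares the two identifications.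
  refine ⟨_, _, s.trans t.symm, ?_⟩
  have h' := S.hom_reindex s hK
  dsimp only at h'
  rw [hs] at h'
  rw [← ht, Matrix.submatrix_submatrix]
  convert h' using 2 <;> (ext i; simp)

/-- For matrices with the same index type. -/
lemma exists_hom_of_tcls_eq' {x y : Matrix ι ι B} (hx : S.Good x) (hy : S.Good y)
    (h : tcls x hx = tcls y hy) : ∃ m : ℕ,
      S.Hom (Matrix.fromBlocks x 0 0 (Matrix.diagonal fun _ : Fin m => S.c))
        (Matrix.fromBlocks y 0 0 (Matrix.diagonal fun _ => S.c)) := by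
  obtain ⟨K, h1, h2, hK⟩ := Quotient.exact (s := S.setoid) h
  dsimp only at h1 h2
  refine ⟨K - Fintype.card ι, ?_⟩
  -- The two matrices have the same size, so one splitting of `Fin K` serves both and no permutation
  -- remains.
  have h' := S.hom_reindex ((Equiv.sumCongr (Fintype.equivFin ι) (Equiv.refl _)).trans
    (splitEquiv h1)) hK
  have key : ∀ z : Matrix ι ι B,
      (padTo S.c K (z.submatrix (Fintype.equivFin ι).symm (Fintype.equivFin ι).symm)).submatrix
        ((Equiv.sumCongr (Fintype.equivFin ι) (Equiv.refl _)).trans (splitEquiv h1))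
        ((Equiv.sumCongr (Fintype.equivFin ι) (Equiv.refl _)).trans (splitEquiv h1))
          = Matrix.fromBlocks z 0 0 (Matrix.diagonal fun _ => S.c) := by
    intro z
    have e := padTo_submatrix (c := S.c) h1
      (z.submatrix (Fintype.equivFin ι).symm (Fintype.equivFin ι).symm)
    have e' := congrArg (fun w => w.submatrix
      (Equiv.sumCongr (Fintype.equivFin ι) (Equiv.refl (Fin (K - Fintype.card ι))))
      (Equiv.sumCongr (Fintype.equivFin ι) (Equiv.refl (Fin (K - Fintype.card ι))))) e
    rw [Matrix.submatrix_submatrix] at e'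
    refine Eq.trans e' ?_
    ext (i | i) (j | j) <;> simp
  dsimp only at h'
  rwa [key, key] at h'

end Classes

end StableSystem

/-! ### Grothendieck groups -/

/-- The Grothendieck group is the localisation at the whole monoid, so elements are identified
exactly when a common summand makes them equal. This summand is the auxiliary quasi-idempotent g
that has to be absorbed later. -/
lemma grothendieck_exists_add {M : Type u} [AddCommMonoid M] {a b : M}
    (h : Algebra.GrothendieckAddGroup.of a = Algebra.GrothendieckAddGroup.of b) :
    ∃ c, a + c = b + c := by
  obtain ⟨c, hc⟩ := (AddLocalization.addMonoidOf (⊤ : AddSubmonoid M)).eq_iff_exists.mp h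
  exact ⟨c, by rw [add_comm a, add_comm b]; exact hc⟩

lemma grothendieck_exists_sub {M : Type u} [AddCommMonoid M]
    (a : Algebra.GrothendieckAddGroup M) : ∃ x y : M,
      a = Algebra.GrothendieckAddGroup.of x - Algebra.GrothendieckAddGroup.of y := by
  obtain ⟨⟨x, y⟩, h⟩ := (AddLocalization.addMonoidOf (⊤ : AddSubmonoid M)).surj a
  exact ⟨x, y, eq_sub_of_add_eq h⟩
end QuantK

namespace QuantK

/-! ### Bounds up to powers of a scale -/

/-- A scale: norms and propagations are measured by powers of `M` and by `r`, errors by `ε`. -/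
structure Scale where
  M : ℝ
  ε : ℝ
  r : ℝ
  two_le : 2 ≤ M
  ε_pos : 0 < ε
  ε_le : ε ≤ 1
  r_pos : 0 < r

namespace Scale

variable (s : Scale)

lemma M_pos : 0 < s.M := by linarith [s.two_le]

lemma pow_pos (n : ℕ) : 0 < s.M ^ n := _root_.pow_pos s.M_pos n

lemma one_le_pow (n : ℕ) : 1 ≤ s.M ^ n := one_le_pow₀ (by linarith [s.two_le])

lemma pow_mono {n m : ℕ} (h : n ≤ m) : s.M ^ n ≤ s.M ^ m :=
  pow_le_pow_right₀ (by linarith [s.two_le]) h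

lemma two_mul_pow_le (n : ℕ) : 2 * s.M ^ n ≤ s.M ^ (n + 1) := by
  rw [pow_succ, mul_comm]
  exact mul_le_mul_of_nonneg_left s.two_le (s.pow_pos n).le

/-- The reason for requiring M ≥ 2: a sum of two powers costs one more exponent, and all later
estimates become linear arithmetic on exponents. -/
lemma pow_add_pow_le (a b : ℕ) : s.M ^ a + s.M ^ b ≤ s.M ^ (a + b + 1) := by
  have h1 := s.pow_mono (Nat.le_add_right a b)
  have h2 := s.pow_mono (Nat.le_add_left b a)
  linarith [s.two_mul_pow_le (a + b)]

lemma pow_lt_succ (n : ℕ) : s.M ^ n < s.M ^ (n + 1) := by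
  linarith [s.two_mul_pow_le n, s.pow_pos n]

end Scale

namespace FilteredMatrixAlgebra

variable {p : ℝ≥0∞} [Fact (1 ≤ p)] {X : FilteredMatrixAlgebra.{u} p}
  {Y : FilteredMatrixAlgebra.{v} p} {ι κ : Type} [Fintype ι] [DecidableEq ι] [Fintype κ]
  [DecidableEq κ]

/-- `‖x‖ ≤ M^n`, with propagation at most `M^n r`. -/
def Bd (s : Scale) (n : ℕ) (x : Matrix ι ι X.carrier) : Prop :=
  ‖x‖ ≤ s.M ^ n ∧ ∀ i j, x i j ∈ X.fil (s.M ^ n * s.r)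

/-- `‖x - y‖ ≤ M^n ε`. -/
def Cl (s : Scale) (n : ℕ) (x y : Matrix ι ι X.carrier) : Prop := ‖x - y‖ ≤ s.M ^ n * s.ε

variable {s : Scale} {a b c d n m : ℕ} {x y z w x' y' : Matrix ι ι X.carrier}

lemma Bd.mono (h : Bd s n x) (hnm : n ≤ m) : Bd s m x :=
  ⟨h.1.trans (s.pow_mono hnm), fil_mono_mem (mul_pos (s.pow_pos n) s.r_pos)
    (mul_le_mul_of_nonneg_right (s.pow_mono hnm) s.r_pos.le) h.2⟩

lemma Bd.add (h : Bd s a x) (h' : Bd s b y) : Bd s (a + b + 1) (x + y) := by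
  refine ⟨(norm_add_le _ _).trans ((add_le_add h.1 h'.1).trans (s.pow_add_pow_le a b)), ?_⟩
  intro i j
  exact Submodule.add_mem _ ((h.mono (by omega : a ≤ a + b + 1)).2 i j)
    ((h'.mono (by omega : b ≤ a + b + 1)).2 i j)

lemma Bd.smul (h : Bd s a x) {t : ℂ} (ht : ‖t‖ ≤ 1) : Bd s a (t • x) := by
  refine ⟨?_, fun i j => Submodule.smul_mem _ _ (h.2 i j)⟩
  rw [norm_smul]
  exact (mul_le_of_le_one_left (norm_nonneg _) ht).trans h.1

lemma Bd.neg (h : Bd s a x) : Bd s a (-x) :=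
  ⟨by rw [norm_neg]; exact h.1, fun i j => Submodule.neg_mem _ (h.2 i j)⟩

lemma Bd.sub (h : Bd s a x) (h' : Bd s b y) : Bd s (a + b + 1) (x - y) := by
  rw [sub_eq_add_neg]; exact h.add h'.neg

lemma Bd.mul (h : Bd s a x) (h' : Bd s b y) : Bd s (a + b + 1) (x * y) := by
  constructor
  · calc ‖x * y‖ ≤ ‖x‖ * ‖y‖ := norm_mul_le _ _
      _ ≤ s.M ^ a * s.M ^ b := mul_le_mul h.1 h'.1 (norm_nonneg _) (s.pow_pos a).le
      _ = s.M ^ (a + b) := (pow_add _ _ _).symm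
      _ ≤ _ := s.pow_mono (by omega)
  · intro i j
    have ha := mul_pos (s.pow_pos a) s.r_pos
    have hb := mul_pos (s.pow_pos b) s.r_pos
    rw [Matrix.mul_apply]
    refine Submodule.sum_mem _ fun k _ => X.fil_mono (add_pos ha hb) ?_
      (X.mul_mem ha hb (h.2 i k) (h'.2 k j))
    rw [← add_mul]
    exact mul_le_mul_of_nonneg_right (s.pow_add_pow_le a b) s.r_pos.le

lemma Bd.zero : Bd s 0 (0 : Matrix ι ι X.carrier) :=
  ⟨by rw [norm_zero]; exact (s.pow_pos 0).le, fun _ _ => Submodule.zero_mem _⟩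

lemma Bd.one : Bd s 0 (1 : Matrix ι ι X.carrier) :=
  ⟨norm_one_le.trans (s.one_le_pow 0), one_entry_mem (mul_pos (s.pow_pos 0) s.r_pos)⟩

lemma Bd.submatrix (h : Bd s a x) (σ τ : κ ≃ ι) : Bd s a (x.submatrix σ τ) :=
  ⟨(norm_submatrix_le x σ τ).trans h.1, fun _ _ => h.2 _ _⟩

lemma Bd.blocks (h : Bd s a x) {y : Matrix κ κ X.carrier} (h' : Bd s b y) :
    Bd s (max a b) (Matrix.fromBlocks x 0 0 y) :=
  ⟨(norm_blocks_le _ _).trans (max_le ((h.mono (le_max_left a b)).1) (h'.mono (le_max_right a b)).1),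
    blocks_mem (h.mono (le_max_left a b)).2 (h'.mono (le_max_right a b)).2⟩

/-- Matrix norms are only controlled on block diagonal matrices and under permutations of rows and
columns. An off-diagonal part is a diagonal one times the swap, which brings general 2 × 2 block
matrices within reach. -/
lemma fromBlocks_eq_add (x y z w : Matrix ι ι X.carrier) : Matrix.fromBlocks x y z w =
    Matrix.fromBlocks x 0 0 w + Matrix.fromBlocks y 0 0 z * Matrix.fromBlocks 0 1 1 0 := by
  simp [Matrix.fromBlocks_multiply, Matrix.fromBlocks_add]

lemma bd_swap : Bd s 0 (Matrix.fromBlocks 0 1 1 0 : Matrix (ι ⊕ ι) (ι ⊕ ι) X.carrier) := by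
  have : (Matrix.fromBlocks 0 1 1 0 : Matrix (ι ⊕ ι) (ι ⊕ ι) X.carrier) =
      (1 : Matrix (ι ⊕ ι) (ι ⊕ ι) X.carrier).submatrix (Equiv.refl _) (Equiv.sumComm _ _) := by
    ext (i | i) (j | j) <;> simp [Matrix.one_apply]
  rw [this]
  exact Bd.one.submatrix _ _

lemma Bd.fromBlocks (hx : Bd s a x) (hy : Bd s b y) (hz : Bd s c z) (hw : Bd s d w) :
    Bd s (a + b + c + d + 2) (Matrix.fromBlocks x y z w) := by
  rw [fromBlocks_eq_add]
  exact ((hx.blocks hw).add ((hy.blocks hz).mul bd_swap)).mono (by omega)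

lemma Bd.map (φ : Hom X Y) (h : Bd s a x) : Bd s a (φ.mat x) :=
  ⟨(φ.norm_mat_le x).trans h.1, fun i j => φ.fil_le (mul_pos (s.pow_pos a) s.r_pos) (h.2 i j)⟩

lemma Cl.mono (h : Cl s n x y) (hnm : n ≤ m) : Cl s m x y :=
  h.trans (mul_le_mul_of_nonneg_right (s.pow_mono hnm) s.ε_pos.le)

lemma Cl.refl (x : Matrix ι ι X.carrier) : Cl s 0 x x := by
  rw [Cl, sub_self, norm_zero]
  exact (mul_pos (s.pow_pos 0) s.ε_pos).le

lemma Cl.of_eq (h : x = y) : Cl s 0 x y := h ▸ Cl.refl x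

lemma Cl.symm (h : Cl s n x y) : Cl s n y x := by
  rw [Cl, norm_sub_rev]; exact h

lemma Cl.trans (h : Cl s a x y) (h' : Cl s b y z) : Cl s (a + b + 1) x z := by
  have e : x - z = (x - y) + (y - z) := by abel
  rw [Cl, e]
  refine (norm_add_le _ _).trans ((add_le_add h h').trans ?_)
  rw [← add_mul]
  exact mul_le_mul_of_nonneg_right (s.pow_add_pow_le a b) s.ε_pos.le

lemma Cl.add (h : Cl s a x x') (h' : Cl s b y y') : Cl s (a + b + 1) (x + y) (x' + y') := by
  have e : x + y - (x' + y') = (x - x') + (y - y') := by abel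
  rw [Cl, e]
  refine (norm_add_le _ _).trans ((add_le_add h h').trans ?_)
  rw [← add_mul]
  exact mul_le_mul_of_nonneg_right (s.pow_add_pow_le a b) s.ε_pos.le

lemma Cl.neg (h : Cl s a x x') : Cl s a (-x) (-x') := by
  rw [Cl, neg_sub_neg, norm_sub_rev]; exact h

lemma Cl.sub (h : Cl s a x x') (h' : Cl s b y y') : Cl s (a + b + 1) (x - y) (x' - y') := by
  rw [sub_eq_add_neg, sub_eq_add_neg]; exact h.add h'.neg

lemma Cl.mul_left (h : Bd s a x) (h' : Cl s b y y') : Cl s (a + b) (x * y) (x * y') := by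
  rw [Cl, ← mul_sub, pow_add, mul_assoc]
  exact (norm_mul_le _ _).trans (mul_le_mul h.1 h' (norm_nonneg _) (s.pow_pos a).le)

lemma Cl.mul_right (h : Bd s a x) (h' : Cl s b y y') : Cl s (a + b) (y * x) (y' * x) := by
  rw [Cl, ← sub_mul, pow_add, mul_comm (s.M ^ a), mul_right_comm]
  exact (norm_mul_le _ _).trans (mul_le_mul h' h.1 (norm_nonneg _)
    (mul_pos (s.pow_pos b) s.ε_pos).le)

lemma Cl.submatrix (h : Cl s a x y) (σ τ : κ ≃ ι) :
    Cl s a (x.submatrix σ τ) (y.submatrix σ τ) :=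
  (norm_submatrix_le (x - y) σ τ).trans h

lemma Cl.blocks (h : Cl s a x x') {y y' : Matrix κ κ X.carrier} (h' : Cl s b y y') :
    Cl s (max a b) (Matrix.fromBlocks x 0 0 y) (Matrix.fromBlocks x' 0 0 y') := by
  rw [Cl, blocks_sub]
  exact (norm_blocks_le _ _).trans (max_le (h.mono (le_max_left a b)) (h'.mono (le_max_right a b)))

lemma Cl.fromBlocks {x₁ x₂ x₃ x₄ y₁ y₂ y₃ y₄ : Matrix ι ι X.carrier} (h₁ : Cl s a x₁ y₁)
    (h₂ : Cl s b x₂ y₂) (h₃ : Cl s c x₃ y₃) (h₄ : Cl s d x₄ y₄) :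
    Cl s (a + b + c + d + 1) (Matrix.fromBlocks x₁ x₂ x₃ x₄) (Matrix.fromBlocks y₁ y₂ y₃ y₄) := by
  rw [fromBlocks_eq_add x₁, fromBlocks_eq_add y₁]
  exact ((h₁.blocks h₄).add (Cl.mul_right bd_swap (h₂.blocks h₃))).mono (by omega)

lemma Cl.map (φ : Hom X Y) (h : Cl s a x y) : Cl s a (φ.mat x) (φ.mat y) := by
  rw [Cl, ← map_sub]
  exact (φ.norm_mat_le _).trans h

/-- Closeness transfers the norm bound, using ε ≤ 1, but says nothing about propagation, which is
therefore a separate hypothesis. -/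
lemma Cl.bd (h : Cl s a x y) (hx : Bd s b x) (hy : ∀ i j, y i j ∈ X.fil (s.M ^ c * s.r)) :
    Bd s (a + b + c + 1) y := by
  refine ⟨?_, (fil_mono_mem (mul_pos (s.pow_pos c) s.r_pos)
    (mul_le_mul_of_nonneg_right (s.pow_mono (by omega)) s.r_pos.le) hy)⟩
  have e : y = x - (x - y) := by abel
  rw [e]
  refine (norm_sub_le _ _).trans ?_
  have h1 : s.M ^ a * s.ε ≤ s.M ^ a := mul_le_of_le_one_right (s.pow_pos a).le s.ε_le
  have h2 := s.pow_add_pow_le a b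
  have h3 := s.pow_mono (show a + b + 1 ≤ a + b + c + 1 by omega)
  have h4 : ‖x - y‖ ≤ s.M ^ a * s.ε := h
  linarith [hx.1]

/-! ### Quasi-idempotents and quasi-inverse pairs at a scale -/

/-- Quasi-idempotents at a scale. -/
def QI (s : Scale) (n : ℕ) (e : Matrix ι ι X.carrier) : Prop := Bd s n e ∧ Cl s n (e * e) e

/-- Quasi-inverse pairs at a scale. -/
def QP (s : Scale) (n : ℕ) (u v : Matrix ι ι X.carrier) : Prop :=
  Bd s n u ∧ Bd s n v ∧ Cl s n (u * v) 1 ∧ Cl s n (v * u) 1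

/-- Exact inverse pairs at a scale. -/
def EP (s : Scale) (n : ℕ) (u v : Matrix ι ι X.carrier) : Prop :=
  Bd s n u ∧ Bd s n v ∧ u * v = 1 ∧ v * u = 1

lemma QI.mono (h : QI s n x) (hnm : n ≤ m) : QI s m x := ⟨h.1.mono hnm, h.2.mono hnm⟩

lemma QP.mono (h : QP s n x y) (hnm : n ≤ m) : QP s m x y :=
  ⟨h.1.mono hnm, h.2.1.mono hnm, h.2.2.1.mono hnm, h.2.2.2.mono hnm⟩

lemma EP.mono (h : EP s n x y) (hnm : n ≤ m) : EP s m x y :=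
  ⟨h.1.mono hnm, h.2.1.mono hnm, h.2.2⟩

lemma QP.symm (h : QP s n x y) : QP s n y x := ⟨h.2.1, h.1, h.2.2.2, h.2.2.1⟩

lemma EP.symm (h : EP s n x y) : EP s n y x := ⟨h.2.1, h.1, h.2.2.2, h.2.2.1⟩

lemma EP.qp (h : EP s n x y) : QP s n x y :=
  ⟨h.1, h.2.1, (Cl.of_eq h.2.2.1).mono n.zero_le, (Cl.of_eq h.2.2.2).mono n.zero_le⟩

lemma QI.map (φ : Hom X Y) (h : QI s n x) : QI s n (φ.mat x) :=
  ⟨h.1.map φ, by rw [← φ.mat_mul]; exact h.2.map φ⟩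

lemma QP.map (φ : Hom X Y) (h : QP s n x y) : QP s n (φ.mat x) (φ.mat y) :=
  ⟨h.1.map φ, h.2.1.map φ, by rw [← φ.mat_mul, ← φ.mat_one]; exact h.2.2.1.map φ,
    by rw [← φ.mat_mul, ← φ.mat_one]; exact h.2.2.2.map φ⟩

lemma EP.map (φ : Hom X Y) (h : EP s n x y) : EP s n (φ.mat x) (φ.mat y) :=
  ⟨h.1.map φ, h.2.1.map φ, by rw [← φ.mat_mul, h.2.2.1, φ.mat_one],
    by rw [← φ.mat_mul, h.2.2.2, φ.mat_one]⟩

lemma QP.submatrix (h : QP s n x y) (σ : κ ≃ ι) :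
    QP s n (x.submatrix σ σ) (y.submatrix σ σ) := by
  refine ⟨h.1.submatrix σ σ, h.2.1.submatrix σ σ, ?_, ?_⟩
  · rw [Matrix.submatrix_mul_equiv, ← Matrix.submatrix_one_equiv σ]; exact h.2.2.1.submatrix σ σ
  · rw [Matrix.submatrix_mul_equiv, ← Matrix.submatrix_one_equiv σ]; exact h.2.2.2.submatrix σ σ

lemma EP.submatrix (h : EP s n x y) (σ : κ ≃ ι) :
    EP s n (x.submatrix σ σ) (y.submatrix σ σ) := by
  refine ⟨h.1.submatrix σ σ, h.2.1.submatrix σ σ, ?_, ?_⟩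
  · rw [Matrix.submatrix_mul_equiv, h.2.2.1, Matrix.submatrix_one_equiv σ]
  · rw [Matrix.submatrix_mul_equiv, h.2.2.2, Matrix.submatrix_one_equiv σ]

lemma QI.blocks (h : QI s n x) {y : Matrix κ κ X.carrier} (h' : QI s m y) :
    QI s (max n m) (Matrix.fromBlocks x 0 0 y) :=
  ⟨h.1.blocks h'.1, by rw [blocks_mul]; exact h.2.blocks h'.2⟩

lemma QP.blocks (h : QP s n x y) {z w : Matrix κ κ X.carrier} (h' : QP s m z w) :
    QP s (max n m) (Matrix.fromBlocks x 0 0 z) (Matrix.fromBlocks y 0 0 w) :=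
  ⟨h.1.blocks h'.1, h.2.1.blocks h'.2.1,
    by rw [blocks_mul, ← Matrix.fromBlocks_one]; exact h.2.2.1.blocks h'.2.2.1,
    by rw [blocks_mul, ← Matrix.fromBlocks_one]; exact h.2.2.2.blocks h'.2.2.2⟩

lemma EP.blocks (h : EP s n x y) {z w : Matrix κ κ X.carrier} (h' : EP s m z w) :
    EP s (max n m) (Matrix.fromBlocks x 0 0 z) (Matrix.fromBlocks y 0 0 w) :=
  ⟨h.1.blocks h'.1, h.2.1.blocks h'.2.1,
    by rw [blocks_mul, h.2.2.1, h'.2.2.1, Matrix.fromBlocks_one],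
    by rw [blocks_mul, h.2.2.2, h'.2.2.2, Matrix.fromBlocks_one]⟩

lemma EP.one : EP s 0 (1 : Matrix ι ι X.carrier) 1 := ⟨Bd.one, Bd.one, mul_one _, mul_one _⟩

lemma QP.one : QP s 0 (1 : Matrix ι ι X.carrier) 1 := EP.one.qp

lemma EP.mul (h : EP s n x y) (h' : EP s m z w) : EP s (n + m + 1) (x * z) (w * y) := by
  refine ⟨h.1.mul h'.1, (h'.2.1.mul h.2.1).mono (by omega), ?_, ?_⟩
  · rw [mul_assoc, ← mul_assoc z, h'.2.2.1, one_mul, h.2.2.1]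
  · rw [mul_assoc, ← mul_assoc y, h.2.2.2, one_mul, h'.2.2.2]

/-- Removes a nearly trivial factor from the middle of a product; only the bounds of the outer
factors are lost. -/
lemma Cl.cancel (h : Cl s a (x * y) 1) (hz : Bd s b z) (hw : Bd s c w) :
    Cl s (a + b + c) (z * x * (y * w)) (z * w) := by
  have := Cl.mul_left hz (Cl.mul_right hw h)
  rw [one_mul] at this
  refine (Eq.subst (motive := fun q => Cl s _ q _) ?_ this).mono (by omega)
  simp only [mul_assoc]

lemma QP.mul (h : QP s n x y) (h' : QP s m z w) : QP s (4 * n + 4 * m + 4) (x * z) (w * y) := by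
  refine ⟨(h.1.mul h'.1).mono (by omega), (h'.2.1.mul h.2.1).mono (by omega), ?_, ?_⟩
  · exact ((Cl.cancel h'.2.2.1 h.1 h.2.1).trans h.2.2.1).mono (by omega)
  · exact ((Cl.cancel h.2.2.2 h'.2.1 h'.1).trans h'.2.2.2).mono (by omega)

lemma QI.conj (h : QI s n x) (h' : QP s m y z) : QI s (5 * n + 5 * m + 5) (y * x * z) := by
  refine ⟨((h'.1.mul h.1).mul h'.2.1).mono (by omega), ?_⟩
  have h1 := Cl.cancel h'.2.2.2 (h'.1.mul h.1) (h.1.mul h'.2.1)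
  have h2 := Cl.mul_left h'.1 (Cl.mul_right h'.2.1 h.2)
  have e1 : y * x * z * (y * (x * z)) = y * x * z * (y * x * z) := by simp only [mul_assoc]
  have e2 : y * x * (x * z) = y * (x * x * z) := by simp only [mul_assoc]
  rw [e1, e2] at h1
  have := h1.trans h2
  rw [← mul_assoc y x z] at this
  exact this.mono (by omega)

/-- Runs through y·y ≈ y·x ≈ x·x ≈ x ≈ y. -/
lemma QI.close (h : QI s n x) (hy : Bd s m y) (h' : Cl s a x y) :
    QI s (3 * n + 2 * m + 3 * a + 3) y := by
  refine ⟨hy.mono (by omega), ?_⟩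
  have h1 := Cl.mul_left hy h'.symm
  have h2 := Cl.mul_right h.1 h'.symm
  exact (((h1.trans h2).trans h.2).trans h').mono (by omega)

/-- The quasi-inverse z is kept, so that a path of perturbations can be paired with the constant
path at z. -/
lemma QP.close (h : QP s n x z) (hy : Bd s m y) (h' : Cl s a x y) :
    QP s (2 * n + m + a + 1) y z := by
  refine ⟨hy.mono (by omega), h.2.1.mono (by omega), ?_, ?_⟩
  · exact ((Cl.mul_right h.2.1 h'.symm).trans h.2.2.1).mono (by omega)
  · exact ((Cl.mul_left h.2.1 h'.symm).trans h.2.2.2).mono (by omega)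

lemma QI.one_sub (h : QI s n x) : QI s (n + 1) (1 - x) := by
  refine ⟨(Bd.one.sub h.1).mono (by omega), ?_⟩
  have e : (1 - x) * (1 - x) - (1 - x) = x * x - x := by noncomm_ring
  rw [Cl, e]
  exact h.2.mono (Nat.le_succ n)

end FilteredMatrixAlgebra
end QuantK

namespace QuantK
namespace FilteredMatrixAlgebra

section Homotopies

variable {p : ℝ≥0∞} [Fact (1 ≤ p)] {X : FilteredMatrixAlgebra.{u} p}
  {Y : FilteredMatrixAlgebra.{v} p} {ι κ : Type} [Fintype ι] [DecidableEq ι] [Fintype κ]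
  [DecidableEq κ] {s : Scale} {a b c d n m : ℕ} {x y z w x' y' : Matrix ι ι X.carrier}

/-! ### Comparison with quasi-idempotents and quasi-invertibles -/

lemma Bd.of_le {r N : ℝ} (hr : 0 < r) (hx : ‖x‖ ≤ N) (hx' : ∀ i j, x i j ∈ X.fil r)
    (hN : N ≤ s.M ^ n) (hr' : r ≤ s.M ^ n * s.r) : Bd s n x :=
  ⟨hx.trans hN, fil_mono_mem hr hr' hx'⟩

lemma IsIdem.qi {ε r N : ℝ} (h : X.IsIdem ε r N x) (hr : 0 < r) (hε : ε ≤ s.M ^ n * s.ε)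
    (hr' : r ≤ s.M ^ n * s.r) (hN : N ≤ s.M ^ n) : QI s n x :=
  ⟨Bd.of_le hr h.2.2.1 h.2.1 hN hr', h.1.le.trans hε⟩

lemma IsInvPair.qp {ε r N : ℝ} (h : X.IsInvPair ε r N x y) (hr : 0 < r)
    (hε : ε ≤ s.M ^ n * s.ε) (hr' : r ≤ s.M ^ n * s.r) (hN : N ≤ s.M ^ n) : QP s n x y :=
  ⟨Bd.of_le hr h.2.2.1 h.1 hN hr', Bd.of_le hr h.2.2.2.1 h.2.1 hN hr', h.2.2.2.2.1.le.trans hε,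
    h.2.2.2.2.2.le.trans hε⟩

/-- One level is given up: it makes the inequality for e² - e strict and pays for the norm of 1 - e.
-/
lemma QI.isIdem {ε r N : ℝ} (h : QI s n x) (hε : s.M ^ (n + 1) * s.ε ≤ ε)
    (hr : s.M ^ (n + 1) * s.r ≤ r) (hN : s.M ^ (n + 1) ≤ N) : X.IsIdem ε r N x := by
  have h1 := s.pow_lt_succ n
  refine ⟨?_, ?_, h.1.1.trans (h1.le.trans hN), ?_⟩
  · exact h.2.trans_lt ((mul_lt_mul_of_pos_right h1 s.ε_pos).trans_le hε)
  · exact fil_mono_mem (mul_pos (s.pow_pos n) s.r_pos)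
      ((mul_le_mul_of_nonneg_right h1.le s.r_pos.le).trans hr) h.1.2
  · have h2 := (Bd.one (X := X) (ι := ι) (s := s)).sub h.1
    exact (h2.mono (show 0 + n + 1 ≤ n + 1 by omega)).1.trans hN

lemma QP.isInvPair {ε r N : ℝ} (h : QP s n x y) (hε : s.M ^ (n + 1) * s.ε ≤ ε)
    (hr : s.M ^ (n + 1) * s.r ≤ r) (hN : s.M ^ (n + 1) ≤ N) : X.IsInvPair ε r N x y := by
  have h1 := s.pow_lt_succ n
  have hr' := (mul_le_mul_of_nonneg_right h1.le s.r_pos.le).trans hr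
  have hr0 := mul_pos (s.pow_pos n) s.r_pos
  have hε' := (mul_lt_mul_of_pos_right h1 s.ε_pos).trans_le hε
  exact ⟨fil_mono_mem hr0 hr' h.1.2, fil_mono_mem hr0 hr' h.2.1.2, h.1.1.trans (h1.le.trans hN),
    h.2.1.1.trans (h1.le.trans hN), h.2.2.1.trans_lt hε', h.2.2.2.trans_lt hε'⟩

/-! ### Homotopies at a scale -/

/-- Homotopies of quasi-idempotents at a scale. -/
def IH (s : Scale) (n : ℕ) (e f : Matrix ι ι X.carrier) : Prop :=
  ∃ γ : Path e f, ∀ t, QI s n (γ t)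

/-- Homotopies of quasi-invertibles at a scale. -/
def GH (s : Scale) (n : ℕ) (u u' : Matrix ι ι X.carrier) : Prop :=
  ∃ (v v' : Matrix ι ι X.carrier) (γ : Path u u') (δ : Path v v'), ∀ t, QP s n (γ t) (δ t)

lemma IH.idemHomotopic {ε r N : ℝ} (h : IH s n x y) (hε : s.M ^ (n + 1) * s.ε ≤ ε)
    (hr : s.M ^ (n + 1) * s.r ≤ r) (hN : s.M ^ (n + 1) ≤ N) : X.IdemHomotopic ε r N x y := by
  obtain ⟨γ, hγ⟩ := h
  exact ⟨γ, fun t => (hγ t).isIdem hε hr hN⟩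

lemma GH.invHomotopic {ε r N : ℝ} (h : GH s n x y) (hε : s.M ^ (n + 1) * s.ε ≤ ε)
    (hr : s.M ^ (n + 1) * s.r ≤ r) (hN : s.M ^ (n + 1) ≤ N) : X.InvHomotopic ε r N x y := by
  obtain ⟨v, v', γ, δ, hγ⟩ := h
  exact ⟨v, v', γ, δ, fun t => (hγ t).isInvPair hε hr hN⟩

lemma IdemHomotopic.ih {ε r N : ℝ} (h : X.IdemHomotopic ε r N x y) (hr : 0 < r)
    (hε : ε ≤ s.M ^ n * s.ε) (hr' : r ≤ s.M ^ n * s.r) (hN : N ≤ s.M ^ n) : IH s n x y := by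
  obtain ⟨γ, hγ⟩ := h
  exact ⟨γ, fun t => (hγ t).qi hr hε hr' hN⟩

lemma InvHomotopic.gh {ε r N : ℝ} (h : X.InvHomotopic ε r N x y) (hr : 0 < r)
    (hε : ε ≤ s.M ^ n * s.ε) (hr' : r ≤ s.M ^ n * s.r) (hN : N ≤ s.M ^ n) : GH s n x y := by
  obtain ⟨v, v', γ, δ, hγ⟩ := h
  exact ⟨v, v', γ, δ, fun t => (hγ t).qp hr hε hr' hN⟩

lemma IH.mono (h : IH s n x y) (hnm : n ≤ m) : IH s m x y := by
  obtain ⟨γ, hγ⟩ := h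
  exact ⟨γ, fun t => (hγ t).mono hnm⟩

lemma GH.mono (h : GH s n x y) (hnm : n ≤ m) : GH s m x y := by
  obtain ⟨v, v', γ, δ, hγ⟩ := h
  exact ⟨v, v', γ, δ, fun t => (hγ t).mono hnm⟩

lemma IH.refl (h : QI s n x) : IH s n x x := ⟨Path.refl x, fun _ => h⟩

lemma IH.symm (h : IH s n x y) : IH s n y x := by
  obtain ⟨γ, hγ⟩ := h
  exact ⟨γ.symm, fun t => hγ _⟩

lemma GH.symm (h : GH s n x y) : GH s n y x := by
  obtain ⟨v, v', γ, δ, hγ⟩ := h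
  exact ⟨v', v, γ.symm, δ.symm, fun t => hγ _⟩

lemma IH.trans (h : IH s n x y) (h' : IH s m y z) : IH s (max n m) x z := by
  obtain ⟨γ, hγ⟩ := h.mono (le_max_left n m)
  obtain ⟨γ', hγ'⟩ := h'.mono (le_max_right n m)
  exact ⟨γ.trans γ', forall_trans (Q := fun a _ => QI s (max n m) a) (δ := γ) (δ' := γ') hγ hγ'⟩

lemma Bd.combo (h : Bd s n x) (h' : Bd s n y) (t : unitInterval) : Bd s n (segPath x y t) :=
  ⟨norm_combo_le h.1 h'.1 t.2.1 t.2.2, entries_combo h.2 h'.2 _ _⟩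

lemma Cl.combo (h : Cl s n x z) (h' : Cl s n y z) (t : unitInterval) :
    Cl s n (segPath x y t) z := by
  have e : segPath x y t - z = ((1 - (t : ℝ) : ℝ) : ℂ) • (x - z) + ((t : ℝ) : ℂ) • (y - z) := by
    show ((1 - (t : ℝ) : ℝ) : ℂ) • x + ((t : ℝ) : ℂ) • y - z = _
    rw [smul_sub, smul_sub, Complex.ofReal_sub, Complex.ofReal_one, sub_smul, sub_smul, one_smul,
      one_smul]
    abel
  rw [Cl, e]
  exact norm_combo_le h h' t.2.1 t.2.2

lemma mul_segPath (z x y : Matrix ι ι X.carrier) (t : unitInterval) :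
    z * segPath x y t = segPath (z * x) (z * y) t := by
  show z * (_ • x + _ • y) = _
  rw [mul_add, mul_smul_comm, mul_smul_comm]; rfl

lemma segPath_mul (z x y : Matrix ι ι X.carrier) (t : unitInterval) :
    segPath x y t * z = segPath (x * z) (y * z) t := by
  show (_ • x + _ • y) * z = _
  rw [add_mul, smul_mul_assoc, smul_mul_assoc]; rfl

/-- The two paths of quasi-inverses need not agree over y. Quasi-inverses of a fixed matrix at a
fixed level form a convex set, so a segment over the constant path at y joins them. -/
lemma GH.trans (h : GH s n x y) (h' : GH s m y z) : GH s (max n m) x z := by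
  obtain ⟨v, v₁, γ, δ, hγ⟩ := h.mono (le_max_left n m)
  obtain ⟨v₂, v', γ', δ', hγ'⟩ := h'.mono (le_max_right n m)
  have a : QP s (max n m) y v₁ := by simpa using hγ 1
  have b : QP s (max n m) y v₂ := by simpa using hγ' 0
  refine ⟨v, v', γ.trans ((Path.refl y).trans γ'), δ.trans ((segPath v₁ v₂).trans δ'),
    forall_trans hγ (forall_trans (fun t => ⟨a.1, a.2.1.combo b.2.1 t, ?_, ?_⟩) hγ')⟩
  · rw [Path.refl_apply, mul_segPath]; exact a.2.2.1.combo b.2.2.1 t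
  · rw [Path.refl_apply, segPath_mul]; exact a.2.2.2.combo b.2.2.2 t

/-- Each point of the segment is as close to x as y is, so `QI.close` applies at every time. -/
lemma IH.of_close (h : QI s n x) (hy : Bd s m y) (h' : Cl s a x y) :
    IH s (5 * n + 2 * m + 3 * a + 3) x y := by
  refine ⟨segPath x y, fun t => (h.close (m := n + m) (a := a) ?_ ?_).mono (by omega)⟩
  · exact (h.1.mono (by omega)).combo (hy.mono (by omega)) t
  · exact (((Cl.refl x).mono (zero_le)).combo h'.symm t).symm

lemma GH.of_close (h : QP s n x z) (hy : Bd s m y) (h' : Cl s a x y) :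
    GH s (3 * n + m + a + 1) x y := by
  refine ⟨z, z, segPath x y, Path.refl z, fun t => (h.close (m := n + m) (a := a) ?_ ?_).mono
    (by omega)⟩
  · exact (h.1.mono (by omega)).combo (hy.mono (by omega)) t
  · exact (((Cl.refl x).mono (zero_le)).combo h'.symm t).symm

lemma IH.blocks (h : IH s n x y) {z w : Matrix κ κ X.carrier} (h' : IH s m z w) :
    IH s (max n m) (Matrix.fromBlocks x 0 0 z) (Matrix.fromBlocks y 0 0 w) := by
  obtain ⟨γ, hγ⟩ := h
  obtain ⟨γ', hγ'⟩ := h'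
  exact ⟨(γ.prod γ').map continuous_blocks, fun t => (hγ t).blocks (hγ' t)⟩

lemma GH.mul_left (h : GH s n x y) (h' : QP s m z w) :
    GH s (4 * n + 4 * m + 4) (z * x) (z * y) := by
  obtain ⟨v, v', γ, δ, hγ⟩ := h
  exact ⟨_, _, γ.map (f := fun q => z * q) (by fun_prop),
    δ.map (f := fun q => q * w) (by fun_prop), fun t => (h'.mul (hγ t)).mono (by omega)⟩

lemma GH.mul_right (h : GH s n x y) (h' : QP s m z w) :
    GH s (4 * n + 4 * m + 4) (x * z) (y * z) := by
  obtain ⟨v, v', γ, δ, hγ⟩ := h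
  exact ⟨_, _, γ.map (f := fun q => q * z) (by fun_prop),
    δ.map (f := fun q => w * q) (by fun_prop), fun t => (hγ t).mul h'⟩

/-! ### Scalar projections -/

variable (X) in
/-- The diagonal matrix with entries `0` and `1` given by `b`. -/
def pr (b : ι → Bool) : Matrix ι ι X.carrier := Matrix.diagonal fun i => if b i then 1 else 0

lemma pr_mul_self (b : ι → Bool) : pr X b * pr X b = pr X b := by
  rw [pr, Matrix.diagonal_mul_diagonal]
  congr 1; ext i; split_ifs <;> simp

lemma pr_true : pr X (fun _ : ι => true) = 1 := by simp [pr]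

lemma pr_false : pr X (fun _ : ι => false) = 0 := by simp [pr]

lemma pr_submatrix (b : ι → Bool) (σ : κ ≃ ι) :
    (pr X b).submatrix σ σ = pr X (fun i => b (σ i)) := by
  ext i j; simp [pr, Matrix.diagonal_apply]

lemma pr_blocks (b : ι → Bool) (b' : κ → Bool) :
    Matrix.fromBlocks (pr X b) 0 0 (pr X b') = pr X (Sum.elim b b') := by
  ext (i | i) (j | j) <;> simp [pr, Matrix.diagonal_apply] <;> split_ifs <;> simp_all

lemma map_pr (φ : Hom X Y) (b : ι → Bool) : φ.mat (pr X b) = pr Y b := by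
  ext i j
  show φ.toAlgHom (pr X b i j) = _
  simp only [pr, Matrix.diagonal_apply]
  split_ifs <;> simp

/-- The index set split into the two parts given by `b`. -/
def boolEquiv (b : ι → Bool) : {i // b i = true} ⊕ {i // ¬ b i = true} ≃ ι :=
  Equiv.sumCompl fun i => b i = true

lemma pr_boolEquiv (b : ι → Bool) : (pr X b).submatrix (boolEquiv b) (boolEquiv b) =
    Matrix.fromBlocks 1 0 0 0 := by
  ext (i | i) (j | j)
  · simp [pr, boolEquiv, Matrix.diagonal_apply, Matrix.one_apply, Subtype.ext_iff, i.2]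
  · have : (i : ι) ≠ j := fun h => j.2 (h ▸ i.2)
    simp [pr, boolEquiv, this]
  · have : (i : ι) ≠ j := fun h => i.2 (h ▸ j.2)
    simp [pr, boolEquiv, this]
  · simp [pr, boolEquiv, Matrix.diagonal_apply, i.2]

/-- After sorting the indices the matrix is diag(1, 0), to which the rule for block diagonal norms
applies. -/
lemma bd_pr (b : ι → Bool) : Bd s 0 (pr X b) := by
  have h : Bd s 0 (Matrix.fromBlocks 1 0 0 0 :
      Matrix ({i // b i = true} ⊕ {i // ¬ b i = true}) _ X.carrier) := Bd.one.blocks Bd.zero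
  rw [← pr_boolEquiv] at h
  simpa [Matrix.submatrix_submatrix] using h.submatrix (boolEquiv b).symm (boolEquiv b).symm

lemma qi_pr (b : ι → Bool) : QI s 0 (pr X b) := ⟨bd_pr b, Cl.of_eq (pr_mul_self b)⟩

/-! ### Whitehead paths -/

lemma bd_quarter : Bd s 2 (quarter X ι) :=
  (Bd.fromBlocks Bd.zero Bd.one.neg Bd.one Bd.zero)

lemma ep_rot (t : ℝ) : EP s 3 (rot X ι t) (rotInv X ι t) := by
  have hc : ‖(Real.cos (Real.pi / 2 * t) : ℂ)‖ ≤ 1 := by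
    rw [Complex.norm_real]; exact Real.abs_cos_le_one _
  have hs : ‖(Real.sin (Real.pi / 2 * t) : ℂ)‖ ≤ 1 := by
    rw [Complex.norm_real]; exact Real.abs_sin_le_one _
  refine ⟨?_, ?_, rot_mul_rotInv t, rotInv_mul_rot t⟩
  · exact (Bd.one.smul hc).add (bd_quarter.smul hs)
  · exact (Bd.one.smul hc).sub (bd_quarter.smul hs)

/-- A path from `diag(g, g')` to `diag(gg', 1)`. -/
def whitehead (g g' : Matrix ι ι X.carrier) (t : ℝ) : Matrix (ι ⊕ ι) (ι ⊕ ι) X.carrier :=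
  Matrix.fromBlocks g 0 0 1 * (rot X ι t * Matrix.fromBlocks 1 0 0 g' * rotInv X ι t)

/-- The inverse of `whitehead g g'`, if `g` and `g'` are inverse to each other. -/
def whiteheadInv (g g' : Matrix ι ι X.carrier) (t : ℝ) : Matrix (ι ⊕ ι) (ι ⊕ ι) X.carrier :=
  rot X ι t * Matrix.fromBlocks 1 0 0 g * rotInv X ι t * Matrix.fromBlocks g' 0 0 1

lemma continuous_whitehead (g g' : Matrix ι ι X.carrier) : Continuous (whitehead g g') := by
  have h1 := continuous_rot (X := X) (ι := ι)
  have h2 := continuous_rotInv (X := X) (ι := ι)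
  unfold whitehead
  fun_prop

lemma continuous_whiteheadInv (g g' : Matrix ι ι X.carrier) : Continuous (whiteheadInv g g') := by
  have h1 := continuous_rot (X := X) (ι := ι)
  have h2 := continuous_rotInv (X := X) (ι := ι)
  unfold whiteheadInv
  fun_prop

lemma whitehead_zero (g g' : Matrix ι ι X.carrier) :
    whitehead g g' 0 = Matrix.fromBlocks g 0 0 g' := by
  rw [whitehead, conj_eq]; simp [Matrix.fromBlocks_multiply]

lemma whitehead_one (g g' : Matrix ι ι X.carrier) :
    whitehead g g' 1 = Matrix.fromBlocks (g * g') 0 0 1 := by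
  rw [whitehead, conj_eq]; simp [Matrix.fromBlocks_multiply]

lemma whiteheadInv_zero (g g' : Matrix ι ι X.carrier) :
    whiteheadInv g g' 0 = Matrix.fromBlocks g' 0 0 g := by
  rw [whiteheadInv, conj_eq]; simp [Matrix.fromBlocks_multiply]

lemma whiteheadInv_one (g g' : Matrix ι ι X.carrier) :
    whiteheadInv g g' 1 = Matrix.fromBlocks (g * g') 0 0 1 := by
  rw [whiteheadInv, conj_eq]; simp [Matrix.fromBlocks_multiply]

/-- Both matrices are products of members of inverse pairs, in opposite orders, hence quasi-inverse
to each other at every time. -/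
lemma QP.whitehead (h : QP s n x y) (t : ℝ) :
    QP s (100 * n + 400) (whitehead x y t) (whiteheadInv x y t) := by
  have h1 := h.blocks (QP.one (X := X) (ι := ι))
  have h2 := (QP.one (X := X) (ι := ι)).blocks h.symm
  have h3 := (((ep_rot (X := X) (ι := ι) (s := s) t).qp.mul h2).mul (ep_rot t).symm.qp)
  have h4 := h1.mul h3
  rw [← mul_assoc (rot X ι t)] at h4
  exact h4.mono (by simp; omega)

/-- Conjugate quasi-idempotents are stably homotopic. -/
lemma QI.conj_homotopic (h : QI s m z) (h' : QP s n x y) :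
    IH s (1000 * n + 100 * m + 3000) (Matrix.fromBlocks (x * z * y) 0 0 (0 : Matrix ι ι X.carrier))
      (Matrix.fromBlocks z 0 0 0) := by
  have hz : QI s m (Matrix.fromBlocks z 0 0 (0 : Matrix ι ι X.carrier)) :=
    (h.blocks (show QI s 0 (0 : Matrix ι ι X.carrier) from
      ⟨Bd.zero, Cl.of_eq (mul_zero 0)⟩)).mono (by simp)
  -- Conjugating diag(z, 0) along the Whitehead path leads from diag(xzy, 0) to diag(xy·z·xy, 0).
  -- Since xy ≈ 1, the end point is close to diag(z, 0), and a segment completes the homotopy.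
  have h1 : IH s (5 * m + 500 * n + 2005) (Matrix.fromBlocks (x * z * y) 0 0
      (0 : Matrix ι ι X.carrier)) (Matrix.fromBlocks (x * y * z * (x * y)) 0 0 0) := by
    have c1 := continuous_whitehead x y
    have c2 := continuous_whiteheadInv x y
    refine ⟨⟨⟨fun t => whitehead x y t * Matrix.fromBlocks z 0 0 0 * whiteheadInv x y t,
      by fun_prop⟩, ?_, ?_⟩, fun t => (hz.conj (h'.whitehead t)).mono (by omega)⟩
    · show whitehead x y ((0 : unitInterval) : ℝ) * _ * whiteheadInv x y ((0 : unitInterval) : ℝ) = _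
      simp [whitehead_zero, whiteheadInv_zero, Matrix.fromBlocks_multiply]
    · show whitehead x y ((1 : unitInterval) : ℝ) * _ * whiteheadInv x y ((1 : unitInterval) : ℝ) = _
      simp [whitehead_one, whiteheadInv_one, Matrix.fromBlocks_multiply]
  have h2 : Cl s (n + n + m + n + n + m + m + 10) z (x * y * z * (x * y)) := by
    have k1 := Cl.mul_right h.1 h'.2.2.1
    have k2 := Cl.mul_left ((h'.1.mul h'.2.1).mul h.1) h'.2.2.1
    rw [one_mul] at k1
    rw [mul_one] at k2
    exact ((k2.trans k1).symm).mono (by omega)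
  have h3 := h2.blocks (Cl.refl (s := s) (0 : Matrix ι ι X.carrier))
  have h4 := ((h'.1.mul h'.2.1).mul h.1).mul (h'.1.mul h'.2.1)
  have h5 := IH.of_close hz (h4.blocks (Bd.zero (X := X) (ι := ι))) h3
  exact (h1.trans h5.symm).mono (by simp; omega)

end Homotopies

end FilteredMatrixAlgebra
end QuantK

namespace QuantK
namespace FilteredMatrixAlgebra

section Elementary

variable {p : ℝ≥0∞} [Fact (1 ≤ p)] {X : FilteredMatrixAlgebra.{u} p}
  {Y : FilteredMatrixAlgebra.{v} p} {ι κ : Type} [Fintype ι] [DecidableEq ι] [Fintype κ]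
  [DecidableEq κ] {s : Scale} {a b c d n m : ℕ} {x y z w x' y' : Matrix ι ι X.carrier}

/-! ### Exact inverse pairs connected to the identity -/

/-- Exact inverse pairs connected to the identity. -/
def EH (s : Scale) (n : ℕ) (x x' : Matrix ι ι X.carrier) : Prop :=
  ∃ (γ : Path x 1) (δ : Path x' 1), ∀ t, EP s n (γ t) (δ t)

lemma EH.ep (h : EH s n x x') : EP s n x x' := by
  obtain ⟨γ, δ, h⟩ := h
  simpa using h 0

lemma EH.gh (h : EH s n x x') : GH s n x 1 := by
  obtain ⟨γ, δ, h⟩ := h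
  exact ⟨_, _, γ, δ, fun t => (h t).qp⟩

lemma EH.mono (h : EH s n x x') (hnm : n ≤ m) : EH s m x x' := by
  obtain ⟨γ, δ, h⟩ := h
  exact ⟨γ, δ, fun t => (h t).mono hnm⟩

lemma EH.symm (h : EH s n x x') : EH s n x' x := by
  obtain ⟨γ, δ, h⟩ := h
  exact ⟨δ, γ, fun t => (h t).symm⟩

lemma EH.one : EH s 0 (1 : Matrix ι ι X.carrier) 1 :=
  ⟨Path.refl _, Path.refl _, fun _ => EP.one⟩

lemma EH.mul (h : EH s n x x') (h' : EH s m y y') : EH s (n + m + 1) (x * y) (y' * x') := by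
  obtain ⟨γ, δ, h⟩ := h
  obtain ⟨γ', δ', h'⟩ := h'
  refine ⟨((γ.prod γ').map (f := fun q => q.1 * q.2) (by fun_prop)).cast rfl (one_mul 1).symm,
    ((δ.prod δ').map (f := fun q => q.2 * q.1) (by fun_prop)).cast rfl (one_mul 1).symm,
    fun t => (h t).mul (h' t)⟩

lemma EH.submatrix (h : EH s n x x') (σ : κ ≃ ι) :
    EH s n (x.submatrix σ σ) (x'.submatrix σ σ) := by
  obtain ⟨γ, δ, h⟩ := h
  exact ⟨(γ.map (continuous_submatrix σ)).cast rfl (Matrix.submatrix_one_equiv σ).symm,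
    (δ.map (continuous_submatrix σ)).cast rfl (Matrix.submatrix_one_equiv σ).symm,
    fun t => (h t).submatrix σ⟩

lemma EH.blocks (h : EH s n x x') {z z' : Matrix κ κ X.carrier} (h' : EH s m z z') :
    EH s (max n m) (Matrix.fromBlocks x 0 0 z) (Matrix.fromBlocks x' 0 0 z') := by
  obtain ⟨γ, δ, h⟩ := h
  obtain ⟨γ', δ', h'⟩ := h'
  exact ⟨((γ.prod γ').map continuous_blocks).cast rfl Matrix.fromBlocks_one.symm,
    ((δ.prod δ').map continuous_blocks).cast rfl Matrix.fromBlocks_one.symm,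
    fun t => (h t).blocks (h' t)⟩

/-- `(1, x; 0, 1)`. -/
def upper (x : Matrix ι ι X.carrier) : Matrix (ι ⊕ ι) (ι ⊕ ι) X.carrier := Matrix.fromBlocks 1 x 0 1

/-- `(1, 0; x, 1)`. -/
def lower (x : Matrix ι ι X.carrier) : Matrix (ι ⊕ ι) (ι ⊕ ι) X.carrier := Matrix.fromBlocks 1 0 x 1

lemma EP.upper (h : Bd s n x) : EP s (n + 2) (upper x) (upper (-x)) := by
  refine ⟨?_, ?_, ?_, ?_⟩
  · exact (Bd.fromBlocks Bd.one h Bd.zero Bd.one).mono (by omega)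
  · exact (Bd.fromBlocks Bd.one h.neg Bd.zero Bd.one).mono (by omega)
  · simp [QuantK.FilteredMatrixAlgebra.upper, Matrix.fromBlocks_multiply]
  · simp [QuantK.FilteredMatrixAlgebra.upper, Matrix.fromBlocks_multiply]

lemma EP.lower (h : Bd s n x) : EP s (n + 2) (lower x) (lower (-x)) := by
  refine ⟨?_, ?_, ?_, ?_⟩
  · exact (Bd.fromBlocks Bd.one Bd.zero h Bd.one).mono (by omega)
  · exact (Bd.fromBlocks Bd.one Bd.zero h.neg Bd.one).mono (by omega)
  · simp [QuantK.FilteredMatrixAlgebra.lower, Matrix.fromBlocks_multiply]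
  · simp [QuantK.FilteredMatrixAlgebra.lower, Matrix.fromBlocks_multiply]

lemma segPath_upper (x : Matrix ι ι X.carrier) (t : unitInterval) :
    segPath (upper x) 1 t = upper (((1 - (t : ℝ) : ℝ) : ℂ) • x) := by
  show ((1 - (t : ℝ) : ℝ) : ℂ) • upper x + ((t : ℝ) : ℂ) • (1 : Matrix (ι ⊕ ι) (ι ⊕ ι) X.carrier) = _
  have : ((1 - (t : ℝ) : ℝ) : ℂ) • (1 : Matrix ι ι X.carrier) + ((t : ℝ) : ℂ) • 1 = 1 := by
    rw [← add_smul]; simp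
  rw [upper, upper, ← Matrix.fromBlocks_one, Matrix.fromBlocks_smul, Matrix.fromBlocks_smul,
    Matrix.fromBlocks_add, this]
  simp

lemma segPath_lower (x : Matrix ι ι X.carrier) (t : unitInterval) :
    segPath (lower x) 1 t = lower (((1 - (t : ℝ) : ℝ) : ℂ) • x) := by
  show ((1 - (t : ℝ) : ℝ) : ℂ) • lower x + ((t : ℝ) : ℂ) • (1 : Matrix (ι ⊕ ι) (ι ⊕ ι) X.carrier) = _
  have : ((1 - (t : ℝ) : ℝ) : ℂ) • (1 : Matrix ι ι X.carrier) + ((t : ℝ) : ℂ) • 1 = 1 := by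
    rw [← add_smul]; simp
  rw [lower, lower, ← Matrix.fromBlocks_one, Matrix.fromBlocks_smul, Matrix.fromBlocks_smul,
    Matrix.fromBlocks_add, this]
  simp

lemma norm_one_sub_coe_le (t : unitInterval) : ‖((1 - (t : ℝ) : ℝ) : ℂ)‖ ≤ 1 := by
  rw [Complex.norm_real, Real.norm_of_nonneg (by linarith [t.2.2])]
  linarith [t.2.1]

/-- The segment to 1 only rescales the off-diagonal entry, so it stays among unipotent matrices,
which have exact inverses. -/
lemma eh_upper (h : Bd s n x) : EH s (n + 2) (upper x) (upper (-x)) := by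
  refine ⟨segPath _ _, segPath _ _, fun t => ?_⟩
  rw [segPath_upper, segPath_upper, smul_neg]
  exact EP.upper (h.smul (norm_one_sub_coe_le t))

lemma eh_lower (h : Bd s n x) : EH s (n + 2) (lower x) (lower (-x)) := by
  refine ⟨segPath _ _, segPath _ _, fun t => ?_⟩
  rw [segPath_lower, segPath_lower, smul_neg]
  exact EP.lower (h.smul (norm_one_sub_coe_le t))

lemma eh_quarter : EH s 3 (quarter X ι) (-quarter X ι) := by
  refine ⟨⟨⟨fun t => rot X ι (1 - t), continuous_rot.comp (by fun_prop)⟩, ?_, ?_⟩,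
    ⟨⟨fun t => rotInv X ι (1 - t), continuous_rotInv.comp (by fun_prop)⟩, ?_, ?_⟩,
    fun t => ep_rot _⟩
  · simp [rot]
  · simp [rot]
  · simp [rotInv]
  · simp [rotInv]

/-- `(1, x; 0, 1)(1, 0; y, 1)(1, x; 0, 1)`. -/
def braid (x y : Matrix ι ι X.carrier) : Matrix (ι ⊕ ι) (ι ⊕ ι) X.carrier :=
  upper x * (lower y * upper x)

lemma eh_braid (hx : Bd s n x) (hy : Bd s m y) :
    EH s (2 * n + m + 8) (braid x y) (upper (-x) * lower (-y) * upper (-x)) :=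
  ((eh_upper hx).mul ((eh_lower hy).mul (eh_upper hx))).mono (by omega)

lemma braid_eq (x y : Matrix ι ι X.carrier) : braid x y =
    Matrix.fromBlocks (1 + x * y) ((1 + x * y) * x + x) y (1 + y * x) := by
  simp only [braid, upper, lower, Matrix.fromBlocks_multiply]
  congr 1
  · simp
  · simp; noncomm_ring
  · simp
  · simp; abel

/-- `diag(u, v)` for inverse `u`, `v`, as a product of elementary matrices. -/
def elem (u v : Matrix ι ι X.carrier) : Matrix (ι ⊕ ι) (ι ⊕ ι) X.carrier :=
  braid u (-v) * quarter X ι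

/-- The inverse of `elem u v`. -/
def elemInv (u v : Matrix ι ι X.carrier) : Matrix (ι ⊕ ι) (ι ⊕ ι) X.carrier :=
  -quarter X ι * (upper (-u) * lower (- -v) * upper (-u))

/-- No relation between x and y is needed. Arbitrary lifts of a quasi-inverse pair thus give an
exactly invertible matrix connected to 1, and only the image of this matrix has to be recognised. -/
lemma eh_elem (hx : Bd s n x) (hy : Bd s m y) :
    EH s (2 * n + m + 12) (elem x y) (elemInv x y) :=
  ((eh_braid hx hy.neg).mul eh_quarter).mono (by omega)

lemma elem_eq (u v : Matrix ι ι X.carrier) : elem u v =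
    Matrix.fromBlocks ((1 - u * v) * u + u) (-(1 - u * v)) (1 - v * u) v := by
  rw [elem, braid_eq, quarter, Matrix.fromBlocks_multiply]
  congr 1 <;> simp <;> noncomm_ring

/-- By `elem_eq`, the deviation from diag(x, y) consists of multiples of 1 - xy and 1 - yx. -/
lemma QP.cl_elem (h : QP s n x y) : Cl s (5 * n + 1) (elem x y) (Matrix.fromBlocks x 0 0 y) := by
  rw [elem_eq]
  have h1 : Cl s n (1 - x * y) 0 := by
    rw [Cl, sub_zero, norm_sub_rev]; exact h.2.2.1
  have h2 : Cl s n (1 - y * x) 0 := by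
    rw [Cl, sub_zero, norm_sub_rev]; exact h.2.2.2
  have h3 : Cl s (n + n) ((1 - x * y) * x + x) x := by
    have := Cl.mul_right h.1 h1
    rw [zero_mul, Cl, sub_zero] at this
    rw [Cl, add_sub_cancel_right]
    exact this
  have h4 := h1.neg
  rw [neg_zero] at h4
  exact (Cl.fromBlocks h3 h4 h2 (Cl.refl y)).mono (by omega)

lemma map_fromBlocks (φ : Hom X Y) (x : Matrix ι ι X.carrier) (y : Matrix ι κ X.carrier)
    (z : Matrix κ ι X.carrier) (w : Matrix κ κ X.carrier) :
    φ.mat (Matrix.fromBlocks x y z w) = Matrix.fromBlocks (x.map φ.toAlgHom) (y.map φ.toAlgHom)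
      (z.map φ.toAlgHom) (w.map φ.toAlgHom) :=
  Matrix.fromBlocks_map _ _ _ _ _

lemma map_blocks (φ : Hom X Y) (x : Matrix ι ι X.carrier) (w : Matrix κ κ X.carrier) :
    φ.mat (Matrix.fromBlocks x 0 0 w) = Matrix.fromBlocks (φ.mat x) 0 0 (φ.mat w) := by
  rw [map_fromBlocks, Matrix.map_zero _ (map_zero φ.toAlgHom), Matrix.map_zero _ (map_zero φ.toAlgHom)]
  rfl

lemma map_upper (φ : Hom X Y) (x : Matrix ι ι X.carrier) : φ.mat (upper x) = upper (φ.mat x) := by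
  have h1 : (1 : Matrix ι ι X.carrier).map φ.toAlgHom = 1 := φ.mat_one
  rw [upper, map_fromBlocks, Matrix.map_zero _ (map_zero φ.toAlgHom), h1]
  rfl

lemma map_lower (φ : Hom X Y) (x : Matrix ι ι X.carrier) : φ.mat (lower x) = lower (φ.mat x) := by
  have h1 : (1 : Matrix ι ι X.carrier).map φ.toAlgHom = 1 := φ.mat_one
  rw [lower, map_fromBlocks, Matrix.map_zero _ (map_zero φ.toAlgHom), h1]
  rfl

lemma map_braid (φ : Hom X Y) (x y : Matrix ι ι X.carrier) :
    φ.mat (braid x y) = braid (φ.mat x) (φ.mat y) := by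
  rw [braid, φ.mat_mul, φ.mat_mul, map_upper, map_lower]; rfl

lemma map_quarter (φ : Hom X Y) : φ.mat (quarter X ι) = quarter Y ι := by
  have h1 : (1 : Matrix ι ι X.carrier).map φ.toAlgHom = 1 := φ.mat_one
  have h2 : (-1 : Matrix ι ι X.carrier).map φ.toAlgHom = -1 := by
    show φ.mat (-1) = -1
    rw [map_neg, φ.mat_one]
  rw [quarter, map_fromBlocks, Matrix.map_zero _ (map_zero φ.toAlgHom), h1, h2]
  rfl

lemma map_elem (φ : Hom X Y) (x y : Matrix ι ι X.carrier) :
    φ.mat (elem x y) = elem (φ.mat x) (φ.mat y) := by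
  rw [elem, φ.mat_mul, map_braid, map_quarter, map_neg]; rfl

lemma Cl.of_sub (h : Cl s n (x - y) 0) : Cl s n x y := by
  rwa [Cl, sub_zero] at h

lemma Cl.sub_zero' (h : Cl s n x y) : Cl s n (x - y) 0 := by
  rw [Cl, sub_zero]; exact h

lemma Cl.mul_left_zero (h : Bd s a x) (h' : Cl s b y 0) : Cl s (a + b) (x * y) 0 := by
  simpa using Cl.mul_left h h'

/-- Reduces a conjugation estimate to an intertwining relation, in which the inverse does not occur.
-/
lemma Cl.conj_of_comm (h : Cl s a (x * y) (z * x)) (hx : EP s b x x') :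
    Cl s (a + b) (x * y * x') z := by
  have := Cl.mul_right hx.2.1 h
  rw [mul_assoc z, hx.2.2.1, mul_one] at this
  exact this.mono (by omega)

/-- `R diag(e, 1 - e) R⁻¹` is close to `diag(0, 1)` for `R = braid (-e) e`. -/
lemma QI.cl_braid (h : QI s n x) :
    Cl s (20 * n + 40) (braid (-x) x * Matrix.fromBlocks x 0 0 (1 - x) *
      (upper (- -x) * lower (-x) * upper (- -x))) (Matrix.fromBlocks 0 0 0 1) := by
  -- For a true idempotent e the braid is (1-e, -e; e, 1-e), which intertwines diag(e, 1-e) with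
  -- diag(0, 1). In general each entry of the defect is a polynomial in e times e - e².
  refine (Cl.conj_of_comm (a := 12 * n + 15) ?_ (eh_braid h.1.neg h.1).ep).mono (by omega)
  rw [braid_eq, Matrix.fromBlocks_multiply, Matrix.fromBlocks_multiply]
  have h0 : Cl s n (x - x * x) 0 := h.2.symm.sub_zero'
  have h1 := h0.add (Cl.mul_left_zero h.1 h0)
  rw [add_zero] at h1
  have h2 := (h0.add (h0.add (Cl.mul_left_zero (h.1.mul h.1).neg h0))).neg
  rw [add_zero, add_zero, neg_zero] at h2
  have h3 := h1.neg
  rw [neg_zero] at h3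
  simp only [zero_mul, mul_zero, add_zero, zero_add, one_mul]
  refine (Cl.fromBlocks (a := 2 * n + 1 + n) (b := 5 * n + 3) (c := n) (d := 3 * n + 1)
    ?_ ?_ h.2 ?_).mono (by omega)
  · refine Eq.subst (motive := fun q => Cl s _ q 0) ?_ (h1.mono (by omega))
    noncomm_ring
  · refine Eq.subst (motive := fun q => Cl s _ q 0) ?_ (h2.mono (by omega))
    noncomm_ring
  · refine Cl.of_sub (Eq.subst (motive := fun q => Cl s _ q 0) ?_ (h3.mono (by omega)))
    noncomm_ring

end Elementary

end FilteredMatrixAlgebra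
end QuantK

namespace QuantK
namespace FilteredMatrixAlgebra

section Shift

variable {p : ℝ≥0∞} [Fact (1 ≤ p)] {X : FilteredMatrixAlgebra.{u} p}
  {Y : FilteredMatrixAlgebra.{v} p} {ι κ : Type} [Fintype ι] [DecidableEq ι] [Fintype κ]
  [DecidableEq κ] {s : Scale} {a b c d n m : ℕ} {x y z w x' y' : Matrix ι ι X.carrier}

/-! ### Block diagonal matrices -/

variable (ι) in
/-- `k + 1` copies of `ι`, with the first one split off. -/
def headEquiv (k : ℕ) : ι ⊕ ι × Fin k ≃ ι × Fin (k + 1) where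
  toFun := Sum.elim (fun i => (i, 0)) fun q => (q.1, q.2.succ)
  invFun q := Fin.cases (motive := fun _ => ι ⊕ ι × Fin k) (Sum.inl q.1) (fun j => Sum.inr (q.1, j)) q.2
  left_inv := by rintro (i | ⟨i, j⟩) <;> rfl
  right_inv := by
    rintro ⟨i, j⟩
    refine Fin.cases ?_ (fun j => ?_) j <;> rfl

variable (ι) in
/-- `k + 1` copies of `ι`, with the last one split off. -/
def lastEquiv (k : ℕ) : ι × Fin k ⊕ ι ≃ ι × Fin (k + 1) where
  toFun := Sum.elim (fun q => (q.1, q.2.castSucc)) fun i => (i, Fin.last k)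
  invFun q := Fin.lastCases (motive := fun _ => ι × Fin k ⊕ ι) (Sum.inr q.1)
    (fun j => Sum.inl (q.1, j)) q.2
  left_inv := by rintro (⟨i, j⟩ | i) <;> simp
  right_inv := by
    rintro ⟨i, j⟩
    refine Fin.lastCases ?_ (fun j => ?_) j <;> simp

lemma blockDiagonal_head {k : ℕ} (f : Fin (k + 1) → Matrix ι ι X.carrier) :
    (Matrix.blockDiagonal f).submatrix (headEquiv ι k) (headEquiv ι k) =
      Matrix.fromBlocks (f 0) 0 0 (Matrix.blockDiagonal fun j => f j.succ) := by
  ext (i | ⟨i, j⟩) (i' | ⟨i', j'⟩) <;>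
    simp [headEquiv, Matrix.blockDiagonal_apply, Fin.succ_ne_zero, (Fin.succ_ne_zero _).symm]

lemma blockDiagonal_last {k : ℕ} (f : Fin (k + 1) → Matrix ι ι X.carrier) :
    (Matrix.blockDiagonal f).submatrix (lastEquiv ι k) (lastEquiv ι k) =
      Matrix.fromBlocks (Matrix.blockDiagonal fun j => f j.castSucc) 0 0 (f (Fin.last k)) := by
  ext (⟨i, j⟩ | i) (⟨i', j'⟩ | i') <;>
    simp [lastEquiv, Matrix.blockDiagonal_apply, Fin.castSucc_ne_last,
      (Fin.castSucc_ne_last _).symm]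

/-- The bound does not involve the number of blocks. This is what makes arbitrarily fine
subdivisions of a homotopy harmless. -/
lemma norm_blockDiagonal_le {k : ℕ} {B : ℝ} (hB : 0 ≤ B) (f : Fin k → Matrix ι ι X.carrier)
    (hf : ∀ j, ‖f j‖ ≤ B) : ‖Matrix.blockDiagonal f‖ ≤ B := by
  induction k with
  | zero =>
    have : Matrix.blockDiagonal f = 0 := by
      ext ⟨i, j⟩; exact j.elim0
    rw [this, norm_zero]; exact hB
  | succ k ih =>
    have h := norm_submatrix_le (Matrix.fromBlocks (f 0) 0 0 (Matrix.blockDiagonal fun j => f j.succ))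
      (headEquiv ι k).symm (headEquiv ι k).symm
    rw [← blockDiagonal_head, Matrix.submatrix_submatrix, Equiv.self_comp_symm,
      Matrix.submatrix_id_id, blockDiagonal_head] at h
    exact h.trans ((norm_blocks_le _ _).trans (max_le (hf 0) (ih _ fun j => hf _)))

lemma Bd.blockDiagonal {k : ℕ} {f : Fin k → Matrix ι ι X.carrier} (hf : ∀ j, Bd s n (f j)) :
    Bd s n (Matrix.blockDiagonal f) := by
  refine ⟨norm_blockDiagonal_le (s.pow_pos n).le f fun j => (hf j).1, ?_⟩
  rintro ⟨i, j⟩ ⟨i', j'⟩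
  rw [Matrix.blockDiagonal_apply]
  split_ifs
  · exact (hf j).2 _ _
  · exact Submodule.zero_mem _

lemma Cl.blockDiagonal {k : ℕ} {f g : Fin k → Matrix ι ι X.carrier} (hf : ∀ j, Cl s n (f j) (g j)) :
    Cl s n (Matrix.blockDiagonal f) (Matrix.blockDiagonal g) := by
  rw [Cl, ← Matrix.blockDiagonal_sub]
  exact norm_blockDiagonal_le (mul_pos (s.pow_pos n) s.ε_pos).le _ hf

lemma QI.blockDiagonal {k : ℕ} {f : Fin k → Matrix ι ι X.carrier} (hf : ∀ j, QI s n (f j)) :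
    QI s n (Matrix.blockDiagonal f) :=
  ⟨Bd.blockDiagonal fun j => (hf j).1, by
    rw [← Matrix.blockDiagonal_mul]; exact Cl.blockDiagonal fun j => (hf j).2⟩

lemma QP.blockDiagonal {k : ℕ} {f g : Fin k → Matrix ι ι X.carrier} (hf : ∀ j, QP s n (f j) (g j)) :
    QP s n (Matrix.blockDiagonal f) (Matrix.blockDiagonal g) := by
  have h1 : Matrix.blockDiagonal (fun _ : Fin k => (1 : Matrix ι ι X.carrier)) = 1 :=
    Matrix.blockDiagonal_one
  refine ⟨Bd.blockDiagonal fun j => (hf j).1, Bd.blockDiagonal fun j => (hf j).2.1, ?_, ?_⟩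
  · rw [← Matrix.blockDiagonal_mul, ← h1]; exact Cl.blockDiagonal fun j => (hf j).2.2.1
  · rw [← Matrix.blockDiagonal_mul, ← h1]; exact Cl.blockDiagonal fun j => (hf j).2.2.2

/-! ### Discretisation of paths -/

/-- Uniform continuity on the unit interval. The subdivision is indexed by all natural numbers and
is constant equal to 1 from k on, so the estimate holds at every index. -/
lemma exists_partition {α : Type u} [PseudoMetricSpace α] {x y : α} (γ : Path x y) {δ : ℝ}
    (hδ : 0 < δ) : ∃ (k : ℕ) (τ : ℕ → unitInterval), τ 0 = 0 ∧ τ k = 1 ∧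
      ∀ i, dist (γ (τ i)) (γ (τ (i + 1))) < δ := by
  obtain ⟨τ, h0, hm, ⟨k, hk⟩, hc⟩ := exists_monotone_Icc_subset_open_cover_unitInterval
    (c := fun t : unitInterval => {t' | dist (γ t') (γ t) < δ / 2})
    (fun t => isOpen_lt (by fun_prop) continuous_const)
    (fun t _ => Set.mem_iUnion.mpr ⟨t, by simpa using hδ⟩)
  refine ⟨k, τ, h0, hk k le_rfl, fun i => ?_⟩
  obtain ⟨t, ht⟩ := hc i
  have h1 : dist (γ (τ i)) (γ t) < δ / 2 := ht ⟨le_rfl, hm (Nat.le_succ i)⟩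
  have h2 : dist (γ (τ (i + 1))) (γ t) < δ / 2 := ht ⟨hm (Nat.le_succ i), le_rfl⟩
  rw [dist_comm] at h2
  linarith [dist_triangle (γ (τ i)) (γ t) (γ (τ (i + 1)))]

/-- The steps have size at most ε, that is, closeness at level 0. Their number k is not controlled,
and no later estimate involves it. -/
lemma GH.exists_chain (h : GH s n x y) : ∃ (k : ℕ) (f f' : ℕ → Matrix ι ι X.carrier),
    f 0 = x ∧ f k = y ∧ (∀ i, QP s n (f i) (f' i)) ∧ ∀ i, Cl s 0 (f i) (f (i + 1)) := by
  obtain ⟨v, v', γ, δ, h⟩ := h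
  obtain ⟨k, τ, h0, hk, hτ⟩ := exists_partition γ s.ε_pos
  refine ⟨k, fun i => γ (τ i), fun i => δ (τ i), by simp [h0], by simp [hk], fun i => h _,
    fun i => ?_⟩
  have := hτ i
  rw [dist_eq_norm] at this
  rw [Cl, pow_zero, one_mul]
  exact this.le

lemma IH.exists_chain (h : IH s n x y) : ∃ (k : ℕ) (f : ℕ → Matrix ι ι X.carrier),
    f 0 = x ∧ f k = y ∧ (∀ i, QI s n (f i)) ∧ ∀ i, Cl s 0 (f i) (f (i + 1)) := by
  obtain ⟨γ, h⟩ := h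
  obtain ⟨k, τ, h0, hk, hτ⟩ := exists_partition γ s.ε_pos
  refine ⟨k, fun i => γ (τ i), by simp [h0], by simp [hk], fun i => h _, fun i => ?_⟩
  have := hτ i
  rw [dist_eq_norm] at this
  rw [Cl, pow_zero, one_mul]
  exact this.le

/-- Concatenation takes the maximum of the levels, so the level does not grow with k. -/
lemma IH.of_chain {f : ℕ → Matrix ι ι X.carrier} (hf : ∀ i, IH s n (f i) (f (i + 1))) (k : ℕ) :
    IH s n (f 0) (f k) := by
  induction k with
  | zero =>
    obtain ⟨γ, h⟩ := hf 0
    have := h 0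
    rw [γ.source] at this
    exact IH.refl this
  | succ k ih => exact (ih.trans (hf k)).mono (by simp)

/-- The sequence `f 0, …, f k`, in two ways: as `f 0` followed by the others, and as `f k` preceded
by the others. -/
lemma exists_shift (k : ℕ) (f : ℕ → Matrix ι ι X.carrier) :
    ∃ σ : ι ⊕ ι × Fin k ≃ ι × Fin k ⊕ ι,
      Matrix.fromBlocks (f 0) 0 0 (Matrix.blockDiagonal fun j : Fin k => f (j + 1)) =
      (Matrix.fromBlocks (Matrix.blockDiagonal fun j : Fin k => f j) 0 0 (f k)).submatrix σ σ := by
  refine ⟨(headEquiv ι k).trans (lastEquiv ι k).symm, ?_⟩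
  have h1 := blockDiagonal_head (X := X) (ι := ι) (fun j : Fin (k + 1) => f j)
  have h2 := blockDiagonal_last (X := X) (ι := ι) (fun j : Fin (k + 1) => f j)
  simp only [Fin.val_zero, Fin.val_succ, Fin.val_castSucc, Fin.val_last] at h1 h2
  rw [← h1, ← h2, Matrix.submatrix_submatrix]
  have e : lastEquiv ι k ∘ (headEquiv ι k).trans (lastEquiv ι k).symm = headEquiv ι k := by
    funext i
    exact Equiv.apply_symm_apply _ _
  rw [e]

/-- Carries an additional summand along the shift. It is used with a block diagonal of
quasi-inverses and with the complement 1 - b, which complete b to a matrix that can be straightened.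
-/
lemma exists_shuffle {ι κ μ : Type} {x y : Matrix ι ι X.carrier} {b a : Matrix κ κ X.carrier}
    {σ : ι ⊕ κ ≃ κ ⊕ ι} (hσ : Matrix.fromBlocks x 0 0 b = (Matrix.fromBlocks a 0 0 y).submatrix σ σ)
    (c : Matrix μ μ X.carrier) : ∃ ρ : ι ⊕ (κ ⊕ μ) ≃ (κ ⊕ μ) ⊕ ι,
      (Matrix.fromBlocks (Matrix.fromBlocks a 0 0 c) 0 0 y).submatrix ρ ρ =
        Matrix.fromBlocks x 0 0 (Matrix.fromBlocks b 0 0 c) := by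
  let τ : (κ ⊕ ι) ⊕ μ ≃ (κ ⊕ μ) ⊕ ι := (Equiv.sumAssoc _ _ _).trans
    ((Equiv.sumCongr (Equiv.refl _) (Equiv.sumComm _ _)).trans (Equiv.sumAssoc _ _ _).symm)
  refine ⟨(Equiv.sumAssoc _ _ _).symm.trans ((Equiv.sumCongr σ (Equiv.refl _)).trans τ), ?_⟩
  have h1 : (Matrix.fromBlocks (Matrix.fromBlocks a 0 0 c) 0 0 y).submatrix τ τ =
      Matrix.fromBlocks (Matrix.fromBlocks a 0 0 y) 0 0 c := by
    ext ((i | i) | i) ((j | j) | j) <;> rfl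
  have h2 : (Matrix.fromBlocks (Matrix.fromBlocks a 0 0 y) 0 0 c).submatrix
      (Equiv.sumCongr σ (Equiv.refl _)) (Equiv.sumCongr σ (Equiv.refl _)) =
      Matrix.fromBlocks (Matrix.fromBlocks x 0 0 b) 0 0 c := by
    rw [hσ]
    ext (i | i) (j | j) <;> rfl
  have h3 : (Matrix.fromBlocks (Matrix.fromBlocks x 0 0 b) 0 0 c).submatrix
      (Equiv.sumAssoc _ _ _).symm (Equiv.sumAssoc _ _ _).symm =
      Matrix.fromBlocks x 0 0 (Matrix.fromBlocks b 0 0 c) := by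
    ext (i | i | i) (j | j | j) <;> rfl
  rw [← h3, ← h2, ← h1]
  rfl

/-! ### Lifting invertibles and conjugating idempotents -/

/-- Matrices can be lifted along `φ` with control. -/
def Lifting (s : Scale) (φ : Hom X Y) : Prop :=
  ∀ (ι : Type) [Fintype ι] [DecidableEq ι] (n : ℕ) (y : Matrix ι ι Y.carrier), Bd s n y →
    ∃ x : Matrix ι ι X.carrier, φ.mat x = y ∧ Bd s (n + 1) x

lemma lifting_id (s : Scale) : Lifting s (Hom.id X) := fun _ _ _ n y h => by
  refine ⟨y, ?_, h.mono n.le_succ⟩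
  ext i j; rfl

lemma map_submatrix (φ : Hom X Y) (x : Matrix ι ι X.carrier) (σ : κ ≃ ι) :
    φ.mat (x.submatrix σ σ) = (φ.mat x).submatrix σ σ := rfl

/-- The lifts of u and u' are in general not quasi-inverse over the source; `elem` is exactly
invertible all the same. -/
lemma exists_lift_elem {φ : Hom X Y} (hφ : Lifting s φ) {u u' : Matrix ι ι Y.carrier}
    (h : QP s n u u') : ∃ W W' : Matrix (ι ⊕ ι) (ι ⊕ ι) X.carrier, EH s (3 * n + 20) W W' ∧
      Cl s (5 * n + 1) (φ.mat W) (Matrix.fromBlocks u 0 0 u') := by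
  obtain ⟨U, rfl, hU⟩ := hφ ι n u h.1
  obtain ⟨U', rfl, hU'⟩ := hφ ι n u' h.2.1
  refine ⟨elem U U', elemInv U U', (eh_elem hU hU').mono (by omega), ?_⟩
  rw [map_elem]
  exact h.cl_elem

/-- A quasi-invertible that is homotopic to the identity lifts after stabilisation to an
invertible that is connected to the identity. -/
lemma GH.exists_lift {φ : Hom X Y} (hφ : Lifting s φ) {u : Matrix ι ι Y.carrier}
    (h : GH s n u 1) : ∃ (κ : Type) (_ : Fintype κ) (_ : DecidableEq κ)
      (L L' : Matrix (ι ⊕ κ) (ι ⊕ κ) X.carrier), EH s (100 * n + 100) L L' ∧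
      Cl s (100 * n + 100) (φ.mat L) (Matrix.fromBlocks u 0 0 1) := by
  obtain ⟨k, f, f', h0, hk, hf, hc⟩ := h.exists_chain
  obtain ⟨σ, hσ⟩ := exists_shift k f
  rw [h0, hk] at hσ
  -- With u = f 0 and f k = 1, diag(u, B) is a permutation of diag(A, 1). Since A ≈ B, the
  -- quasi-inverse B' of B also serves A. Hence diag(A, B') and diag(B, B') both lift to exact
  -- invertibles W and Z, with bounds independent of k.
  set A := Matrix.blockDiagonal fun j : Fin k => f j
  set B := Matrix.blockDiagonal fun j : Fin k => f (j + 1)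
  set B' := Matrix.blockDiagonal fun j : Fin k => f' (j + 1)
  have hB : QP s n B B' := QP.blockDiagonal fun j => hf _
  have hA : QP s (4 * n + 1) A B' :=
    (hB.close (Bd.blockDiagonal fun j => (hf j).1) (Cl.blockDiagonal fun j => hc j).symm).mono
      (by omega)
  obtain ⟨W, W', hW, hWc⟩ := exists_lift_elem hφ hA
  obtain ⟨Z, Z', hZ, hZc⟩ := exists_lift_elem hφ hB
  obtain ⟨ρ, hρ⟩ := exists_shuffle hσ B'
  -- The permuted diag(W, 1) lifts diag(u, B, B') approximately; multiplication by diag(1, Z⁻¹)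
  -- removes B and B' and leaves diag(u, 1).
  have h1 := (hW.blocks (EH.one (X := X) (ι := ι))).submatrix ρ
  have h2 := (EH.one (X := X) (ι := ι)).blocks hZ.symm
  refine ⟨ι × Fin k ⊕ ι × Fin k, inferInstance, inferInstance, _, _, (h1.mul h2).mono ?_, ?_⟩
  · simp; omega
  · rw [φ.mat_mul, map_submatrix, map_blocks, map_blocks, φ.mat_one]
    have k1 := (hWc.blocks (Cl.refl (1 : Matrix ι ι Y.carrier))).submatrix ρ ρ
    rw [hρ] at k1
    have k2 := Cl.mul_right (h2.ep.map φ).1 k1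
    rw [map_blocks, φ.mat_one] at k2
    refine (k2.trans (b := 20 * n + 50) ?_).mono (by simp; omega)
    have k3 := Cl.mul_right (hZ.ep.map φ).2.1 hZc.symm
    rw [(hZ.ep.map φ).2.2.1] at k3
    rw [blocks_mul, mul_one]
    exact ((Cl.refl u).blocks k3).mono (by simp; omega)

/-- Approximate conjugacy by an exact invertible that lifts along `φ`: `q(S) x q(S)⁻¹ ≈ y`. -/
def ConjLift (s : Scale) (n : ℕ) (φ : Hom X Y) (x y : Matrix ι ι Y.carrier) : Prop :=
  ∃ S S' : Matrix ι ι X.carrier, EP s n S S' ∧ Cl s n (φ.mat S * x * φ.mat S') y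

variable {φ : Hom X Y}

lemma ConjLift.mono {x y : Matrix ι ι Y.carrier} (h : ConjLift s n φ x y) (hnm : n ≤ m) :
    ConjLift s m φ x y := by
  obtain ⟨S, S', h1, h2⟩ := h
  exact ⟨S, S', h1.mono hnm, h2.mono hnm⟩

lemma ConjLift.symm {x y : Matrix ι ι Y.carrier} (h : ConjLift s n φ x y) :
    ConjLift s (3 * n) φ y x := by
  obtain ⟨S, S', h1, h2⟩ := h
  refine ⟨S', S, h1.symm.mono (by omega), ?_⟩
  have h3 := h1.map φ
  have h4 := Cl.mul_left h3.2.1 (Cl.mul_right h3.1 h2.symm)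
  have e : φ.mat S' * (φ.mat S * x * φ.mat S' * φ.mat S) = x := by
    rw [mul_assoc, h3.2.2.2, mul_one, ← mul_assoc, h3.2.2.2, one_mul]
  rw [e, ← mul_assoc] at h4
  exact h4.mono (by omega)

lemma ConjLift.trans {x y z : Matrix ι ι Y.carrier} (h : ConjLift s n φ x y)
    (h' : ConjLift s m φ y z) : ConjLift s (2 * n + 4 * m + 1) φ x z := by
  obtain ⟨S, S', h1, h2⟩ := h
  obtain ⟨T, T', h3, h4⟩ := h'
  refine ⟨T * S, S' * T', (h3.mul h1).mono (by omega), ?_⟩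
  have h5 := h3.map φ
  have h6 := Cl.mul_left h5.1 (Cl.mul_right h5.2.1 h2)
  simp only [← mul_assoc] at h6
  have h7 := h6.trans h4
  rw [φ.mat_mul, φ.mat_mul]
  simp only [← mul_assoc]
  exact h7.mono (by omega)

lemma ConjLift.of_close {x y : Matrix ι ι Y.carrier} (h : Cl s n x y) : ConjLift s n φ x y := by
  refine ⟨1, 1, EP.one.mono n.zero_le, ?_⟩
  rw [φ.mat_one, one_mul, mul_one]
  exact h

lemma ConjLift.submatrix {x y : Matrix ι ι Y.carrier} (h : ConjLift s n φ x y) (σ : κ ≃ ι) :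
    ConjLift s n φ (x.submatrix σ σ) (y.submatrix σ σ) := by
  obtain ⟨S, S', h1, h2⟩ := h
  refine ⟨S.submatrix σ σ, S'.submatrix σ σ, h1.submatrix σ, ?_⟩
  rw [map_submatrix, map_submatrix, Matrix.submatrix_mul_equiv, Matrix.submatrix_mul_equiv]
  exact h2.submatrix σ σ

lemma ConjLift.blocks {x y : Matrix ι ι Y.carrier} (h : ConjLift s n φ x y)
    {z w : Matrix κ κ Y.carrier} (h' : ConjLift s m φ z w) :
    ConjLift s (max n m) φ (Matrix.fromBlocks x 0 0 z) (Matrix.fromBlocks y 0 0 w) := by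
  obtain ⟨S, S', h1, h2⟩ := h
  obtain ⟨T, T', h3, h4⟩ := h'
  refine ⟨_, _, h1.blocks h3, ?_⟩
  rw [map_blocks, map_blocks, blocks_mul, blocks_mul]
  exact h2.blocks h4

/-- A matrix is conjugate to its permutations. -/
lemma ConjLift.perm (x : Matrix ι ι Y.carrier) (σ : ι ≃ ι) :
    ConjLift s 0 φ x (x.submatrix σ σ) := by
  have h1 : Bd s 0 ((1 : Matrix ι ι X.carrier).submatrix σ (Equiv.refl ι)) := Bd.one.submatrix _ _
  have h2 : Bd s 0 ((1 : Matrix ι ι X.carrier).submatrix (Equiv.refl ι) σ) := Bd.one.submatrix _ _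
  refine ⟨_, _, ⟨h1, h2, ?_, ?_⟩, Cl.of_eq ?_⟩
  · rw [Matrix.submatrix_mul_equiv, one_mul, Matrix.submatrix_one_equiv]
  · have : (1 : Matrix ι ι X.carrier).submatrix (Equiv.refl ι) σ *
        (1 : Matrix ι ι X.carrier).submatrix σ (Equiv.refl ι) = 1 := by
      rw [Matrix.submatrix_mul_equiv, one_mul]
      ext i j; rfl
    exact this
  · have e1 : φ.mat ((1 : Matrix ι ι X.carrier).submatrix σ (Equiv.refl ι)) =
        (1 : Matrix ι ι Y.carrier).submatrix σ (Equiv.refl ι) := by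
      rw [← φ.mat_one]; rfl
    have e2 : φ.mat ((1 : Matrix ι ι X.carrier).submatrix (Equiv.refl ι) σ) =
        (1 : Matrix ι ι Y.carrier).submatrix (Equiv.refl ι) σ := by
      rw [← φ.mat_one]; rfl
    have e3 : x = x.submatrix (Equiv.refl ι) (Equiv.refl ι) := by ext i j; rfl
    rw [e1, e2]
    conv_lhs => rw [e3]
    rw [Matrix.submatrix_mul_equiv, Matrix.submatrix_mul_equiv, one_mul, mul_one]

/-- A lift f of e need not be a quasi-idempotent, but the braid of -f and f is exactly invertible
and maps to the braid of -e and e, which straightens diag(e, 1 - e). -/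
lemma QI.conjLift_braid (hφ : Lifting s φ) {e : Matrix ι ι Y.carrier} (h : QI s n e) :
    ConjLift s (20 * n + 40) φ (Matrix.fromBlocks e 0 0 (1 - e)) (Matrix.fromBlocks 0 0 0 1) := by
  obtain ⟨f, rfl, hf⟩ := hφ ι n e h.1
  refine ⟨_, _, (eh_braid hf.neg hf).ep.mono (by omega), ?_⟩
  rw [map_braid, φ.mat_mul, φ.mat_mul, map_upper, map_lower, map_neg, map_neg, map_neg]
  exact h.cl_braid

/-- Homotopic quasi-idempotents become conjugate after adding a scalar projection. -/
lemma IH.conjLift (hφ : Lifting s φ) {e f : Matrix ι ι Y.carrier} (h : IH s n e f) :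
    ∃ (κ : Type) (_ : Fintype κ) (_ : DecidableEq κ) (b : κ → Bool),
      ConjLift s (1000 * n + 2000) φ (Matrix.fromBlocks e 0 0 (pr Y b))
        (Matrix.fromBlocks f 0 0 (pr Y b)) := by
  obtain ⟨k, g, h0, hk, hg, hc⟩ := h.exists_chain
  obtain ⟨σ, hσ⟩ := exists_shift k g
  rw [h0, hk] at hσ
  set A := Matrix.blockDiagonal fun j : Fin k => g j
  set B := Matrix.blockDiagonal fun j : Fin k => g (j + 1)
  have hA : QI s n A := QI.blockDiagonal fun j => hg _
  have hB : QI s n B := QI.blockDiagonal fun j => hg _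
  have hAB := (Cl.refl (s := s) (1 : Matrix (ι × Fin k) (ι × Fin k) Y.carrier)).sub
    (Cl.blockDiagonal (k := k) (f := fun j => g j) (g := fun j => g (j + 1)) fun j => hc j).symm
  obtain ⟨ρ, hρ⟩ := exists_shuffle hσ (1 - B)
  -- The middle term is diag(e, B, 1-B). Straightening B makes it diag(e, 0, 1). The same matrix is
  -- a permutation of diag(A, 1-B, f), which is close to diag(A, 1-A, f); straightening A makes that
  -- diag(0, 1, f), and a last permutation gives diag(f, 0, 1).
  have c1 := (ConjLift.of_close (φ := φ) (Cl.refl (s := s) e)).blocks (hB.conjLift_braid hφ)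
  have c2 := (((ConjLift.of_close (φ := φ) ((Cl.refl (s := s) A).blocks hAB)).trans
    (hA.conjLift_braid hφ)).blocks (ConjLift.of_close (φ := φ) (Cl.refl (s := s) f))).submatrix ρ
  rw [hρ] at c2
  let τ : (ι × Fin k ⊕ ι × Fin k) ⊕ ι ≃ ι ⊕ (ι × Fin k ⊕ ι × Fin k) := Equiv.sumComm _ _
  have c3 := ConjLift.perm (s := s) (φ := φ)
    (Matrix.fromBlocks f 0 0 (Matrix.fromBlocks 0 0 0 1)) (ρ.trans τ)
  have e3 : (Matrix.fromBlocks f 0 0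
      (Matrix.fromBlocks 0 0 0 (1 : Matrix (ι × Fin k) (ι × Fin k) Y.carrier))).submatrix
        (ρ.trans τ) (ρ.trans τ) =
      (Matrix.fromBlocks (Matrix.fromBlocks 0 0 0 1) 0 0 f).submatrix ρ ρ := by
    have : (Matrix.fromBlocks f 0 0
      (Matrix.fromBlocks 0 0 0 (1 : Matrix (ι × Fin k) (ι × Fin k) Y.carrier))).submatrix τ τ =
        Matrix.fromBlocks (Matrix.fromBlocks 0 0 0 1) 0 0 f := by
      ext (i | i) (j | j) <;> rfl
    rw [← this]; rfl
  rw [e3] at c3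
  refine ⟨ι × Fin k ⊕ ι × Fin k, inferInstance, inferInstance,
    Sum.elim (fun _ => false) (fun _ => true), ?_⟩
  rw [← pr_blocks, pr_false, pr_true]
  exact ((c1.symm.trans c2).trans c3.symm).mono (by simp; omega)

end Shift

end FilteredMatrixAlgebra
end QuantK

namespace QuantK

/-! ### Scales and parameters -/

/-- `Q` dominates the `n`-th level of the scale. -/
def Scale.Above (s : Scale) (n : ℕ) (Q : Param) : Prop :=
  s.M ^ n * s.ε ≤ Q.ε ∧ s.M ^ n * s.r ≤ Q.r ∧ s.M ^ n ≤ Q.N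

/-- `Q` is dominated by the `n`-th level of the scale. -/
def Scale.Below (s : Scale) (n : ℕ) (Q : Param) : Prop :=
  Q.ε ≤ s.M ^ n * s.ε ∧ Q.r ≤ s.M ^ n * s.r ∧ Q.N ≤ s.M ^ n

lemma Scale.Above.mono {s : Scale} {n m : ℕ} {Q : Param} (h : s.Above n Q) (hm : m ≤ n) :
    s.Above m Q :=
  ⟨(mul_le_mul_of_nonneg_right (s.pow_mono hm) s.ε_pos.le).trans h.1,
    (mul_le_mul_of_nonneg_right (s.pow_mono hm) s.r_pos.le).trans h.2.1,
    (s.pow_mono hm).trans h.2.2⟩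

lemma Scale.Above.trans {s : Scale} {n : ℕ} {Q Q' : Param} (h : s.Above n Q) (h' : Q ≤ Q') :
    s.Above n Q' :=
  ⟨h.1.trans h'.1, h.2.1.trans h'.2.1, h.2.2.trans h'.2.2⟩

lemma Scale.Below.le {s : Scale} {n : ℕ} {Q Q' : Param} (h : s.Below n Q) (h' : s.Above n Q') :
    Q ≤ Q' :=
  ⟨h.1.trans h'.1, h.2.1.trans h'.2.1, h.2.2.trans h'.2.2⟩

lemma Scale.Below.mono {s : Scale} {n m : ℕ} {Q : Param} (h : s.Below n Q) (hm : n ≤ m) :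
    s.Below m Q :=
  ⟨h.1.trans (mul_le_mul_of_nonneg_right (s.pow_mono hm) s.ε_pos.le),
    h.2.1.trans (mul_le_mul_of_nonneg_right (s.pow_mono hm) s.r_pos.le),
    h.2.2.trans (s.pow_mono hm)⟩

namespace FilteredMatrixAlgebra

/-! ### Classes of quasi-idempotents and quasi-invertibles -/

section Class

variable {p : ℝ≥0∞} [Fact (1 ≤ p)] {X : FilteredMatrixAlgebra.{u} p}
  {Y : FilteredMatrixAlgebra.{v} p} {ι κ : Type} [Fintype ι] [DecidableEq ι] [Fintype κ]
  [DecidableEq κ] {s : Scale} {a b c d n m : ℕ} {P Q : Param}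

lemma IsIdem.qi_of_below {e : Matrix ι ι X.carrier} (h : X.IsIdem Q.ε Q.r Q.N e)
    (hQ : s.Below n Q) : QI s n e := h.qi Q.r_pos hQ.1 hQ.2.1 hQ.2.2

lemma QI.isIdem_of_above {e : Matrix ι ι X.carrier} (h : QI s n e) (hQ : s.Above (n + 1) Q) :
    X.IsIdem Q.ε Q.r Q.N e := h.isIdem hQ.1 hQ.2.1 hQ.2.2

lemma IsInv.exists_qp {e : Matrix ι ι X.carrier} (h : X.IsInv Q.ε Q.r Q.N e)
    (hQ : s.Below n Q) : ∃ e', QP s n e e' := by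
  obtain ⟨e', h⟩ := h
  exact ⟨e', h.qp Q.r_pos hQ.1 hQ.2.1 hQ.2.2⟩

lemma QP.isInv_of_above {e e' : Matrix ι ι X.carrier} (h : QP s n e e')
    (hQ : s.Above (n + 1) Q) : X.IsInv Q.ε Q.r Q.N e := ⟨e', h.isInvPair hQ.1 hQ.2.1 hQ.2.2⟩

lemma Scale.Above.two_mul_le (h : s.Above (n + 1) Q) :
    s.M ^ (n + 1) * s.ε ≤ 4 * Q.ε ∧ s.M ^ (n + 1) * s.r ≤ Q.r ∧ s.M ^ (n + 1) * s.r ≤ 2 * Q.r ∧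
      s.M ^ (n + 1) ≤ 4 * Q.N :=
  ⟨by linarith [h.1, Q.ε_pos], h.2.1, by linarith [h.2.1, Q.r_pos],
    by linarith [h.2.2, Q.one_le_N]⟩

/-- Two levels pay for the constants 4ε, 2r and 4N in the homotopy relation, since 4 ≤ M². -/
lemma Scale.Below.four_mul_le (h : s.Below n Q) :
    4 * Q.ε ≤ s.M ^ (n + 2) * s.ε ∧ Q.r ≤ s.M ^ (n + 2) * s.r ∧ 2 * Q.r ≤ s.M ^ (n + 2) * s.r ∧
      4 * Q.N ≤ s.M ^ (n + 2) := by
  have h1 : 4 * s.M ^ n ≤ s.M ^ (n + 2) := by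
    linarith [s.two_mul_pow_le n, s.two_mul_pow_le (n + 1)]
  have h2 := mul_le_mul_of_nonneg_right h1 s.ε_pos.le
  have h3 := mul_le_mul_of_nonneg_right h1 s.r_pos.le
  have := Q.r_pos
  exact ⟨by linarith [h.1], by linarith [h.2.1], by linarith [h.2.1], by linarith [h.2.2]⟩

open Classical in
/-- The class of a quasi-idempotent, with junk value `0` on other matrices. -/
def icls (Q : Param) (e : Matrix ι ι X.carrier) : X.K0u Q :=
  if h : X.IsIdem Q.ε Q.r Q.N e then
    Algebra.GrothendieckAddGroup.of (StableSystem.tcls (S := X.idemSystem Q) e h) else 0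

open Classical in
/-- The class of a quasi-invertible, with junk value `0` on other matrices. -/
def gcls (Q : Param) (u : Matrix ι ι X.carrier) : X.K1u Q :=
  if h : X.IsInv Q.ε Q.r Q.N u then StableSystem.tcls (S := X.glSystem Q) u h else 0

lemma icls_eq {e : Matrix ι ι X.carrier} (h : X.IsIdem Q.ε Q.r Q.N e) : icls Q e =
    Algebra.GrothendieckAddGroup.of (StableSystem.tcls (S := X.idemSystem Q) e h) := dif_pos h

lemma gcls_eq {u : Matrix ι ι X.carrier} (h : X.IsInv Q.ε Q.r Q.N u) : gcls Q u =
    StableSystem.tcls (S := X.glSystem Q) u h := dif_pos h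

lemma icls_fin {e : Matrix (Fin n) (Fin n) X.carrier} (h : X.IsIdem Q.ε Q.r Q.N e) :
    icls Q e = X.idemClass Q e h := by
  rw [icls_eq h, StableSystem.tcls_fin (S := X.idemSystem Q) h]; rfl

lemma gcls_fin {u : Matrix (Fin n) (Fin n) X.carrier} (h : X.IsInv Q.ε Q.r Q.N u) :
    gcls Q u = X.invClass Q u h := by
  rw [gcls_eq h, StableSystem.tcls_fin (S := X.glSystem Q) h]; rfl

lemma icls_submatrix {e : Matrix ι ι X.carrier} (h : X.IsIdem Q.ε Q.r Q.N e) (σ : κ ≃ ι) :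
    icls Q (e.submatrix σ σ) = icls Q e := by
  rw [icls_eq h, icls_eq (h.reindex σ)]
  exact congrArg _ (StableSystem.tcls_reindex (S := X.idemSystem Q) σ h (h.reindex σ) rfl)

lemma icls_blocks {e : Matrix ι ι X.carrier} (h : X.IsIdem Q.ε Q.r Q.N e)
    {f : Matrix κ κ X.carrier} (h' : X.IsIdem Q.ε Q.r Q.N f) :
    icls Q (Matrix.fromBlocks e 0 0 f) = icls Q e + icls Q f := by
  rw [icls_eq h, icls_eq h', icls_eq (h.blocks h'), ← map_add]
  exact congrArg _ (StableSystem.tcls_blocks (S := X.idemSystem Q) h h')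

lemma gcls_blocks {e : Matrix ι ι X.carrier} (h : X.IsInv Q.ε Q.r Q.N e)
    {f : Matrix κ κ X.carrier} (h' : X.IsInv Q.ε Q.r Q.N f) :
    gcls Q (Matrix.fromBlocks e 0 0 f) = gcls Q e + gcls Q f := by
  rw [gcls_eq h, gcls_eq h', gcls_eq ((X.glSystem Q).good_blocks h h')]
  exact StableSystem.tcls_blocks (S := X.glSystem Q) h h'

lemma isIdem_zero : X.IsIdem Q.ε Q.r Q.N (0 : Matrix ι ι X.carrier) :=
  zero_isIdem Q.ε_pos Q.one_le_N

lemma isInv_one : X.IsInv Q.ε Q.r Q.N (1 : Matrix ι ι X.carrier) :=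
  ⟨1, one_isInvPair Q.ε_pos Q.r_pos Q.one_le_N⟩

lemma icls_zero : icls Q (0 : Matrix ι ι X.carrier) = 0 := by
  rw [icls_eq isIdem_zero, ← map_zero (Algebra.GrothendieckAddGroup.of)]
  have := StableSystem.tcls_pad (S := X.idemSystem Q) (ι := ι)
  rw [← this]
  exact congrArg _ (StableSystem.tcls_congr _ _ Matrix.diagonal_zero.symm)

lemma gcls_one : gcls Q (1 : Matrix ι ι X.carrier) = 0 := by
  rw [gcls_eq isInv_one]
  have := StableSystem.tcls_pad (S := X.glSystem Q) (ι := ι)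
  rw [← this]
  exact StableSystem.tcls_congr _ _ Matrix.diagonal_one.symm

lemma icls_pad {e : Matrix ι ι X.carrier} (h : X.IsIdem Q.ε Q.r Q.N e) :
    icls Q (Matrix.fromBlocks e 0 0 (0 : Matrix κ κ X.carrier)) = icls Q e := by
  rw [icls_blocks h isIdem_zero, icls_zero, add_zero]

lemma gcls_pad {e : Matrix ι ι X.carrier} (h : X.IsInv Q.ε Q.r Q.N e) :
    gcls Q (Matrix.fromBlocks e 0 0 (1 : Matrix κ κ X.carrier)) = gcls Q e := by
  rw [gcls_blocks h isInv_one, gcls_one, add_zero]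

lemma IH.left {e f : Matrix ι ι X.carrier} (h : IH s n e f) : QI s n e := by
  obtain ⟨γ, h⟩ := h
  simpa using h 0

lemma GH.left {u w : Matrix ι ι X.carrier} (h : GH s n u w) : ∃ u', QP s n u u' := by
  obtain ⟨v, v', γ, δ, h⟩ := h
  exact ⟨v, by simpa using h 0⟩

lemma IH.icls_eq {e f : Matrix ι ι X.carrier} (h : IH s n e f) (hQ : s.Above (n + 1) Q) :
    icls Q e = icls Q f := by
  have h1 := h.left.isIdem_of_above hQ
  have h2 := h.symm.left.isIdem_of_above hQ
  have hQ' := Scale.Above.two_mul_le hQ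
  rw [FilteredMatrixAlgebra.icls_eq h1, FilteredMatrixAlgebra.icls_eq h2]
  exact congrArg _ (StableSystem.tcls_hom (S := X.idemSystem Q) h1 h2
    (h.idemHomotopic hQ'.1 hQ'.2.1 hQ'.2.2.2))

lemma GH.gcls_eq {e f : Matrix ι ι X.carrier} (h : GH s n e f) (hQ : s.Above (n + 1) Q) :
    gcls Q e = gcls Q f := by
  have h1 := (h.left.choose_spec).isInv_of_above hQ
  have h2 := (h.symm.left.choose_spec).isInv_of_above hQ
  have hQ' := Scale.Above.two_mul_le hQ
  rw [FilteredMatrixAlgebra.gcls_eq h1, FilteredMatrixAlgebra.gcls_eq h2]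
  exact StableSystem.tcls_hom (S := X.glSystem Q) h1 h2
    (h.invHomotopic hQ'.1 hQ'.2.2.1 hQ'.2.2.2)

lemma mapK0u_icls (φ : Hom X Y) (h : P ≤ Q) {e : Matrix ι ι X.carrier}
    (he : X.IsIdem P.ε P.r P.N e) : φ.mapK0u h (icls P e) = icls Q (φ.mat e) := by
  have he' := (φ.isIdem P.r_pos he).mono P.r_pos h.1 h.2.1 h.2.2
  rw [icls_eq he, icls_eq he', Hom.mapK0u_of]
  rfl

lemma mapGL_gcls (φ : Hom X Y) (h : P ≤ Q) {e : Matrix ι ι X.carrier}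
    (he : X.IsInv P.ε P.r P.N e) : φ.mapGL h (gcls P e) = gcls Q (φ.mat e) := by
  have he' : Y.IsInv Q.ε Q.r Q.N (φ.mat e) := by
    obtain ⟨v, hv⟩ := he
    exact ⟨_, (φ.isInvPair P.r_pos hv).mono P.r_pos h.1 h.2.1 h.2.2⟩
  rw [gcls_eq he, gcls_eq he']
  rfl

lemma exists_icls (y : X.K0u Q) : ∃ (n m : ℕ) (e : Matrix (Fin n) (Fin n) X.carrier)
    (f : Matrix (Fin m) (Fin m) X.carrier), X.IsIdem Q.ε Q.r Q.N e ∧ X.IsIdem Q.ε Q.r Q.N f ∧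
      y = icls Q e - icls Q f := by
  obtain ⟨a, b, rfl⟩ := grothendieck_exists_sub y
  obtain ⟨n, e, he, rfl⟩ := StableSystem.cls_surj a
  obtain ⟨m, f, hf, rfl⟩ := StableSystem.cls_surj b
  exact ⟨n, m, e, f, he, hf, by rw [icls_fin he, icls_fin hf]; rfl⟩

lemma exists_gcls (y : X.K1u Q) : ∃ (n : ℕ) (e : Matrix (Fin n) (Fin n) X.carrier),
    X.IsInv Q.ε Q.r Q.N e ∧ y = gcls Q e := by
  obtain ⟨n, e, he, rfl⟩ := StableSystem.cls_surj y
  exact ⟨n, e, he, by rw [gcls_fin he]; rfl⟩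

lemma exists_gh_of_gcls_eq {e : Matrix ι ι X.carrier} {f : Matrix κ κ X.carrier}
    (he : X.IsInv Q.ε Q.r Q.N e) (hf : X.IsInv Q.ε Q.r Q.N f) (h : gcls Q e = gcls Q f)
    (hQ : s.Below n Q) : ∃ (m m' : ℕ) (σ : ι ⊕ Fin m ≃ κ ⊕ Fin m'),
      GH s (n + 2) (Matrix.fromBlocks e 0 0 1)
        ((Matrix.fromBlocks f 0 0 1).submatrix σ σ) := by
  rw [gcls_eq he, gcls_eq hf] at h
  obtain ⟨m, m', σ, hσ⟩ := StableSystem.exists_hom_of_tcls_eq (S := X.glSystem Q) he hf h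
  have e1 : ∀ k, (Matrix.diagonal fun _ : Fin k => (X.glSystem Q).c) = 1 :=
    fun k => Matrix.diagonal_one
  rw [e1, e1] at hσ
  have hQ' := Scale.Below.four_mul_le hQ
  exact ⟨m, m', σ, InvHomotopic.gh hσ (by linarith [Q.r_pos]) hQ'.1 hQ'.2.2.1 hQ'.2.2.2⟩

/-- Passing to the Grothendieck group costs a common summand g, passing to stable classes costs
zeros. The summand is itself a quasi-idempotent at level n, so it can be completed by 1 - g. -/
lemma exists_ih_of_icls_eq {e f : Matrix ι ι X.carrier}
    (he : X.IsIdem Q.ε Q.r Q.N e) (hf : X.IsIdem Q.ε Q.r Q.N f) (h : icls Q e = icls Q f)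
    (hQ : s.Below n Q) : ∃ (k m : ℕ) (g : Matrix (Fin k) (Fin k) X.carrier), QI s n g ∧
      IH s (n + 2)
        (Matrix.fromBlocks (Matrix.fromBlocks e 0 0 g) 0 0 (0 : Matrix (Fin m) (Fin m) X.carrier))
        (Matrix.fromBlocks (Matrix.fromBlocks f 0 0 g) 0 0 0) := by
  rw [icls_eq he, icls_eq hf] at h
  obtain ⟨c, hc⟩ := grothendieck_exists_add h
  obtain ⟨k, g, hg, rfl⟩ := StableSystem.cls_surj c
  rw [← StableSystem.tcls_fin] at hc
  replace hc := (StableSystem.tcls_blocks (S := X.idemSystem Q) he hg).trans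
    (hc.trans (StableSystem.tcls_blocks (S := X.idemSystem Q) hf hg).symm)
  obtain ⟨m, hm⟩ := StableSystem.exists_hom_of_tcls_eq' _ _ hc
  have e1 : ∀ k, (Matrix.diagonal fun _ : Fin k => (X.idemSystem Q).c) = 0 :=
    fun k => Matrix.diagonal_zero
  rw [e1] at hm
  have hQ' := Scale.Below.four_mul_le hQ
  exact ⟨k, m, g, IsIdem.qi_of_below hg hQ,
    IdemHomotopic.ih hm Q.r_pos hQ'.1 hQ'.2.1 hQ'.2.2.2⟩

/-- Idempotents with the same class in `K_0` become conjugate after adding a scalar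
projection. -/
lemma exists_conjLift_of_icls_eq {φ : Hom X Y} (hφ : Lifting s φ) {e f : Matrix ι ι Y.carrier}
    (he : Y.IsIdem Q.ε Q.r Q.N e) (hf : Y.IsIdem Q.ε Q.r Q.N f) (h : icls Q e = icls Q f)
    (hQ : s.Below n Q) : ∃ (κ : Type) (_ : Fintype κ) (_ : DecidableEq κ) (b : κ → Bool),
      ConjLift s (100000 * n + 100000) φ (Matrix.fromBlocks e 0 0 (pr Y b))
        (Matrix.fromBlocks f 0 0 (pr Y b)) := by
  obtain ⟨k, m, g, hg, hh⟩ := exists_ih_of_icls_eq he hf h hQ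
  -- The summand 1 - g is added on both sides: together with g it can be rotated to the scalar
  -- projection diag(0, 1), so that only scalar projections remain as summands.
  obtain ⟨κ, i1, i2, b, hb⟩ := (hh.blocks (IH.refl hg.one_sub)).conjLift hφ
  let τ : ι ⊕ ((Fin k ⊕ Fin k) ⊕ (Fin m ⊕ κ)) ≃ (((ι ⊕ Fin k) ⊕ Fin m) ⊕ Fin k) ⊕ κ :=
    { toFun := Sum.elim (fun i => .inl (.inl (.inl (.inl i))))
        (Sum.elim (Sum.elim (fun i => .inl (.inl (.inl (.inr i)))) (fun i => .inl (.inr i)))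
          (Sum.elim (fun i => .inl (.inl (.inr i))) (fun i => .inr i)))
      invFun := Sum.elim (Sum.elim (Sum.elim (Sum.elim (fun i => .inl i)
        (fun i => .inr (.inl (.inl i)))) (fun i => .inr (.inr (.inl i))))
          (fun i => .inr (.inl (.inr i)))) (fun i => .inr (.inr (.inr i)))
      left_inv := by rintro (i | (i | i) | (i | i)) <;> rfl
      right_inv := by rintro ((((i | i) | i) | i) | i) <;> rfl }
  have hτ : ∀ x : Matrix ι ι Y.carrier,
      (Matrix.fromBlocks (Matrix.fromBlocks (Matrix.fromBlocks (Matrix.fromBlocks x 0 0 g) 0 0 0)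
        0 0 (1 - g)) 0 0 (pr Y b)).submatrix τ τ =
      Matrix.fromBlocks x 0 0 (Matrix.fromBlocks (Matrix.fromBlocks g 0 0 (1 - g)) 0 0
        (Matrix.fromBlocks (0 : Matrix (Fin m) (Fin m) Y.carrier) 0 0 (pr Y b))) := by
    intro x
    ext (i | (i | i) | (i | i)) (j | (j | j) | (j | j)) <;> rfl
  have hb' := hb.submatrix τ
  rw [hτ, hτ] at hb'
  have key : ∀ x : Matrix ι ι Y.carrier, ConjLift s (20 * n + 40) φ
      (Matrix.fromBlocks x 0 0 (Matrix.fromBlocks (Matrix.fromBlocks g 0 0 (1 - g)) 0 0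
        (Matrix.fromBlocks (0 : Matrix (Fin m) (Fin m) Y.carrier) 0 0 (pr Y b))))
      (Matrix.fromBlocks x 0 0 (Matrix.fromBlocks (Matrix.fromBlocks 0 0 0 1) 0 0
        (Matrix.fromBlocks (0 : Matrix (Fin m) (Fin m) Y.carrier) 0 0 (pr Y b)))) := fun x =>
    ((ConjLift.of_close (Cl.refl x)).blocks ((hg.conjLift_braid hφ).blocks
      (ConjLift.of_close (Cl.refl _)))).mono (by simp)
  refine ⟨(Fin k ⊕ Fin k) ⊕ (Fin m ⊕ κ), inferInstance, inferInstance,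
    Sum.elim (Sum.elim (fun _ => false) (fun _ => true)) (Sum.elim (fun _ => false) b), ?_⟩
  rw [← pr_blocks, ← pr_blocks, ← pr_blocks, pr_false, pr_true, pr_false]
  exact (((key e).symm.trans hb').trans (key f)).mono (by simp; omega)

end Class

end FilteredMatrixAlgebra
end QuantK

namespace QuantK
namespace FilteredMatrixAlgebra

/-! ### Corner projections and the Whitehead path -/

section Corner

variable {p : ℝ≥0∞} [Fact (1 ≤ p)] {X : FilteredMatrixAlgebra.{u} p}
  {Y : FilteredMatrixAlgebra.{v} p} {ι κ : Type} [Fintype ι] [DecidableEq ι] [Fintype κ]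
  [DecidableEq κ] {s : Scale} {a b c d n m : ℕ} {x y z w x' y' : Matrix ι ι X.carrier}

variable (X ι κ) in
/-- `diag(1, 0)`. -/
def corn : Matrix (ι ⊕ κ) (ι ⊕ κ) X.carrier := Matrix.fromBlocks 1 0 0 0

lemma corn_eq_pr : corn X ι κ = pr X (Sum.elim (fun _ => true) (fun _ => false)) := by
  rw [← pr_blocks, pr_true, pr_false]; rfl

lemma bd_corn : Bd s 0 (corn X ι κ) := by rw [corn_eq_pr]; exact bd_pr _

lemma qi_corn : QI s 0 (corn X ι κ) := by rw [corn_eq_pr]; exact qi_pr _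

lemma map_corn (φ : Hom X Y) : φ.mat (corn X ι κ) = corn Y ι κ := by
  rw [corn_eq_pr, map_pr, corn_eq_pr]

lemma blocks_mul_corn (x : Matrix ι ι X.carrier) (y : Matrix κ κ X.carrier) :
    Matrix.fromBlocks x 0 0 y * corn X ι κ = Matrix.fromBlocks x 0 0 0 := by
  rw [corn, blocks_mul, mul_one, mul_zero]

lemma corn_mul_blocks (x : Matrix ι ι X.carrier) (y : Matrix κ κ X.carrier) :
    corn X ι κ * Matrix.fromBlocks x 0 0 y = Matrix.fromBlocks x 0 0 0 := by
  rw [corn, blocks_mul, one_mul, zero_mul]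

lemma map_rot (φ : Hom X Y) (t : ℝ) : φ.mat (rot X ι t) = rot Y ι t := by
  have h : ∀ (z : ℂ) (x : Matrix (ι ⊕ ι) (ι ⊕ ι) X.carrier), φ.mat (z • x) = z • φ.mat x :=
    fun z x => Matrix.map_smul _ _ (map_smul φ.toAlgHom z) x
  rw [rot, rot, map_add, h, h, map_quarter, φ.mat_one]

lemma map_rotInv (φ : Hom X Y) (t : ℝ) : φ.mat (rotInv X ι t) = rotInv Y ι t := by
  have h : ∀ (z : ℂ) (x : Matrix (ι ⊕ ι) (ι ⊕ ι) X.carrier), φ.mat (z • x) = z • φ.mat x :=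
    fun z x => Matrix.map_smul _ _ (map_smul φ.toAlgHom z) x
  rw [rotInv, rotInv, map_sub, h, h, map_quarter, φ.mat_one]

lemma map_whitehead (φ : Hom X Y) (g g' : Matrix ι ι X.carrier) (t : ℝ) :
    φ.mat (whitehead g g' t) = whitehead (φ.mat g) (φ.mat g') t := by
  simp only [whitehead, φ.mat_mul, map_blocks, map_rot, map_rotInv, φ.mat_one]

lemma map_whiteheadInv (φ : Hom X Y) (g g' : Matrix ι ι X.carrier) (t : ℝ) :
    φ.mat (whiteheadInv g g' t) = whiteheadInv (φ.mat g) (φ.mat g') t := by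
  simp only [whiteheadInv, φ.mat_mul, map_blocks, map_rot, map_rotInv, φ.mat_one]

lemma rot_conj_diag (x : Matrix ι ι X.carrier) (t : ℝ) :
    rot X ι t * Matrix.fromBlocks x 0 0 x * rotInv X ι t = Matrix.fromBlocks x 0 0 x := by
  rw [conj_eq]
  simp only [sub_self, smul_zero]
  rw [← add_smul, ← add_smul, ← Complex.ofReal_add, ← Complex.ofReal_add, ← sq, ← sq,
    Real.cos_sq_add_sin_sq, Real.sin_sq_add_cos_sq]
  simp

lemma rot_mul_diag (x : Matrix ι ι X.carrier) (t : ℝ) :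
    rot X ι t * Matrix.fromBlocks x 0 0 x = Matrix.fromBlocks x 0 0 x * rot X ι t := by
  conv_rhs => rw [← rot_conj_diag x t]
  rw [mul_assoc, rotInv_mul_rot, mul_one]

lemma rotInv_mul_diag (x : Matrix ι ι X.carrier) (t : ℝ) :
    rotInv X ι t * Matrix.fromBlocks x 0 0 x = Matrix.fromBlocks x 0 0 x * rotInv X ι t := by
  conv_lhs => rw [← rot_conj_diag x t]
  rw [← mul_assoc, ← mul_assoc, rotInv_mul_rot, one_mul]

/-- Rotations commute exactly with diag(e, e), and both diagonal factors of the Whitehead path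
almost fix diag(e, e). So the path almost fixes diag(e, e), and cutting with the corner gives
diag(e, 0). -/
lemma Cl.whitehead_mul {g g' e : Matrix ι ι X.carrier} (hg : Bd s n g)
    (h1 : Cl s n (g * e) e) (h2 : Cl s n (g' * e) e) (t : ℝ) :
    Cl s (3 * n + 20) (whitehead g g' t * Matrix.fromBlocks e 0 0 0) (Matrix.fromBlocks e 0 0 0) := by
  have k1 := (Cl.refl (s := s) e).blocks h2
  have k2 := Cl.mul_left (ep_rot (X := X) (ι := ι) (s := s) t).1
    (Cl.mul_right (ep_rot (X := X) (ι := ι) (s := s) t).2.1 k1)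
  have k3 := Cl.mul_left (hg.blocks (Bd.one (X := X) (ι := ι))) k2
  have k4 := k3.trans (b := n) (z := Matrix.fromBlocks e 0 0 e) (by
    rw [← mul_assoc (rot X ι t), rot_conj_diag, blocks_mul, one_mul]
    exact (h1.blocks (Cl.refl e)).mono (by simp))
  have k5 := Cl.mul_right (bd_corn (X := X) (ι := ι) (κ := ι)) k4
  -- The corner does not commute with rotations. Therefore diag(e, 0) is written as diag(e, e) times
  -- the corner; only diag(e, e) is moved past the rotation, and the corner stays on the far right.
  have e1 : whitehead g g' t * Matrix.fromBlocks e 0 0 0 =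
      Matrix.fromBlocks g 0 0 1 * (rot X ι t * (Matrix.fromBlocks e 0 0 (g' * e) *
        rotInv X ι t)) * corn X ι ι := by
    have : Matrix.fromBlocks e 0 0 (g' * e) = Matrix.fromBlocks 1 0 0 g' *
        Matrix.fromBlocks e 0 0 e := by rw [blocks_mul, one_mul]
    rw [this, ← blocks_mul_corn e e, whitehead]
    simp only [mul_assoc]
    rw [← mul_assoc (rotInv X ι t), rotInv_mul_diag]
    simp only [mul_assoc]
  rw [blocks_mul_corn, ← e1] at k5
  exact k5.mono (by simp; omega)

lemma Cl.mul_whiteheadInv {g g' e : Matrix ι ι X.carrier} (hg : Bd s n g')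
    (h1 : Cl s n (e * g) e) (h2 : Cl s n (e * g') e) (t : ℝ) :
    Cl s (3 * n + 20) (Matrix.fromBlocks e 0 0 0 * whiteheadInv g g' t)
      (Matrix.fromBlocks e 0 0 0) := by
  have k1 := (Cl.refl (s := s) e).blocks h1
  have k2 := Cl.mul_left (ep_rot (X := X) (ι := ι) (s := s) t).1
    (Cl.mul_right (ep_rot (X := X) (ι := ι) (s := s) t).2.1 k1)
  have k3 := Cl.mul_right (hg.blocks (Bd.one (X := X) (ι := ι))) k2
  have k4 := k3.trans (b := n) (z := Matrix.fromBlocks e 0 0 e) (by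
    rw [← mul_assoc (rot X ι t), rot_conj_diag, blocks_mul, mul_one]
    exact (h2.blocks (Cl.refl e)).mono (by simp))
  have k5 := Cl.mul_left (bd_corn (X := X) (ι := ι) (κ := ι)) k4
  have e1 : Matrix.fromBlocks e 0 0 0 * whiteheadInv g g' t =
      corn X ι ι * ((rot X ι t * (Matrix.fromBlocks e 0 0 (e * g) *
        rotInv X ι t)) * Matrix.fromBlocks g' 0 0 1) := by
    have : Matrix.fromBlocks e 0 0 (e * g) =
        Matrix.fromBlocks e 0 0 e * Matrix.fromBlocks 1 0 0 g := by rw [blocks_mul, mul_one]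
    rw [this, ← corn_mul_blocks e e, whiteheadInv]
    simp only [← mul_assoc]
    rw [mul_assoc (corn X ι ι) (rot X ι t), rot_mul_diag]
    simp only [mul_assoc]
  rw [corn_mul_blocks, ← e1] at k5
  exact k5.mono (by simp; omega)

end Corner

/-! ### Completely filtered extensions -/

section Ext

variable {p : ℝ≥0∞} [Fact (1 ≤ p)] [Fact (p ≠ ∞)]

/-- The properties of a completely filtered extension `J^♯ → A^♯ → (A/J)^♯`. -/
structure Extension (C : ℝ) (XJ XA XQ : FilteredMatrixAlgebra.{u} p) where
  j : Hom XJ XA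
  q : Hom XA XQ
  unitJ : Hom (scalars p) XJ
  unitA : Hom (scalars p) XA
  one_le : 1 ≤ C
  norm_le : ∀ {ι : Type} [Fintype ι] [DecidableEq ι] (x : Matrix ι ι XJ.carrier), ‖x‖ ≤ ‖j.mat x‖
  mem_of_mem : ∀ {r : ℝ} {a : XJ.carrier}, 0 < r → j.toAlgHom a ∈ XA.fil r → a ∈ XJ.fil r
  exists_mem : ∀ {r : ℝ} {b : XQ.carrier}, 0 < r → b ∈ XQ.fil r →
    ∃ a ∈ XA.fil r, q.toAlgHom a = b
  approx : ∀ {ι : Type} [Fintype ι] [DecidableEq ι] {r δ : ℝ} (_ : 0 < r) {x : Matrix ι ι XA.carrier}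
    (_ : ∀ i k, x i k ∈ XA.fil r) (_ : ‖q.mat x‖ < δ), ∃ z : Matrix ι ι XJ.carrier,
      (∀ i k, XJ.aug (z i k) = 0) ∧ (∀ i k, z i k ∈ XJ.fil r) ∧ ‖x - j.mat z‖ < 3 * C * δ
  q_j : ∀ a, q.toAlgHom (j.toAlgHom a) = algebraMap ℂ _ (XJ.aug a)

namespace Extension

variable {C : ℝ} {XJ XA XQ : FilteredMatrixAlgebra.{u} p} (E : Extension C XJ XA XQ)
  {s : Scale} {ι κ : Type} [Fintype ι] [DecidableEq ι] [Fintype κ] [DecidableEq κ] {n m : ℕ}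

-- The approximation property loses a factor 3C and is always applied with the bound doubled,
-- because it asks for a strict inequality. The assumption 40C ≤ M absorbs both in one level.
include E in
lemma six_mul_le (hs : 40 * C ≤ s.M) (n : ℕ) : 3 * C * (2 * s.M ^ n) ≤ s.M ^ (n + 1) := by
  rw [pow_succ]
  nlinarith [s.pow_pos n, E.one_le]

/-- Entrywise lifts have the right propagation but no norm bound. The image of the lift has norm at
most M^n, so the approximation property provides an element of J whose subtraction reduces the norm
to M^(n+1) without changing the image. -/
lemma lifting (hs : 40 * C ≤ s.M) : Lifting s E.q := by
  intro ι _ _ n y hy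
  have hr : 0 < s.M ^ n * s.r := mul_pos (s.pow_pos n) s.r_pos
  choose a ha hq using fun i k => E.exists_mem hr (hy.2 i k)
  have e : E.q.mat (Matrix.of a) = y := by ext i k; exact hq i k
  obtain ⟨z, hz, hz', hx⟩ := E.approx hr (x := Matrix.of a) ha (δ := 2 * s.M ^ n) (by
    rw [e]; linarith [hy.1, s.pow_pos n])
  refine ⟨Matrix.of a - E.j.mat z, ?_, hx.le.trans (E.six_mul_le hs n), ?_⟩
  · rw [map_sub, e]
    have : E.q.mat (E.j.mat z) = 0 := by
      ext i k
      show E.q.toAlgHom (E.j.toAlgHom (z i k)) = 0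
      rw [E.q_j, hz, map_zero]
    rw [this, sub_zero]
  · exact fil_mono_mem hr (mul_le_mul_of_nonneg_right (s.pow_mono n.le_succ) s.r_pos.le)
      fun i k => Submodule.sub_mem _ (ha i k) (E.j.fil_le hr (hz' i k))

/-- Norms and propagation over J^♯ are those of A^♯, so estimates for the images of matrices over
J^♯ descend without loss. -/
lemma bd_of_bd {x : Matrix ι ι XJ.carrier} (h : Bd s n (E.j.mat x)) : Bd s n x :=
  ⟨(E.norm_le x).trans h.1, fun i k => E.mem_of_mem (mul_pos (s.pow_pos n) s.r_pos) (h.2 i k)⟩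

lemma cl_of_cl {x y : Matrix ι ι XJ.carrier} (h : Cl s n (E.j.mat x) (E.j.mat y)) : Cl s n x y := by
  rw [Cl, ← map_sub] at h
  exact (E.norm_le _).trans h

lemma qi_of_qi {x : Matrix ι ι XJ.carrier} (h : QI s n (E.j.mat x)) : QI s n x :=
  ⟨E.bd_of_bd h.1, E.cl_of_cl (by rw [E.j.mat_mul]; exact h.2)⟩

lemma qp_of_qp {x y : Matrix ι ι XJ.carrier} (h : QP s n (E.j.mat x) (E.j.mat y)) : QP s n x y :=
  ⟨E.bd_of_bd h.1, E.bd_of_bd h.2.1, E.cl_of_cl (by rw [E.j.mat_mul, E.j.mat_one]; exact h.2.2.1),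
    E.cl_of_cl (by rw [E.j.mat_mul, E.j.mat_one]; exact h.2.2.2)⟩

/-- A matrix over `A^♯` whose image in `(A/J)^♯` is close to a scalar projection is close to a
matrix over `J^♯`. -/
lemma exists_approx (hs : 40 * C ≤ s.M) {e f : Matrix ι ι XA.carrier} (he : Bd s n e)
    (hf : Bd s n f) (h : Cl s n (E.q.mat e) (E.q.mat f)) : ∃ z : Matrix ι ι XJ.carrier,
      (∀ i k, XJ.aug (z i k) = 0) ∧ Bd s (10 * n + 10) z ∧ Cl s (n + 1) e (f + E.j.mat z) := by
  have hr : 0 < s.M ^ n * s.r := mul_pos (s.pow_pos n) s.r_pos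
  -- The factor 2 turns the weak inequality of `Cl` into the strict one needed here.
  obtain ⟨z, h1, h2, h3⟩ := E.approx hr (x := e - f)
    (fun i k => Submodule.sub_mem _ (he.2 i k) (hf.2 i k)) (δ := 2 * (s.M ^ n * s.ε)) (by
      rw [map_sub]
      have := mul_pos (s.pow_pos n) s.ε_pos
      refine lt_of_le_of_lt h ?_
      linarith)
  have h4 : Cl s (n + 1) (e - f) (E.j.mat z) := by
    refine h3.le.trans ?_
    have := mul_le_mul_of_nonneg_right (E.six_mul_le hs n) s.ε_pos.le
    nlinarith
  refine ⟨z, h1, E.bd_of_bd ((h4.bd (he.sub hf) (c := n)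
    fun i k => E.j.fil_le hr (h2 i k)).mono (by omega)), ?_⟩
  rw [Cl, sub_add_eq_sub_sub]
  exact h4

/-- A path of quasi-idempotents over `A^♯` whose image in `(A/J)^♯` stays close to a scalar
projection gives a homotopy over `J^♯`. -/
lemma ih_of_path (hs : 40 * C ≤ s.M) {e₀ e₁ : Matrix ι ι XA.carrier} (γ : Path e₀ e₁) {b : ι → Bool}
    (hγ : ∀ t, QI s n (γ t)) (hb : ∀ t, Cl s n (E.q.mat (γ t)) (pr XQ b))
    {y₀ y₁ : Matrix ι ι XJ.carrier} (hy₀ : Bd s n y₀) (hy₁ : Bd s n y₁)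
    (h₀ : Cl s n e₀ (E.j.mat y₀)) (h₁ : Cl s n e₁ (E.j.mat y₁)) :
    IH s (1000 * n + 1000) y₀ y₁ := by
  -- No continuous choice of approximations over J^♯ is attempted. They are chosen pointwise; those
  -- at consecutive subdivision points are close to each other and are joined by segments.
  obtain ⟨k, τ, hτ0, hτk, hτ⟩ := exists_partition γ (mul_pos (s.pow_pos 0) s.ε_pos)
  have hx : ∀ t, ∃ z : Matrix ι ι XJ.carrier, Bd s (10 * n + 12) z ∧
      Cl s (n + 1) (γ t) (E.j.mat z) := by
    intro t
    obtain ⟨z, -, hz, hz'⟩ := E.exists_approx hs (hγ t).1 ((bd_pr b).mono n.zero_le)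
      (by rw [map_pr]; exact hb t)
    refine ⟨pr XJ b + z, ((bd_pr b).add hz).mono (by omega), ?_⟩
    rw [map_add, map_pr]
    exact hz'
  choose z hz hz' using hx
  have hqi : ∀ t, QI s (100 * n + 50) (z t) := fun t =>
    E.qi_of_qi (((hγ t).close ((hz t).map E.j) (hz' t)).mono (by omega))
  have step : ∀ i, IH s (1000 * n + 1000) (z (τ i)) (z (τ (i + 1))) := by
    intro i
    have h1 : Cl s 0 (γ (τ i)) (γ (τ (i + 1))) := by
      rw [Cl, ← dist_eq_norm]; exact (hτ i).le
    have h2 := E.cl_of_cl (((hz' (τ i)).symm.trans h1).trans (hz' (τ (i + 1))))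
    exact (IH.of_close (hqi _) (hz _) h2).mono (by omega)
  have hmid := IH.of_chain step k
  have hs0 := E.cl_of_cl ((hz' (τ 0)).symm.trans (by rw [hτ0, γ.source]; exact h₀))
  have hs1 := E.cl_of_cl ((hz' (τ k)).symm.trans (by rw [hτk, γ.target]; exact h₁))
  exact (((IH.of_close (hqi _) hy₀ hs0).symm.trans hmid).trans
    (IH.of_close (hqi _) hy₁ hs1)).mono (by simp; omega)

end Extension

end Ext

end FilteredMatrixAlgebra
end QuantK

namespace QuantK
namespace FilteredMatrixAlgebra

/-! ### Comparing lifts of block diagonal matrices -/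

section Compare

variable {p : ℝ≥0∞} [Fact (1 ≤ p)] {X : FilteredMatrixAlgebra.{u} p}
  {ι κ : Type} [Fintype ι] [DecidableEq ι] [Fintype κ] [DecidableEq κ] {s : Scale} {n m : ℕ}

/-- The `(1, 1)`-corner of the inverse of an approximately block diagonal matrix. -/
lemma QP.cl_corner {w w' : Matrix (ι ⊕ κ) (ι ⊕ κ) X.carrier} (hw : QP s n w w')
    {u u' : Matrix ι ι X.carrier} {v : Matrix κ κ X.carrier} (hu : QP s n u u')
    (h : Cl s n w (Matrix.fromBlocks u 0 0 v)) :
    Cl s n (w * corn X ι κ) (Matrix.fromBlocks u 0 0 0) ∧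
    Cl s n (corn X ι κ * w) (Matrix.fromBlocks u 0 0 0) ∧
    Cl s (6 * n + 4) (w' * corn X ι κ) (Matrix.fromBlocks u' 0 0 0) ∧
    Cl s (6 * n + 4) (corn X ι κ * w') (Matrix.fromBlocks u' 0 0 0) := by
  have hd : Bd s n (Matrix.fromBlocks u' 0 0 (0 : Matrix κ κ X.carrier)) :=
    (hu.2.1.blocks Bd.zero).mono (by simp)
  have k1 := Cl.mul_right (bd_corn (X := X) (ι := ι) (κ := κ)) h
  have k2 := Cl.mul_left (bd_corn (X := X) (ι := ι) (κ := κ)) h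
  rw [blocks_mul_corn] at k1
  rw [corn_mul_blocks] at k2
  refine ⟨k1.mono (by omega), k2.mono (by omega), ?_, ?_⟩
  · have k3 := ((Cl.mul_left hw.2.1 h).symm.trans hw.2.2.2)
    have k4 := Cl.mul_right hd k3
    rw [mul_assoc, blocks_mul, mul_zero, one_mul] at k4
    have k5 := Cl.mul_left hw.2.1 (hu.2.2.1.blocks (Cl.refl (0 : Matrix κ κ X.carrier)))
    exact (k5.symm.trans k4).mono (by simp; omega)
  · have k3 := ((Cl.mul_right hw.2.1 h).symm.trans hw.2.2.1)
    have k4 := Cl.mul_left hd k3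
    rw [← mul_assoc, blocks_mul, zero_mul, mul_one] at k4
    have k5 := Cl.mul_right hw.2.1 (hu.2.2.2.blocks (Cl.refl (0 : Matrix κ κ X.carrier)))
    exact (k5.symm.trans k4).mono (by simp; omega)

/-- The transition matrix w₁⁻¹w₂ has upper left block close to u₁⁻¹u₂, and dividing by l ≈ u₁⁻¹u₂
makes it almost the identity on the corner, from both sides. The lower right block is irrelevant, so
v₁ and v₂ need not be related. -/
lemma QP.cl_transition {w₁ w₁' w₂ w₂' : Matrix (ι ⊕ κ) (ι ⊕ κ) X.carrier} (h₁ : QP s n w₁ w₁')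
    (h₂ : QP s n w₂ w₂') {u₁ u₁' u₂ u₂' l l' : Matrix ι ι X.carrier} {v₁ v₂ : Matrix κ κ X.carrier}
    (hu₁ : QP s n u₁ u₁') (hu₂ : QP s n u₂ u₂') (hw₁ : Cl s n w₁ (Matrix.fromBlocks u₁ 0 0 v₁))
    (hw₂ : Cl s n w₂ (Matrix.fromBlocks u₂ 0 0 v₂)) (hl : EP s n l l') (hl' : Cl s n l (u₁' * u₂)) :
    Cl s (20 * n + 20) (corn X ι κ * (w₁' * w₂ * Matrix.fromBlocks l' 0 0 1)) (corn X ι κ) ∧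
    Cl s (20 * n + 20) ((w₁' * w₂ * Matrix.fromBlocks l' 0 0 1) * corn X ι κ) (corn X ι κ) := by
  obtain ⟨-, -, a1, a2⟩ := h₁.cl_corner hu₁ hw₁
  obtain ⟨b1, b2, -, -⟩ := h₂.cl_corner hu₂ hw₂
  have hu1' : Bd s n (Matrix.fromBlocks u₁' 0 0 (0 : Matrix κ κ X.carrier)) :=
    (hu₁.2.1.blocks Bd.zero).mono (by simp)
  have hu2 : Bd s n (Matrix.fromBlocks u₂ 0 0 (0 : Matrix κ κ X.carrier)) :=
    (hu₂.1.blocks Bd.zero).mono (by simp)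
  have hL : Bd s n (Matrix.fromBlocks l' 0 0 (1 : Matrix κ κ X.carrier)) :=
    (hl.2.1.blocks Bd.one).mono (by simp)
  have e0 : Matrix.fromBlocks u₁' 0 0 (0 : Matrix κ κ X.carrier) * Matrix.fromBlocks u₂ 0 0 0 =
      Matrix.fromBlocks (u₁' * u₂) 0 0 0 := by rw [blocks_mul, mul_zero]
  have e1 : Matrix.fromBlocks l 0 0 (0 : Matrix κ κ X.carrier) * Matrix.fromBlocks l' 0 0 1 =
      corn X ι κ := by rw [blocks_mul, zero_mul, hl.2.2.1]; rfl
  have e2 : Matrix.fromBlocks u₁' 0 0 (0 : Matrix κ κ X.carrier) * corn X ι κ =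
      Matrix.fromBlocks u₁' 0 0 0 := blocks_mul_corn _ _
  have e3 : corn X ι κ * Matrix.fromBlocks u₂ 0 0 (0 : Matrix κ κ X.carrier) =
      Matrix.fromBlocks u₂ 0 0 0 := corn_mul_blocks _ _
  have hl0 : Cl s n (Matrix.fromBlocks (u₁' * u₂) 0 0 (0 : Matrix κ κ X.carrier))
      (Matrix.fromBlocks l 0 0 0) := (hl'.symm.blocks (Cl.refl _)).mono (by simp)
  have c1 : Cl s (10 * n + 10) (corn X ι κ * w₁' * w₂) (Matrix.fromBlocks l 0 0 0) := by
    have k1 := Cl.mul_right h₂.1 a2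
    have k2 := Cl.mul_left hu1' b2
    rw [← mul_assoc, e2, e0] at k2
    exact ((k1.trans k2).trans hl0).mono (by omega)
  have c2 : Cl s (10 * n + 10) (w₁' * w₂ * corn X ι κ) (Matrix.fromBlocks l 0 0 0) := by
    have k1 := Cl.mul_left h₁.2.1 b1
    have k2 := Cl.mul_right hu2 a1
    rw [mul_assoc, e3, e0] at k2
    rw [← mul_assoc] at k1
    exact ((k1.trans k2).trans hl0).mono (by omega)
  constructor
  · have k := Cl.mul_right hL c1
    rw [e1] at k
    simp only [← mul_assoc]
    exact k.mono (by omega)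
  · have k := Cl.mul_right hL c2
    rw [e1, mul_assoc, corn_mul_blocks] at k
    rw [mul_assoc, blocks_mul_corn]
    exact k.mono (by omega)

/-- The projection `diag(e, 0)` is fixed along the Whitehead path of a quasi-invertible which
almost fixes `e`. -/
lemma QP.cl_whitehead_conj {g g' e : Matrix ι ι X.carrier} (h : QP s n g g') (he : Bd s 0 e)
    (h1 : Cl s n (e * g) e) (h2 : Cl s n (g * e) e) (t : ℝ) :
    Cl s (300 * n + 1000) (FilteredMatrixAlgebra.whitehead g g' t * Matrix.fromBlocks e 0 0 0 * whiteheadInv g g' t)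
      (Matrix.fromBlocks e 0 0 0) := by
  -- Multiplying g e ≈ e by g' on the left shows that the quasi-inverse almost fixes e as well; the
  -- other side is analogous.
  have h3 : Cl s (3 * n + 2) (g' * e) e := by
    have k1 := Cl.mul_left h.2.1 h2
    have k2 := Cl.mul_right he h.2.2.2
    rw [one_mul, mul_assoc] at k2
    exact (k1.symm.trans k2).mono (by omega)
  have h4 : Cl s (3 * n + 2) (e * g') e := by
    have k1 := Cl.mul_right h.2.1 h1
    have k2 := Cl.mul_left he h.2.2.1
    rw [mul_one, ← mul_assoc] at k2
    exact (k1.symm.trans k2).mono (by omega)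
  have k1 := Cl.whitehead_mul (n := 3 * n + 2) (h.1.mono (by omega)) (h2.mono (by omega)) h3 t
  have k2 := Cl.mul_whiteheadInv (n := 3 * n + 2) (h.2.1.mono (by omega)) (h1.mono (by omega)) h4 t
  exact ((Cl.mul_right (h.whitehead t).2.1 k1).trans k2).mono (by omega)

end Compare

namespace Extension

section

variable {p : ℝ≥0∞} [Fact (1 ≤ p)] [Fact (p ≠ ∞)]
  {C : ℝ} {XJ XA XQ : FilteredMatrixAlgebra.{u} p} (E : Extension C XJ XA XQ)
  {s : Scale} {ι κ : Type} [Fintype ι] [DecidableEq ι] [Fintype κ] [DecidableEq κ] {n m : ℕ}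

/-- Two lifts of `diag(u₁, v₁)` and `diag(u₂, v₂)`, with `u₁` homotopic to `u₂`, give homotopic
idempotents over `J^♯`. -/
lemma ih_of_lifts (hs : 40 * C ≤ s.M) {w₁ w₁' w₂ w₂' : Matrix (ι ⊕ κ) (ι ⊕ κ) XA.carrier}
    (h₁ : QP s n w₁ w₁') (h₂ : QP s n w₂ w₂') {u₁ u₁' u₂ u₂' : Matrix ι ι XQ.carrier}
    {l l' : Matrix ι ι XA.carrier} {v₁ v₂ : Matrix κ κ XQ.carrier}
    (hu₁ : QP s n u₁ u₁') (hu₂ : QP s n u₂ u₂')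
    (hw₁ : Cl s n (E.q.mat w₁) (Matrix.fromBlocks u₁ 0 0 v₁))
    (hw₂ : Cl s n (E.q.mat w₂) (Matrix.fromBlocks u₂ 0 0 v₂)) (hl : EP s n l l')
    (hl' : Cl s n (E.q.mat l) (u₁' * u₂)) {y₁ y₂ : Matrix (ι ⊕ κ) (ι ⊕ κ) XJ.carrier}
    (hy₁ : Bd s n y₁) (hy₂ : Bd s n y₂) (k₁ : Cl s n (w₁ * corn XA ι κ * w₁') (E.j.mat y₁))
    (k₂ : Cl s n (w₂ * corn XA ι κ * w₂') (E.j.mat y₂)) :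
    IH s (10000000000 * n + 10000000000) (Matrix.fromBlocks y₂ 0 0 (0 : Matrix (ι ⊕ κ) (ι ⊕ κ) XJ.carrier))
      (Matrix.fromBlocks y₁ 0 0 0) := by
  set c := corn XA ι κ with hc
  set lt := Matrix.fromBlocks l 0 0 (1 : Matrix κ κ XA.carrier)
  set lt' := Matrix.fromBlocks l' 0 0 (1 : Matrix κ κ XA.carrier)
  have hlt : EP s n lt lt' := (hl.blocks EP.one).mono (by simp)
  -- The factor lt is block diagonal with second block 1: conjugation by it preserves the corner c,
  -- while it corrects the image of the transition to be almost 1 on c.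
  set g := w₁' * w₂ * lt'
  set g' := lt * (w₂' * w₁)
  have hg : QP s (50 * n + 50) g g' := ((h₁.symm.mul h₂).mul hlt.symm.qp).mono (by omega)
  obtain ⟨t1, t2⟩ := QP.cl_transition (h₁.map E.q) (h₂.map E.q) hu₁ hu₂ hw₁ hw₂ (hl.map E.q) hl'
  have eqg : E.q.mat g = E.q.mat w₁' * E.q.mat w₂ * Matrix.fromBlocks (E.q.mat l') 0 0 1 := by
    rw [E.q.mat_mul, E.q.mat_mul, map_blocks, E.q.mat_one]
  rw [← eqg] at t1 t2
  have hP := fun t => (hg.map E.q).cl_whitehead_conj bd_corn (t1.mono (by omega))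
    (t2.mono (by omega)) t
  -- the path
  let W : Matrix ((ι ⊕ κ) ⊕ (ι ⊕ κ)) ((ι ⊕ κ) ⊕ (ι ⊕ κ)) XA.carrier := Matrix.fromBlocks w₁ 0 0 1
  let W' : Matrix ((ι ⊕ κ) ⊕ (ι ⊕ κ)) ((ι ⊕ κ) ⊕ (ι ⊕ κ)) XA.carrier := Matrix.fromBlocks w₁' 0 0 1
  have hW : QP s n W W' := (h₁.blocks QP.one).mono (by simp)
  let c2 : Matrix ((ι ⊕ κ) ⊕ (ι ⊕ κ)) ((ι ⊕ κ) ⊕ (ι ⊕ κ)) XA.carrier := Matrix.fromBlocks c 0 0 0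
  let b : (ι ⊕ κ) ⊕ (ι ⊕ κ) → Bool :=
    Sum.elim (Sum.elim (fun _ => true) (fun _ => false)) (fun _ => false)
  have hc2 : c2 = pr XA b := by
    rw [← pr_blocks, ← corn_eq_pr, pr_false]
  have hc2' : Matrix.fromBlocks (corn XQ ι κ) 0 0 (0 : Matrix (ι ⊕ κ) (ι ⊕ κ) XQ.carrier) = pr XQ b := by
    rw [← pr_blocks, ← corn_eq_pr, pr_false]
  -- As g need not be connected to 1, the extra summand is used: diag(g, g') is connected to
  -- diag(gg', 1). Conjugating diag(c, 0) along this path and then by w₁ leads from w₂cw₂' to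
  -- w₁cw₁', up to small errors.
  let e : ℝ → Matrix ((ι ⊕ κ) ⊕ (ι ⊕ κ)) ((ι ⊕ κ) ⊕ (ι ⊕ κ)) XA.carrier := fun t =>
    W * (whitehead g g' t * c2 * whiteheadInv g g' t) * W'
  have he : Continuous e := by
    have i1 := continuous_whitehead g g'
    have i2 := continuous_whiteheadInv g g'
    fun_prop
  have hqi : ∀ t, QI s (1000000 * n + 1000000) (e t) := fun t => by
    have := (((hc2 ▸ qi_pr b : QI s 0 c2).conj (hg.whitehead t)).conj hW)
    exact this.mono (by omega)
  have hcw : Cl s (10 * n + 10) (E.q.mat w₁ * corn XQ ι κ * E.q.mat w₁') (corn XQ ι κ) := by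
    obtain ⟨a1, -, -, a2⟩ := (h₁.map E.q).cl_corner hu₁ hw₁
    have i1 := Cl.mul_right (h₁.map E.q).2.1 a1
    have hu1 : Bd s n (Matrix.fromBlocks u₁ 0 0 (0 : Matrix κ κ XQ.carrier)) :=
      (hu₁.1.blocks Bd.zero).mono (by simp)
    have i2 := Cl.mul_left hu1 a2
    rw [← mul_assoc, blocks_mul_corn, blocks_mul, zero_mul] at i2
    have i3 : Cl s n (Matrix.fromBlocks (u₁ * u₁') 0 0 (0 : Matrix κ κ XQ.carrier))
      (corn XQ ι κ) := (hu₁.2.2.1.blocks (Cl.refl _)).mono (by simp)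
    exact ((i1.trans i2).trans i3).mono (by omega)
  -- The image of the whole path stays near the scalar projection: q(g) almost fixes the corner,
  -- hence so does its Whitehead path, and q(w₁) is almost block diagonal.
  have hpr : ∀ t, Cl s (1000000 * n + 1000000) (E.q.mat (e t)) (pr XQ b) := fun t => by
    have i1 := Cl.mul_right (hW.map E.q).2.1 (Cl.mul_left (hW.map E.q).1 (hP t))
    have e1 : E.q.mat (e t) = E.q.mat W * (whitehead (E.q.mat g) (E.q.mat g') t *
        Matrix.fromBlocks (corn XQ ι κ) 0 0 0 * whiteheadInv (E.q.mat g) (E.q.mat g') t) *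
        E.q.mat W' := by
      simp only [e, E.q.mat_mul, map_whitehead, map_whiteheadInv]
      rw [hc2', hc2, map_pr]
    rw [← e1] at i1
    have e2 : E.q.mat W * Matrix.fromBlocks (corn XQ ι κ) 0 0 0 * E.q.mat W' =
        Matrix.fromBlocks (E.q.mat w₁ * corn XQ ι κ * E.q.mat w₁') 0 0 0 := by
      rw [map_blocks, map_blocks, blocks_mul, blocks_mul, mul_zero, zero_mul]
    rw [e2] at i1
    have i2 := i1.trans (hcw.blocks (Cl.refl (0 : Matrix (ι ⊕ κ) (ι ⊕ κ) XQ.carrier)))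
    rw [hc2'] at i2
    exact i2.mono (by simp; omega)
  -- This holds exactly because l' and l are exact inverses. At time 0 the correction lt therefore
  -- disappears and w₂cw₂' remains between factors w₁w₁' ≈ 1.
  have hcl : lt' * c * lt = c := by
    rw [hc, blocks_mul_corn, blocks_mul, zero_mul, hl.2.2.2]; rfl
  have e0 : e 0 = Matrix.fromBlocks (w₁ * w₁' * (w₂ * c * w₂') * (w₁ * w₁')) 0 0 0 := by
    simp only [e, W, W', c2, whitehead_zero, whiteheadInv_zero, blocks_mul, mul_zero, zero_mul]
    congr 1
    have : w₁ * (g * c * g') * w₁' = w₁ * w₁' * (w₂ * (lt' * c * lt) * w₂') * (w₁ * w₁') := by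
      simp only [g, g', mul_assoc]
    rw [this, hcl]
  have e1 : e 1 = Matrix.fromBlocks (w₁ * (g * g' * c * (g * g')) * w₁') 0 0 0 := by
    simp only [e, W, W', c2, whitehead_one, whiteheadInv_one, blocks_mul, mul_zero, zero_mul]
  let γ : Path (e 0) (e 1) :=
    { toFun := fun t => e t
      continuous_toFun := he.comp continuous_subtype_val
      source' := by simp
      target' := by simp }
  refine (E.ih_of_path hs (n := 1000000 * n + 1000000) γ (fun t => hqi t) (fun t => hpr t)
    ((hy₂.blocks Bd.zero).mono (by simp; omega)) ((hy₁.blocks Bd.zero).mono (by simp; omega))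
    ?_ ?_).mono (by omega)
  · have hwc : Bd s (3 * n + 3) (w₂ * c * w₂') :=
      ((h₂.1.mul bd_corn).mul h₂.2.1).mono (by omega)
    have i1 := Cl.mul_right (h₁.1.mul h₁.2.1) (Cl.mul_right hwc h₁.2.2.1)
    have i2 := Cl.mul_left hwc h₁.2.2.1
    rw [one_mul] at i1
    rw [mul_one] at i2
    have i3 := (i1.trans i2).trans k₂
    rw [e0, map_blocks, map_zero]
    exact (i3.blocks (Cl.refl _)).mono (by simp; omega)
  · have i1 := Cl.mul_right (hg.1.mul hg.2.1) (Cl.mul_right (bd_corn (s := s)) hg.2.2.1)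
    have i2 := Cl.mul_left (bd_corn (s := s) (X := XA) (ι := ι) (κ := κ)) hg.2.2.1
    rw [one_mul] at i1
    rw [mul_one] at i2
    have i3 := (Cl.mul_right h₁.2.1 (Cl.mul_left h₁.1 (i1.trans i2))).trans k₁
    rw [e1, map_blocks, map_zero]
    exact (i3.blocks (Cl.refl _)).mono (by simp; omega)

end

end Extension

end FilteredMatrixAlgebra
end QuantK

namespace QuantK
namespace FilteredMatrixAlgebra

/-! ### Block sums of block matrices -/

section Shuffle

variable {p : ℝ≥0∞} [Fact (1 ≤ p)] {X : FilteredMatrixAlgebra.{u} p}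
  {ι κ μ ν : Type} [Fintype ι] [DecidableEq ι] [Fintype κ] [DecidableEq κ]
  [Fintype μ] [DecidableEq μ] [Fintype ν] [DecidableEq ν] {s : Scale} {n m : ℕ}

lemma blocks_add (x x' : Matrix ι ι X.carrier) (y y' : Matrix κ κ X.carrier) :
    Matrix.fromBlocks (x + x') 0 0 (y + y') =
      Matrix.fromBlocks x 0 0 y + Matrix.fromBlocks x' 0 0 y' := by
  rw [Matrix.fromBlocks_add]; simp

/-- Two block matrices, arranged as a block matrix of block sums. -/
def shuffle (x : Matrix (ι ⊕ κ) (ι ⊕ κ) X.carrier) (y : Matrix (μ ⊕ ν) (μ ⊕ ν) X.carrier) :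
    Matrix ((ι ⊕ μ) ⊕ (κ ⊕ ν)) ((ι ⊕ μ) ⊕ (κ ⊕ ν)) X.carrier :=
  (Matrix.fromBlocks x 0 0 y).submatrix (Equiv.sumSumSumComm ι μ κ ν) (Equiv.sumSumSumComm ι μ κ ν)

lemma shuffle_corn : shuffle (corn X ι κ) (corn X μ ν) = corn X (ι ⊕ μ) (κ ⊕ ν) := by
  rw [shuffle, corn_eq_pr, corn_eq_pr, pr_blocks, pr_submatrix, corn_eq_pr]
  congr 1
  funext i
  rcases i with (i | i) | (i | i) <;> rfl

lemma shuffle_mul (x x' : Matrix (ι ⊕ κ) (ι ⊕ κ) X.carrier) (y y' : Matrix (μ ⊕ ν) (μ ⊕ ν) X.carrier) :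
    shuffle (x * x') (y * y') = shuffle x y * shuffle x' y' := by
  rw [shuffle, shuffle, shuffle, Matrix.submatrix_mul_equiv, blocks_mul]

lemma shuffle_add (x x' : Matrix (ι ⊕ κ) (ι ⊕ κ) X.carrier) (y y' : Matrix (μ ⊕ ν) (μ ⊕ ν) X.carrier) :
    shuffle (x + x') (y + y') = shuffle x y + shuffle x' y' := by
  rw [shuffle, blocks_add]; rfl

lemma shuffle_blocks (a : Matrix ι ι X.carrier) (b : Matrix κ κ X.carrier)
    (c : Matrix μ μ X.carrier) (d : Matrix ν ν X.carrier) :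
    shuffle (Matrix.fromBlocks a 0 0 b) (Matrix.fromBlocks c 0 0 d) =
      Matrix.fromBlocks (Matrix.fromBlocks a 0 0 c) 0 0 (Matrix.fromBlocks b 0 0 d) := by
  ext ((i | i) | (i | i)) ((k | k) | (k | k)) <;> rfl

lemma map_shuffle {Y : FilteredMatrixAlgebra.{v} p} (φ : Hom X Y)
    (x : Matrix (ι ⊕ κ) (ι ⊕ κ) X.carrier) (y : Matrix (μ ⊕ ν) (μ ⊕ ν) X.carrier) :
    φ.mat (shuffle x y) = shuffle (φ.mat x) (φ.mat y) := by
  rw [shuffle, map_submatrix, map_blocks]; rfl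

lemma corn_submatrix (σ : μ ≃ ι) (ρ : ν ≃ κ) :
    (corn X ι κ).submatrix (Equiv.sumCongr σ ρ) (Equiv.sumCongr σ ρ) = corn X μ ν := by
  rw [corn_eq_pr, pr_submatrix, corn_eq_pr]
  congr 1
  funext i
  rcases i with i | i <;> rfl

lemma blocks_submatrix (a : Matrix ι ι X.carrier) (b : Matrix κ κ X.carrier)
    (σ : μ ≃ ι) (ρ : ν ≃ κ) :
    (Matrix.fromBlocks a 0 0 b).submatrix (Equiv.sumCongr σ ρ) (Equiv.sumCongr σ ρ) =
      Matrix.fromBlocks (a.submatrix σ σ) 0 0 (b.submatrix ρ ρ) := by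
  ext (i | i) (k | k) <;> rfl

/-- Conjugation by an approximately block diagonal matrix. -/
lemma QP.cl_conj_corn {w w' : Matrix (ι ⊕ κ) (ι ⊕ κ) X.carrier} (hw : QP s n w w')
    {u u' : Matrix ι ι X.carrier} {v : Matrix κ κ X.carrier} (hu : QP s n u u')
    (h : Cl s n w (Matrix.fromBlocks u 0 0 v)) :
    Cl s (10 * n + 10) (w * corn X ι κ * w') (corn X ι κ) := by
  obtain ⟨a1, -, -, a2⟩ := hw.cl_corner hu h
  have i1 := Cl.mul_right hw.2.1 a1
  have hu1 : Bd s n (Matrix.fromBlocks u 0 0 (0 : Matrix κ κ X.carrier)) :=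
    (hu.1.blocks Bd.zero).mono (by simp)
  have i2 := Cl.mul_left hu1 a2
  rw [← mul_assoc, blocks_mul_corn, blocks_mul, zero_mul] at i2
  have i3 : Cl s n (Matrix.fromBlocks (u * u') 0 0 (0 : Matrix κ κ X.carrier))
    (corn X ι κ) := (hu.2.2.1.blocks (Cl.refl _)).mono (by simp)
  exact ((i1.trans i2).trans i3).mono (by omega)

end Shuffle

/-! ### Boundary data and the boundary map -/

namespace Extension

section

variable {p : ℝ≥0∞} [Fact (1 ≤ p)] [Fact (p ≠ ∞)]
  {C : ℝ} {XJ XA XQ : FilteredMatrixAlgebra.{u} p} (E : Extension C XJ XA XQ)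
  {s : Scale} {ι κ μ ν : Type} [Fintype ι] [DecidableEq ι] [Fintype κ] [DecidableEq κ]
  [Fintype μ] [DecidableEq μ] [Fintype ν] [DecidableEq ν] {n m : ℕ} {P Q : Param}

/-- Boundary data at a level of a scale. -/
structure IsDatum (s : Scale) (n : ℕ) (u : Matrix ι ι XQ.carrier)
    (w w' : Matrix (ι ⊕ κ) (ι ⊕ κ) XA.carrier) (y : Matrix (ι ⊕ κ) (ι ⊕ κ) XJ.carrier) : Prop where
  inv : ∃ u', QP s n u u'
  pair : QP s n w w'
  lift : ∃ v, Cl s n (E.q.mat w) (Matrix.fromBlocks u 0 0 v)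
  bd : Bd s n y
  aug : ∀ i k, XJ.aug (y i k) = 0
  approx : Cl s n (w * corn XA ι κ * w') (corn XA ι κ + E.j.mat y)

/-- The class `[y + diag(1, 0)] - [diag(1, 0)]`. -/
def dcls (Q : Param) (y : Matrix (ι ⊕ κ) (ι ⊕ κ) XJ.carrier) : XJ.K0u Q :=
  icls Q (y + corn XJ ι κ) - icls Q (corn XJ ι κ)

variable {E} {u : Matrix ι ι XQ.carrier} {w w' : Matrix (ι ⊕ κ) (ι ⊕ κ) XA.carrier}
  {y : Matrix (ι ⊕ κ) (ι ⊕ κ) XJ.carrier}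

lemma IsDatum.mono (h : E.IsDatum s n u w w' y) (hnm : n ≤ m) : E.IsDatum s m u w w' y := by
  obtain ⟨⟨u', h1⟩, h2, ⟨v, h3⟩, h4, h5, h6⟩ := h
  exact ⟨⟨u', h1.mono hnm⟩, h2.mono hnm, ⟨v, h3.mono hnm⟩, h4.mono hnm, h5, h6.mono hnm⟩

lemma IsDatum.approx' (h : E.IsDatum s n u w w' y) :
    Cl s n (w * corn XA ι κ * w') (E.j.mat (y + corn XJ ι κ)) := by
  rw [map_add, map_corn, add_comm]; exact h.approx

lemma IsDatum.bd' (h : E.IsDatum s n u w w' y) : Bd s (n + 1) (y + corn XJ ι κ) :=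
  (h.bd.add bd_corn).mono (by omega)

/-- Over A^♯ the matrix is close to a conjugate of the corner, hence a quasi-idempotent; the
property descends to J^♯ since the norms agree. -/
lemma IsDatum.qi (h : E.IsDatum s n u w w' y) : QI s (30 * n + 30) (y + corn XJ ι κ) :=
  E.qi_of_qi (((qi_corn.conj h.pair).close (h.bd'.map E.j) h.approx').mono (by omega))

/-- Data add up under block sums once the blocks are rearranged so that the two corners form one
corner. Both stabilisation and additivity of the boundary rest on this. -/
lemma IsDatum.blocks (h : E.IsDatum s n u w w' y) {u₁ : Matrix μ μ XQ.carrier}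
    {w₁ w₁' : Matrix (μ ⊕ ν) (μ ⊕ ν) XA.carrier} {y₁ : Matrix (μ ⊕ ν) (μ ⊕ ν) XJ.carrier}
    (h' : E.IsDatum s n u₁ w₁ w₁' y₁) :
    E.IsDatum s n (Matrix.fromBlocks u 0 0 u₁) (shuffle w w₁) (shuffle w' w₁') (shuffle y y₁) := by
  obtain ⟨⟨u', h1⟩, h2, ⟨v, h3⟩, h4, h5, h6⟩ := h
  obtain ⟨⟨u₁', k1⟩, k2, ⟨v₁, k3⟩, k4, k5, k6⟩ := h'
  refine ⟨⟨_, (h1.blocks k1).mono (by simp)⟩, ((h2.blocks k2).submatrix _).mono (by simp),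
    ⟨Matrix.fromBlocks v 0 0 v₁, ?_⟩, ((h4.blocks k4).submatrix _ _).mono (by simp), ?_, ?_⟩
  · rw [map_shuffle, ← shuffle_blocks]
    exact ((h3.blocks k3).submatrix _ _).mono (by simp)
  · rintro ((i | i) | (i | i)) ((k | k) | (k | k)) <;>
      first | exact h5 _ _ | exact k5 _ _ | exact map_zero XJ.aug
  · rw [← shuffle_corn, map_shuffle, ← shuffle_mul, ← shuffle_mul, ← shuffle_add]
    exact ((h6.blocks k6).submatrix _ _).mono (by simp)

lemma dcls_shuffle {y : Matrix (ι ⊕ κ) (ι ⊕ κ) XJ.carrier} {y₁ : Matrix (μ ⊕ ν) (μ ⊕ ν) XJ.carrier}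
    (h : QI s n (y + corn XJ ι κ)) (h' : QI s n (y₁ + corn XJ μ ν)) (hQ : s.Above (n + 1) Q) :
    dcls Q (shuffle y y₁) = dcls Q y + dcls Q y₁ := by
  have i1 := h.isIdem_of_above hQ
  have i2 := h'.isIdem_of_above hQ
  have i3 := (qi_corn (X := XJ) (ι := ι) (κ := κ)).isIdem_of_above (hQ.mono (by omega))
  have i4 := (qi_corn (X := XJ) (ι := μ) (κ := ν)).isIdem_of_above (hQ.mono (by omega))
  rw [dcls, ← shuffle_corn, ← shuffle_add, shuffle, shuffle, icls_submatrix (i1.blocks i2),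
    icls_submatrix (i3.blocks i4), icls_blocks i1 i2, icls_blocks i3 i4, dcls, dcls]
  abel

lemma IsDatum.submatrix (h : E.IsDatum s n u w w' y) (σ : μ ≃ ι) (ρ : ν ≃ κ) :
    E.IsDatum s n (u.submatrix σ σ)
      (w.submatrix (Equiv.sumCongr σ ρ) (Equiv.sumCongr σ ρ))
      (w'.submatrix (Equiv.sumCongr σ ρ) (Equiv.sumCongr σ ρ))
      (y.submatrix (Equiv.sumCongr σ ρ) (Equiv.sumCongr σ ρ)) := by
  obtain ⟨⟨u', h1⟩, h2, ⟨v, h3⟩, h4, h5, h6⟩ := h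
  refine ⟨⟨_, h1.submatrix σ⟩, h2.submatrix _, ⟨v.submatrix ρ ρ, ?_⟩, h4.submatrix _ _,
    fun i k => h5 _ _, ?_⟩
  · rw [map_submatrix, ← blocks_submatrix]
    exact h3.submatrix _ _
  · rw [← corn_submatrix σ ρ, map_submatrix, Matrix.submatrix_mul_equiv,
      Matrix.submatrix_mul_equiv]
    exact h6.submatrix _ _

lemma dcls_submatrix (h : QI s n (y + corn XJ ι κ)) (σ : μ ≃ ι) (ρ : ν ≃ κ)
    (hQ : s.Above (n + 1) Q) :
    dcls Q (y.submatrix (Equiv.sumCongr σ ρ) (Equiv.sumCongr σ ρ)) = dcls Q y := by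
  have i1 := h.isIdem_of_above hQ
  have i3 := (qi_corn (X := XJ) (ι := ι) (κ := κ)).isIdem_of_above (hQ.mono (by omega))
  rw [dcls, ← corn_submatrix σ ρ, icls_submatrix i3, dcls, ← icls_submatrix i1 (Equiv.sumCongr σ ρ)]
  rfl

variable (E) in
lemma isDatum_one : E.IsDatum s 0 (1 : Matrix μ μ XQ.carrier) (1 : Matrix (μ ⊕ ν) (μ ⊕ ν) _) 1 0 where
  inv := ⟨1, QP.one⟩
  pair := QP.one
  lift := ⟨1, by rw [E.q.mat_one, Matrix.fromBlocks_one]; exact Cl.refl _⟩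
  bd := Bd.zero
  aug _ _ := map_zero _
  approx := by rw [one_mul, mul_one, map_zero, add_zero]; exact Cl.refl _

lemma dcls_zero : dcls Q (0 : Matrix (μ ⊕ ν) (μ ⊕ ν) XJ.carrier) = 0 := by
  rw [dcls, zero_add, sub_self]

/-- Stabilisation of boundary data. -/
lemma IsDatum.exists_pad (h : E.IsDatum s n u w w' y) (μ ν : Type) [Fintype μ] [DecidableEq μ]
    [Fintype ν] [DecidableEq ν] (hQ : s.Above (30 * n + 31) Q) :
    ∃ (w₁ w₁' : Matrix ((ι ⊕ μ) ⊕ (κ ⊕ ν)) ((ι ⊕ μ) ⊕ (κ ⊕ ν)) XA.carrier)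
      (y₁ : Matrix ((ι ⊕ μ) ⊕ (κ ⊕ ν)) ((ι ⊕ μ) ⊕ (κ ⊕ ν)) XJ.carrier),
      E.IsDatum s n (Matrix.fromBlocks u 0 0 (1 : Matrix μ μ XQ.carrier)) w₁ w₁' y₁ ∧
        dcls Q y₁ = dcls Q y := by
  refine ⟨_, _, _, h.blocks ((E.isDatum_one (μ := μ) (ν := ν)).mono n.zero_le), ?_⟩
  rw [dcls_shuffle h.qi (by rw [zero_add]; exact qi_corn.mono (by omega)) hQ, dcls_zero, add_zero]

/-- The class does not depend on the data, for homotopic quasi-invertibles of the same size. -/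
lemma IsDatum.dcls_eq_of_gh (hs : 40 * C ≤ s.M) {u₁ : Matrix ι ι XQ.carrier}
    {w₁ w₁' : Matrix (ι ⊕ κ) (ι ⊕ κ) XA.carrier} {y₁ : Matrix (ι ⊕ κ) (ι ⊕ κ) XJ.carrier}
    (h : E.IsDatum s n u w w' y) (h' : E.IsDatum s n u₁ w₁ w₁' y₁) (hu : GH s n u u₁)
    (hQ : s.Above (1000000000000000 * n + 1000000000000000) Q) : dcls Q y = dcls Q y₁ := by
  obtain ⟨u', hu'⟩ := h.inv
  -- Multiplying the homotopy by u' gives 1 ≈ u'u ~ u'u₁, so u'u₁ is homotopic to 1 and lifts after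
  -- stabilisation to an exact invertible l. This l is the correction needed in `ih_of_lifts`.
  have g1 := hu.mul_left hu'.symm
  have g2 := GH.of_close QP.one (hu'.2.1.mul hu'.1) hu'.2.2.2.symm
  obtain ⟨α, i1, i2, l, l', hl, hl'⟩ := (g2.trans g1).symm.exists_lift (E.lifting hs)
  -- Only the block of u has to grow by the stabilisation of l; the complementary block is left as
  -- it is.
  obtain ⟨a, a', z, ha, hz⟩ := h.exists_pad α Empty (hQ.mono (by omega))
  obtain ⟨b, b', t, hb, ht⟩ := h'.exists_pad α Empty (hQ.mono (by omega))
  rw [← hz, ← ht]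
  obtain ⟨v₁, hv₁⟩ := ha.lift
  obtain ⟨v₂, hv₂⟩ := hb.lift
  obtain ⟨u₁', hu₁'⟩ := h'.inv
  have hl2 : Cl s (1000 * n + 1000) (E.q.mat l) (Matrix.fromBlocks u' 0 0 (1 : Matrix α α XQ.carrier) *
      Matrix.fromBlocks u₁ 0 0 1) := by
    rw [blocks_mul, one_mul]
    exact hl'.mono (by simp; omega)
  have key := E.ih_of_lifts hs (n := 1000 * n + 1000) (ha.pair.mono (by omega))
    (hb.pair.mono (by omega)) ((hu'.blocks (QP.one (ι := α))).mono (by simp; omega))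
    ((hu₁'.blocks (QP.one (ι := α))).mono (by simp; omega))
    (hv₁.mono (by omega)) (hv₂.mono (by omega)) (hl.ep.mono (by simp; omega)) hl2
    (ha.bd'.mono (by omega)) (hb.bd'.mono (by omega)) (ha.approx'.mono (by omega))
    (hb.approx'.mono (by omega))
  have k := key.icls_eq (Q := Q) (hQ.mono (by omega))
  have j1 := ha.qi.isIdem_of_above (Q := Q) (hQ.mono (by omega))
  have j2 := hb.qi.isIdem_of_above (Q := Q) (hQ.mono (by omega))
  rw [icls_pad j1, icls_pad j2] at k
  rw [dcls, dcls, k]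

/-- The class does not depend on the data. -/
lemma IsDatum.dcls_eq (hs : 40 * C ≤ s.M) {u₁ : Matrix μ μ XQ.carrier}
    {w₁ w₁' : Matrix (μ ⊕ ν) (μ ⊕ ν) XA.carrier} {y₁ : Matrix (μ ⊕ ν) (μ ⊕ ν) XJ.carrier}
    (h : E.IsDatum s n u w w' y) (h' : E.IsDatum s n u₁ w₁ w₁' y₁)
    (hu : XQ.IsInv P.ε P.r P.N u) (hu₁ : XQ.IsInv P.ε P.r P.N u₁) (hc : gcls P u = gcls P u₁)
    (hP : s.Below 1 P) (hQ : s.Above (10000000000000000 * n + 10000000000000000) Q) : dcls Q y = dcls Q y₁ := by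
  obtain ⟨k, k', σ, hσ⟩ := exists_gh_of_gcls_eq hu hu₁ hc hP
  -- The complementary blocks are indexed by κ and ν. Each is padded by the other, so that they
  -- agree after exchanging the summands; the first blocks are matched by the permutation σ.
  obtain ⟨a, a', z, ha, hz⟩ := h.exists_pad (Q := Q) (Fin k) ν (hQ.mono (by omega))
  obtain ⟨b, b', t, hb, ht⟩ := h'.exists_pad (Q := Q) (Fin k') κ (hQ.mono (by omega))
  have hb' := hb.submatrix σ (Equiv.sumComm κ ν)
  rw [← hz, ← ht, ← dcls_submatrix hb.qi σ (Equiv.sumComm κ ν) (hQ.mono (by omega))]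
  exact (ha.mono (by omega)).dcls_eq_of_gh (n := n + 3) hs (hb'.mono (by omega))
    (hσ.mono (by omega)) (hQ.mono (by omega))

variable (E) in
/-- Existence of data with an exact invertible lift. -/
lemma exists_isDatum (hs : 40 * C ≤ s.M) {u u' : Matrix ι ι XQ.carrier} (h : QP s n u u') :
    ∃ (w w' : Matrix (ι ⊕ ι) (ι ⊕ ι) XA.carrier) (y : Matrix (ι ⊕ ι) (ι ⊕ ι) XJ.carrier),
      EP s (3 * n + 20) w w' ∧ Cl s (5 * n + 1) (E.q.mat w) (Matrix.fromBlocks u 0 0 u') ∧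
      Cl s (200 * n + 1000) (w * corn XA ι ι * w') (corn XA ι ι + E.j.mat y) ∧
      E.IsDatum s (1000 * n + 10000) u w w' y := by
  obtain ⟨w, w', hw, hq⟩ := exists_lift_elem (E.lifting hs) h
  have h1 := (hw.ep.qp.map E.q).mono (m := 5 * n + 20) (by omega)
  have h2 := h1.cl_conj_corn (h.mono (by omega)) (hq.mono (by omega))
  have hb := (hw.ep.1.mul (bd_corn (ι := ι) (κ := ι))).mul hw.ep.2.1
  rw [← map_corn E.q, ← E.q.mat_mul, ← E.q.mat_mul] at h2
  obtain ⟨y, y1, y2, y3⟩ := E.exists_approx hs (n := 50 * n + 210) (hb.mono (by omega))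
    (bd_corn.mono (by omega)) (h2.mono (by omega))
  exact ⟨w, w', y, hw.ep, hq, y3.mono (by omega), ⟨u', h.mono (by omega)⟩,
    hw.ep.qp.mono (by omega), ⟨u', hq.mono (by omega)⟩, y2.mono (by omega), y1, y3.mono (by omega)⟩

-- The boundary class is a function of the class of u, so one value d serves all data. The summand
-- 11000 = 1000·1 + 10000 is the level of the data constructed from a quasi-invertible at level 1.
variable (E) in
lemma exists_class (hs : 40 * C ≤ s.M) (n : ℕ) (hP : s.Below 1 P)
    (hQ : s.Above (10000000000000000 * (n + 11000) + 10000000000000000) Q) (a : XQ.K1u P) : ∃ d : XJ.K0u Q,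
      ∀ {ι κ : Type} [Fintype ι] [DecidableEq ι] [Fintype κ] [DecidableEq κ]
        {u : Matrix ι ι XQ.carrier} {w w' : Matrix (ι ⊕ κ) (ι ⊕ κ) XA.carrier}
        {y : Matrix (ι ⊕ κ) (ι ⊕ κ) XJ.carrier}, XQ.IsInv P.ε P.r P.N u → gcls P u = a →
        E.IsDatum s n u w w' y → dcls Q y = d := by
  obtain ⟨k, u, hu, rfl⟩ := exists_gcls a
  obtain ⟨u', hu'⟩ := hu.exists_qp hP
  obtain ⟨w, w', y, -, -, -, h⟩ := E.exists_isDatum hs hu'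
  refine ⟨dcls Q y, fun hu₁ h1 h2 => ?_⟩
  exact (h2.mono (by omega)).dcls_eq (n := n + 11000) hs (h.mono (by omega)) hu₁ hu h1 hP hQ

variable (E) in
/-- The boundary map. -/
def bdry (hs : 40 * C ≤ s.M) (n : ℕ) (hn : 11000 ≤ n) (hP : s.Below 1 P)
    (hQ : s.Above (10000000000000000 * (n + 11000) + 10000000000000000) Q) : XQ.K1u P →+ XJ.K0u Q :=
  AddMonoidHom.mk' (fun a => (E.exists_class hs n hP hQ a).choose) fun a b => by
    obtain ⟨k, u, hu, rfl⟩ := exists_gcls a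
    obtain ⟨m, t, ht, rfl⟩ := exists_gcls b
    obtain ⟨u', hu'⟩ := hu.exists_qp hP
    obtain ⟨t', ht'⟩ := ht.exists_qp hP
    obtain ⟨w, w', y, -, -, -, h⟩ := E.exists_isDatum hs hu'
    obtain ⟨w₁, w₁', y₁, -, -, -, h'⟩ := E.exists_isDatum hs ht'
    have hut : XQ.IsInv P.ε P.r P.N (Matrix.fromBlocks u 0 0 t) := (XQ.glSystem P).good_blocks hu ht
    -- The block sum of data for two classes is a datum for their sum, and independence of the data
    -- lets each value be computed from the chosen datum.
    have hh := h.blocks h'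
    rw [← (E.exists_class hs n hP hQ _).choose_spec hu rfl (h.mono (by omega)),
      ← (E.exists_class hs n hP hQ _).choose_spec ht rfl (h'.mono (by omega)),
      ← (E.exists_class hs n hP hQ _).choose_spec hut (gcls_blocks hu ht) (hh.mono (by omega)),
      dcls_shuffle h.qi h'.qi (hQ.mono (by omega))]

lemma bdry_gcls {hs : 40 * C ≤ s.M} {n : ℕ} {hn : 11000 ≤ n} {hP : s.Below 1 P}
    {hQ : s.Above (10000000000000000 * (n + 11000) + 10000000000000000) Q} (hu : XQ.IsInv P.ε P.r P.N u)
    (h : E.IsDatum s n u w w' y) : E.bdry hs n hn hP hQ (gcls P u) = dcls Q y :=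
  ((E.exists_class hs n hP hQ _).choose_spec hu rfl h).symm

end

end Extension

end FilteredMatrixAlgebra
end QuantK

namespace QuantK
namespace FilteredMatrixAlgebra

/-! ### The homotopy from diag(u, v) to the identity with the parameters of boundary data -/

section Pair

variable {p : ℝ≥0∞} [Fact (1 ≤ p)] {X : FilteredMatrixAlgebra.{u} p}
  {ι κ : Type} [Fintype ι] [DecidableEq ι] [Fintype κ] [DecidableEq κ]

/-- The diagonal entries are combinations of x and y with weights cos² and sin², and the
off-diagonal ones carry |cos·sin| ≤ 1/2 against ‖x - y‖ ≤ 2 max. The total factor 2 matches the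
error 2ε in the boundary data. -/
lemma norm_conj_lt (t : ℝ) {x y : Matrix ι ι X.carrier} {ε : ℝ} (hx : ‖x‖ < ε) (hy : ‖y‖ < ε) :
    ‖rot X ι t * Matrix.fromBlocks x 0 0 y * rotInv X ι t‖ < 2 * ε := by
  rw [conj_eq]
  set c := Real.cos (Real.pi / 2 * t)
  set s := Real.sin (Real.pi / 2 * t)
  have hcs : c ^ 2 + s ^ 2 = 1 := Real.cos_sq_add_sin_sq _
  have k1 : |c * s| ≤ 1 / 2 := by
    rw [abs_le]
    constructor <;> nlinarith [sq_nonneg (c + s), sq_nonneg (c - s)]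
  have hm := max_lt hx hy
  have hm1 := le_max_left ‖x‖ ‖y‖
  have hm2 := le_max_right ‖x‖ ‖y‖
  set m := max ‖x‖ ‖y‖
  have combo : ∀ {a b : Matrix ι ι X.carrier} {c s : ℝ}, c ^ 2 + s ^ 2 = 1 → ‖a‖ ≤ m → ‖b‖ ≤ m →
      ‖((c * c : ℝ) : ℂ) • a + ((s * s : ℝ) : ℂ) • b‖ ≤ m := by
    intro a b c s hcs ha hb
    refine (norm_add_le _ _).trans ?_
    rw [norm_smul, norm_smul, Complex.norm_real, Complex.norm_real,
      Real.norm_of_nonneg (mul_self_nonneg c), Real.norm_of_nonneg (mul_self_nonneg s)]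
    have i1 := mul_le_mul_of_nonneg_left ha (mul_self_nonneg c)
    have i2 := mul_le_mul_of_nonneg_left hb (mul_self_nonneg s)
    have i3 : c * c * m + s * s * m = m := by rw [← add_mul, ← sq, ← sq, hcs, one_mul]
    linarith
  have hoff : ‖((c * s : ℝ) : ℂ) • (x - y)‖ ≤ m := by
    rw [norm_smul, Complex.norm_real, Real.norm_eq_abs]
    have i1 : ‖x - y‖ ≤ 2 * m := (norm_sub_le _ _).trans (by linarith)
    have i2 := mul_le_mul k1 i1 (norm_nonneg _) (by norm_num)
    linarith
  have e : ∀ a b d : Matrix ι ι X.carrier, Matrix.fromBlocks a b b d =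
      Matrix.fromBlocks a 0 0 d + Matrix.fromBlocks 0 b b 0 := by
    intro a b d; rw [Matrix.fromBlocks_add]; simp
  rw [e]
  have j1 := (norm_blocks_le (((c * c : ℝ) : ℂ) • x + ((s * s : ℝ) : ℂ) • y)
    (((s * s : ℝ) : ℂ) • x + ((c * c : ℝ) : ℂ) • y)).trans
      (max_le (combo hcs hm1 hm2) (combo (by rw [add_comm]; exact hcs) hm1 hm2))
  have j2 := (norm_antiblocks_le (((c * s : ℝ) : ℂ) • (x - y)) (((c * s : ℝ) : ℂ) • (x - y))).trans
    (max_le hoff hoff)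
  exact (norm_add_le _ _).trans_lt (by linarith)

/-- For an `(ε, r, N)`-inverse pair `(u, v)`, `diag(u, v)` is `(2ε, 2r, 2(N+ε))`-homotopic to the
identity. -/
lemma IsInvPair.invHomotopic_one {ε r N : ℝ} (hε : 0 < ε) (hr : 0 < r) (hN : 1 ≤ N)
    {u v : Matrix ι ι X.carrier} (h : X.IsInvPair ε r N u v) :
    X.InvHomotopic (2 * ε) (2 * r) (2 * (N + ε)) (Matrix.fromBlocks u 0 0 v) 1 := by
  obtain ⟨h1, h2, h3, h4, h5, h6⟩ := h
  have hr2 : r ≤ 2 * r := by linarith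
  have r2 : 0 < 2 * r := by linarith
  have n1 : ‖(1 : Matrix ι ι X.carrier)‖ ≤ 1 := norm_one_le
  have huv : ‖u * v‖ ≤ 1 + ε := by
    have : u * v = (u * v - 1) + 1 := by abel
    rw [this]; exact (norm_add_le _ _).trans (by linarith)
  have hvu : ‖v * u‖ ≤ 1 + ε := by
    have : v * u = (v * u - 1) + 1 := by abel
    rw [this]; exact (norm_add_le _ _).trans (by linarith)
  have first : X.InvHomotopic (2 * ε) (2 * r) (2 * (N + ε)) (Matrix.fromBlocks u 0 0 v)
      (Matrix.fromBlocks (u * v) 0 0 1) := by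
    -- U moves v from the second diagonal place to the first, from diag(u, v) to diag(uv, 1). V is
    -- the corresponding path for the inverse: UV is constant, and VU is a rotation of diag(vu, uv).
    let U : ℝ → Matrix (ι ⊕ ι) (ι ⊕ ι) X.carrier := fun t =>
      Matrix.fromBlocks u 0 0 1 * (rot X ι t * Matrix.fromBlocks 1 0 0 v * rotInv X ι t)
    let V : ℝ → Matrix (ι ⊕ ι) (ι ⊕ ι) X.carrier := fun t =>
      (rot X ι t * Matrix.fromBlocks v 0 0 1 * rotInv X ι t) * Matrix.fromBlocks 1 0 0 u
    have cU : Continuous U := by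
      have h1 := continuous_rot (X := X) (ι := ι)
      have h2 := continuous_rotInv (X := X) (ι := ι)
      fun_prop
    have cV : Continuous V := by
      have h1 := continuous_rot (X := X) (ι := ι)
      have h2 := continuous_rotInv (X := X) (ι := ι)
      fun_prop
    have eU : ∀ t, U t =
        ((Real.cos (Real.pi / 2 * t) * Real.cos (Real.pi / 2 * t) : ℝ) : ℂ) •
            Matrix.fromBlocks u 0 0 v +
          ((Real.sin (Real.pi / 2 * t) * Real.sin (Real.pi / 2 * t) : ℝ) : ℂ) •
            Matrix.fromBlocks (u * v) 0 0 1 +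
          ((Real.cos (Real.pi / 2 * t) * Real.sin (Real.pi / 2 * t) : ℝ) : ℂ) •
            Matrix.fromBlocks 0 (u - u * v) (1 - v) 0 := by
      intro t
      simp only [U]
      rw [conj_eq, Matrix.fromBlocks_multiply, Matrix.fromBlocks_smul, Matrix.fromBlocks_smul,
        Matrix.fromBlocks_smul, Matrix.fromBlocks_add, Matrix.fromBlocks_add]
      simp only [mul_add, mul_smul_comm, mul_one, one_mul, zero_mul, add_zero, zero_add, smul_zero,
        mul_sub]
      congr 1 <;> (try simp only [sub_self, smul_zero]) <;> abel
    have eV : ∀ t, V t =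
        ((Real.cos (Real.pi / 2 * t) * Real.cos (Real.pi / 2 * t) : ℝ) : ℂ) •
            Matrix.fromBlocks v 0 0 u +
          ((Real.sin (Real.pi / 2 * t) * Real.sin (Real.pi / 2 * t) : ℝ) : ℂ) •
            Matrix.fromBlocks 1 0 0 (v * u) +
          ((Real.cos (Real.pi / 2 * t) * Real.sin (Real.pi / 2 * t) : ℝ) : ℂ) •
            Matrix.fromBlocks 0 (v * u - u) (v - 1) 0 := by
      intro t
      simp only [V]
      rw [conj_eq, Matrix.fromBlocks_multiply, Matrix.fromBlocks_smul, Matrix.fromBlocks_smul,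
        Matrix.fromBlocks_smul, Matrix.fromBlocks_add, Matrix.fromBlocks_add]
      simp only [add_mul, smul_mul_assoc, mul_one, one_mul, mul_zero, add_zero, zero_add, smul_zero,
        sub_mul]
      congr 1 <;> abel
    -- The weights cos² and sin² turn N and 1 + ε into at most N + ε, and the off-diagonal part
    -- contributes at most (N + 1 + ε)/2 ≤ N + ε. This is the origin of 2(N + ε).
    have bound : ∀ (t : ℝ) (a b d : Matrix (ι ⊕ ι) (ι ⊕ ι) X.carrier), ‖a‖ ≤ N → ‖b‖ ≤ 1 + ε →
        ‖d‖ ≤ N + 1 + ε →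
        ‖((Real.cos (Real.pi / 2 * t) * Real.cos (Real.pi / 2 * t) : ℝ) : ℂ) • a +
          ((Real.sin (Real.pi / 2 * t) * Real.sin (Real.pi / 2 * t) : ℝ) : ℂ) • b +
          ((Real.cos (Real.pi / 2 * t) * Real.sin (Real.pi / 2 * t) : ℝ) : ℂ) • d‖ ≤ 2 * (N + ε) := by
      intro t a b d ha hb hd
      set c := Real.cos (Real.pi / 2 * t)
      set s := Real.sin (Real.pi / 2 * t)
      have hcs : c ^ 2 + s ^ 2 = 1 := Real.cos_sq_add_sin_sq _
      refine (norm_add₃_le).trans ?_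
      rw [norm_smul, norm_smul, norm_smul, Complex.norm_real, Complex.norm_real, Complex.norm_real,
        Real.norm_of_nonneg (mul_self_nonneg c), Real.norm_of_nonneg (mul_self_nonneg s),
        Real.norm_eq_abs]
      have k1 : |c * s| ≤ 1 / 2 := by
        rw [abs_le]
        constructor <;> nlinarith [sq_nonneg (c + s), sq_nonneg (c - s)]
      have k2 : |c * s| * ‖d‖ ≤ 1 / 2 * (N + 1 + ε) := by
        gcongr
      have k3 : c * c * ‖a‖ ≤ c * c * (N + ε) :=
        mul_le_mul_of_nonneg_left (by linarith) (mul_self_nonneg c)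
      have k4 : s * s * ‖b‖ ≤ s * s * (N + ε) :=
        mul_le_mul_of_nonneg_left (by linarith) (mul_self_nonneg s)
      have k5 : c * c * (N + ε) + s * s * (N + ε) = N + ε := by
        rw [← add_mul, ← sq, ← sq, hcs, one_mul]
      linarith
    have memcomb : ∀ (t : ℝ) (a b d : Matrix (ι ⊕ ι) (ι ⊕ ι) X.carrier),
        (∀ i j, a i j ∈ X.fil (2 * r)) → (∀ i j, b i j ∈ X.fil (2 * r)) →
        (∀ i j, d i j ∈ X.fil (2 * r)) → ∀ i j,
        (((Real.cos (Real.pi / 2 * t) * Real.cos (Real.pi / 2 * t) : ℝ) : ℂ) • a +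
          ((Real.sin (Real.pi / 2 * t) * Real.sin (Real.pi / 2 * t) : ℝ) : ℂ) • b +
          ((Real.cos (Real.pi / 2 * t) * Real.sin (Real.pi / 2 * t) : ℝ) : ℂ) • d) i j ∈
            X.fil (2 * r) := fun t a b d ha hb hd i j =>
      Submodule.add_mem _ (entries_combo ha hb _ _ i j) (Submodule.smul_mem _ _ (hd i j))
    have anti_mem : ∀ {x y : Matrix ι ι X.carrier}, (∀ i j, x i j ∈ X.fil (2 * r)) →
        (∀ i j, y i j ∈ X.fil (2 * r)) →
        ∀ i j, Matrix.fromBlocks 0 x y 0 i j ∈ X.fil (2 * r) := by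
      intro x y hx hy
      rintro (i | i) (j | j)
      · exact Submodule.zero_mem _
      · exact hx i j
      · exact hy i j
      · exact Submodule.zero_mem _
    have sub_mem : ∀ {x y : Matrix ι ι X.carrier}, (∀ i j, x i j ∈ X.fil (2 * r)) →
        (∀ i j, y i j ∈ X.fil (2 * r)) → ∀ i j, (x - y) i j ∈ X.fil (2 * r) :=
      fun hx hy i j => Submodule.sub_mem _ (hx i j) (hy i j)
    have mu := fil_mono_mem hr hr2 h1
    have mv := fil_mono_mem hr hr2 h2
    have m1 := one_entry_mem (X := X) (ι := ι) r2
    have muv := mul_entries_mem hr h1 h2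
    have mvu := mul_entries_mem hr h2 h1
    have eUV : ∀ t, U t * V t = Matrix.fromBlocks (u * v) 0 0 (v * u) := by
      intro t
      have hcomm : rot X ι t * Matrix.fromBlocks v 0 0 v * rotInv X ι t =
          Matrix.fromBlocks v 0 0 v := by
        rw [conj_eq]
        simp only [sub_self, smul_zero]
        rw [← add_smul, ← add_smul, ← Complex.ofReal_add, ← Complex.ofReal_add, ← sq, ← sq,
          Real.cos_sq_add_sin_sq, Real.sin_sq_add_cos_sq]
        simp
      calc U t * V t = Matrix.fromBlocks u 0 0 1 *
            ((rot X ι t * Matrix.fromBlocks 1 0 0 v * rotInv X ι t) *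
              (rot X ι t * Matrix.fromBlocks v 0 0 1 * rotInv X ι t)) *
              Matrix.fromBlocks 1 0 0 u := by simp only [U, V, mul_assoc]
        _ = _ := by
          rw [conj_mul_conj, blocks_mul, one_mul, mul_one, hcomm, blocks_mul, blocks_mul, mul_one,
            one_mul]
    have eVU : ∀ t, V t * U t =
        rot X ι t * Matrix.fromBlocks (v * u) 0 0 (u * v) * rotInv X ι t := by
      intro t
      have hcomm : rot X ι t * Matrix.fromBlocks u 0 0 u * rotInv X ι t =
          Matrix.fromBlocks u 0 0 u := by
        rw [conj_eq]
        simp only [sub_self, smul_zero]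
        rw [← add_smul, ← add_smul, ← Complex.ofReal_add, ← Complex.ofReal_add, ← sq, ← sq,
          Real.cos_sq_add_sin_sq, Real.sin_sq_add_cos_sq]
        simp
      calc V t * U t = (rot X ι t * Matrix.fromBlocks v 0 0 1 * rotInv X ι t) *
            (Matrix.fromBlocks 1 0 0 u * Matrix.fromBlocks u 0 0 1) *
              (rot X ι t * Matrix.fromBlocks 1 0 0 v * rotInv X ι t) := by
            simp only [U, V, mul_assoc]
        _ = _ := by
          rw [blocks_mul, one_mul, mul_one, ← hcomm, conj_mul_conj, conj_mul_conj, blocks_mul,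
            blocks_mul, one_mul, mul_one]
    refine ⟨Matrix.fromBlocks v 0 0 u, Matrix.fromBlocks 1 0 0 (v * u),
      ⟨⟨fun t => U t, by fun_prop⟩, ?_, ?_⟩, ⟨⟨fun t => V t, by fun_prop⟩, ?_, ?_⟩, fun t => ?_⟩
    · show U ((0 : unitInterval) : ℝ) = _
      rw [eU]; simp
    · show U ((1 : unitInterval) : ℝ) = _
      rw [eU]; simp
    · show V ((0 : unitInterval) : ℝ) = _
      rw [eV]; simp
    · show V ((1 : unitInterval) : ℝ) = _
      rw [eV]; simp
    show X.IsInvPair _ _ _ (U t) (V t)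
    refine ⟨?_, ?_, ?_, ?_, ?_, ?_⟩
    · rw [eU]
      exact memcomb _ _ _ _ (blocks_mem mu mv) (blocks_mem muv m1)
        (anti_mem (sub_mem mu muv) (sub_mem m1 mv))
    · rw [eV]
      exact memcomb _ _ _ _ (blocks_mem mv mu) (blocks_mem m1 mvu)
        (anti_mem (sub_mem mvu mu) (sub_mem mv m1))
    · rw [eU]
      refine bound _ _ _ _ ((norm_blocks_le _ _).trans (max_le h3 h4))
        ((norm_blocks_le _ _).trans (max_le huv (by linarith)))
        ((norm_antiblocks_le _ _).trans (max_le ?_ ?_))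
      · exact (norm_sub_le _ _).trans (by linarith)
      · exact (norm_sub_le _ _).trans (by linarith)
    · rw [eV]
      refine bound _ _ _ _ ((norm_blocks_le _ _).trans (max_le h4 h3))
        ((norm_blocks_le _ _).trans (max_le (by linarith) hvu))
        ((norm_antiblocks_le _ _).trans (max_le ?_ ?_))
      · exact (norm_sub_le _ _).trans (by linarith)
      · exact (norm_sub_le _ _).trans (by linarith)
    · rw [eUV, ← Matrix.fromBlocks_one, blocks_sub]
      exact (norm_blocks_le _ _).trans_lt (max_lt (by linarith) (by linarith))
    · have := conj_sub (t : ℝ) (Matrix.fromBlocks (v * u) 0 0 (u * v))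
        (1 : Matrix (ι ⊕ ι) (ι ⊕ ι) X.carrier)
      rw [conj_one] at this
      rw [eVU, this]
      rw [← Matrix.fromBlocks_one, blocks_sub]
      exact norm_conj_lt _ h6 h5
  have second : X.InvHomotopic (2 * ε) (2 * r) (2 * (N + ε))
      (Matrix.fromBlocks (u * v) 0 0 (1 : Matrix ι ι X.carrier)) 1 := by
    rw [← Matrix.fromBlocks_one]
    have small : ‖Matrix.fromBlocks (u * v) 0 0 (1 : Matrix ι ι X.carrier) - 1‖ ≤ ε := by
      rw [← Matrix.fromBlocks_one, blocks_sub]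
      refine (norm_blocks_le _ _).trans (max_le h5.le ?_)
      rw [sub_self, norm_zero]; exact hε.le
    have one' : (1 : Matrix (ι ⊕ ι) (ι ⊕ ι) X.carrier) = Matrix.fromBlocks 1 0 0 1 :=
      Matrix.fromBlocks_one.symm
    have pb : X.IsInvPair (2 * ε) (2 * r) (2 * (N + ε))
        (1 : Matrix (ι ⊕ ι) (ι ⊕ ι) X.carrier) (Matrix.fromBlocks (u * v) 0 0 1) := by
      refine ⟨one_entry_mem r2, blocks_mem (mul_entries_mem hr h1 h2) (one_entry_mem r2),
        norm_one_le.trans (by linarith), (norm_blocks_le _ _).trans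
          (max_le (by linarith) (by linarith)), ?_, ?_⟩
      · rw [one_mul]; linarith
      · rw [mul_one]; linarith
    have pc := (one_isInvPair (X := X) (ι := ι ⊕ ι) (show 0 < 2 * ε by linarith) r2
      (show 1 ≤ 2 * (N + ε) by linarith))
    rw [← one']
    -- Here 1 is a constant quasi-inverse of the whole segment. `IsInvPair.combo` moves the second
    -- member of a pair, so the members are exchanged afterwards.
    refine ⟨1, 1, segPath _ _, Path.refl 1, fun t => ?_⟩
    have := pb.combo pc t
    exact ⟨this.2.1, this.1, this.2.2.2.1, this.2.2.1, this.2.2.2.2.2, this.2.2.2.2.1⟩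
  exact first.trans second

end Pair

end FilteredMatrixAlgebra
end QuantK

namespace QuantK
namespace FilteredMatrixAlgebra

/-! ### Conjugation, compressions and reduced classes -/

section Compress

variable {p : ℝ≥0∞} [Fact (1 ≤ p)] {X : FilteredMatrixAlgebra.{u} p}
  {Y : FilteredMatrixAlgebra.{v} p} {ι κ : Type} [Fintype ι] [DecidableEq ι] [Fintype κ]
  [DecidableEq κ] {s : Scale} {a b c d n m : ℕ} {x y z w x' y' : Matrix ι ι X.carrier}
  {P Q : Param}

/-- Conjugate quasi-idempotents have the same class. -/
lemma ConjLift.icls_eq {φ : Hom X Y} {e f : Matrix ι ι Y.carrier} (h : ConjLift s n φ e f)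
    (he : QI s n e) (hf : Bd s n f) (hQ : s.Above (10000 * n + 10000) Q) : icls Q e = icls Q f := by
  obtain ⟨S, S', hS, hc⟩ := h
  have h1 := he.conj_homotopic (hS.map φ).qp
  have h2 := IH.of_close (he.conj (hS.map φ).qp) hf hc
  have i1 := he.isIdem_of_above (Q := Q) (hQ.mono (by omega))
  have i2 := (he.conj (hS.map φ).qp).isIdem_of_above (Q := Q) (hQ.mono (by omega))
  rw [← h2.icls_eq (Q := Q) (hQ.mono (by omega)), ← icls_pad (κ := ι) i1, ← icls_pad (κ := ι) i2]
  exact (h1.icls_eq (Q := Q) (hQ.mono (by omega))).symm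

/-- The braid conjugates diag(x, 1 - x) to diag(0, 1). This allows negative classes to be replaced
by complements. -/
lemma QI.icls_add_compl (h : QI s n x) (hQ : s.Above (1000000 * n + 1000000) Q) :
    icls Q x + icls Q (1 - x) = icls Q (1 : Matrix ι ι X.carrier) := by
  have h1 := h.isIdem_of_above (Q := Q) (hQ.mono (by omega))
  have h2 := h.one_sub.isIdem_of_above (Q := Q) (hQ.mono (by omega))
  have h3 := (h.conjLift_braid (lifting_id s)).icls_eq (Q := Q) (n := 20 * n + 40)
    ((h.blocks h.one_sub).mono (by simp; omega)) ((Bd.zero.blocks Bd.one).mono (by simp))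
    (hQ.mono (by omega))
  rw [icls_blocks h1 h2] at h3
  have h4 : X.IsIdem Q.ε Q.r Q.N (1 : Matrix ι ι X.carrier) := by
    rw [← pr_true]; exact (qi_pr (s := s) _).isIdem_of_above (hQ.mono (by omega))
  rw [h3, icls_blocks isIdem_zero h4, icls_zero, zero_add]

/-- The difference of the classes of two quasi-idempotents is the difference of the classes of a
quasi-idempotent and of a scalar projection. -/
lemma icls_sub_eq {f : Matrix κ κ X.carrier} (he : QI s n x) (hf : QI s n f)
    (hQ : s.Above (1000000 * n + 1000000) Q) :
    icls Q x - icls Q f = icls Q (Matrix.fromBlocks x 0 0 (1 - f)) -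
      icls Q (pr X (Sum.elim (fun _ : ι => false) (fun _ : κ => true))) := by
  have h1 := he.isIdem_of_above (Q := Q) (hQ.mono (by omega))
  have h2 := hf.one_sub.isIdem_of_above (Q := Q) (hQ.mono (by omega))
  have h4 : X.IsIdem Q.ε Q.r Q.N (1 : Matrix κ κ X.carrier) := by
    rw [← pr_true]; exact (qi_pr (s := s) _).isIdem_of_above (hQ.mono (by omega))
  rw [← pr_blocks, pr_false, pr_true, icls_blocks h1 h2, icls_blocks isIdem_zero h4, icls_zero,
    zero_add, ← hf.icls_add_compl hQ]
  abel

/-- `e x e + (1 - e)`. -/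
def compress (e x : Matrix ι ι X.carrier) : Matrix ι ι X.carrier := e * x * e + (1 - e)

lemma map_compress (φ : Hom X Y) (e x : Matrix ι ι X.carrier) :
    φ.mat (compress e x) = compress (φ.mat e) (φ.mat x) := by
  rw [compress, map_add, map_sub, φ.mat_mul, φ.mat_mul, φ.mat_one]; rfl

lemma Bd.compress {e : Matrix ι ι X.carrier} (he : Bd s 0 e) (hx : Bd s n x) :
    Bd s (n + 5) (compress e x) :=
  (((he.mul hx).mul he).add (Bd.one.sub he)).mono (by omega)

lemma Cl.compress {e : Matrix ι ι X.carrier} (he : Bd s 0 e) (h : Cl s n x y) :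
    Cl s (n + 1) (compress e x) (compress e y) :=
  ((Cl.mul_right he (Cl.mul_left he h)).add (Cl.refl _)).mono (by omega)

/-- Multiply x e x' ≈ e by x on the right and cancel x'x. -/
lemma QP.cl_comm {e : Matrix ι ι X.carrier} (h : QP s n x x') (he : Bd s 0 e)
    (hc : Cl s n (x * e * x') e) : Cl s (5 * n + 5) (x * e) (e * x) := by
  have i1 := Cl.mul_right h.1 hc
  have i2 := Cl.mul_left (h.1.mul he) h.2.2.2
  rw [mul_one, ← mul_assoc] at i2
  exact (i2.symm.trans i1).mono (by omega)

/-- Compressions of quasi-inverses that almost commute with the projection are quasi-inverses. -/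
lemma QP.compress {e : Matrix ι ι X.carrier} (h : QP s n x x') (he : Bd s 0 e) (hee : e * e = e)
    (hc : Cl s n (x * e * x') e) : QP s (10 * n + 20) (compress e x) (compress e x') := by
  have c1 := h.cl_comm he hc
  have c2 : Cl s (5 * n + 5) (x' * e) (e * x') := by
    have i1 := Cl.mul_left h.2.1 hc
    have i2 := Cl.mul_right (he.mul h.2.1) h.2.2.2
    have e1 : x' * x * (e * x') = x' * (x * e * x') := by simp only [mul_assoc]
    rw [one_mul, e1] at i2
    exact (i1.symm.trans i2).mono (by omega)
  -- Since e is an exact idempotent, the product of the two compressions equals e(ae)(a'e) + (1 - e)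
  -- on the nose. Moving e past a then leaves e(aa')e + (1 - e) ≈ 1.
  have key : ∀ {a a' : Matrix ι ι X.carrier}, Bd s n a → Bd s n a' → Cl s n (a * a') 1 →
      Cl s (5 * n + 5) (a * e) (e * a) →
      Cl s (10 * n + 20) (FilteredMatrixAlgebra.compress e a * FilteredMatrixAlgebra.compress e a') 1 := by
    intro a a' ha ha' haa hae
    have e1 : FilteredMatrixAlgebra.compress e a * FilteredMatrixAlgebra.compress e a' =
        e * (a * e) * (a' * e) + (1 - e) := by
      have e2 : FilteredMatrixAlgebra.compress e a * FilteredMatrixAlgebra.compress e a' =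
        e * a * (e * e) * (a' * e) + (e * a * (e - e * e)) + ((e - e * e) * a' * e) +
          (1 - e - e + e * e) := by
        rw [FilteredMatrixAlgebra.compress, FilteredMatrixAlgebra.compress]; noncomm_ring
      rw [e2, hee, sub_self]
      simp only [mul_zero, zero_mul, add_zero, mul_assoc]
      congr 1; abel
    have e3 : e * (e * a) * (a' * e) = e * (a * a') * e := by
      rw [← mul_assoc e e a, hee]; simp only [mul_assoc]
    have i1 := Cl.mul_right (ha'.mul he) (Cl.mul_left he hae)
    have i2 := Cl.mul_right he (Cl.mul_left he haa)
    rw [e3] at i1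
    rw [mul_one, hee] at i2
    have i3 := (i1.trans i2).add (Cl.refl (1 - e))
    rw [add_sub_cancel, ← e1] at i3
    exact i3.mono (by omega)
  exact ⟨(Bd.compress he h.1).mono (by omega), (Bd.compress he h.2.1).mono (by omega),
    key h.1 h.2.1 h.2.2.1 c1, key h.2.1 h.1 h.2.2.2 c2⟩

/-- If `S` conjugates `x` to `y`, and `t` conjugates `y` to itself, then `t⁻¹ S` conjugates `x`
to `y`. -/
lemma Cl.conj_conj {t t' S S' : Matrix ι ι X.carrier} (ht : EP s n t t') (hS : Cl s m (S * x * S') y)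
    (hy : Cl s m (t * y * t') y) : Cl s (4 * n + 4 * m + 4) (t' * S * x * (S' * t)) y := by
  have i1 := Cl.mul_right ht.1 (Cl.mul_left ht.2.1 hS)
  have i2 := Cl.mul_right ht.1 (Cl.mul_left ht.2.1 hy)
  have e1 : t' * (t * y * t') * t = y := by
    have : t' * (t * y * t') * t = (t' * t) * y * (t' * t) := by simp only [mul_assoc]
    rw [this, ht.2.2.2, one_mul, mul_one]
  rw [e1] at i2
  have e2 : t' * (S * x * S') * t = t' * S * x * (S' * t) := by simp only [mul_assoc]
  rw [e2] at i1
  exact (i1.trans i2.symm).mono (by omega)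

lemma mat_id (x : Matrix ι ι X.carrier) : (Hom.id X).mat x = x := by ext i k; rfl

variable [Fact (p ≠ ∞)]

lemma gcls_mem_K1red {u : Matrix ι ι X.carrier} (hu : X.IsInv P.ε P.r P.N u) :
    gcls P u ∈ X.K1red P ↔ gcls P (X.augHom.mat u) = 0 := by
  rw [← mapGL_gcls X.augHom (le_refl P) hu]; rfl

lemma mem_K1red_of_aug_eq_one {u : Matrix ι ι X.carrier} (hu : X.IsInv P.ε P.r P.N u)
    (h : X.augHom.mat u = 1) : gcls P u ∈ X.K1red P := by
  rw [gcls_mem_K1red hu, h, gcls_one]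

lemma icls_sub_mem_K0red {e : Matrix ι ι X.carrier} {f : Matrix κ κ X.carrier}
    (he : X.IsIdem P.ε P.r P.N e) (hf : X.IsIdem P.ε P.r P.N f) :
    icls P e - icls P f ∈ X.K0red P ↔
      icls P (X.augHom.mat e) = icls P (X.augHom.mat f) := by
  rw [← mapK0u_icls X.augHom (le_refl P) he, ← mapK0u_icls X.augHom (le_refl P) hf, ← sub_eq_zero,
    ← map_sub]; rfl

lemma aug_mat_eq (φ : Hom X Y) (x : Matrix ι ι X.carrier) :
    Y.augHom.mat (φ.mat x) = X.augHom.mat x := by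
  ext i k; exact φ.aug_comp _

lemma aug_unit (η : Hom (scalars p) X) (x : Matrix ι ι (scalars p).carrier) :
    X.augHom.mat (η.mat x) = x := by
  ext i k; exact η.aug_comp _

end Compress

namespace Extension

section

variable {p : ℝ≥0∞} [Fact (1 ≤ p)] [Fact (p ≠ ∞)]
  {C : ℝ} {XJ XA XQ : FilteredMatrixAlgebra.{u} p} (E : Extension C XJ XA XQ)
  {s : Scale} {ι κ μ ν : Type} [Fintype ι] [DecidableEq ι] [Fintype κ] [DecidableEq κ]
  [Fintype μ] [DecidableEq μ] [Fintype ν] [DecidableEq ν] {n m : ℕ} {P P' Q R R' : Param}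

/-- The composition J^♯ → (A/J)^♯ factors through the augmentation followed by the units, so it
annihilates the kernel of the augmentation on K-groups. The unit has to be contractive on matrices
for this to make sense at the level of K-groups. -/
lemma q_j_mat (x : Matrix ι ι XJ.carrier) :
    E.q.mat (E.j.mat x) = E.q.mat (E.unitA.mat (XJ.augHom.mat x)) := by
  ext i k
  refine (E.q_j (x i k)).trans ?_
  have h1 : E.unitA.toAlgHom (XJ.aug (x i k)) = algebraMap ℂ _ (XJ.aug (x i k)) :=
    E.unitA.toAlgHom.commutes _
  show _ = E.q.toAlgHom (E.unitA.toAlgHom (XJ.aug (x i k)))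
  rw [h1, AlgHom.commutes]

lemma dcls_mem_K0red {y : Matrix (ι ⊕ κ) (ι ⊕ κ) XJ.carrier}
    (hy : QI s n (y + corn XJ ι κ)) (h : ∀ i k, XJ.aug (y i k) = 0) (hQ : s.Above (n + 1) Q) :
    dcls Q y ∈ XJ.K0red Q := by
  have i1 := hy.isIdem_of_above hQ
  have i3 := (qi_corn (X := XJ) (ι := ι) (κ := κ)).isIdem_of_above (hQ.mono (by omega))
  rw [dcls, icls_sub_mem_K0red i1 i3, map_add]
  have : XJ.augHom.mat y = 0 := by ext i k; exact h i k
  rw [this, zero_add]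

/-! ### Vanishing of the compositions -/

lemma q_j_K1 (hP : P ≤ P') (hQ : P' ≤ Q) {a : XJ.K1u P} (ha : a ∈ XJ.K1red P) :
    E.q.mapGL hQ (E.j.mapGL hP a) = 0 := by
  obtain ⟨k, u, hu, rfl⟩ := exists_gcls a
  rw [gcls_mem_K1red hu] at ha
  have inv : ∀ {Y : FilteredMatrixAlgebra.{u} p} (φ : Hom XJ Y) {T : Param}, P ≤ T →
      Y.IsInv T.ε T.r T.N (φ.mat u) := by
    intro Y φ T h
    obtain ⟨v, hv⟩ := hu
    exact ⟨_, (φ.isInvPair P.r_pos hv).mono P.r_pos h.1 h.2.1 h.2.2⟩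
  have inv2 : (scalars p).IsInv P.ε P.r P.N (XJ.augHom.mat u) := by
    obtain ⟨v, hv⟩ := hu
    exact ⟨_, XJ.augHom.isInvPair P.r_pos hv⟩
  have inv3 : XA.IsInv P'.ε P'.r P'.N (E.unitA.mat (XJ.augHom.mat u)) := by
    obtain ⟨v, hv⟩ := inv2
    exact ⟨_, (E.unitA.isInvPair P.r_pos hv).mono P.r_pos hP.1 hP.2.1 hP.2.2⟩
  rw [mapGL_gcls E.j hP hu, mapGL_gcls E.q hQ (inv E.j hP), E.q_j_mat,
    ← mapGL_gcls E.q hQ inv3, ← mapGL_gcls E.unitA hP inv2, ha, map_zero, map_zero]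

lemma q_j_K0 (hP : P ≤ P') (hQ : P' ≤ Q) {a : XJ.K0u P} (ha : a ∈ XJ.K0red P) :
    E.q.mapK0u hQ (E.j.mapK0u hP a) = 0 := by
  obtain ⟨k, m, e, f, he, hf, rfl⟩ := exists_icls a
  rw [icls_sub_mem_K0red he hf] at ha
  have key : ∀ {k : ℕ} {e : Matrix (Fin k) (Fin k) XJ.carrier}, XJ.IsIdem P.ε P.r P.N e →
      E.q.mapK0u hQ (E.j.mapK0u hP (icls P e)) =
        E.q.mapK0u hQ (E.unitA.mapK0u hP (icls P (XJ.augHom.mat e))) := by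
    intro k e he
    have i1 := (E.j.isIdem P.r_pos he).mono P.r_pos hP.1 hP.2.1 hP.2.2
    have i2 := XJ.augHom.isIdem P.r_pos he
    have i3 := (E.unitA.isIdem P.r_pos i2).mono P.r_pos hP.1 hP.2.1 hP.2.2
    rw [mapK0u_icls E.j hP he, mapK0u_icls E.q hQ i1, mapK0u_icls E.unitA hP i2,
      mapK0u_icls E.q hQ i3, E.q_j_mat]
  rw [map_sub, map_sub, key he, key hf, ha, sub_self]

/-- If u comes from A^♯, then diag(u, u') with u' over A^♯ is itself a lift. It is block diagonal,
so it almost preserves the corner and y = 0 is admissible. -/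
lemma bdry_q {hs : 40 * C ≤ s.M} {hn : 11000 ≤ n} {hP' : s.Below 1 P'}
    {hQ : s.Above (10000000000000000 * (n + 11000) + 10000000000000000) Q} (hP : P ≤ P')
    (a : XA.K1u P) : E.bdry hs n hn hP' hQ (E.q.mapGL hP a) = 0 := by
  obtain ⟨k, u, hu, rfl⟩ := exists_gcls a
  obtain ⟨u', hu'⟩ := hu.exists_qp (n := 1) ⟨hP.1.trans hP'.1, hP.2.1.trans hP'.2.1,
    hP.2.2.trans hP'.2.2⟩
  have hu2 : XQ.IsInv P'.ε P'.r P'.N (E.q.mat u) := by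
    obtain ⟨v, hv⟩ := hu
    exact ⟨_, (E.q.isInvPair P.r_pos hv).mono P.r_pos hP.1 hP.2.1 hP.2.2⟩
  have hd : E.IsDatum s n (E.q.mat u) (Matrix.fromBlocks u 0 0 u') (Matrix.fromBlocks u' 0 0 u)
      (0 : Matrix (Fin k ⊕ Fin k) (Fin k ⊕ Fin k) XJ.carrier) := by
    refine ⟨⟨_, (hu'.map E.q).mono (by omega)⟩, (hu'.blocks hu'.symm).mono (by simp; omega),
      ⟨E.q.mat u', ?_⟩, Bd.zero.mono (by omega), fun _ _ => map_zero _, ?_⟩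
    · rw [map_blocks]; exact (Cl.refl _).mono (by omega)
    · rw [map_zero, add_zero, blocks_mul_corn, blocks_mul, zero_mul]
      exact (hu'.2.2.1.blocks (Cl.refl (0 : Matrix (Fin k) (Fin k) XA.carrier))).mono
        (by simp; omega)
  rw [mapGL_gcls E.q hP hu, bdry_gcls hu2 hd, dcls_zero]

/-- Over A^♯ the lift w is available as a conjugating element, so y + diag(1, 0) and diag(1, 0) have
the same class there. -/
lemma j_bdry {hs : 40 * C ≤ s.M} {hn : 11000 ≤ n} {hP : s.Below 1 P}
    {hQ : s.Above (10000000000000000 * (n + 11000) + 10000000000000000) Q} (hR : Q ≤ R)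
    (a : XQ.K1u P) : E.j.mapK0u hR (E.bdry hs n hn hP hQ a) = 0 := by
  obtain ⟨k, u, hu, rfl⟩ := exists_gcls a
  obtain ⟨u', hu'⟩ := hu.exists_qp hP
  obtain ⟨w, w', y, hw, -, -, h⟩ := E.exists_isDatum hs hu'
  have i1 := h.qi.isIdem_of_above (Q := Q) (hQ.mono (by omega))
  have i2 := (qi_corn (X := XJ) (ι := Fin k) (κ := Fin k)).isIdem_of_above (hQ.mono (by omega))
  rw [bdry_gcls hu (h.mono (by omega)), dcls, map_sub, mapK0u_icls E.j hR i1,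
    mapK0u_icls E.j hR i2, map_corn, sub_eq_zero]
  have hc : ConjLift s 100000 (Hom.id XA) (corn XA (Fin k) (Fin k)) (E.j.mat (y + corn XJ _ _)) :=
    ⟨w, w', hw.mono (by omega), by rw [mat_id, mat_id]; exact h.approx'.mono (by omega)⟩
  exact (hc.icls_eq (qi_corn.mono (by omega)) ((h.bd'.map E.j).mono (by omega))
    ((hQ.trans hR).mono (by omega))).symm

end

end Extension

end FilteredMatrixAlgebra
end QuantK

namespace QuantK

/-- The parameters at a level of a scale. -/
def Scale.level (s : Scale) (n : ℕ) (h : s.M ^ n * s.ε < 1 / 20) : Param where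
  ε := s.M ^ n * s.ε
  r := s.M ^ n * s.r
  N := s.M ^ n
  ε_pos := mul_pos (s.pow_pos n) s.ε_pos
  ε_lt := h
  r_pos := mul_pos (s.pow_pos n) s.r_pos
  one_le_N := s.one_le_pow n

/-- An equality of classes can be exploited quantitatively only at parameters bounded by a level.
The target parameters may be arbitrarily large, so equalities are tested at an intermediate T equal
to the level. -/
lemma Scale.Above.exists_level {s : Scale} {n : ℕ} {Q : Param} (h : s.Above n Q) :
    ∃ T : Param, s.Above n T ∧ s.Below n T ∧ T ≤ Q :=
  ⟨s.level n (h.1.trans_lt Q.ε_lt), ⟨le_rfl, le_rfl, le_rfl⟩, ⟨le_rfl, le_rfl, le_rfl⟩, h⟩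

namespace FilteredMatrixAlgebra

/-! ### Exchange of coordinates and normal forms in K_0 -/

section Flip

variable {p : ℝ≥0∞} [Fact (1 ≤ p)] {X : FilteredMatrixAlgebra.{u} p}
  {Y : FilteredMatrixAlgebra.{v} p} {ι κ : Type} [Fintype ι] [DecidableEq ι] [Fintype κ]
  [DecidableEq κ] {s : Scale} {n m : ℕ} {P Q R : Param}

lemma compress_blocks (e x : Matrix ι ι X.carrier) (f y : Matrix κ κ X.carrier) :
    compress (Matrix.fromBlocks e 0 0 f) (Matrix.fromBlocks x 0 0 y) =
      Matrix.fromBlocks (compress e x) 0 0 (compress f y) := by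
  rw [compress, blocks_mul, blocks_mul, ← Matrix.fromBlocks_one, blocks_sub, ← blocks_add]; rfl

lemma compress_corn (x : Matrix ι ι X.carrier) (y : Matrix κ κ X.carrier) :
    compress (corn X ι κ) (Matrix.fromBlocks x 0 0 y) = Matrix.fromBlocks x 0 0 1 := by
  rw [corn, compress_blocks, compress, compress]
  simp

lemma compress_one {e : Matrix ι ι X.carrier} (he : e * e = e) : compress e 1 = 1 := by
  rw [compress, mul_one, he, add_sub_cancel]

/-- Exchange of the two copies of the indices outside `b`. -/
def flip (b : ι → Bool) : ι ⊕ ι ≃ ι ⊕ ι where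
  toFun := Sum.elim (fun i => if b i = true then .inl i else .inr i)
    (fun i => if b i = true then .inr i else .inl i)
  invFun := Sum.elim (fun i => if b i = true then .inl i else .inr i)
    (fun i => if b i = true then .inr i else .inl i)
  left_inv := by rintro (i | i) <;> by_cases h : b i = true <;> simp [h]
  right_inv := by rintro (i | i) <;> by_cases h : b i = true <;> simp [h]

lemma pr_mul_apply (b : ι → Bool) (x : Matrix ι ι X.carrier) (i k : ι) :
    (pr X b * x) i k = if b i = true then x i k else 0 := by
  rw [pr, Matrix.diagonal_mul]; split_ifs <;> simp

lemma mul_pr_apply (b : ι → Bool) (x : Matrix ι ι X.carrier) (i k : ι) :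
    (x * pr X b) i k = if b k = true then x i k else 0 := by
  rw [pr, Matrix.mul_diagonal]; split_ifs <;> simp

lemma pr_not (b : ι → Bool) : pr X (fun i => !b i) = 1 - pr X b := by
  ext i k
  rw [pr, pr, Matrix.sub_apply, Matrix.one_apply, Matrix.diagonal_apply, Matrix.diagonal_apply]
  by_cases h : i = k
  · subst h; cases b i <;> simp
  · simp [h]

/-- Boundary data are formulated for the corner, whereas a scalar projection has its ones anywhere.
The exchange carries diag(p, 1-p), with p the projection given by b, to the corner, and diag(x, 1)
to a matrix with the two compressions of x on the diagonal and the mixed terms pxp^⊥ and p^⊥xp off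
it. These are small when x almost commutes with p. -/
lemma blocks_one_flip (b : ι → Bool) (x : Matrix ι ι X.carrier) :
    (Matrix.fromBlocks x 0 0 (1 : Matrix ι ι X.carrier)).submatrix (flip b) (flip b) =
      Matrix.fromBlocks (compress (pr X b) x) (pr X b * x * pr X (fun i => !b i))
        (pr X (fun i => !b i) * x * pr X b) (compress (pr X fun i => !b i) x) := by
  rw [compress, compress, ← pr_not, ← pr_not]
  have e : ∀ (b : ι → Bool) (i k : ι), pr X b i k = if i = k then if b i = true then 1 else 0 else 0 :=
    fun b i k => by rw [pr, Matrix.diagonal_apply]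
  ext (i | i) (k | k) <;> by_cases hi : b i = true <;> by_cases hk : b k = true <;>
    by_cases h : i = k <;>
    simp_all [flip, mul_pr_apply, pr_mul_apply]

lemma pr_flip (b : ι → Bool) : (Matrix.fromBlocks (pr X b) 0 0 (pr X fun i => !b i)).submatrix
    (flip b) (flip b) = corn X ι ι := by
  rw [pr_blocks, pr_submatrix, corn_eq_pr]
  congr 1
  funext i
  rcases i with i | i <;> rcases hi : b i <;> simp [flip, hi]

lemma Cl.fromBlocks_zero {x y a d : Matrix ι ι X.carrier} (hx : Cl s n x 0) (hy : Cl s n y 0) :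
    Cl s (2 * n + 1) (Matrix.fromBlocks a x y d) (Matrix.fromBlocks a 0 0 d) :=
  ((Cl.refl a).fromBlocks hx hy (Cl.refl d)).mono (by omega)

lemma mapK0u_id_left (φ : Hom X Y) (h : P ≤ Q) (h' : Q ≤ R) (a : X.K0u P) :
    φ.mapK0u h' ((Hom.id X).mapK0u h a) = φ.mapK0u (h.trans h') a := by
  obtain ⟨k, m, e, f, he, hf, rfl⟩ := exists_icls a
  have key : ∀ {k : ℕ} {e : Matrix (Fin k) (Fin k) X.carrier}, X.IsIdem P.ε P.r P.N e →
      φ.mapK0u h' ((Hom.id X).mapK0u h (icls P e)) = φ.mapK0u (h.trans h') (icls P e) := by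
    intro k e he
    have he' : X.IsIdem Q.ε Q.r Q.N ((Hom.id X).mat e) :=
      ((Hom.id X).isIdem P.r_pos he).mono P.r_pos h.1 h.2.1 h.2.2
    rw [mapK0u_icls _ h he, mapK0u_icls _ h' he', mapK0u_icls _ _ he, mat_id]
  simp only [map_sub, key he, key hf]

lemma mapK0u_eq_zero (φ : Hom X Y) (h : P ≤ Q) (h' : Q ≤ R) {a : X.K0u P}
    (ha : φ.mapK0u h a = 0) : φ.mapK0u (h.trans h') a = 0 := by
  rw [← mapK0u_id_left φ h h']
  rw [Hom.mapK0u_square (Hom.id X) φ φ (Hom.id Y) (fun _ => rfl) h h' h h', ha, map_zero]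

/-- Every element of `K_0` is the difference of the classes of a quasi-idempotent and of a scalar
projection. -/
lemma exists_normal_form [Fact (p ≠ ∞)] (hP : s.Below 1 P) (a : X.K0u P) :
    ∃ (ι : Type) (_ : Fintype ι) (_ : DecidableEq ι) (e : Matrix ι ι X.carrier) (b : ι → Bool),
      QI s 3 e ∧ (∀ {Y : FilteredMatrixAlgebra.{v} p} (φ : Hom X Y) {T : Param} (h : P ≤ T),
        s.Above 4000000 T → φ.mapK0u h a = icls T (φ.mat e) - icls T (pr Y b)) ∧
      ∀ {T : Param} (h : P ≤ T), s.Above 4000000 T →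
        X.augHom.mapK0u h a = icls T (X.augHom.mat e) - icls T (pr (scalars p) b) := by
  obtain ⟨k, m, e, f, he, hf, rfl⟩ := exists_icls a
  have he' := IsIdem.qi_of_below he hP
  have hf' := IsIdem.qi_of_below hf hP
  refine ⟨Fin k ⊕ Fin m, inferInstance, inferInstance, Matrix.fromBlocks e 0 0 (1 - f),
    Sum.elim (fun _ => false) (fun _ => true),
    (he'.blocks hf'.one_sub).mono (by simp), fun {Y} φ T h hT => ?_, fun {T} h hT => ?_⟩
  · rw [map_sub, mapK0u_icls φ h he, mapK0u_icls φ h hf,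
      icls_sub_eq (he'.map φ) (hf'.map φ) (hT.mono (by omega)), map_blocks, map_sub, φ.mat_one]
  · rw [map_sub, mapK0u_icls _ h he, mapK0u_icls _ h hf,
      icls_sub_eq (he'.map _) (hf'.map _) (hT.mono (by omega)), map_blocks, map_sub, Hom.mat_one]

end Flip

end FilteredMatrixAlgebra
end QuantK

namespace QuantK
namespace FilteredMatrixAlgebra
namespace Extension

/-! ### Exactness at K_1(A) and at K_0(A) -/

section Exactness

variable {p : ℝ≥0∞} [Fact (1 ≤ p)] [Fact (p ≠ ∞)]
  {C : ℝ} {XJ XA XQ : FilteredMatrixAlgebra.{u} p} (E : Extension C XJ XA XQ)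
  {s : Scale} {ι κ μ ν : Type} [Fintype ι] [DecidableEq ι] [Fintype κ] [DecidableEq κ]
  [Fintype μ] [DecidableEq μ] [Fintype ν] [DecidableEq ν] {n m : ℕ} {P P' Q R R' T : Param}

/-- Exactness at `K_1(A)`. -/
lemma exact_K1A (hs : 40 * C ≤ s.M) (hP : P ≤ P') (hP' : s.Below 1 P') (hR : s.Above 1000000 R)
    (hRR : R ≤ R') (hPR : P ≤ R') {a : XA.K1u P} (ha : E.q.mapGL hP a = 0) :
    ∃ x ∈ XJ.K1red R, E.j.mapGL hRR x = (Hom.id XA).mapGL hPR a := by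
  obtain ⟨k, u, hu, rfl⟩ := exists_gcls a
  obtain ⟨u', hu'⟩ := hu.exists_qp (n := 1) ⟨hP.1.trans hP'.1, hP.2.1.trans hP'.2.1,
    hP.2.2.trans hP'.2.2⟩
  have hu2 : XQ.IsInv P'.ε P'.r P'.N (E.q.mat u) := by
    obtain ⟨v, hv⟩ := hu
    exact ⟨_, (E.q.isInvPair P.r_pos hv).mono P.r_pos hP.1 hP.2.1 hP.2.2⟩
  rw [mapGL_gcls E.q hP hu, ← gcls_one (X := XQ) (ι := Fin 0)] at ha
  obtain ⟨m, m', σ, hσ⟩ := exists_gh_of_gcls_eq hu2 isInv_one ha hP'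
  rw [Matrix.fromBlocks_one, Matrix.submatrix_one_equiv] at hσ
  -- L lifts the stabilised q(u) and is connected to 1 over A^♯, so L⁻¹U has the same class as u
  -- while its image is close to 1.
  obtain ⟨κ, _, _, L, L', hL, hc⟩ := hσ.exists_lift (E.lifting hs)
  set U : Matrix ((Fin k ⊕ Fin m) ⊕ κ) ((Fin k ⊕ Fin m) ⊕ κ) XA.carrier :=
    Matrix.fromBlocks (Matrix.fromBlocks u 0 0 1) 0 0 1 with hU
  set U' : Matrix ((Fin k ⊕ Fin m) ⊕ κ) ((Fin k ⊕ Fin m) ⊕ κ) XA.carrier :=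
    Matrix.fromBlocks (Matrix.fromBlocks u' 0 0 1) 0 0 1 with hU'
  have hUU : QP s 1 U U' := ((hu'.blocks QP.one).blocks QP.one).mono (by simp)
  have hqU : E.q.mat U = Matrix.fromBlocks (Matrix.fromBlocks (E.q.mat u) 0 0 1) 0 0 1 := by
    rw [hU, map_blocks, map_blocks, E.q.mat_one, E.q.mat_one]
  rw [← hqU] at hc
  have hx := hL.ep.symm.qp.mul hUU
  have c1 : Cl s 2000 (E.q.mat (L' * U)) (E.q.mat 1) := by
    have i1 := Cl.mul_left (hL.ep.2.1.map E.q) hc.symm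
    rw [← E.q.mat_mul, ← E.q.mat_mul, hL.ep.2.2.2] at i1
    exact i1.mono (by omega)
  have c2 : Cl s 2000 (E.q.mat (U' * L)) (E.q.mat 1) := by
    have i1 := (Cl.mul_left (hUU.2.1.map E.q) hc).trans
      (b := 1) (z := 1) (by rw [← E.q.mat_mul, ← E.q.mat_one]; exact hUU.2.2.2.map E.q)
    rw [← E.q.mat_mul] at i1
    rw [E.q.mat_one]
    exact i1.mono (by omega)
  -- L⁻¹U and its quasi-inverse are approximated separately; the approximations over J^♯ then form a
  -- quasi-inverse pair, with scalar parts equal to 1.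
  obtain ⟨z, z1, z2, z3⟩ := E.exists_approx hs (n := 2000) (hx.1.mono (by omega))
    (Bd.one.mono (by omega)) c1
  obtain ⟨z', z1', z2', z3'⟩ := E.exists_approx hs (n := 2000) (hx.2.1.mono (by omega))
    (Bd.one.mono (by omega)) c2
  have e : ∀ z, (1 : Matrix ((Fin k ⊕ Fin m) ⊕ κ) ((Fin k ⊕ Fin m) ⊕ κ) XA.carrier) + E.j.mat z =
      E.j.mat (1 + z) := fun z => by rw [map_add, E.j.mat_one]
  rw [e] at z3 z3'
  have b1 : Bd s 30000 (1 + z) := (Bd.one.add z2).mono (by omega)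
  have b2 : Bd s 30000 (1 + z') := (Bd.one.add z2').mono (by omega)
  have hX : QP s 200000 (1 + z) (1 + z') := E.qp_of_qp
    (((hx.close (b1.map E.j) z3).symm.close (b2.map E.j) z3').symm.mono (by omega))
  have hX' := hX.isInv_of_above (Q := R) (hR.mono (by omega))
  have hR2 := hR.trans hRR
  refine ⟨gcls R (1 + z), mem_K1red_of_aug_eq_one hX' ?_, ?_⟩
  · rw [map_add, Hom.mat_one, add_eq_left]
    ext i k; exact z1 i k
  · rw [mapGL_gcls E.j hRR hX', mapGL_gcls _ hPR hu, mat_id]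
    -- Over A^♯ the approximation is close to L⁻¹U, and L⁻¹ is connected to 1, so a homotopy leads
    -- to U.
    have i1 := GH.of_close hx (b1.map E.j) z3
    have i2 := hL.symm.gh.mul_right hUU
    rw [one_mul] at i2
    rw [← i1.gcls_eq (Q := R') (hR2.mono (by omega)), i2.gcls_eq (Q := R') (hR2.mono (by omega)),
      hU, gcls_pad, gcls_pad]
    · exact hu'.isInv_of_above (hR2.mono (by omega))
    · exact (hu'.blocks QP.one).isInv_of_above (hR2.mono (by simp))

/-- Exactness at `K_0(A)`. -/
lemma exact_K0A (hs : 40 * C ≤ s.M) (hP : P ≤ P') (hP' : s.Below 1 P')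
    (hR : s.Above 10000000000000000000000000 R)
    (hRR : R ≤ R') (hPR : P ≤ R') {a : XA.K0u P} (ha : E.q.mapK0u hP a = 0) :
    ∃ x ∈ XJ.K0red R, E.j.mapK0u hRR x = (Hom.id XA).mapK0u hPR a := by
  obtain ⟨ι, _, _, e, b, he, h1, -⟩ := exists_normal_form (s := s)
    ⟨hP.1.trans hP'.1, hP.2.1.trans hP'.2.1, hP.2.2.trans hP'.2.2⟩ a
  -- The vanishing of the image is relaxed to T, where the normal form is valid and parameters are
  -- bounded by a level.
  obtain ⟨T, hT, hT', hTR⟩ := Scale.Above.exists_level (n := 4000000) (hR.mono (by omega))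
  have hPT : P' ≤ T := (hP'.mono (m := 4000000) (by omega)).le hT
  have ha' := mapK0u_eq_zero E.q hP hPT ha
  rw [h1 E.q (hP.trans hPT) hT, sub_eq_zero] at ha'
  have q1 : XQ.IsIdem T.ε T.r T.N (E.q.mat e) :=
    (he.map E.q).isIdem_of_above (hT.mono (by omega))
  have q2 : XQ.IsIdem T.ε T.r T.N (pr XQ b) :=
    (qi_pr (s := s) b).isIdem_of_above (hT.mono (by omega))
  -- The conjugation of q(e) to a scalar projection is the image of an exact invertible S over A^♯.
  -- Hence S diag(e, b') S⁻¹ has the class of diag(e, b'), and its image in the quotient is close to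
  -- a scalar projection.
  obtain ⟨κ, _, _, b', S, S', hS, hc⟩ := exists_conjLift_of_icls_eq (E.lifting hs) q1 q2 ha' hT'
  rw [pr_blocks] at hc
  have hE : QI s 3 (Matrix.fromBlocks e 0 0 (pr XA b')) := (he.blocks (qi_pr b')).mono (by simp)
  have hF := hE.conj hS.qp
  have hqF : Cl s 1000000000000 (E.q.mat (S * Matrix.fromBlocks e 0 0 (pr XA b') * S'))
      (E.q.mat (pr XA (Sum.elim b b'))) := by
    rw [E.q.mat_mul, E.q.mat_mul, map_blocks, map_pr, map_pr]
    exact hc.mono (by omega)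
  -- The correction z has zero scalar part, so the difference of classes formed with it lies in the
  -- reduced group.
  obtain ⟨z, z1, z2, z3⟩ := E.exists_approx hs (n := 10000000000000) (hF.1.mono (by omega))
    ((bd_pr _).mono (by omega)) (hqF.mono (by omega))
  rw [← map_pr E.j (Sum.elim b b'), ← map_add] at z3
  have bz : Bd s 1000000000000000 (pr XJ (Sum.elim b b') + z) :=
    ((bd_pr _).add z2).mono (by omega)
  have hz : QI s 100000000000000000 (pr XJ (Sum.elim b b') + z) :=
    E.qi_of_qi ((hF.close (bz.map E.j) z3).mono (by omega))
  have hR2 := hR.trans hRR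
  have i1 := hz.isIdem_of_above (Q := R) (hR.mono (by omega))
  have i2 : XJ.IsIdem R.ε R.r R.N (pr XJ (Sum.elim b b')) :=
    (qi_pr (s := s) _).isIdem_of_above (hR.mono (by omega))
  have i3 : XA.IsIdem R'.ε R'.r R'.N (pr XA b') :=
    (qi_pr (s := s) _).isIdem_of_above (hR2.mono (by omega))
  have i4 : XA.IsIdem R'.ε R'.r R'.N (pr XA b) :=
    (qi_pr (s := s) _).isIdem_of_above (hR2.mono (by omega))
  have i5 : XA.IsIdem R'.ε R'.r R'.N e := he.isIdem_of_above (hR2.mono (by omega))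
  refine ⟨icls R (pr XJ (Sum.elim b b') + z) - icls R (pr XJ (Sum.elim b b')), ?_, ?_⟩
  · rw [icls_sub_mem_K0red i1 i2, map_add, add_eq_left.2]
    ext i k; exact z1 i k
  · have hcl : ConjLift s 10000000000000000 (Hom.id XA) (Matrix.fromBlocks e 0 0 (pr XA b'))
        (E.j.mat (pr XJ (Sum.elim b b') + z)) :=
      ⟨S, S', hS.mono (by omega), by rw [mat_id, mat_id]; exact z3.mono (by omega)⟩
    rw [map_sub, mapK0u_icls E.j hRR i1, mapK0u_icls E.j hRR i2, map_pr,
      ← hcl.icls_eq (Q := R') (hE.mono (by omega)) ((bz.map E.j).mono (by omega)) (hR2.mono (by omega)),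
      h1 (Hom.id XA) hPR (hR2.mono (by omega)), mat_id, icls_blocks i5 i3, ← pr_blocks,
      icls_blocks i4 i3]
    abel

end Exactness

end Extension

end FilteredMatrixAlgebra
end QuantK

namespace QuantK
namespace FilteredMatrixAlgebra
namespace Extension

/-! ### Exactness at K_1(A/J) -/

section Exactness

variable {p : ℝ≥0∞} [Fact (1 ≤ p)] [Fact (p ≠ ∞)]
  {C : ℝ} {XJ XA XQ : FilteredMatrixAlgebra.{u} p} (E : Extension C XJ XA XQ)
  {s : Scale} {ι κ μ ν : Type} [Fintype ι] [DecidableEq ι] [Fintype κ] [DecidableEq κ]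
  [Fintype μ] [DecidableEq μ] [Fintype ν] [DecidableEq ν] {n m : ℕ} {P P' Q R R' T : Param}

/-- Elements conjugating idempotents with the same scalar part, which is a scalar projection, may
be taken with scalar part `1`. -/
lemma exists_conj_normalised {X : FilteredMatrixAlgebra.{u} p} (η : Hom (scalars p) X)
    {S S' x : Matrix ι ι X.carrier} {b : ι → Bool} (hS : EP s n S S')
    (hc : Cl s n (S * x * S') (pr X b)) (hx : X.augHom.mat x = pr (scalars p) b) :
    ∃ S₁ S₁' : Matrix ι ι X.carrier, EP s (2 * n + 1) S₁ S₁' ∧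
      Cl s (8 * n + 4) (S₁ * x * S₁') (pr X b) ∧ X.augHom.mat S₁ = 1 ∧ X.augHom.mat S₁' = 1 := by
  have ht : EP s n (η.mat (X.augHom.mat S)) (η.mat (X.augHom.mat S')) := (hS.map X.augHom).map η
  -- The scalar part t of S conjugates the projection approximately to itself, because x already has
  -- this projection as its scalar part. So t⁻¹S conjugates as S does, and its scalar part is
  -- exactly 1.
  have h1 := (hc.map X.augHom).map η
  rw [Hom.mat_mul, Hom.mat_mul, Hom.mat_mul, Hom.mat_mul, hx, map_pr, map_pr, map_pr] at h1
  refine ⟨_, _, (ht.symm.mul hS).mono (by omega), (Cl.conj_conj ht hc h1).mono (by omega), ?_, ?_⟩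
  · rw [Hom.mat_mul, aug_unit, ← Hom.mat_mul, hS.2.2.2, Hom.mat_one]
  · rw [Hom.mat_mul, aug_unit, ← Hom.mat_mul, hS.2.2.2, Hom.mat_one]

/-- Exactness at `K_1(A/J)`. -/
lemma exact_K1Q {hs : 40 * C ≤ s.M} {hn : 11000 ≤ n} {hP : s.Below 1 P}
    {hQ : s.Above (10000000000000000 * (n + 11000) + 10000000000000000) Q} (hQm : s.Below m Q)
    (hR : s.Above (1000000000000 * m + 1000000000000) R) (hRR : R ≤ R') (hPR : P ≤ R')
    {a : XQ.K1u P} (haP : a ∈ XQ.K1red P) (ha : E.bdry hs n hn hP hQ a = 0) :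
    ∃ x ∈ XA.K1red R, E.q.mapGL hRR x = (Hom.id XQ).mapGL hPR a := by
  obtain ⟨k, u, hu, rfl⟩ := exists_gcls a
  obtain ⟨u', hu'⟩ := hu.exists_qp hP
  obtain ⟨w, w', y, hw, hq, hwy, h⟩ := E.exists_isDatum hs hu'
  have i1 := h.qi.isIdem_of_above (Q := Q) (hQ.mono (by omega))
  have i2 := (qi_corn (X := XJ) (ι := Fin k) (κ := Fin k)).isIdem_of_above (hQ.mono (by omega))
  rw [bdry_gcls hu (h.mono (by omega)), dcls, sub_eq_zero] at ha
  obtain ⟨κ, _, _, b, S, S', hS, hc⟩ := exists_conjLift_of_icls_eq (lifting_id s) i1 i2 ha hQm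
  generalize hK : 100000 * m + 100000 = K at hS hc
  rw [mat_id, mat_id, corn_eq_pr, pr_blocks, ← corn_eq_pr] at hc
  set B : (Fin k ⊕ Fin k) ⊕ κ → Bool := Sum.elim (Sum.elim (fun _ => true) fun _ => false) b with hB
  have hBX : ∀ X : FilteredMatrixAlgebra.{u} p,
      Matrix.fromBlocks (corn X (Fin k) (Fin k)) 0 0 (pr X b) = pr X B := fun X => by
    rw [corn_eq_pr, pr_blocks]
  -- The image of j(S₁) in the quotient is its scalar part, hence 1 after normalisation.
  -- Multiplication by it therefore does not affect the image of the lift.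
  obtain ⟨S₁, S₁', hS₁, hc₁, hπ, -⟩ := exists_conj_normalised E.unitJ hS hc (by
    have e1 : XJ.augHom.mat y = 0 := by ext i k; exact h.aug i k
    rw [map_blocks, map_add, map_corn, map_pr, e1, zero_add, corn_eq_pr, pr_blocks])
  -- Conjugation by diag(w, 1) takes the scalar projection B approximately to diag(y + corner, b),
  -- and S₁ takes it back. So g almost commutes with B and its compression is a quasi-invertible
  -- over A^♯.
  set g := E.j.mat S₁ * Matrix.fromBlocks w 0 0 1 with hg
  set g' := Matrix.fromBlocks w' 0 0 1 * E.j.mat S₁' with hg'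
  have hgg : EP s (2 * K + 30) g g' :=
    ((hS₁.map E.j).mul (hw.blocks (EP.one (ι := κ)))).mono (by omega)
  have hgc : Cl s (20 * K + 5000) (g * pr XA B * g') (pr XA B) := by
    have j1 := Cl.mul_left (hS₁.1.map E.j) (Cl.mul_right (hS₁.2.1.map E.j)
      ((h.approx').blocks (Cl.refl (pr XA b))))
    have j2 := hc₁.map E.j
    rw [E.j.mat_mul, E.j.mat_mul, map_blocks, map_pr, map_pr, mul_assoc] at j2
    have j3 := j1.trans j2
    have e1 : E.j.mat S₁ * (Matrix.fromBlocks (w * corn XA (Fin k) (Fin k) * w') 0 0 (pr XA b) *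
        E.j.mat S₁') = g * pr XA B * g' := by
      have e2 : Matrix.fromBlocks (w * corn XA (Fin k) (Fin k) * w') 0 0 (pr XA b) =
          Matrix.fromBlocks w 0 0 1 * pr XA B * Matrix.fromBlocks w' 0 0 1 := by
        rw [← hBX, blocks_mul, blocks_mul, one_mul, mul_one]
      rw [e2, hg, hg']
      simp only [mul_assoc]
    rw [e1] at j3
    exact j3.mono (by omega)
  have hcomp := (hgg.qp.mono (m := 20 * K + 5000) (by omega)).compress (bd_pr B) (pr_mul_self B) hgc
  -- Since q(g) = diag(q(w), 1) and q(w) ≈ diag(u, u'), compression to the corner replaces u' by 1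
  -- and leaves u.
  have hqc : Cl s 7 (E.q.mat (compress (pr XA B) g))
      (Matrix.fromBlocks (Matrix.fromBlocks u 0 0 1) 0 0 1) := by
    have e1 : E.q.mat g = Matrix.fromBlocks (E.q.mat w) 0 0 1 := by
      rw [hg, E.q.mat_mul, E.q_j_mat, hπ, Hom.mat_one, Hom.mat_one, one_mul, map_blocks, Hom.mat_one]
    have j1 := Cl.compress (bd_pr B) (hq.blocks (Cl.refl (1 : Matrix κ κ XQ.carrier)))
    rw [map_compress, map_pr, e1]
    rw [← hBX, compress_blocks, compress_blocks, compress_corn, compress_one (pr_mul_self b)] at j1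
    rw [← hBX, compress_blocks, compress_one (pr_mul_self b)]
    exact j1.mono (by simp)
  have hR2 := hR.trans hRR
  have hx := hcomp.isInv_of_above (Q := R) (hR.mono (by clear * - hK; omega))
  have hPR1 : P ≤ R := (hP.mono (m := 1000000000000) (by omega)).le (hR.mono (by clear * - hK; omega))
  have hu0 : ∀ {T : Param}, P ≤ T → XQ.IsInv T.ε T.r T.N u := by
    intro T hT
    obtain ⟨v, hv⟩ := hu
    exact ⟨_, hv.mono P.r_pos hT.1 hT.2.1 hT.2.2⟩
  have hU : QP s 1 (Matrix.fromBlocks (Matrix.fromBlocks u 0 0 (1 : Matrix (Fin k) (Fin k) XQ.carrier))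
      0 0 (1 : Matrix κ κ XQ.carrier)) (Matrix.fromBlocks (Matrix.fromBlocks u' 0 0 1) 0 0 1) :=
    ((hu'.blocks QP.one).blocks QP.one).mono (by simp)
  have hgh := GH.of_close (hcomp.map E.q) (hU.1) hqc
  have hclass : ∀ {T : Param}, s.Above (1000000000000 * m + 1000000000000) T → P ≤ T →
      gcls T (E.q.mat (compress (pr XA B) g)) = gcls T u := by
    intro T hT hPT
    rw [hgh.gcls_eq (hT.mono (by clear * - hK; omega)), gcls_pad, gcls_pad]
    · exact hu0 hPT
    · exact (hu'.blocks QP.one).isInv_of_above (hT.mono (by clear * - hK; omega))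
  refine ⟨gcls R (compress (pr XA B) g), ?_, ?_⟩
  -- The augmentation factors through the quotient, where the class of the compression is that of u,
  -- and the latter is reduced by assumption.
  · rw [gcls_mem_K1red hx, ← aug_mat_eq E.q,
      ← mapGL_gcls XQ.augHom (le_refl R) ((hcomp.map E.q).isInv_of_above (hR.mono (by clear * - hK; omega))),
      hclass hR hPR1, ← mat_id u, ← mapGL_gcls (Hom.id XQ) hPR1 hu]
    exact mapGL_mem (Hom.id XQ) hPR1 haP
  · rw [mapGL_gcls E.q hRR hx, mapGL_gcls _ hPR hu, mat_id, hclass hR2 hPR]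

end Exactness

end Extension

end FilteredMatrixAlgebra
end QuantK

namespace QuantK
namespace FilteredMatrixAlgebra

/-! ### Reduced forms and exactness at K_0(J) -/

section

variable {p : ℝ≥0∞} [Fact (1 ≤ p)] [Fact (p ≠ ∞)] {X : FilteredMatrixAlgebra.{u} p}
  {s : Scale} {n m : ℕ} {P P' Q R R' T : Param}

/-- Elements of the reduced group `K_0` are differences of the class of a quasi-idempotent whose
scalar part is a scalar projection, and of the class of this projection. -/
lemma exists_reduced_form (η : Hom (scalars p) X) (hP : s.Below 1 P)
    (hR : s.Above 1000000000000 R) {a : X.K0u P} (ha : a ∈ X.K0red P) :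
    ∃ (ι : Type) (_ : Fintype ι) (_ : DecidableEq ι) (e : Matrix ι ι X.carrier) (b : ι → Bool),
      QI s 1000000000000000 e ∧ X.augHom.mat e = pr (scalars p) b ∧
      ∀ {Y : FilteredMatrixAlgebra.{v} p} (φ : Hom X Y) {T : Param} (h : P ≤ T),
        s.Above 1000000000000000000000 T → φ.mapK0u h a = icls T (φ.mat e) - icls T (pr Y b) := by
  obtain ⟨ι, _, _, e, b, he, h1, h2⟩ := exists_normal_form.{u, v} hP a
  obtain ⟨T, hT, hT', hTR⟩ := Scale.Above.exists_level (n := 4000000) (hR.mono (by omega))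
  have hPT : P ≤ T := (hP.mono (m := 4000000) (by omega)).le hT
  have ha' := mapK0u_eq_zero X.augHom (le_refl P) hPT ha
  rw [h2 hPT hT, sub_eq_zero] at ha'
  have q1 : (scalars p).IsIdem T.ε T.r T.N (X.augHom.mat e) :=
    (he.map X.augHom).isIdem_of_above (hT.mono (by omega))
  have q2 : (scalars p).IsIdem T.ε T.r T.N (pr (scalars p) b) :=
    (qi_pr (s := s) b).isIdem_of_above (hT.mono (by omega))
  -- Reducedness is an equality of classes over ℂ, which gives a conjugation by a scalar matrix S.
  -- The unit transports S to X.
  obtain ⟨κ, _, _, b', S, S', hS, hc⟩ := exists_conjLift_of_icls_eq (lifting_id s) q1 q2 ha' hT'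
  rw [pr_blocks, mat_id, mat_id] at hc
  set x := Matrix.fromBlocks e 0 0 (pr X b') with hx
  have hxq : QI s 3 x := (he.blocks (qi_pr b')).mono (by simp)
  have hSX := hS.map η
  have hy := hxq.conj hSX.qp
  set y := η.mat S * x * η.mat S' with hy'
  have hπ : X.augHom.mat y = S * Matrix.fromBlocks (X.augHom.mat e) 0 0 (pr (scalars p) b') * S' := by
    rw [hy', Hom.mat_mul, Hom.mat_mul, aug_unit, aug_unit, hx, map_blocks, map_pr]
  rw [← hπ] at hc
  -- The scalar part of y is only close to the projection. It is replaced by the projection itself,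
  -- a small change that makes the scalar part exact.
  set z := y - η.mat (X.augHom.mat y) + pr X (Sum.elim b b') with hz
  have hcz : Cl s 1000000000000 y z := by
    have i1 := (hc.map η).sub_zero'
    have e1 : y - z = η.mat (X.augHom.mat y) - η.mat (pr (scalars p) (Sum.elim b b')) - 0 := by
      rw [hz, map_pr]; abel
    rw [Cl, e1]
    exact i1.mono (by omega)
  have hbz : Bd s 10000000000000 z :=
    ((hy.1.sub ((hy.1.map X.augHom).map η)).add (bd_pr _)).mono (by omega)
  refine ⟨ι ⊕ κ, inferInstance, inferInstance, z, Sum.elim b b',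
    (hy.close hbz hcz).mono (by omega), ?_, fun {Y} φ T h hT => ?_⟩
  · rw [hz, map_add, map_sub, aug_unit, sub_self, zero_add, map_pr]
  · have hcl : ConjLift s 10000000000000 (Hom.id Y) (φ.mat x) (φ.mat z) := by
      refine ⟨_, _, (hSX.map φ).mono (by omega), ?_⟩
      rw [mat_id, mat_id, ← Hom.mat_mul, ← Hom.mat_mul]
      exact (hcz.map φ).mono (by omega)
    have i1 := (he.map φ).isIdem_of_above (Q := T) (hT.mono (by omega))
    have i2 : Y.IsIdem T.ε T.r T.N (pr Y b') := (qi_pr (s := s) _).isIdem_of_above (hT.mono (by omega))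
    have i3 : Y.IsIdem T.ε T.r T.N (pr Y b) := (qi_pr (s := s) _).isIdem_of_above (hT.mono (by omega))
    rw [← hcl.icls_eq (Q := T) ((hxq.map φ).mono (by omega)) (hbz.map φ) (hT.mono (by omega)), hx,
      map_blocks, map_pr, icls_blocks i1 i2, ← pr_blocks, icls_blocks i3 i2, h1 φ h (hT.mono (by omega))]
    abel

end

namespace Extension

section Exactness

variable {p : ℝ≥0∞} [Fact (1 ≤ p)] [Fact (p ≠ ∞)]
  {C : ℝ} {XJ XA XQ : FilteredMatrixAlgebra.{u} p} (E : Extension C XJ XA XQ)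
  {s : Scale} {ι κ μ ν : Type} [Fintype ι] [DecidableEq ι] [Fintype κ] [DecidableEq κ]
  [Fintype μ] [DecidableEq μ] [Fintype ν] [DecidableEq ν] {n m : ℕ} {P P' Q R R' T : Param}

/-- A quasi-idempotent over `J^♯` that is conjugate to a scalar projection over `A^♯` is a
boundary. -/
lemma exists_isDatum_of_conj {e : Matrix ι ι XJ.carrier} {b : ι → Bool} {S S' : Matrix ι ι XA.carrier}
    (he : QI s n e) (hπ : XJ.augHom.mat e = pr (scalars p) b) (hS : EP s n S S')
    (hc : Cl s n (S * pr XA b * S') (E.j.mat e)) (hS1 : XA.augHom.mat S = 1) :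
    ∃ (u u' : Matrix ι ι XQ.carrier) (w w' : Matrix (ι ⊕ ι) (ι ⊕ ι) XA.carrier)
      (y : Matrix (ι ⊕ ι) (ι ⊕ ι) XJ.carrier), QP s (100 * n + 100) u u' ∧ XQ.augHom.mat u = 1 ∧
        E.IsDatum s (100 * n + 100) u w w' y ∧
        ∀ {T : Param}, s.Above (n + 1) T → dcls T y = icls T e - icls T (pr XJ b) := by
  have hqc : Cl s n (E.q.mat S * pr XQ b * E.q.mat S') (pr XQ b) := by
    have i1 := hc.map E.q
    rwa [E.q_j_mat, hπ, map_pr, map_pr, E.q.mat_mul, E.q.mat_mul, map_pr] at i1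
  have hqS := (hS.map E.q).qp
  -- The image of e in the quotient is its scalar part, so q(S) almost commutes with the projection;
  -- u is the compression of q(S).
  have hu := hqS.compress (bd_pr b) (pr_mul_self b) hqc
  have hcomm := hqS.cl_comm (bd_pr b) hqc
  -- The mixed corners of q(S) are small because q(S) almost commutes with the projection, whose
  -- product with its complement vanishes.
  have o1 : Cl s (5 * n + 6) (pr XQ b * E.q.mat S * pr XQ fun i => !b i) 0 := by
    have i1 := Cl.mul_right (bd_pr fun i => !b i) hcomm.symm
    have e1 : E.q.mat S * pr XQ b * (pr XQ fun i => !b i) = 0 := by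
      rw [pr_not, mul_assoc, mul_sub, mul_one, pr_mul_self, sub_self, mul_zero]
    rw [e1] at i1
    exact i1.mono (by omega)
  have o2 : Cl s (5 * n + 6) ((pr XQ fun i => !b i) * E.q.mat S * pr XQ b) 0 := by
    have i1 := Cl.mul_left (bd_pr fun i => !b i) hcomm
    have e1 : (pr XQ fun i => !b i) * (pr XQ b * E.q.mat S) = 0 := by
      rw [pr_not, ← mul_assoc, sub_mul, one_mul, pr_mul_self, sub_self, zero_mul]
    rw [e1, ← mul_assoc] at i1
    exact i1.mono (by omega)
  -- After the exchange of coordinates the image of diag(S, 1) is close to the block diagonal matrix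
  -- of the two compressions of q(S). Hence it is a lift as required in boundary data, with corner
  -- conjugated to the exchanged diag(SpS⁻¹, 1-p) ≈ diag(e, 1-p).
  have hw := (hS.blocks (EP.one (ι := ι))).submatrix (flip b)
  have hey : ((Matrix.fromBlocks (e - pr XJ b) 0 0 0).submatrix (flip b) (flip b) + corn XJ ι ι) =
      (Matrix.fromBlocks e 0 0 (pr XJ fun i => !b i)).submatrix (flip b) (flip b) := by
    have e1 : Matrix.fromBlocks e 0 0 (pr XJ fun i => !b i) =
        Matrix.fromBlocks (e - pr XJ b) 0 0 0 + Matrix.fromBlocks (pr XJ b) 0 0 (pr XJ fun i => !b i) := by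
      rw [← blocks_add, sub_add_cancel, zero_add]
    rw [e1, ← pr_flip b]; rfl
  refine ⟨_, _, _, _, (Matrix.fromBlocks (e - pr XJ b) 0 0 0).submatrix (flip b) (flip b),
    hu.mono (by omega), ?_, ⟨⟨_, hu.mono (by omega)⟩, hw.qp.mono (by simp; omega),
      ⟨compress (pr XQ fun i => !b i) (E.q.mat S), ?_⟩, ?_, ?_, ?_⟩, fun {T} hT => ?_⟩
  · rw [map_compress, aug_mat_eq, hS1, map_pr, compress_one (pr_mul_self b)]
  · rw [map_submatrix, map_blocks, E.q.mat_one, blocks_one_flip]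
    exact (Cl.fromBlocks_zero o1 o2).mono (by omega)
  · exact (((he.1.sub (bd_pr b)).blocks (Bd.zero (ι := ι))).submatrix _ _).mono (by simp; omega)
  · have hz : XJ.augHom.mat (Matrix.fromBlocks (e - pr XJ b) 0 0 (0 : Matrix ι ι XJ.carrier)) = 0 := by
      rw [map_blocks, map_sub, hπ, map_pr, sub_self, map_zero, Matrix.fromBlocks_zero]
    intro i k
    exact congrFun (congrFun hz (flip b i)) (flip b k)
  · have e1 : corn XA ι ι + E.j.mat
        ((Matrix.fromBlocks (e - pr XJ b) 0 0 0).submatrix (flip b) (flip b)) =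
        (Matrix.fromBlocks (E.j.mat e) 0 0 (pr XA fun i => !b i)).submatrix (flip b) (flip b) := by
      rw [← map_corn E.j, ← map_add, add_comm, hey, map_submatrix, map_blocks, map_pr]
    rw [e1, ← pr_flip b,
      Matrix.submatrix_mul_equiv, Matrix.submatrix_mul_equiv, blocks_mul, blocks_mul, one_mul,
      mul_one]
    exact ((hc.blocks (Cl.refl _)).submatrix _ _).mono (by simp; omega)
  · have i1 := he.isIdem_of_above hT
    have i2 : XJ.IsIdem T.ε T.r T.N (pr XJ fun i => !b i) :=
      (qi_pr (s := s) _).isIdem_of_above (hT.mono (by omega))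
    have i3 : XJ.IsIdem T.ε T.r T.N (pr XJ b) :=
      (qi_pr (s := s) _).isIdem_of_above (hT.mono (by omega))
    rw [dcls, hey, ← pr_flip b, icls_submatrix (i1.blocks i2), icls_submatrix (i3.blocks i2),
      icls_blocks i1 i2, icls_blocks i3 i2]
    abel

/-- Exactness at `K_0(J)`. -/
lemma exact_K0J (hP : P ≤ P') (hP' : s.Below 1 P')
    (hR : s.Above 1000000000000000000000000000000 R) {a : XJ.K0u P} (haP : a ∈ XJ.K0red P)
    (ha : E.j.mapK0u hP a = 0) :
    ∃ (Ω : Type) (_ : Fintype Ω) (_ : DecidableEq Ω) (u u' : Matrix Ω Ω XQ.carrier)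
      (w w' : Matrix (Ω ⊕ Ω) (Ω ⊕ Ω) XA.carrier) (y : Matrix (Ω ⊕ Ω) (Ω ⊕ Ω) XJ.carrier),
      QP s 1000000000000000000000000000000000 u u' ∧ XQ.augHom.mat u = 1 ∧
        E.IsDatum s 1000000000000000000000000000000000 u w w' y ∧
        ∀ {T : Param} (h : P ≤ T), s.Above 1000000000000000000000000000000000 T →
          dcls T y = (Hom.id XJ).mapK0u h a := by
  obtain ⟨ι, _, _, e, b, he, hπ, h1⟩ := exists_reduced_form.{u, u} E.unitJ (s := s)
    ⟨hP.1.trans hP'.1, hP.2.1.trans hP'.2.1, hP.2.2.trans hP'.2.2⟩ (hR.mono (by omega)) haP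
  obtain ⟨T, hT, hT', hTR⟩ := Scale.Above.exists_level (n := 1000000000000000000000) (hR.mono (by omega))
  have hPT : P' ≤ T := (hP'.mono (m := 1000000000000000000000) (by omega)).le hT
  have ha' := mapK0u_eq_zero E.j hP hPT ha
  rw [h1 E.j (hP.trans hPT) hT, sub_eq_zero] at ha'
  have q1 : XA.IsIdem T.ε T.r T.N (E.j.mat e) :=
    (he.map E.j).isIdem_of_above (hT.mono (by omega))
  have q2 : XA.IsIdem T.ε T.r T.N (pr XA b) :=
    (qi_pr (s := s) b).isIdem_of_above (hT.mono (by omega))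
  obtain ⟨κ, _, _, b', S, S', hS, hc⟩ := exists_conjLift_of_icls_eq (lifting_id s) q1 q2 ha' hT'
  rw [pr_blocks, mat_id, mat_id] at hc
  have hx : E.j.mat (Matrix.fromBlocks e 0 0 (pr XJ b')) =
      Matrix.fromBlocks (E.j.mat e) 0 0 (pr XA b') := by rw [map_blocks, map_pr]
  have hx' : XJ.augHom.mat (Matrix.fromBlocks e 0 0 (pr XJ b')) = pr (scalars p) (Sum.elim b b') := by
    rw [map_blocks, map_pr, hπ, pr_blocks]
  rw [← hx] at hc
  -- S₁ takes the idempotent to the scalar projection, whereas the boundary construction needs the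
  -- opposite direction; so S₁' is used as the conjugating element. Its scalar part 1 makes the
  -- resulting quasi-invertible over the quotient reduced.
  obtain ⟨S₁, S₁', hS₁, hc₁, hπ₁, hπ₁'⟩ := exists_conj_normalised E.unitA hS hc (by
    rw [aug_mat_eq, hx'])
  have hc₂ : Cl s 100000000000000000000000000000 (S₁' * pr XA (Sum.elim b b') * S₁)
      (E.j.mat (Matrix.fromBlocks e 0 0 (pr XJ b'))) := by
    have i1 := Cl.mul_left hS₁.2.1 (Cl.mul_right hS₁.1 hc₁.symm)
    have e1 : S₁' * (S₁ * E.j.mat (Matrix.fromBlocks e 0 0 (pr XJ b')) * S₁' * S₁) =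
        (S₁' * S₁) * E.j.mat (Matrix.fromBlocks e 0 0 (pr XJ b')) * (S₁' * S₁) := by
      simp only [mul_assoc]
    rw [e1, hS₁.2.2.2, one_mul, mul_one, ← mul_assoc] at i1
    exact i1.mono (by omega)
  obtain ⟨u, u', w, w', y, hu, hu1, hd, hcl⟩ := E.exists_isDatum_of_conj
    (n := 100000000000000000000000000000) ((he.blocks (qi_pr b')).mono (by simp)) hx'
    (hS₁.symm.mono (by omega)) hc₂ hπ₁'
  refine ⟨ι ⊕ κ, inferInstance, inferInstance, u, u', w, w', y, hu.mono (by omega), hu1,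
    hd.mono (by omega), fun {T} h hT => ?_⟩
  have i1 : XJ.IsIdem T.ε T.r T.N e := he.isIdem_of_above (hT.mono (by omega))
  have i2 : XJ.IsIdem T.ε T.r T.N (pr XJ b') := (qi_pr (s := s) _).isIdem_of_above (hT.mono (by omega))
  have i3 : XJ.IsIdem T.ε T.r T.N (pr XJ b) := (qi_pr (s := s) _).isIdem_of_above (hT.mono (by omega))
  rw [hcl (hT.mono (by omega)), ← pr_blocks, icls_blocks i1 i2, icls_blocks i3 i2,
    h1 (Hom.id XJ) h (hT.mono (by omega)), mat_id]
  abel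

end Exactness

end Extension

end FilteredMatrixAlgebra
end QuantK

namespace QuantK

/-! ### Polynomial control pairs -/

/-- The control pair `λ_N = h_{ε,N} = (40 C N)^n`. -/
def powControl (C : ℝ) (hC : 1 ≤ C) (n : ℕ) : ControlPair where
  lam N := (40 * C * N) ^ n
  h _ N := (40 * C * N) ^ n
  one_le_lam hN := one_le_pow₀ (by nlinarith)
  lam_mono h h' := pow_le_pow_left₀ (by nlinarith) (by nlinarith) n
  one_le_h _ _ hN := one_le_pow₀ (by nlinarith)
  h_anti _ _ _ _ := le_rfl

lemma powControl_le {C : ℝ} (hC : 1 ≤ C) {n m : ℕ} (h : n ≤ m) :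
    powControl C hC n ≤ powControl C hC m :=
  ⟨fun _ hN => pow_le_pow_right₀ (by nlinarith) h,
    fun _ _ _ _ hN => pow_le_pow_right₀ (by nlinarith) h⟩

/-- The scale with `M = 40 C N`. -/
def Param.scale (P : Param) (C : ℝ) (hC : 1 ≤ C) : Scale where
  M := 40 * C * P.N
  ε := P.ε
  r := P.r
  two_le := by nlinarith [P.one_le_N]
  ε_pos := P.ε_pos
  ε_le := by linarith [P.ε_lt]
  r_pos := P.r_pos

section Scale

variable {C : ℝ} {hC : 1 ≤ C} {P Q : Param} {n m : ℕ}

lemma Param.le_scale_M : 40 * C ≤ (P.scale C hC).M :=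
  le_mul_of_one_le_right (by linarith) P.one_le_N

lemma Param.N_le_scale_M : P.N ≤ (P.scale C hC).M := by
  show P.N ≤ 40 * C * P.N
  nlinarith [P.one_le_N]

lemma Param.below_scale : (P.scale C hC).Below 1 P := by
  have h1 := (P.scale C hC).two_le
  refine ⟨?_, ?_, ?_⟩ <;> rw [pow_one]
  · exact le_mul_of_one_le_left P.ε_pos.le (by linarith)
  · exact le_mul_of_one_le_left P.r_pos.le (by linarith)
  · exact P.N_le_scale_M

lemma Param.above_ctrl (hP : (powControl C hC n).lam P.N * P.ε < 1 / 20) :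
    (P.scale C hC).Above n (P.ctrl _ hP) := ⟨le_rfl, le_rfl, le_rfl⟩

lemma Param.below_ctrl (hP : (powControl C hC n).lam P.N * P.ε < 1 / 20) :
    (P.scale C hC).Below n (P.ctrl _ hP) := ⟨le_rfl, le_rfl, le_rfl⟩

lemma Param.le_ctrl_pow (hn : 1 ≤ n) (hP : (powControl C hC n).lam P.N * P.ε < 1 / 20) :
    P ≤ P.ctrl _ hP := (P.below_scale.mono hn).le (P.above_ctrl hP)

lemma Param.induced_below_scale (hP : ControlPair.induced.lam P.N * P.ε < 1 / 20) :
    (P.scale C hC).Below 1 (P.ctrl _ hP) := by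
  refine ⟨?_, ?_, ?_⟩ <;> rw [pow_one]
  · exact mul_le_mul_of_nonneg_right P.N_le_scale_M P.ε_pos.le
  · show 1 * P.r ≤ _
    exact mul_le_mul_of_nonneg_right (by linarith [(P.scale C hC).two_le]) P.r_pos.le
  · exact P.N_le_scale_M

end Scale

namespace FilteredMatrixAlgebra

section Relax

variable {p : ℝ≥0∞} [Fact (1 ≤ p)] {X : FilteredMatrixAlgebra.{u} p}
  {Y : FilteredMatrixAlgebra.{v} p} {P Q R : Param}

lemma mapK0u_id_right (φ : Hom X Y) (h : P ≤ Q) (h' : Q ≤ R) (a : X.K0u P) :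
    (Hom.id Y).mapK0u h' (φ.mapK0u h a) = φ.mapK0u (h.trans h') a := by
  rw [← mapK0u_id_left φ h h']
  exact Hom.mapK0u_square φ (Hom.id Y) (Hom.id X) φ (fun _ => rfl) h h' h h' a

lemma mapGL_id_right (φ : Hom X Y) (h : P ≤ Q) (h' : Q ≤ R) (a : X.K1u P) :
    (Hom.id Y).mapGL h' (φ.mapGL h a) = φ.mapGL (h.trans h') a := by
  obtain ⟨k, u, ⟨v, hu⟩, rfl⟩ := exists_gcls a
  rw [mapGL_gcls φ h ⟨v, hu⟩, mapGL_gcls φ _ ⟨v, hu⟩,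
    mapGL_gcls _ h' ⟨_, (φ.isInvPair P.r_pos hu).mono P.r_pos h.1 h.2.1 h.2.2⟩, mat_id]

end Relax

namespace Extension

section

variable {p : ℝ≥0∞} [Fact (1 ≤ p)] [Fact (p ≠ ∞)]
  {C : ℝ} {XJ XA XQ : FilteredMatrixAlgebra.{u} p} {E : Extension C XJ XA XQ}
  {s s' : Scale} {ι κ : Type} [Fintype ι] [DecidableEq ι] [Fintype κ] [DecidableEq κ] {n m : ℕ}
  {P Q R : Param} {u : Matrix ι ι XQ.carrier}
  {w w' : Matrix (ι ⊕ κ) (ι ⊕ κ) XA.carrier} {y : Matrix (ι ⊕ κ) (ι ⊕ κ) XJ.carrier}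

/-- Change of scale. -/
lemma IsDatum.rescale (h : E.IsDatum s n u w w' y) (hM : s.M ^ n ≤ s'.M ^ m)
    (hε : s.M ^ n * s.ε ≤ s'.M ^ m * s'.ε) (hr : s.M ^ n * s.r ≤ s'.M ^ m * s'.r) :
    E.IsDatum s' m u w w' y := by
  have hb : ∀ {X : FilteredMatrixAlgebra.{u} p} {α : Type} [Fintype α] [DecidableEq α]
      {x : Matrix α α X.carrier}, Bd s n x → Bd s' m x := fun hx =>
    Bd.of_le (mul_pos (s.pow_pos n) s.r_pos) hx.1 hx.2 hM hr
  have hp : ∀ {X : FilteredMatrixAlgebra.{u} p} {α : Type} [Fintype α] [DecidableEq α]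
      {x x' : Matrix α α X.carrier}, QP s n x x' → QP s' m x x' := fun hx =>
    ⟨hb hx.1, hb hx.2.1, le_trans hx.2.2.1 hε, le_trans hx.2.2.2 hε⟩
  obtain ⟨⟨u', h1⟩, h2, ⟨v, h3⟩, h4, h5, h6⟩ := h
  exact ⟨⟨u', hp h1⟩, hp h2, ⟨v, le_trans h3 hε⟩, hb h4, h5, le_trans h6 hε⟩

lemma mapK0u_dcls (hy : XJ.IsIdem P.ε P.r P.N (y + corn XJ ι κ))
    (hc : XJ.IsIdem P.ε P.r P.N (corn XJ ι κ)) (h : P ≤ Q) :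
    (Hom.id XJ).mapK0u h (dcls P y) = dcls Q y := by
  rw [dcls, map_sub, mapK0u_icls _ h hy, mapK0u_icls _ h hc, mat_id, mat_id]; rfl

lemma isIdem_corn (hP : s.Above 1 P) : XJ.IsIdem P.ε P.r P.N (corn XJ ι κ) :=
  (qi_corn (X := XJ)).isIdem_of_above hP

end

/-! ### The controlled boundary morphism and controlled exactness -/

section Morphism

variable {p : ℝ≥0∞} [Fact (1 ≤ p)] [Fact (p ≠ ∞)]
  {C : ℝ} {XJ XA XQ : FilteredMatrixAlgebra.{u} p} (E : Extension C XJ XA XQ) (hC : 1 ≤ C)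
  {n m l : ℕ} (hn : 11000 ≤ n)
  (hm : 10000000000000000 * (n + 11000) + 10000000000000000 ≤ m)

/-- The controlled boundary morphism. -/
def bdryMorphism : ControlledMorphism (powControl C hC m) XQ.K1 XJ.K0 where
  app P hP := ((E.bdry P.le_scale_M n hn P.below_scale
    ((P.above_ctrl hP).mono hm)).comp (XQ.K1red P).subtype).codRestrict _ fun x => by
      obtain ⟨⟩ := x
      rename_i x hx
      obtain ⟨k, u, hu, rfl⟩ := exists_gcls x
      obtain ⟨u', hu'⟩ := hu.exists_qp (P.below_scale (hC := hC))
      obtain ⟨w, w', y, -, -, -, h⟩ := E.exists_isDatum P.le_scale_M hu'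
      show E.bdry P.le_scale_M n hn P.below_scale ((P.above_ctrl hP).mono hm) (gcls P u) ∈ _
      rw [bdry_gcls hu (h.mono (by omega))]
      exact dcls_mem_K0red h.qi h.aug ((P.above_ctrl hP).mono (by omega))
  naturality P P' hP hP' hle hle' x := by
    obtain ⟨x, hx⟩ := x
    obtain ⟨k, u, hu, rfl⟩ := exists_gcls x
    obtain ⟨u', hu'⟩ := hu.exists_qp (P.below_scale (hC := hC))
    obtain ⟨w, w', y, -, -, -, h⟩ := E.exists_isDatum P.le_scale_M hu'
    -- One datum, chosen at P, is also a datum on the larger scale of P', so both sides of the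
    -- square are computed from the same y.
    have hM : (P.scale C hC).M ≤ (P'.scale C hC).M :=
      mul_le_mul_of_nonneg_left hle.2.2 (by linarith)
    have hp := pow_le_pow_left₀ (by linarith [(P.scale C hC).two_le]) hM n
    have hp0 := ((P'.scale C hC).pow_pos n).le
    have h' : E.IsDatum (P'.scale C hC) n u w w' y := (h.mono (by omega)).rescale hp
      (mul_le_mul hp hle.1 P.ε_pos.le hp0) (mul_le_mul hp hle.2.1 P.r_pos.le hp0)
    refine Subtype.ext ?_
    show E.bdry P'.le_scale_M n hn P'.below_scale ((P'.above_ctrl hP').mono hm)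
        ((Hom.id XQ).mapGL hle (gcls P u)) = (Hom.id XJ).mapK0u hle'
      (E.bdry P.le_scale_M n hn P.below_scale ((P.above_ctrl hP).mono hm) (gcls P u))
    have hu2 : XQ.IsInv P'.ε P'.r P'.N u := by
      obtain ⟨v, hv⟩ := hu
      exact ⟨_, hv.mono P.r_pos hle.1 hle.2.1 hle.2.2⟩
    rw [mapGL_gcls _ hle hu, mat_id, bdry_gcls hu2 h', bdry_gcls hu (h.mono (by omega)),
      mapK0u_dcls (h.qi.isIdem_of_above ((P.above_ctrl hP).mono (by omega)))
        (isIdem_corn ((P.above_ctrl hP).mono (by omega)))]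

/-- The induced maps already raise ε to Nε. This is still at level 1 of the scale of P since N ≤ M,
so the vanishing hypothesis is available where the exactness argument needs it. -/
lemma isExact_K1A (hl : 1000000 ≤ l) : IsExact (powControl C hC l) E.j.onK1 E.q.onK1 := by
  refine ⟨fun P hP x => Subtype.ext (E.q_j_K1 (P.le_induced (lt_of_comp_lt hP))
    (Param.le_induced _ (Param.comp_lt hP)) x.2), fun P hF hG y hy => ?_⟩
  have hR := (P.above_ctrl (lt_of_comp_lt hF)).mono hl
  have h1 : P ≤ P.comp _ _ hF := ((P.le_ctrl_pow (by omega) _).trans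
    ((P.ctrl _ (lt_of_comp_lt hF)).le_induced (Param.comp_lt hF))).trans (Param.ctrl_ctrl_le hF)
  obtain ⟨x, hx, h⟩ := E.exact_K1A P.le_scale_M (P.le_induced hG) (P.induced_below_scale hG) hR
    (((P.ctrl _ (lt_of_comp_lt hF)).le_induced (Param.comp_lt hF)).trans (Param.ctrl_ctrl_le hF))
    h1 (congrArg Subtype.val hy)
  refine ⟨h1, ⟨x, hx⟩, Subtype.ext ?_⟩
  exact (mapGL_id_right _ (Param.le_induced _ (Param.comp_lt hF)) (Param.ctrl_ctrl_le hF) x).trans h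

lemma isExact_K0A (hl : 10000000000000000000000000 ≤ l) :
    IsExact (powControl C hC l) E.j.onK0 E.q.onK0 := by
  refine ⟨fun P hP x => Subtype.ext (E.q_j_K0 (P.le_induced (lt_of_comp_lt hP))
    (Param.le_induced _ (Param.comp_lt hP)) x.2), fun P hF hG y hy => ?_⟩
  have hR := (P.above_ctrl (lt_of_comp_lt hF)).mono hl
  have h1 : P ≤ P.comp _ _ hF := ((P.le_ctrl_pow (by omega) _).trans
    ((P.ctrl _ (lt_of_comp_lt hF)).le_induced (Param.comp_lt hF))).trans (Param.ctrl_ctrl_le hF)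
  obtain ⟨x, hx, h⟩ := E.exact_K0A P.le_scale_M (P.le_induced hG) (P.induced_below_scale hG) hR
    (((P.ctrl _ (lt_of_comp_lt hF)).le_induced (Param.comp_lt hF)).trans (Param.ctrl_ctrl_le hF))
    h1 (congrArg Subtype.val hy)
  refine ⟨h1, ⟨x, hx⟩, Subtype.ext ?_⟩
  exact (mapK0u_id_right _ (Param.le_induced _ (Param.comp_lt hF)) (Param.ctrl_ctrl_le hF) x).trans h

lemma isExact_K1Q (hl : 1000000000000 * m + 1000000000000 ≤ l) :
    IsExact (powControl C hC l) E.q.onK1 (E.bdryMorphism hC hn hm) := by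
  refine ⟨fun P hP x => Subtype.ext (E.bdry_q (hs := Param.le_scale_M) (hn := hn)
    (hP' := Param.below_scale) (hQ := (Param.above_ctrl (hC := hC) (Param.comp_lt hP)).mono hm)
    (P.le_induced (lt_of_comp_lt hP)) x.1), fun P hF hG y hy => ?_⟩
  have hR := (P.above_ctrl (lt_of_comp_lt hF)).mono hl
  have h1 : P ≤ P.comp _ _ hF := ((P.le_ctrl_pow (by omega) _).trans
    ((P.ctrl _ (lt_of_comp_lt hF)).le_induced (Param.comp_lt hF))).trans (Param.ctrl_ctrl_le hF)
  obtain ⟨x, hx, h⟩ := E.exact_K1Q (hs := P.le_scale_M) (hn := hn) (hP := P.below_scale)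
    (hQ := (P.above_ctrl hG).mono hm) (P.below_ctrl hG) hR
    (((P.ctrl _ (lt_of_comp_lt hF)).le_induced (Param.comp_lt hF)).trans (Param.ctrl_ctrl_le hF))
    h1 y.2 (congrArg Subtype.val hy)
  refine ⟨h1, ⟨x, hx⟩, Subtype.ext ?_⟩
  exact (mapGL_id_right _ (Param.le_induced _ (Param.comp_lt hF)) (Param.ctrl_ctrl_le hF) x).trans h

lemma isExact_K0J (hl : 10000000000000000000000000000000000 ≤ l) :
    IsExact (powControl C hC l) (E.bdryMorphism hC hn hm) E.j.onK0 := by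
  refine ⟨fun P hP x => Subtype.ext (E.j_bdry (hs := Param.le_scale_M) (hn := hn)
    (hP := Param.below_scale) (hQ := (Param.above_ctrl (hC := hC) (lt_of_comp_lt hP)).mono hm)
    (Param.le_induced _ (Param.comp_lt hP)) x.1), fun P hF hG y hy => ?_⟩
  have hR := (P.above_ctrl (lt_of_comp_lt hF)).mono hl
  have hPR := P.le_ctrl_pow (by clear * - hl hm hn; omega) (lt_of_comp_lt hF)
  have hRT := ((P.ctrl _ (lt_of_comp_lt hF)).le_ctrl_pow (by clear * - hl hm hn; omega) (Param.comp_lt hF)).trans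
    (Param.ctrl_ctrl_le hF)
  obtain ⟨Ω, _, _, u, u', w, w', z, hu, hu1, hd, hcl⟩ := E.exact_K0J (P.le_induced hG)
    (P.induced_below_scale hG) (hR.mono (by norm_num)) y.2 (congrArg Subtype.val hy)
  set R := P.ctrl _ (lt_of_comp_lt hF)
  have huR : XQ.IsInv R.ε R.r R.N u := hu.isInv_of_above (hR.mono (by norm_num))
  -- The datum lives at a very high level of the scale of P. That level is dominated by R, and R is
  -- at level 1 of its own scale, so on the scale of R the same matrices form a datum at level 1.
  have hd' : E.IsDatum (R.scale C hC) 1 u w w' z := by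
    have hR' := hR.mono (m := 1000000000000000000000000000000000) (by norm_num)
    have hb := R.below_scale (hC := hC)
    exact hd.rescale (hR'.2.2.trans hb.2.2) (hR'.1.trans hb.1) (hR'.2.1.trans hb.2.1)
  refine ⟨hPR.trans hRT, ⟨gcls R u, mem_K1red_of_aug_eq_one huR hu1⟩, Subtype.ext ?_⟩
  show (Hom.id XJ).mapK0u (Param.ctrl_ctrl_le hF) (E.bdry R.le_scale_M n hn
    R.below_scale ((R.above_ctrl (Param.comp_lt hF)).mono hm) (gcls R u)) =
    (Hom.id XJ).mapK0u (hPR.trans hRT) y.1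
  have ha := (R.above_ctrl (Param.comp_lt hF)).mono hm
  rw [bdry_gcls huR (hd'.mono (by clear * - hl hm hn; omega)),
    mapK0u_dcls (hd'.qi.isIdem_of_above (ha.mono (by clear * - hl hm hn; omega))) (isIdem_corn (ha.mono (by clear * - hl hm hn; omega))),
    hcl _ ((hR.mono (by norm_num)).trans hRT)]

end Morphism

end Extension

end FilteredMatrixAlgebra
end QuantK

namespace QuantK

/-! ### Scalar matrices on subspaces of quotients of `L_p` -/

section SQp

variable {p : ℝ≥0∞} [Fact (1 ≤ p)] [hp : Fact (p ≠ ∞)] {ι : Type} [Fintype ι]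

lemma toReal_pos_of_fact (p : ℝ≥0∞) [Fact (1 ≤ p)] [hp : Fact (p ≠ ∞)] : 0 < p.toReal :=
  ENNReal.toReal_pos (lt_of_lt_of_le one_pos (Fact.out : 1 ≤ p)).ne' hp.out

lemma PiLp_norm_rpow {E : Type u} [SeminormedAddCommGroup E] (z : PiLp p (fun _ : ι => E)) :
    ‖z‖ ^ p.toReal = ∑ i, ‖z i‖ ^ p.toReal := by
  have hp0 := toReal_pos_of_fact p
  rw [PiLp.norm_eq_sum hp0, ← Real.rpow_mul (Finset.sum_nonneg fun i _ => by positivity),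
    one_div_mul_cancel hp0.ne', Real.rpow_one]

/-- The scalar matrix `z` acts on `ℓ_p^n(E)` with norm at most `K`. -/
def ScalarBound (p : ℝ≥0∞) (K : ℝ) (z : Matrix ι ι ℂ) (E : Type u) [SeminormedAddCommGroup E]
    [NormedSpace ℂ E] : Prop :=
  ∀ x : ι → E, ∑ i, ‖∑ j, z i j • x j‖ ^ p.toReal ≤ K ^ p.toReal * ∑ j, ‖x j‖ ^ p.toReal

lemma scalarBound_complex (z : Matrix ι ι ℂ) :
    ScalarBound p (opNorm p ι (z.map fun a => a • (1 : ℂ →L[ℂ] ℂ))) z ℂ := by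
  intro x
  have h := ContinuousLinearMap.le_opNorm (matrixOp p (z.map fun a => a • (1 : ℂ →L[ℂ] ℂ)))
    (WithLp.toLp p x)
  have h2 := Real.rpow_le_rpow (norm_nonneg _) h (toReal_pos_of_fact p).le
  rw [Real.mul_rpow (norm_nonneg _) (norm_nonneg _), PiLp_norm_rpow, PiLp_norm_rpow] at h2
  simpa [matrixOp_apply, opNorm] using h2

lemma opNorm_le_of_scalarBound {E : Type u} [NormedAddCommGroup E] [NormedSpace ℂ E] {K : ℝ}
    (hK : 0 ≤ K) {z : Matrix ι ι ℂ} (h : ScalarBound p K z E) :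
    opNorm p ι (z.map fun a => a • (1 : E →L[ℂ] E)) ≤ K := by
  refine ContinuousLinearMap.opNorm_le_bound _ hK fun x => ?_
  rw [← Real.rpow_le_rpow_iff (norm_nonneg _) (by positivity) (toReal_pos_of_fact p),
    Real.mul_rpow hK (norm_nonneg _), PiLp_norm_rpow, PiLp_norm_rpow]
  simpa [matrixOp_apply] using h fun i => x i

lemma ScalarBound.of_isometry {E : Type u} [SeminormedAddCommGroup E] [NormedSpace ℂ E] {F : Type v}
    [SeminormedAddCommGroup F] [NormedSpace ℂ F] {K : ℝ} {z : Matrix ι ι ℂ} (h : ScalarBound p K z F)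
    (φ : E →ₗᵢ[ℂ] F) : ScalarBound p K z E := by
  intro x
  have := h fun i => φ (x i)
  simpa only [← map_smul, ← map_sum, φ.norm_map] using this

/-- Each vector is lifted with norm increased by less than δ, the bound is used upstairs, and δ
tends to 0. -/
lemma ScalarBound.quotient {F : Type v} [NormedAddCommGroup F] [NormedSpace ℂ F] {K : ℝ} (hK : 0 ≤ K)
    {z : Matrix ι ι ℂ} (h : ScalarBound p K z F) (M : Submodule ℂ F) :
    ScalarBound p K z (F ⧸ M) := by
  intro x
  have hp0 := toReal_pos_of_fact p
  have lim : Filter.Tendsto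
      (fun δ : ℝ => K ^ p.toReal * ∑ j, (‖x j‖ + δ) ^ p.toReal)
      (nhdsWithin 0 (Set.Ioi 0)) (nhds (K ^ p.toReal * ∑ j, ‖x j‖ ^ p.toReal)) := by
    have : Continuous fun δ : ℝ => K ^ p.toReal * ∑ j, (‖x j‖ + δ) ^ p.toReal := by
      refine continuous_const.mul (continuous_finsetSum _ fun j _ => ?_)
      exact (continuous_const.add continuous_id).rpow_const fun _ => Or.inr hp0.le
    simpa using (this.tendsto 0).mono_left nhdsWithin_le_nhds
  refine ge_of_tendsto lim ?_
  filter_upwards [self_mem_nhdsWithin] with δ hδ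
  choose f hf hfn using fun j => Submodule.Quotient.norm_mk_lt (x j) (show 0 < δ from hδ)
  refine le_trans ?_ ((h f).trans ?_)
  · refine Finset.sum_le_sum fun i _ => Real.rpow_le_rpow (norm_nonneg _) ?_ hp0.le
    have e : ∑ j, z i j • x j = Submodule.Quotient.mk (∑ j, z i j • f j) := by
      rw [← Submodule.mkQ_apply, map_sum]
      refine Finset.sum_congr rfl fun j _ => ?_
      rw [map_smul, Submodule.mkQ_apply, hf]
    rw [e]
    exact Submodule.Quotient.norm_mk_le M _
  · refine mul_le_mul_of_nonneg_left ?_ (Real.rpow_nonneg hK _)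
    exact Finset.sum_le_sum fun j _ => Real.rpow_le_rpow (norm_nonneg _) (hfn j).le hp0.le

lemma ScalarBound.enorm {K : ℝ} (hK : 0 ≤ K) {z : Matrix ι ι ℂ} (h : ScalarBound p K z ℂ)
    (x : ι → ℂ) : ∑ i, ‖∑ j, z i j • x j‖ₑ ^ p.toReal ≤
      ENNReal.ofReal (K ^ p.toReal) * ∑ j, ‖x j‖ₑ ^ p.toReal := by
  have hp0 := toReal_pos_of_fact p
  have e : ∀ y : ι → ℂ, ∑ i, ‖y i‖ₑ ^ p.toReal = ENNReal.ofReal (∑ i, ‖y i‖ ^ p.toReal) := by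
    intro y
    rw [ENNReal.ofReal_sum_of_nonneg fun i _ => by positivity]
    refine Finset.sum_congr rfl fun i _ => ?_
    rw [← ofReal_norm, ENNReal.ofReal_rpow_of_nonneg (norm_nonneg _) hp0.le]
  rw [e, e, ← ENNReal.ofReal_mul (Real.rpow_nonneg hK _)]
  exact ENNReal.ofReal_le_ofReal (h x)

/-- The inequality for scalars holds almost everywhere on Ω; integrating its p-th power form gives
the inequality for functions. -/
lemma ScalarBound.lp {Ω : Type v} [MeasurableSpace Ω] (μ : MeasureTheory.Measure Ω) {K : ℝ} (hK : 0 ≤ K)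
    {z : Matrix ι ι ℂ} (h : ScalarBound p K z ℂ) : ScalarBound p K z (MeasureTheory.Lp ℂ p μ) := by
  intro f
  have hp0 := toReal_pos_of_fact p
  have hne : p ≠ 0 := (lt_of_lt_of_le one_pos (Fact.out : 1 ≤ p)).ne'
  have key : ∀ g : MeasureTheory.Lp ℂ p μ, ENNReal.ofReal (‖g‖ ^ p.toReal) =
      ∫⁻ ω, ‖g ω‖ₑ ^ p.toReal ∂μ := by
    intro g
    rw [← ENNReal.ofReal_rpow_of_nonneg (norm_nonneg _) hp0.le, ofReal_norm,
      MeasureTheory.Lp.enorm_def,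
      MeasureTheory.eLpNorm_eq_lintegral_rpow_enorm_toReal hne hp.out, ← ENNReal.rpow_mul,
      one_div_mul_cancel hp0.ne', ENNReal.rpow_one]
  have meas : ∀ g : MeasureTheory.Lp ℂ p μ, AEMeasurable (fun ω => ‖g ω‖ₑ ^ p.toReal) μ := fun g =>
    (MeasureTheory.Lp.aestronglyMeasurable g).enorm.pow_const _
  have sum : ∀ g : ι → MeasureTheory.Lp ℂ p μ, ENNReal.ofReal (∑ i, ‖g i‖ ^ p.toReal) =
      ∫⁻ ω, ∑ i, ‖g i ω‖ₑ ^ p.toReal ∂μ := by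
    intro g
    rw [ENNReal.ofReal_sum_of_nonneg fun i _ => by positivity,
      MeasureTheory.lintegral_finsetSum' _ fun i _ => meas (g i)]
    exact Finset.sum_congr rfl fun i _ => key (g i)
  have hae : ∀ᵐ ω ∂μ, ∀ i, (∑ j, z i j • f j : MeasureTheory.Lp ℂ p μ) ω = ∑ j, z i j • f j ω := by
    refine MeasureTheory.ae_all_iff.2 fun i => ?_
    have h1 := MeasureTheory.Lp.coeFn_fun_finsetSum Finset.univ fun j => z i j • f j
    have h2 : ∀ᵐ ω ∂μ, ∀ j, (z i j • f j : MeasureTheory.Lp ℂ p μ) ω = z i j • f j ω :=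
      MeasureTheory.ae_all_iff.2 fun j => MeasureTheory.Lp.coeFn_smul _ _
    filter_upwards [h1, h2] with ω h1 h2
    rw [h1]
    exact Finset.sum_congr rfl fun j _ => h2 j
  refine (ENNReal.ofReal_le_ofReal_iff (mul_nonneg (Real.rpow_nonneg hK _)
    (Finset.sum_nonneg fun j _ => by positivity))).1 ?_
  rw [ENNReal.ofReal_mul (Real.rpow_nonneg hK _), sum, sum,
    ← MeasureTheory.lintegral_const_mul' _ _ ENNReal.ofReal_ne_top]
  refine MeasureTheory.lintegral_mono_ae ?_
  filter_upwards [hae] with ω hω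
  simp only [hω]
  exact h.enorm hK fun j => f j ω

/-- The p-th power inequality passes from ℂ to L_p, to quotients and to subspaces. The geometry of E
enters the proof only here. -/
lemma IsSQp.opNorm_scalar_le {E : Type u} [NormedAddCommGroup E] [NormedSpace ℂ E]
    (hE : IsSQp.{u, v} p E) (z : Matrix ι ι ℂ) :
    opNorm p ι (z.map fun a => a • (1 : E →L[ℂ] E)) ≤
      opNorm p ι (z.map fun a => a • (1 : ℂ →L[ℂ] ℂ)) := by
  obtain ⟨Ω, _, μ, M, _, ⟨φ⟩⟩ := hE
  have hK : 0 ≤ opNorm p ι (z.map fun a => a • (1 : ℂ →L[ℂ] ℂ)) := norm_nonneg _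
  exact opNorm_le_of_scalarBound hK
    ((((scalarBound_complex z).lp μ hK).quotient hK M).of_isometry φ)

end SQp

end QuantK

namespace QuantK

namespace FilteredMatrixAlgebra

/-! ### Boundary data over matrices of the form `diag(u, v)` -/

lemma blockSum_submatrix {B : Type u} [Zero B] {k l : ℕ} (x : Matrix (Fin k) (Fin k) B)
    (y : Matrix (Fin l) (Fin l) B) :
    (blockSum x y).submatrix finSumFinEquiv finSumFinEquiv = Matrix.fromBlocks x 0 0 y := by
  ext i j; simp [blockSum]

lemma blockSum_one_zero {B : Type u} [Zero B] [One B] {k : ℕ} (x : Matrix (Fin k) (Fin k) B) :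
    blockSum x (1 : Matrix (Fin 0) (Fin 0) B) = x := by
  ext i j
  have h : ∀ i : Fin (k + 0), finSumFinEquiv.symm i = Sum.inl (Fin.cast (add_zero k) i) :=
    fun i => finSumFinEquiv_symm_apply_castAdd (n := 0) i
  rw [blockSum, Matrix.submatrix_apply, h, h]
  rfl

namespace Extension

section

variable {p : ℝ≥0∞} [Fact (1 ≤ p)] [Fact (p ≠ ∞)]
  {C : ℝ} {XJ XA XQ : FilteredMatrixAlgebra.{u} p} {E : Extension C XJ XA XQ}
  {s : Scale} {n k l : ℕ} {P Q : Param} {u : Matrix (Fin k) (Fin k) XQ.carrier}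
  {v : Matrix (Fin l) (Fin l) XQ.carrier}
  {w w' : Matrix (Fin (k + l)) (Fin (k + l)) XA.carrier}
  {y : Matrix (Fin (k + l)) (Fin (k + l)) XJ.carrier}

/-- Translates the conditions in the definition of the boundary map, for matrices of size k + l,
into a datum for block matrices. The factor 3C is absorbed by one level, and the norm of y is
recovered from its closeness to a bounded matrix. -/
lemma isDatum_of_blockSum (hs : 40 * C ≤ s.M) (hu : ∃ u', QP s n u u')
    (hw : XA.IsInvPair (s.M ^ n * s.ε) (s.M ^ n * s.r) (s.M ^ n) w w')
    (hl : ‖E.q.mat w - blockSum u v‖ < s.M ^ n * s.ε) (ha : ∀ i j, XJ.aug (y i j) = 0)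
    (hy : ∀ i j, y i j ∈ XJ.fil (s.M ^ n * s.r))
    (h : ‖w * XA.corner k l * w' - XA.corner k l - E.j.mat y‖ < 3 * C * (s.M ^ n * s.ε)) :
    E.IsDatum s (10 * n + 100) u (w.submatrix finSumFinEquiv finSumFinEquiv)
      (w'.submatrix finSumFinEquiv finSumFinEquiv)
      (y.submatrix finSumFinEquiv finSumFinEquiv) := by
  have hr : 0 < s.M ^ n * s.r := mul_pos (s.pow_pos n) s.r_pos
  obtain ⟨u', hu⟩ := hu
  have hw' : QP s n (w.submatrix (finSumFinEquiv (m := k) (n := l)) finSumFinEquiv)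
    (w'.submatrix finSumFinEquiv finSumFinEquiv) :=
    (hw.qp hr le_rfl le_rfl le_rfl).submatrix finSumFinEquiv
  have e : (XA.corner k l).submatrix finSumFinEquiv finSumFinEquiv = corn XA (Fin k) (Fin l) :=
    blockSum_submatrix _ _
  have h1 : Cl s (n + 1) (w.submatrix finSumFinEquiv finSumFinEquiv * corn XA (Fin k) (Fin l) *
      w'.submatrix finSumFinEquiv finSumFinEquiv - corn XA (Fin k) (Fin l))
      (E.j.mat (y.submatrix finSumFinEquiv finSumFinEquiv)) := by
    rw [← e, map_submatrix, Matrix.submatrix_mul_equiv, Matrix.submatrix_mul_equiv]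
    refine ((norm_submatrix_le (w * XA.corner k l * w' - XA.corner k l - E.j.mat y)
      finSumFinEquiv finSumFinEquiv).trans h.le).trans ?_
    have := E.six_mul_le hs n
    nlinarith [mul_nonneg (mul_nonneg (show (0 : ℝ) ≤ C by linarith [E.one_le]) (s.pow_pos n).le)
      s.ε_pos.le, s.ε_pos]
  have hb := ((hw'.1.mul (bd_corn (ι := Fin k) (κ := Fin l))).mul hw'.2.1).sub
    (bd_corn (s := s) (X := XA) (ι := Fin k) (κ := Fin l))
  have h2 := h1.bd hb (c := n) fun i j => E.j.fil_le hr (hy _ _)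
  refine ⟨⟨u', hu.mono (by omega)⟩, hw'.mono (by omega), ⟨v, ?_⟩, ⟨?_, ?_⟩, fun i j => ha _ _, ?_⟩
  · rw [← blockSum_submatrix, map_submatrix]
    exact Cl.submatrix (Cl.mono (n := n) hl.le (by omega)) _ _
  · exact (E.norm_le _).trans (h2.mono (m := 10 * n + 100) (by omega)).1
  · exact fil_mono_mem hr (mul_le_mul_of_nonneg_right (s.pow_mono (by omega)) s.r_pos.le)
      fun i j => hy _ _
  · refine le_trans (le_of_eq ?_) (h1.mono (m := 10 * n + 100) (by omega))
    rw [sub_sub]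

/-- The quasi-inverse of u serves as v, and the lift built from elementary matrices serves as w. All
its levels are below 20000, which leaves room for strict inequalities. -/
lemma exists_blockSum (E : Extension C XJ XA XQ) (hs : 40 * C ≤ s.M) (hn : 20000 ≤ n)
    {ε r N : ℝ} (hε : 0 < ε)
    (hr : 0 < r) (hN : 1 ≤ N) (h1 : ε ≤ s.M * s.ε) (h2 : r ≤ s.M * s.r)
    (h3 : N ≤ s.M) (hu : XQ.IsInv ε r N u) :
    ∃ (v : Matrix (Fin k) (Fin k) XQ.carrier)
      (w w' : Matrix (Fin (k + k)) (Fin (k + k)) XA.carrier)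
      (y : Matrix (Fin (k + k)) (Fin (k + k)) XJ.carrier),
      XQ.IsInv ε r N v ∧
      XQ.InvHomotopic (2 * ε) (2 * r) (2 * (N + ε)) (blockSum u v) 1 ∧
      XA.IsInvPair (s.M ^ n * s.ε) (s.M ^ n * s.r) (s.M ^ n) w w' ∧
      ‖E.q.mat w - blockSum u v‖ < s.M ^ n * s.ε ∧ (∀ i j, XJ.aug (y i j) = 0) ∧
      (∀ i j, y i j ∈ XJ.fil (s.M ^ n * s.r)) ∧
      ‖w * XA.corner k k * w' - XA.corner k k - E.j.mat y‖ < 3 * C * (s.M ^ n * s.ε) := by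
  obtain ⟨u', hu⟩ := hu
  have hq : QP s 1 u u' := hu.qp hr (by rwa [pow_one]) (by rwa [pow_one]) (by rwa [pow_one])
  obtain ⟨w, w', y, hw, hlift, hcl, hd⟩ := E.exists_isDatum hs hq
  have hlt : ∀ {a : ℕ}, a ≤ 19999 → s.M ^ a * s.ε < s.M ^ n * s.ε := fun {a} ha =>
    mul_lt_mul_of_pos_right ((s.pow_lt_succ a).trans_le (s.pow_mono (by omega))) s.ε_pos
  refine ⟨u', w.submatrix finSumFinEquiv.symm finSumFinEquiv.symm,
    w'.submatrix finSumFinEquiv.symm finSumFinEquiv.symm,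
    y.submatrix finSumFinEquiv.symm finSumFinEquiv.symm,
    ⟨u, hu.2.1, hu.1, hu.2.2.2.1, hu.2.2.1, hu.2.2.2.2.2, hu.2.2.2.2.1⟩, ?_, ?_, ?_,
    fun i j => hd.aug _ _, ?_, ?_⟩
  · obtain ⟨v, v', γ, δ, hγ⟩ := hu.invHomotopic_one hε hr hN
    have e : (1 : Matrix (Fin (k + k)) (Fin (k + k)) XQ.carrier) =
      (1 : Matrix (Fin k ⊕ Fin k) (Fin k ⊕ Fin k) XQ.carrier).submatrix
        finSumFinEquiv.symm finSumFinEquiv.symm := (Matrix.submatrix_one_equiv _).symm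
    rw [e]
    exact ⟨_, _, γ.map (continuous_submatrix finSumFinEquiv.symm),
      δ.map (continuous_submatrix finSumFinEquiv.symm), fun t => (hγ t).reindex _⟩
  · exact (hw.qp.submatrix finSumFinEquiv.symm).isInvPair
      (mul_le_mul_of_nonneg_right (s.pow_mono (by omega)) s.ε_pos.le)
      (mul_le_mul_of_nonneg_right (s.pow_mono (by omega)) s.r_pos.le) (s.pow_mono (by omega))
  · rw [map_submatrix]
    exact (Cl.submatrix hlift finSumFinEquiv.symm finSumFinEquiv.symm).trans_lt (hlt (by norm_num))
  · exact fil_mono_mem (mul_pos (s.pow_pos _) s.r_pos) (mul_le_mul_of_nonneg_right (s.pow_mono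
      (by omega)) s.r_pos.le) fun i j => hd.bd.2 _ _
  · have h3 : s.M ^ n * s.ε ≤ 3 * C * (s.M ^ n * s.ε) :=
      le_mul_of_one_le_left (mul_pos (s.pow_pos n) s.ε_pos).le (by linarith [E.one_le])
    have h4 := Cl.submatrix hcl (finSumFinEquiv (m := k) (n := k)).symm
      (finSumFinEquiv (m := k) (n := k)).symm
    refine lt_of_le_of_lt (le_trans (le_of_eq ?_) h4) ((hlt (by norm_num)).trans_le h3)
    rw [map_submatrix, corner, blockSum, Matrix.submatrix_mul_equiv, Matrix.submatrix_mul_equiv,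
      sub_sub]
    rfl

end

section

variable {p : ℝ≥0∞} [Fact (1 ≤ p)] [Fact (p ≠ ∞)]
  {C : ℝ} {XJ XA XQ : FilteredMatrixAlgebra.{u} p} {E : Extension C XJ XA XQ} {hC : 1 ≤ C}
  {n m k l : ℕ} {hn : 11000 ≤ n}
  {hm : 10000000000000000 * (n + 11000) + 10000000000000000 ≤ m}

lemma bdryMorphism_invClass {P : Param} (hP : (powControl C hC m).lam P.N * P.ε < 1 / 20)
    {u : Matrix (Fin k) (Fin k) XQ.carrier} (hu : XQ.IsInv P.ε P.r P.N u)
    (hker : XQ.invClass P u hu ∈ XQ.K1red P)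
    {w w' : Matrix (Fin k ⊕ Fin l) (Fin k ⊕ Fin l) XA.carrier}
    {y : Matrix (Fin (k + l)) (Fin (k + l)) XJ.carrier}
    (h : E.IsDatum (P.scale C hC) n u w w' (y.submatrix finSumFinEquiv finSumFinEquiv)) :
    ∃ (hy : XJ.IsIdem (P.ctrl _ hP).ε (P.ctrl _ hP).r (P.ctrl _ hP).N (y + XJ.corner k l))
      (h1 : XJ.IsIdem (P.ctrl _ hP).ε (P.ctrl _ hP).r (P.ctrl _ hP).N (XJ.corner k l)),
      (XJ.K0red (P.ctrl _ hP)).subtype ((E.bdryMorphism hC hn hm).app P hP ⟨XQ.invClass P u hu, hker⟩) =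
        XJ.idemClass (P.ctrl _ hP) _ hy - XJ.idemClass (P.ctrl _ hP) _ h1 := by
  have ha := P.above_ctrl hP
  have e1 : (y.submatrix (finSumFinEquiv (m := k) (n := l)) finSumFinEquiv + corn XJ _ _).submatrix
      finSumFinEquiv.symm finSumFinEquiv.symm = y + XJ.corner k l := by
    ext i j; simp [corner, blockSum, corn]
  have e2 : (corn XJ (Fin k) (Fin l)).submatrix finSumFinEquiv.symm finSumFinEquiv.symm =
    XJ.corner k l := rfl
  have hy := h.qi.isIdem_of_above (ha.mono (m := 30 * n + 30 + 1) (by clear * - hm; omega))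
  have h1 : XJ.IsIdem (P.ctrl _ hP).ε (P.ctrl _ hP).r (P.ctrl _ hP).N
    (corn XJ (Fin k) (Fin l)) := isIdem_corn (ha.mono (by clear * - hm; omega))
  have hy' := hy.reindex finSumFinEquiv.symm
  have h1' := h1.reindex finSumFinEquiv.symm
  rw [e1] at hy'
  rw [e2] at h1'
  refine ⟨hy', h1', ?_⟩
  rw [← icls_fin hy', ← icls_fin h1']
  have h3 := icls_submatrix hy finSumFinEquiv.symm
  have h4 := icls_submatrix h1 finSumFinEquiv.symm
  rw [e1] at h3
  rw [e2] at h4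
  rw [h3, h4]
  show E.bdry P.le_scale_M n hn P.below_scale ((P.above_ctrl hP).mono hm) (XQ.invClass P u hu) = _
  rw [← gcls_fin hu, bdry_gcls hu h]
  rfl

end

end Extension

end FilteredMatrixAlgebra
end QuantK

namespace QuantK

/-! ### Extensions of filtered algebras of operators -/

namespace FilteredSubalgebra

variable {E : Type u} [NormedAddCommGroup E] [NormedSpace ℂ E] {p : ℝ≥0∞} [Fact (1 ≤ p)]
  [Fact (p ≠ ∞)]

lemma unitizationNrm_algebraMap_le (hE : IsSQp.{u, v} p E) (A : FilteredSubalgebra E) {ι : Type}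
    [Fintype ι] (x : Matrix ι ι ℂ) : A.unitizationNrm p ι (x.map (algebraMap ℂ A.unitizationAlg)) ≤
      opNorm p ι (x.map fun a => a • (1 : ℂ →L[ℂ] ℂ)) := by
  have e : opNorm p ι ((x.map (algebraMap ℂ A.unitizationAlg)).map A.opPart) =
      opNorm p ι (x.map fun a => a • (1 : E →L[ℂ] E)) :=
    congrArg (opNorm p ι) (by
      ext1 i k
      exact Algebra.algebraMap_eq_smul_one (A := E →L[ℂ] E) (x i k))
  exact max_le (e.le.trans (hE.opNorm_scalar_le x)) le_rfl

lemma algebraMap_mem_fil (A : FilteredSubalgebra E) (r : ℝ) (z : ℂ) :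
    algebraMap ℂ A.unitizationAlg z ∈ (A.unitization p).fil r := by
  show algebraMap ℂ (E →L[ℂ] E) z - z • (1 : E →L[ℂ] E) ∈ A.fil r
  rw [Algebra.algebraMap_eq_smul_one, sub_self]
  exact zero_mem _

/-- The unit `ℂ → A^♯`. -/
def unitHom (hE : IsSQp.{u, v} p E) (A : FilteredSubalgebra E) :
    (FilteredMatrixAlgebra.scalars p).Hom (A.unitization p) where
  toAlgHom := Algebra.ofId ℂ A.unitizationAlg
  nrm_le _ _ x := A.unitizationNrm_algebraMap_le hE x
  fil_le {r a} _ _ := A.algebraMap_mem_fil (p := p) r a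
  aug_comp _ := rfl

namespace ClosedIdeal

variable {A : FilteredSubalgebra E} {J : A.ClosedIdeal} {C : ℝ} {ι : Type} [Fintype ι] {r δ : ℝ}

/-- Replaces the two infima by actual elements, and `Fin n` by an arbitrary finite index type. -/
lemma IsCompletelyFiltered.exists_lt (h : J.IsCompletelyFiltered p C) (hC : 0 < C) (hr : 0 < r)
    {x : Matrix ι ι (E →L[ℂ] E)} (hx : ∀ i j, x i j ∈ A.fil r) {y : Matrix ι ι (E →L[ℂ] E)}
    (hy : ∀ i j, y i j ∈ J.carrier) (hδ : opNorm p ι (x + y) < δ) :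
    ∃ z : Matrix ι ι (E →L[ℂ] E), (∀ i j, z i j ∈ J.carrier ⊓ A.fil r) ∧
      opNorm p ι (x + z) < C * δ := by
  let σ : Fin (Fintype.card ι) ≃ ι := (Fintype.equivFin ι).symm
  have h1 := h (Fintype.card ι) r hr (x.submatrix σ σ) fun i j => hx _ _
  have h2 : (⨅ y : {y : Matrix (Fin (Fintype.card ι)) (Fin (Fintype.card ι)) (E →L[ℂ] E) //
      ∀ i j, y i j ∈ J.carrier}, opNorm p (Fin (Fintype.card ι)) (x.submatrix σ σ + y.1)) < δ := by
    refine lt_of_le_of_lt ?_ ((opNorm_submatrix_le (x + y) σ σ).trans_lt hδ)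
    exact ciInf_le (f := fun y : {y : Matrix (Fin (Fintype.card ι)) (Fin (Fintype.card ι))
      (E →L[ℂ] E) // ∀ i j, y i j ∈ J.carrier} => opNorm p _ (x.submatrix σ σ + y.1))
      ⟨0, by rintro _ ⟨y, rfl⟩; exact norm_nonneg _⟩ ⟨y.submatrix σ σ, fun i j => hy _ _⟩
  have : Nonempty {y : Matrix (Fin (Fintype.card ι)) (Fin (Fintype.card ι)) (E →L[ℂ] E) //
    ∀ i j, y i j ∈ J.carrier ⊓ A.fil r} := ⟨⟨0, fun i j => zero_mem _⟩⟩
  obtain ⟨⟨z, hz⟩, h3⟩ := exists_lt_of_ciInf_lt (h1.trans_lt (mul_lt_mul_of_pos_left h2 hC))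
  refine ⟨z.submatrix σ.symm σ.symm, fun i j => hz _ _, lt_of_le_of_lt ?_ h3⟩
  refine le_trans (le_of_eq ?_) (opNorm_submatrix_le (x.submatrix σ σ + z) σ.symm σ.symm)
  congr 1
  ext i j
  simp

/-- A lift of norm below δ has scalar part below δ, in M_n(ℂ) and hence over E. Removing the scalars
leaves 2δ, complete filtration gives 2Cδ, and putting the scalars back gives 2Cδ + δ ≤ 3Cδ. -/
lemma IsCompletelyFiltered.exists_approx (hE : IsSQp.{u, v} p E) (h : J.IsCompletelyFiltered p C)
    (hC : 1 ≤ C) (hr : 0 < r) {x : Matrix ι ι A.unitizationAlg}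
    (hx : ∀ i k, x i k ∈ (A.unitization p).fil r)
    (hδ : quotientNorm (A.unitizationNrm p) J.quot ι (x.map J.quot) < δ) :
    ∃ z : Matrix ι ι J.toFiltered.unitizationAlg,
      (∀ i k, J.toFiltered.scalarPart (z i k) = 0) ∧
      (∀ i k, z i k ∈ (J.toFiltered.unitization p).fil r) ∧
      A.unitizationNrm p ι (fun i k => x i k - ⟨(z i k).1, J.le (z i k).2⟩) < 3 * C * δ := by
  obtain ⟨X, hX, hX'⟩ := exists_lift_lt (nrm := A.unitizationNrm p) J.quot_surjective
    (x.map J.quot) (sub_pos.2 hδ)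
  rw [add_sub_cancel] at hX'
  have hXx : ∀ i k, X i k - x i k ∈ J.ideal := fun i k =>
    Ideal.Quotient.eq.1 (congrFun (congrFun hX i) k)
  have hsc : ∀ i k, (X i k).1.2 = (x i k).1.2 := fun i k => sub_eq_zero.1 (hXx i k).1
  obtain ⟨ho, hs⟩ := max_lt_iff.1 hX'
  set S : Matrix ι ι ℂ := fun i k => (x i k).1.2 with hS
  have e1 : (X.map fun a => A.scalarPart a • (1 : ℂ →L[ℂ] ℂ)) = S.map fun a => a • 1 := by
    ext1 i k
    exact congrArg (· • (1 : ℂ →L[ℂ] ℂ)) (hsc i k)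
  rw [e1] at hs
  have hs' := (hE.opNorm_scalar_le S).trans_lt hs
  have hδ0 : 0 < δ := lt_of_le_of_lt (norm_nonneg _) ho
  -- The small lift X differs from x by a matrix over J and has the same scalar part S, so the
  -- nonunital part of x plus this matrix is X - S.
  have hsum : opNorm p ι (x.map A.nonunitalPart + Matrix.of fun i k => (X i k - x i k).1.1) < 2 * δ := by
    have e2 : (x.map A.nonunitalPart + Matrix.of fun i k => (X i k - x i k).1.1) = X.map A.opPart + (-1 : ℂ) • S.map fun a => a • 1 := by
      ext1 i k
      show ((x i k).1.1 - (x i k).1.2 • (1 : E →L[ℂ] E)) + ((X i k).1.1 - (x i k).1.1) =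
        (X i k).1.1 + (-1 : ℂ) • ((x i k).1.2 • (1 : E →L[ℂ] E))
      rw [neg_one_smul]
      abel
    rw [e2, opNorm, matrixOp_add, matrixOp_smul]
    refine (norm_add_le _ _).trans_lt ?_
    rw [norm_smul, norm_neg, norm_one, one_mul]
    have h1 : ‖matrixOp p (X.map A.opPart)‖ < δ := ho
    have h2 : ‖matrixOp p (S.map fun a => a • (1 : E →L[ℂ] E))‖ < δ := hs'
    linarith
  obtain ⟨y, hy, hlt⟩ := h.exists_lt (by linarith) hr (x := x.map A.nonunitalPart)
    (fun i k => hx i k) (fun i k => (hXx i k).2) hsum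
  have hmem : ∀ i k, (-(y i k), (0 : ℂ)).1 - (-(y i k), (0 : ℂ)).2 • (1 : E →L[ℂ] E) ∈
      J.carrier ⊓ A.fil r := fun i k => by
    rw [zero_smul, sub_zero]
    exact neg_mem (hy i k)
  refine ⟨fun i k => ⟨(-(y i k), 0), (hmem i k).1⟩, fun i k => rfl, hmem, max_lt ?_ ?_⟩
  · have e3 : Matrix.map (fun i k => x i k - ⟨(-(y i k), 0), J.le (hmem i k).1⟩) A.opPart =
        (x.map A.nonunitalPart + y) + S.map fun a => a • 1 := by
      ext1 i k
      show (x i k).1.1 - -(y i k) =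
        ((x i k).1.1 - (x i k).1.2 • (1 : E →L[ℂ] E)) + y i k + (x i k).1.2 • (1 : E →L[ℂ] E)
      abel
    rw [e3, opNorm, matrixOp_add]
    refine (norm_add_le _ _).trans_lt ?_
    have h1 : ‖matrixOp p (x.map A.nonunitalPart + y)‖ < C * (2 * δ) := hlt
    have h2 : ‖matrixOp p (S.map fun a => a • (1 : E →L[ℂ] E))‖ < δ := hs'
    nlinarith
  · have e4 : Matrix.map (fun i k => x i k - ⟨(-(y i k), 0), J.le (hmem i k).1⟩)
        (fun a => A.scalarPart a • (1 : ℂ →L[ℂ] ℂ)) = S.map fun a => a • 1 := by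
      ext1 i k
      show ((x i k).1.2 - 0) • (1 : ℂ →L[ℂ] ℂ) = (x i k).1.2 • 1
      rw [sub_zero]
    rw [e4]
    nlinarith

/-- The extension `0 → J → A → A/J → 0`. -/
def extension (hE : IsSQp.{u, v} p E) (hC : 1 ≤ C) (h : J.IsCompletelyFiltered p C) :
    FilteredMatrixAlgebra.Extension C (J.toFiltered.unitization p) (A.unitization p)
      (J.quotient p) where
  j := J.inclusion p
  q := J.quotientHom p
  unitJ := J.toFiltered.unitHom hE
  unitA := A.unitHom hE
  one_le := hC
  norm_le _ := le_rfl
  mem_of_mem {_ a} _ ha := ⟨a.2, ha⟩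
  exists_mem _ hb := hb
  approx hr _ hx hδ := h.exists_approx hE hC hr hx hδ
  q_j a := by
    refine (Ideal.Quotient.eq (I := J.ideal)).2 ⟨sub_self _, ?_⟩
    show a.1.1 - algebraMap ℂ (E →L[ℂ] E) a.1.2 ∈ J.carrier
    rw [Algebra.algebraMap_eq_smul_one]
    exact a.2

lemma isBoundaryMap_bdryMorphism (hE : IsSQp.{u, v} p E) (hC : 1 ≤ C)
    (h : J.IsCompletelyFiltered p C) {n₀ n m : ℕ} (h₀ : 20000 ≤ n₀) (h₁ : 10 * n₀ + 100 ≤ n)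
    (hn : 11000 ≤ n) (hm : 10000000000000000 * (n + 11000) + 10000000000000000 ≤ m) :
    J.IsBoundaryMap p C (powControl C hC n₀) ((extension hE hC h).bdryMorphism hC hn hm) := by
  intro P hP k u hu hker
  have hb := P.below_scale (hC := hC)
  have hb' := hb
  rw [Scale.Below, pow_one] at hb'
  refine ⟨?_, fun l v w w' y hd => ?_⟩
  · obtain ⟨v, w, w', y, h1, h2, h3, h4, h5, h6, h7⟩ := (extension hE hC h).exists_blockSum
      P.le_scale_M h₀ P.ε_pos P.r_pos P.one_le_N hb'.1 hb'.2.1 hb'.2.2 hu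
    -- No stabilisation of u is needed, so the added identity block has size 0.
    refine ⟨0, k, v, w, w', y, ?_⟩
    rw [FilteredMatrixAlgebra.blockSum_one_zero]
    exact ⟨h1, h2, h3, h4, h5, h6, h7⟩
  · obtain ⟨u', hu'⟩ := hu.exists_qp hb
    exact FilteredMatrixAlgebra.Extension.bdryMorphism_invClass hP hu hker
      ((FilteredMatrixAlgebra.Extension.isDatum_of_blockSum (E := extension hE hC h)
        (s := P.scale C hC) P.le_scale_M ⟨u', hu'.mono (by omega)⟩ hd.pair hd.lift hd.aug_eq
        hd.mem hd.approx).mono h₁)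

end ClosedIdeal

end FilteredSubalgebra

end QuantK


end

open QuantK in
theorem mainTheorem1 (C : ℝ) (hC : 1 ≤ C) :
    ∃ aux cD c : ControlPair, aux ≤ cD ∧
      ∀ (p : ℝ≥0∞) [Fact (1 ≤ p)] [Fact (p ≠ ∞)] (E : Type u) [NormedAddCommGroup E]
        [NormedSpace ℂ E] [CompleteSpace E] (_ : IsSQp.{u, v} p E)
        (A : FilteredSubalgebra E) (_ : A.IsFiltered) (J : A.ClosedIdeal)
        (_ : J.IsCompletelyFiltered p C),
        ∃ D : ControlledMorphism cD (J.quotient p).K1 (J.toFiltered.unitization p).K0,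
          J.IsBoundaryMap p C aux D ∧
          IsExact c (J.inclusion p).onK1 (J.quotientHom p).onK1 ∧
          IsExact c (J.quotientHom p).onK1 D ∧
          IsExact c D (J.inclusion p).onK0 ∧
          IsExact c (J.inclusion p).onK0 (J.quotientHom p).onK0 := by
  refine ⟨powControl C hC 20000, powControl C hC 10000000000000000000000,
    powControl C hC 100000000000000000000000000000000000, powControl_le hC (by norm_num), ?_⟩
  intro p _ _ E _ _ _ hE A _ J hJ
  -- Data for the auxiliary exponent 20000 are data at level 10·20000 + 100 = 200100. The exponent
  -- of the boundary morphism must exceed what independence of the data costs at that level, and the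
  -- last exponent must exceed 10¹² times that of the morphism, as needed at K_1(A/J).
  have hm : 10000000000000000 * (200100 + 11000) + 10000000000000000 ≤ 10000000000000000000000 := by
    norm_num
  let X := FilteredSubalgebra.ClosedIdeal.extension hE hC hJ
  exact ⟨X.bdryMorphism hC (by norm_num) hm,
    FilteredSubalgebra.ClosedIdeal.isBoundaryMap_bdryMorphism hE hC hJ le_rfl (by norm_num) _ _,
    X.isExact_K1A hC (by norm_num), X.isExact_K1Q hC _ _ (by norm_num),
    X.isExact_K0J hC _ _ (by norm_num), X.isExact_K0A hC (by norm_num)⟩
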